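/- Let $M$ be a closed oriented smooth 4-manifold with a smooth Riemannian metric $g$, and let $\omega$ be a smooth 2-form on $M$ which is self-dual ($*_g\omega=\omega$) and harmonic ($\Delta_g\omega=0$), and which, as a section of the bundle $\bigwedge^+_g$ of self-dual 2-forms, is transverse to the zero section. Let $Z=\{p\in M : \omega(p)=0\}$ (a disjoint union of embedded circles). On $S^1\times D^3$, $S^1=\mathbb R/2\pi\mathbb Z$, with coordinates $(\theta,x_1,x_2,x_3)$, put $$\sigma_1=d\theta\wedge dx_1+dx_2\wedge dx_3,\quad \sigma_2=d\theta\wedge dx_2+dx_3\wedge dx_1,\quad \sigma_3=d\theta\wedge dx_3+dx_1\wedge dx_2,$$ $$\omega_A=x_1\sigma_1+x_2\sigma_2-2x_3\sigma_3,$$ $$\omega_B=(x_1\cos\theta+x_2\sin\theta)e^{x_3}\sigma_1+(x_1\sin\theta-x_2\cos\theta)e^{x_3}\sigma_2+R(-x_1\sigma_1+x_3\sigma_3),$$ where $0<R<1$ is any fixed number. Then for every open set $U\supseteq Z$ there is a family of 2-forms $\omega_t$, $t\in[0,1]$, on $M$, smooth in $(t,p)\in[0,1]\times M$, with $\omega_0=\omega$,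 such that for every $t\in[0,1]$: 1. $\omega_t$ is closed, its zero set is exactly $Z$, it is nondegenerate on $M\setminus Z$, and at each point of $Z$ its intrinsic derivative $T_pM\to\bigwedge^2T_p^*M$ has rank 3; 2. $\omega_t=\omega$ outside $U$; 3. $[\omega_t]=[\omega]$ in $H^2(M;\mathbb R)$; and such that for every connected component $C$ of $Z$ there are $r>0$ and a smooth diffeomorphism $\Phi$ of $S^1\times D^3(r)$, where $D^3(r)=\{|x|<r\}$, onto an open neighbourhood of $C$ in $M$, with $\Phi(S^1\times\{0\})=C$, for which $\Phi^*\omega_1$ is one of $\omega_A,\,-\omega_A,\,\omega_B,\,-\omega_B$. -/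

import Mathlib

open Set Topology
open scoped Manifold ContDiff

/- On `EuclideanSpace` this instance would shadow the standard `chartedSpaceSelf`. -/
attribute [-instance] TopCat.of.chartedSpace

noncomputable section

namespace SDForms

/-- The model space of a 4-manifold; it also carries the coordinates
`(θ, x₁, x₂, x₃) = (y 0, y 1, y 2, y 3)` around a circle. -/
abbrev E4 : Type := EuclideanSpace ℝ (Fin 4)

/-! ### Differential forms on a 4-manifold -/

section Forms

variable (M : Type*) [TopologicalSpace M] [ChartedSpace E4 M]

/-- Differential `k`-forms on `M` (no regularity): an alternating `k`-linear form on each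
tangent space. -/
abbrev DiffForm (k : ℕ) : Type _ :=
  ∀ x : M, TangentSpace (𝓡 4) x [⋀^Fin k]→L[ℝ] ℝ

variable {M}

/-- The pull-back `f^* σ` of a form on `M` under a map `f` from (an open subset of) `ℝ⁴` to `M`. -/
def pullback {k : ℕ} (f : E4 → M) (σ : DiffForm M k) : E4 → E4 [⋀^Fin k]→L[ℝ] ℝ :=
  fun y => (σ (f y)).compContinuousLinearMap (mfderiv (𝓡 4) (𝓡 4) f y)

/-- The expression of `σ` in the preferred chart at `x`. -/
def localRep {k : ℕ} (σ : DiffForm M k) (x : M) : E4 → E4 [⋀^Fin k]→L[ℝ] ℝ :=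
  pullback (extChartAt (𝓡 4) x).symm σ

/-- `σ` is smooth: its coefficients are smooth in every preferred chart. -/
def IsSmoothForm {k : ℕ} (σ : DiffForm M k) : Prop :=
  ∀ x : M, ContDiffOn ℝ ∞ (localRep σ x) (extChartAt (𝓡 4) x).target

/-- The family `Ω t`, `t ∈ [0, 1]`, is smooth jointly in `t` and the point of `M`. -/
def IsSmoothFamily {k : ℕ} (Ω : ℝ → DiffForm M k) : Prop :=
  ∀ x : M, ContDiffOn ℝ ∞ (fun q : ℝ × E4 => localRep (Ω q.1) x q.2)
    (Icc (0 : ℝ) 1 ×ˢ (extChartAt (𝓡 4) x).target)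

/-- The exterior derivative. At `x` it is computed in the preferred chart at `x`, whose derivative
at `x` is the identity of `TangentSpace (𝓡 4) x = E4`. -/
def dForm {k : ℕ} (σ : DiffForm M k) : DiffForm M (k + 1) :=
  fun x => (extDeriv (localRep σ x) (extChartAt (𝓡 4) x x) : E4 [⋀^Fin (k + 1)]→L[ℝ] ℝ)

/-- Two closed 2-forms define the same class in `H²(M; ℝ)` (de Rham cohomology): they differ by the
differential of a smooth 1-form. -/
def SameClass (σ σ' : DiffForm M 2) : Prop :=
  ∃ η : DiffForm M 1, IsSmoothForm η ∧ dForm η = σ' - σ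

/-- The set of zeros of `σ`. -/
def zeroLocus {k : ℕ} (σ : DiffForm M k) : Set M := {x | σ x = 0}

/-- The derivative of the coefficients of `σ` at `x` in the preferred chart at `x`. At a zero of `σ`
this is the intrinsic derivative `T_xM → Λ^k T_x^*M` of the section `σ`. -/
def derivAt {k : ℕ} (σ : DiffForm M k) (x : M) : E4 →L[ℝ] E4 [⋀^Fin k]→L[ℝ] ℝ :=
  fderiv ℝ (localRep σ x) (extChartAt (𝓡 4) x x)

/-- `σ` is nondegenerate at `x`. -/
def NondegenerateAt (σ : DiffForm M 2) (x : M) : Prop :=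
  ∀ v : TangentSpace (𝓡 4) x, (∀ w : TangentSpace (𝓡 4) x, σ x ![v, w] = 0) → v = 0

/-- A singular symplectic form: closed, nondegenerate wherever it is nonzero, and
with intrinsic derivative of rank 3 at each zero. -/
structure IsSingularSymplectic (σ : DiffForm M 2) : Prop where
  closed : dForm σ = 0
  nondegenerate : ∀ x, x ∉ zeroLocus σ → NondegenerateAt σ x
  rank_eq : ∀ x ∈ zeroLocus σ, Module.finrank ℝ (derivAt σ x).range = 3

end Forms

/-! ### Orientation, metric, Hodge star, Laplacian -/

section Hodge

/-- `contract η v` is the alternating form `w ↦ η (v₀, …, v_{k-1}, w₀, …, w_{m-1})`. -/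
def contract (m : ℕ) : (k : ℕ) → E4 [⋀^Fin (m + k)]→L[ℝ] ℝ → (Fin k → E4) → E4 [⋀^Fin m]→L[ℝ] ℝ
  | 0, η, _ => η
  | k + 1, η, v => contract m k (ContinuousAlternatingMap.curryLeft (n := m + k) η (v 0)) (Fin.tail v)

/-- The standard basis of `E4`; in `TangentSpace (𝓡 4) x = E4` it is the coordinate basis of the
preferred chart at `x`. -/
def stdVec (i : Fin 4) : E4 := EuclideanSpace.single i 1

variable (M : Type*) [TopologicalSpace M] [ChartedSpace E4 M]

/-- An orientation of `M`, given by a nowhere vanishing smooth 4-form. -/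
structure OrientationForm where
  form : DiffForm M 4
  smooth : IsSmoothForm form
  ne_zero : ∀ x, form x ≠ 0

variable {M} [IsManifold (𝓡 4) ∞ M]

variable (M) in
/-- Smooth Riemannian metrics on `M`. -/
abbrev Metric : Type _ :=
  Bundle.ContMDiffRiemannianMetric (𝓡 4) ∞ E4 (fun x : M => TangentSpace (𝓡 4) x)

/-- The matrix `g_{ij}` of the metric at `x` in the coordinate basis. -/
def gram (g : Metric M) (x : M) : Matrix (Fin 4) (Fin 4) ℝ :=
  Matrix.of fun i j => g.inner x (stdVec i) (stdVec j)

/-- The Riemannian volume form of `g` at `x`: the positive multiple of the orientation form whose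
value on the coordinate basis is `± √det (g_{ij})`. -/
def volAt (o : OrientationForm M) (g : Metric M) (x : M) : E4 [⋀^Fin 4]→L[ℝ] ℝ :=
  (Real.sqrt (gram g x).det / |o.form x stdVec|) • (o.form x : E4 [⋀^Fin 4]→L[ℝ] ℝ)

/-- The Hodge star from `k`-forms to `m`-forms, `m + k = 4`, on a 4-dimensional space with
Gram matrix `G` and volume form `vol`, in index notation:
`(⋆α)(w) = (1/k!) ∑ g^{i₁j₁} ⋯ g^{i_kj_k} α(b_{i₁}, …, b_{i_k}) vol(b_{j₁}, …, b_{j_k}, w)`. -/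
def hodgeStar (k m : ℕ) (G : Matrix (Fin 4) (Fin 4) ℝ) (vol : E4 [⋀^Fin (m + k)]→L[ℝ] ℝ)
    (α : E4 [⋀^Fin k]→L[ℝ] ℝ) : E4 [⋀^Fin m]→L[ℝ] ℝ :=
  ((k.factorial : ℝ)⁻¹) • ∑ i : Fin k → Fin 4, ∑ j : Fin k → Fin 4,
    ((∏ a, G⁻¹ (i a) (j a)) * α (fun a => stdVec (i a))) •
      contract m k vol (fun a => stdVec (j a))

/-- The Hodge star of `(M, g)` at `x` on 2-forms. -/
def star2At (o : OrientationForm M) (g : Metric M) (x : M) (α : E4 [⋀^Fin 2]→L[ℝ] ℝ) :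
    E4 [⋀^Fin 2]→L[ℝ] ℝ :=
  hodgeStar 2 2 (gram g x) (volAt o g x) α

/-- The Hodge star of `(M, g)` at `x` on 3-forms. -/
def star3At (o : OrientationForm M) (g : Metric M) (x : M) (α : E4 [⋀^Fin 3]→L[ℝ] ℝ) :
    E4 [⋀^Fin 1]→L[ℝ] ℝ :=
  hodgeStar 3 1 (gram g x) (volAt o g x) α

/-- The Hodge star `⋆ : Ω² → Ω²`. -/
def star2 (o : OrientationForm M) (g : Metric M) (σ : DiffForm M 2) : DiffForm M 2 :=
  fun x => star2At o g x (σ x)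

/-- The Hodge star `⋆ : Ω³ → Ω¹`. -/
def star3 (o : OrientationForm M) (g : Metric M) (σ : DiffForm M 3) : DiffForm M 1 :=
  fun x => star3At o g x (σ x)

/-- The codifferential `δ = -⋆d⋆ : Ω² → Ω¹` (in dimension four). -/
def codiff2 (o : OrientationForm M) (g : Metric M) (σ : DiffForm M 2) : DiffForm M 1 :=
  -star3 o g (dForm (star2 o g σ))

/-- The codifferential `δ = -⋆d⋆ : Ω³ → Ω²` (in dimension four). -/
def codiff3 (o : OrientationForm M) (g : Metric M) (σ : DiffForm M 3) : DiffForm M 2 :=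
  -star2 o g (dForm (star3 o g σ))

/-- The Hodge Laplacian `Δ = dδ + δd` on 2-forms. -/
def laplacian (o : OrientationForm M) (g : Metric M) (σ : DiffForm M 2) : DiffForm M 2 :=
  dForm (codiff2 o g σ) + codiff3 o g (dForm σ)

/-- `σ` is a smooth self-dual harmonic 2-form: `⋆σ = σ` and `Δσ = 0`. -/
structure IsSelfDualHarmonic (o : OrientationForm M) (g : Metric M) (σ : DiffForm M 2) : Prop where
  smooth : IsSmoothForm σ
  selfDual : star2 o g σ = σ
  harmonic : laplacian o g σ = 0

/-- The section `σ` of the bundle `Λ⁺` of self-dual forms is transverse to the zero section: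
at each zero `x`, the intrinsic derivative `T_xM → Λ⁺_x` is onto. -/
def IsTransverse (o : OrientationForm M) (g : Metric M) (σ : DiffForm M 2) : Prop :=
  ∀ x ∈ zeroLocus σ, ∀ α : E4 [⋀^Fin 2]→L[ℝ] ℝ, star2At o g x α = α →
    ∃ v : E4, derivAt σ x v = α

end Hodge

/-! ### The two model forms on `S¹ × D³` -/

section Models

/-- The constant 2-form `dy_i ∧ dy_j` on `E4`. -/
def dydy (i j : Fin 4) : E4 [⋀^Fin 2]→L[ℝ] ℝ where
  toFun v := v 0 i * v 1 j - v 0 j * v 1 i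
  map_update_add' v a x y := by
    fin_cases a <;> simp [Function.update] <;> ring
  map_update_smul' v a c x := by
    fin_cases a <;> simp [Function.update] <;> ring
  map_eq_zero_of_eq' v a b hab hne := by
    have h : v 0 = v 1 := by
      fin_cases a <;> fin_cases b <;> first | exact absurd rfl hne | exact hab | exact hab.symm
    simp only [h]
    ring
  cont := by fun_prop

/-- `dθ dx₁ + dx₂ dx₃`. -/
def sigma1 : E4 [⋀^Fin 2]→L[ℝ] ℝ := dydy 0 1 + dydy 2 3
/-- `dθ dx₂ + dx₃ dx₁`. -/
def sigma2 : E4 [⋀^Fin 2]→L[ℝ] ℝ := dydy 0 2 + dydy 3 1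
/-- `dθ dx₃ + dx₁ dx₂`. -/
def sigma3 : E4 [⋀^Fin 2]→L[ℝ] ℝ := dydy 0 3 + dydy 1 2

/-- The model form `ω_A` (oriented splitting). -/
def omegaA (y : E4) : E4 [⋀^Fin 2]→L[ℝ] ℝ :=
  y 1 • sigma1 + y 2 • sigma2 - (2 * y 3) • sigma3

/-- The model form `ω_B` (unoriented splitting) with parameter `R`. -/
def omegaB (R : ℝ) (y : E4) : E4 [⋀^Fin 2]→L[ℝ] ℝ :=
  ((y 1 * Real.cos (y 0) + y 2 * Real.sin (y 0)) * Real.exp (y 3)) • sigma1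
    + ((y 1 * Real.sin (y 0) - y 2 * Real.cos (y 0)) * Real.exp (y 3)) • sigma2
    + R • ((-y 1) • sigma1 + y 3 • sigma3)

/-- `ℝ × D³(r)`, the universal cover of `S¹ × D³(r)`, `S¹ = ℝ / 2πℤ`. -/
def tube (r : ℝ) : Set E4 := {y | y 1 ^ 2 + y 2 ^ 2 + y 3 ^ 2 < r ^ 2}

/-- `Φ`, which is `2π`-periodic in `θ`, induces a diffeomorphism of `S¹ × D³(r)` onto
an open subset of `M` that takes `S¹ × {0}` onto `C`. -/
structure IsTubularChart {M : Type*} [TopologicalSpace M] [ChartedSpace E4 M]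
    (Φ : E4 → M) (r : ℝ) (C : Set M) : Prop where
  smooth : ContMDiffOn (𝓡 4) (𝓡 4) ∞ Φ (tube r)
  injective_mfderiv : ∀ y ∈ tube r, Function.Injective (mfderiv (𝓡 4) (𝓡 4) Φ y)
  eq_iff : ∀ y ∈ tube r, ∀ y' ∈ tube r,
    Φ y = Φ y' ↔ ∃ n : ℤ, y' = y + (2 * Real.pi * n) • stdVec 0
  core : Φ '' {y | y 1 = 0 ∧ y 2 = 0 ∧ y 3 = 0} = C

end Models

end SDForms

end

open Set Topology
open scoped Manifold ContDiff

noncomputable section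

namespace SDForms

local notation "Λ[" k "]" => E4 [⋀^Fin k]→L[ℝ] ℝ

local notation "chart" => extChartAt (𝓡 4)

/-! The deformation is `σ + t dη`, with `η` a 1-form supported in disjoint tubular neighbourhoods of
the zero circles. Closedness and the cohomology class are then automatic, and the theorem comes down
to choosing good coordinates and a good `η` near one circle.

Role of the metric. Put `h = ⋆dσ`. For a self-dual form with `Δσ = 0` the form `dh` is
anti-self-dual, so `d(h ∧ σ) = -h ∧ dσ`, which is a nonnegative multiple of the volume form; Stokes
gives `dσ = 0` (`IsSelfDualHarmonic.closed`). Nonzero self-dual forms are nondegenerate, and at a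
zero the intrinsic derivative `D` maps onto the 3-dimensional space of self-dual forms. These facts,
collected in `IsNearSymplectic`, are all that is kept of `g`.

A zero. Let `X` span the kernel of `D`. The bilinear form `(u, w) ↦ D u (X, w)` is symmetric because
`σ` is closed, and its radical is the line of `X`. Closedness and the constant sign of the Pfaffian
exclude a definite form modulo `X`, so the signature is `(2, 1)` or `(1, 2)`, and exactly one
direction of `X` gives `(2, 1)` (`exists_basis`, `posDir_or`, `not_posDir_neg`). This orients every
zero circle. It is also why the models `-ω_A` and `-ω_B` need not occur: the choice of orientation
absorbs the sign.

The circles. A vector field tangent to the zero locus is glued from straight charts, and its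
integral curves parametrise the components (`exists_loop`).

Two types. Along a loop the negative cone of the Lorentzian form has two halves, and one turn
preserves or exchanges them; let `ε = 1` or `ε = -1` accordingly. There is an orthonormal normal
frame `v, q, n` with `v` periodic and `q`, `n` multiplied by `ε` after a turn
(`exists_orthonormal_fields`). For `ε = 1` the frame `v, q, √2 n` has the Gram matrix `diag(1, 1,
-2)` of `ω_A`. For `ε = -1` a half-angle rotation turns `q, n` into a periodic pair, and the frame
can be arranged to have the Gram matrix of `ω_B` (`exists_adaptedFrame`).

Interpolation. In a tubular chart whose normal derivative is this frame, the pull-back `β` of `σ`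
and the model `m` vanish on the axis, and their derivatives there have the same contraction with
`∂_θ`. The Pfaffian is bilinear in that contraction and the remaining coefficients, so it is affine
on the segment between the derivatives and stays positive (`pf_affine`). Hence `(1 - l) β + l m` is
nondegenerate off the axis, and remains so after any error of size `ε |x|` (`exists_pf_pos`).
Finally `m - β = dρ` with `ρ = O(|x|²)`, and a logarithmic cutoff `χ` with `|x| |dχ|` small makes
the error `dχ ∧ ρ` of `d(χρ)` small compared with `|x|` (`exists_axis_deformation`). The model is
reached exactly near the circle, so no Moser argument is needed. -/

theorem two_le_infty : (2 : WithTop ℕ∞) ≤ ∞ := ENat.LEInfty.out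

/-! ### Forms on `ℝ⁴` through their coefficients -/

section Coefficients

theorem sum_coord_smul_stdVec (v : E4) : ∑ i, v i • stdVec i = v := by
  ext j
  simp [stdVec, Fin.sum_univ_four]
  fin_cases j <;> simp

theorem apply_eq_sum {k : ℕ} (α : Λ[k]) (v : Fin k → E4) :
    α v = ∑ i : Fin k → Fin 4, (∏ a, v a (i a)) * α (fun a => stdVec (i a)) := by
  conv_lhs => rw [show v = fun a => ∑ i, v a i • stdVec i from
    funext fun a => (sum_coord_smul_stdVec (v a)).symm]
  have := α.toMultilinearMap.map_sum (fun a i => v a i • stdVec i)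
  simp only [MultilinearMap.map_smul_univ] at this
  exact this

theorem ext_stdVec {k : ℕ} {α β : Λ[k]}
    (h : ∀ i : Fin k → Fin 4, α (fun a => stdVec (i a)) = β (fun a => stdVec (i a))) : α = β := by
  ext v
  rw [apply_eq_sum, apply_eq_sum β]
  simp [h]

/-- The coefficients of a form in the standard basis. -/
def coeffs (k : ℕ) : (Λ[k]) →ₗ[ℝ] ((Fin k → Fin 4) → ℝ) where
  toFun α i := α (fun a => stdVec (i a))
  map_add' _ _ := rfl
  map_smul' _ _ := rfl

theorem coeffs_injective (k : ℕ) : Function.Injective (coeffs k) :=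
  fun _ _ h => ext_stdVec fun i => congrFun h i

instance (k : ℕ) : FiniteDimensional ℝ (Λ[k]) :=
  FiniteDimensional.of_injective (coeffs k) (coeffs_injective k)

/-- The coefficient map is injective, and a linear left inverse is continuous because the dimension
is finite; composing with it recovers the form. -/
theorem contDiffAt_form_of_coeffs {F : Type*} [NormedAddCommGroup F] [NormedSpace ℝ F] {k : ℕ}
    {n : WithTop ℕ∞} {α : F → Λ[k]} {s : Set F} {y : F}
    (h : ∀ i : Fin k → Fin 4, ContDiffWithinAt ℝ n (fun z => α z (fun a => stdVec (i a))) s y) :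
    ContDiffWithinAt ℝ n α s y := by
  obtain ⟨g, hg⟩ := (coeffs k).exists_leftInverse_of_injective
    (LinearMap.ker_eq_bot.2 (coeffs_injective k))
  have h1 : α = fun z => LinearMap.toContinuousLinearMap g (fun i => α z (fun a => stdVec (i a))) := by
    funext z
    exact (LinearMap.congr_fun hg (α z)).symm
  rw [h1]
  exact (LinearMap.toContinuousLinearMap g).contDiff.comp_contDiffWithinAt (contDiffWithinAt_pi.2 h)

/-- Evaluation of forms at fixed vectors, as a continuous linear map. -/
def evalForm {k : ℕ} (v : Fin k → E4) : (Λ[k]) →L[ℝ] ℝ :=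
  LinearMap.toContinuousLinearMap
    { toFun := fun α => α v, map_add' := fun _ _ => rfl, map_smul' := fun _ _ => rfl }

@[simp] theorem evalForm_apply {k : ℕ} (v : Fin k → E4) (α : Λ[k]) :
    evalForm v α = α v := rfl

theorem ContDiffWithinAt.form_apply {F : Type*} [NormedAddCommGroup F] [NormedSpace ℝ F] {k : ℕ}
    {n : WithTop ℕ∞} {α : F → Λ[k]} {v : F → Fin k → E4} {s : Set F} {y : F}
    (hα : ContDiffWithinAt ℝ n α s y) (hv : ∀ a, ContDiffWithinAt ℝ n (fun z => v z a) s y) :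
    ContDiffWithinAt ℝ n (fun z => α z (v z)) s y := by
  have h1 : (fun z => α z (v z)) = fun z => ∑ i : Fin k → Fin 4, (∏ a, v z a (i a)) *
      α z (fun a => stdVec (i a)) := funext fun z => apply_eq_sum (α z) (v z)
  rw [h1]
  refine ContDiffWithinAt.sum fun i _ => ContDiffWithinAt.mul ?_ ?_
  · refine contDiffWithinAt_prod fun a _ => ?_
    exact (EuclideanSpace.proj (𝕜 := ℝ) (i a)).contDiff.comp_contDiffWithinAt (hv a)
  · exact (evalForm _).contDiff.comp_contDiffWithinAt hα

theorem contDiffAt_pullbackForm {k : ℕ} {α : E4 → Λ[k]} {f : E4 → E4} {y : E4}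
    (hα : ContDiffAt ℝ ∞ α (f y)) (hf : ContDiffAt ℝ ∞ f y) :
    ContDiffAt ℝ ∞ (fun z => (α (f z)).compContinuousLinearMap (fderiv ℝ f z)) y := by
  have h1 : ContDiffAt ℝ ∞ (fderiv ℝ f) y := hf.fderiv_right (by simp)
  have h2 : ContDiffAt ℝ ∞ (fun z => α (f z)) y := hα.comp y hf
  rw [← contDiffWithinAt_univ] at *
  refine contDiffAt_form_of_coeffs fun i => ?_
  exact ContDiffWithinAt.form_apply (v := fun z a => fderiv ℝ f z (stdVec (i a))) h2
    fun a => h1.clm_apply contDiffWithinAt_const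

end Coefficients

/-! ### Pull-backs, charts and the exterior derivative on `M` -/

section Charts

variable {M : Type*} [TopologicalSpace M] [ChartedSpace E4 M]

theorem isOpen_target (x : M) : IsOpen (chart x).target :=
  isOpen_extChartAt_target x

/-- The value of a form at a point, on the model space. -/
def valAt {k : ℕ} (σ : DiffForm M k) (p : M) : Λ[k] := σ p

/-- The derivative of a map `E4 → M` as an endomorphism of the model space. -/
def tder (f : E4 → M) (y : E4) : E4 →L[ℝ] E4 := mfderiv (𝓡 4) (𝓡 4) f y

theorem pullback_def {k : ℕ} (σ : DiffForm M k) (f : E4 → M) (y : E4) :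
    pullback f σ y = (valAt σ (f y)).compContinuousLinearMap (tder f y) := rfl

theorem tder_comp {f : E4 → M} {g : E4 → E4} {y : E4}
    (hf : MDifferentiableAt (𝓡 4) (𝓡 4) f (g y)) (hg : DifferentiableAt ℝ g y) :
    tder (f ∘ g) y = (tder f (g y)).comp (fderiv ℝ g y) := by
  have := mfderiv_comp y hf hg.mdifferentiableAt
  rw [mfderiv_eq_fderiv] at this
  exact this

theorem tder_congr {f g : E4 → M} {y : E4} (h : f =ᶠ[𝓝 y] g) : tder f y = tder g y :=
  h.mfderiv_eq

theorem pullback_comp {k : ℕ} (σ : DiffForm M k) {f : E4 → M} {g : E4 → E4} {y : E4}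
    (hf : MDifferentiableAt (𝓡 4) (𝓡 4) f (g y)) (hg : DifferentiableAt ℝ g y) :
    pullback (f ∘ g) σ y = (pullback f σ (g y)).compContinuousLinearMap (fderiv ℝ g y) := by
  rw [pullback_def, pullback_def, tder_comp hf hg]
  rfl

theorem pullback_congr {k : ℕ} (σ : DiffForm M k) {f g : E4 → M} {y : E4} (h : f =ᶠ[𝓝 y] g) :
    pullback f σ y = pullback g σ y := by
  rw [pullback_def, pullback_def, tder_congr h, h.self_of_nhds]

theorem localRep_differentiable {k : ℕ} {σ : DiffForm M k} (hσ : IsSmoothForm σ) (x : M) {y : E4}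
    (hy : y ∈ (chart x).target) : ContDiffAt ℝ ∞ (localRep σ x) y :=
  (hσ x).contDiffAt ((isOpen_target x).mem_nhds hy)

variable [IsManifold (𝓡 4) ∞ M]

theorem contMDiffOn_symm (x : M) :
    ContMDiffOn (𝓡 4) (𝓡 4) ∞ (chart x).symm (chart x).target :=
  contMDiffOn_extChartAt_symm x

theorem mdifferentiableAt_symm (x : M) {y : E4} (hy : y ∈ (chart x).target) :
    MDifferentiableAt (𝓡 4) (𝓡 4) (chart x).symm y :=
  ((contMDiffOn_symm x).contMDiffAt ((isOpen_target x).mem_nhds hy)).mdifferentiableAt (by simp)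

theorem contMDiffAt_chart (x : M) {p : M} (hp : p ∈ (chart x).source) :
    ContMDiffAt (𝓡 4) (𝓡 4) ∞ (chart x) p :=
  contMDiffAt_extChartAt' (by simpa using hp)

/-- The expression of a map `f : E4 → M` in the preferred chart at `x`. -/
def chartRep (f : E4 → M) (x : M) : E4 → E4 := fun y => chart x (f y)

theorem contDiffAt_chartRep {f : E4 → M} {x : M} {y : E4} (hf : ContMDiffAt (𝓡 4) (𝓡 4) ∞ f y)
    (hx : f y ∈ (chart x).source) : ContDiffAt ℝ ∞ (chartRep f x) y :=
  (ContMDiffAt.comp y (contMDiffAt_chart x hx) hf).contDiffAt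

/-- A pull-back from `M` becomes a pull-back between subsets of `ℝ⁴`, to which the calculus of forms
on a vector space applies. -/
theorem pullback_eq_localRep {k : ℕ} (σ : DiffForm M k) {f : E4 → M} {x : M} {y : E4}
    (hf : MDifferentiableAt (𝓡 4) (𝓡 4) f y) (hx : f y ∈ (chart x).source) :
    pullback f σ y =
      (localRep σ x (chartRep f x y)).compContinuousLinearMap (fderiv ℝ (chartRep f x) y) := by
  have h1 : f =ᶠ[𝓝 y] (chart x).symm ∘ chartRep f x := by
    filter_upwards [hf.continuousAt.preimage_mem_nhds
      ((isOpen_extChartAt_source x).mem_nhds hx)] with z hz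
    exact ((chart x).left_inv hz).symm
  rw [pullback_congr σ h1, pullback_comp]
  · rfl
  · exact mdifferentiableAt_symm x ((chart x).map_source hx)
  · exact (MDifferentiableAt.comp y ((contMDiffAt_chart x hx).mdifferentiableAt (by simp))
      hf).differentiableAt

/-- The tangent space at `x` is identified with `E4` by the preferred chart at `x`, so this chart
reads itself as the identity. Hence `dForm` and `derivAt`, computed in that chart, need no
correction factor. -/
theorem tder_symm_self (x : M) :
    tder (chart x).symm (chart x x) = ContinuousLinearMap.id ℝ E4 := by
  have h := mdifferentiableAt_symm x (mem_extChartAt_target (I := 𝓡 4) x)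
  have key : HasMFDerivAt (𝓡 4) (𝓡 4) (chart x).symm (chart x x)
      (ContinuousLinearMap.id ℝ E4) := by
    refine ⟨h.continuousAt, ?_⟩
    have : (writtenInExtChartAt (𝓡 4) (𝓡 4) (chart x x) (chart x).symm)
        =ᶠ[𝓝 (chart x x)] id := by
      filter_upwards [(isOpen_target x).mem_nhds (mem_extChartAt_target (I := 𝓡 4) x)] with y hy
      simp only [writtenInExtChartAt, extChartAt_to_inv, Function.comp_apply, id]
      exact (chart x).right_inv hy
    exact ((hasFDerivAt_id _).congr_of_eventuallyEq this).hasFDerivWithinAt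
  exact key.mfderiv

theorem localRep_self {k : ℕ} (σ : DiffForm M k) (x : M) :
    localRep σ x (chart x x) = valAt σ x := by
  rw [localRep, pullback_def, tder_symm_self, extChartAt_to_inv]
  rfl

theorem pullback_eventuallyEq {k : ℕ} (σ : DiffForm M k) {f : E4 → M} {x : M} {y : E4}
    (hf : ContMDiffAt (𝓡 4) (𝓡 4) ∞ f y) (hx : f y ∈ (chart x).source) :
    pullback f σ =ᶠ[𝓝 y] fun z =>
      (localRep σ x (chartRep f x z)).compContinuousLinearMap (fderiv ℝ (chartRep f x) z) := by
  have h1 : ∀ᶠ z in 𝓝 y, ContMDiffAt (𝓡 4) (𝓡 4) 1 f z :=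
    (contMDiffAt_iff_contMDiffAt_nhds (by simp)).1 (hf.of_le (by simp))
  filter_upwards [h1, hf.continuousAt.preimage_mem_nhds
      ((isOpen_extChartAt_source x).mem_nhds hx)] with z hz hz2
  exact pullback_eq_localRep σ (hz.mdifferentiableAt (by simp)) hz2

theorem contDiffAt_pullback {k : ℕ} {σ : DiffForm M k} (hσ : IsSmoothForm σ) {f : E4 → M} {y : E4}
    (hf : ContMDiffAt (𝓡 4) (𝓡 4) ∞ f y) : ContDiffAt ℝ ∞ (pullback f σ) y := by
  have hx := mem_extChartAt_source (I := 𝓡 4) (f y)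
  refine ContDiffAt.congr_of_eventuallyEq ?_ (pullback_eventuallyEq σ hf hx)
  exact contDiffAt_pullbackForm
    (localRep_differentiable hσ _ ((chart (f y)).map_source hx))
    (contDiffAt_chartRep hf hx)

/-- Both sides pass to the chart centred at `f y`, in which `dForm` is defined at that point; there
the claim is the naturality of `extDeriv` on `E4`. -/
theorem extDeriv_pullback_center {k : ℕ} {σ : DiffForm M k} (hσ : IsSmoothForm σ) {f : E4 → M}
    {y : E4} (hf : ContMDiffAt (𝓡 4) (𝓡 4) ∞ f y) :
    extDeriv (pullback f σ) y = pullback f (dForm σ) y := by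
  have hx := mem_extChartAt_source (I := 𝓡 4) (f y)
  have hy := (chart (f y)).map_source hx
  rw [(pullback_eventuallyEq σ hf hx).extDeriv_eq, extDeriv_pullback (r := ∞) (f := chartRep f (f y)) (x := y)
    ((localRep_differentiable hσ _ hy).differentiableAt (by simp)) (contDiffAt_chartRep hf hx)
    (by simpa using two_le_infty), pullback_eq_localRep _ (hf.mdifferentiableAt (by simp)) hx]
  congr 1
  exact (localRep_self (dForm σ) (f y)).symm

/-- `dForm` uses a different chart at every point. Naturality, applied to an inverse chart, shows
that one fixed chart computes it on its whole domain, so that smoothness and `d ∘ d = 0` can be read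
off there. -/
theorem localRep_dForm {k : ℕ} {σ : DiffForm M k} (hσ : IsSmoothForm σ) (x : M) {y : E4}
    (hy : y ∈ (chart x).target) :
    localRep (dForm σ) x y = extDeriv (localRep σ x) y :=
  (extDeriv_pullback_center hσ
    ((contMDiffOn_symm x).contMDiffAt ((isOpen_target x).mem_nhds hy))).symm

theorem isSmoothForm_dForm {k : ℕ} {σ : DiffForm M k} (hσ : IsSmoothForm σ) :
    IsSmoothForm (dForm σ) := by
  intro x y hy
  have h1 : ContDiffAt ℝ ∞ (extDeriv (localRep σ x)) y := by
    have h2 : ContDiffAt ℝ ∞ (fderiv ℝ (localRep σ x)) y :=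
      (localRep_differentiable hσ x hy).fderiv_right (by simp)
    exact (ContinuousAlternatingMap.alternatizeUncurryFinCLM ℝ E4 ℝ).contDiff.contDiffAt.comp y h2
  refine (h1.congr_of_eventuallyEq ?_).contDiffWithinAt
  filter_upwards [(isOpen_target x).mem_nhds hy] with z hz using localRep_dForm hσ x hz

theorem dForm_dForm {k : ℕ} {σ : DiffForm M k} (hσ : IsSmoothForm σ) : dForm (dForm σ) = 0 := by
  funext x
  have hx := mem_extChartAt_target (I := 𝓡 4) x
  have : localRep (dForm σ) x =ᶠ[𝓝 (chart x x)] extDeriv (localRep σ x) := by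
    filter_upwards [(isOpen_target x).mem_nhds hx] with z hz using localRep_dForm hσ x hz
  have h2 := extDeriv_extDeriv_apply (localRep_differentiable hσ x hx) (by simpa using two_le_infty)
  rw [← this.extDeriv_eq] at h2
  exact h2

omit [IsManifold (𝓡 4) ∞ M] in
theorem localRep_add {k : ℕ} (σ τ : DiffForm M k) (x : M) :
    localRep (σ + τ) x = localRep σ x + localRep τ x := rfl

omit [IsManifold (𝓡 4) ∞ M] in
theorem isSmoothForm_add {k : ℕ} {σ τ : DiffForm M k} (hσ : IsSmoothForm σ)
    (hτ : IsSmoothForm τ) : IsSmoothForm (σ + τ) := fun x => (hσ x).add (hτ x)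

omit [IsManifold (𝓡 4) ∞ M] in
theorem isSmoothForm_smul {k : ℕ} (c : ℝ) {σ : DiffForm M k} (hσ : IsSmoothForm σ) :
    IsSmoothForm (c • σ) := fun x => (hσ x).const_smul c

omit [IsManifold (𝓡 4) ∞ M] in
theorem dForm_add {k : ℕ} {σ τ : DiffForm M k} (hσ : IsSmoothForm σ) (hτ : IsSmoothForm τ) :
    dForm (σ + τ) = dForm σ + dForm τ := by
  funext x
  have hx := mem_extChartAt_target (I := 𝓡 4) x
  exact extDeriv_add ((localRep_differentiable hσ x hx).differentiableAt (by simp))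
    ((localRep_differentiable hτ x hx).differentiableAt (by simp))

omit [IsManifold (𝓡 4) ∞ M] in
theorem dForm_smul {k : ℕ} (c : ℝ) (σ : DiffForm M k) : dForm (c • σ) = c • dForm σ := by
  funext x
  exact extDeriv_smul c (localRep σ x)

/-- A map with injective derivative at `y` has a smooth local inverse, expressed in a chart. -/
theorem exists_local_inverse {f : E4 → M} {x : M} {y : E4}
    (hf : ContMDiffAt (𝓡 4) (𝓡 4) ∞ f y) (hinj : Function.Injective (tder f y))
    (hx : f y ∈ (chart x).source) :
    ∃ h : E4 → E4, ContDiffAt ℝ ∞ h (chart x (f y)) ∧ h (chart x (f y)) = y ∧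
      (∀ᶠ z in 𝓝 (chart x (f y)), f (h z) = (chart x).symm z) ∧
      ∀ᶠ w in 𝓝 y, h (chart x (f w)) = w := by
  have hy := (chart x).map_source hx
  have hg := contDiffAt_chartRep hf hx
  have hd : DifferentiableAt ℝ (chartRep f x) y := hg.differentiableAt (by simp)
  have heq : f =ᶠ[𝓝 y] (chart x).symm ∘ chartRep f x := by
    filter_upwards [hf.continuousAt.preimage_mem_nhds
      ((isOpen_extChartAt_source x).mem_nhds hx)] with z hz
    exact ((chart x).left_inv hz).symm
  have hcomp : tder f y = (tder (chart x).symm (chartRep f x y)).comp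
      (fderiv ℝ (chartRep f x) y) := by
    rw [tder_congr heq, tder_comp (mdifferentiableAt_symm x hy) hd]
  have hinj' : Function.Injective (fderiv ℝ (chartRep f x) y) := by
    rw [hcomp] at hinj
    exact Function.Injective.of_comp (f := tder (chart x).symm (chartRep f x y)) hinj
  let L : E4 ≃L[ℝ] E4 := (LinearEquiv.ofInjectiveEndo (fderiv ℝ (chartRep f x) y).toLinearMap
    hinj').toContinuousLinearEquiv
  have hL : HasFDerivAt (chartRep f x) (L : E4 →L[ℝ] E4) y := hd.hasFDerivAt
  refine ⟨hg.localInverse hL (by simp), hg.to_localInverse hL (by simp), ?_, ?_, ?_⟩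
  · exact hg.localInverse_apply_image hL (by simp)
  · have h1 := (hg.hasStrictFDerivAt' hL (by simp)).eventually_right_inverse
    have h2 : ∀ᶠ z in 𝓝 (chartRep f x y), f (hg.localInverse hL (by simp) z) ∈
        (chart x).source := by
      have hc : ContinuousAt (hg.localInverse hL (by simp)) (chartRep f x y) :=
        (hg.to_localInverse hL (by simp)).continuousAt
      have hv := hg.localInverse_apply_image hL (by simp)
      have : ContinuousAt (fun z => f (hg.localInverse hL (by simp) z)) (chartRep f x y) := by
        refine ContinuousAt.comp ?_ hc
        rw [hv]; exact hf.continuousAt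
      refine this.preimage_mem_nhds ((isOpen_extChartAt_source x).mem_nhds ?_)
      rw [hv]; exact hx
    filter_upwards [h1, h2] with z hz hz2
    rw [← (chart x).left_inv hz2]
    exact congrArg _ hz
  · exact (hg.hasStrictFDerivAt' hL (by simp)).eventually_left_inverse

/-- A form is smooth near a point in the image of a local diffeomorphism `f` if its pull-back
under `f` is smooth. -/
theorem contDiffAt_localRep_of_pullback {k : ℕ} {σ : DiffForm M k} {f : E4 → M} {x : M} {y : E4}
    (hf : ContMDiffAt (𝓡 4) (𝓡 4) ∞ f y) (hinj : Function.Injective (tder f y))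
    (hx : f y ∈ (chart x).source) (hσ : ContDiffAt ℝ ∞ (pullback f σ) y) :
    ContDiffAt ℝ ∞ (localRep σ x) (chart x (f y)) := by
  obtain ⟨h, hh, hhy, hr, -⟩ := exists_local_inverse hf hinj hx
  have h0 : ContMDiffAt (𝓡 4) (𝓡 4) ∞ f (h (chart x (f y))) := by rwa [hhy]
  have h1 : ∀ᶠ z in 𝓝 (chart x (f y)), ContMDiffAt (𝓡 4) (𝓡 4) 1 f (h z) :=
    hh.continuousAt.eventually ((contMDiffAt_iff_contMDiffAt_nhds (by simp)).1 (h0.of_le (by simp)))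
  have h2 : ∀ᶠ z in 𝓝 (chart x (f y)), ContDiffAt ℝ 1 h z :=
    (hh.of_le (by simp)).eventually (by simp)
  have h3 : localRep σ x =ᶠ[𝓝 (chart x (f y))] fun z =>
      (pullback f σ (h z)).compContinuousLinearMap (fderiv ℝ h z) := by
    filter_upwards [h1, h2, hr.eventually_nhds] with z hz1 hz2 hz3
    rw [← pullback_comp σ (hz1.mdifferentiableAt (by simp)) (hz2.differentiableAt (by simp))]
    exact pullback_congr σ (hz3.mono fun w hw => hw.symm)
  refine ContDiffAt.congr_of_eventuallyEq ?_ h3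
  exact contDiffAt_pullbackForm (by rwa [hhy]) hh

end Charts

/-! ### Contraction of a form with several vectors -/

section Contract

theorem contract_add (m k : ℕ) (η ζ : Λ[m + k]) (v : Fin k → E4) :
    contract m k (η + ζ) v = contract m k η v + contract m k ζ v := by
  induction k with
  | zero => rfl
  | succ k ih =>
    exact ih (ContinuousAlternatingMap.curryLeft (n := m + k) η (v 0))
      (ContinuousAlternatingMap.curryLeft (n := m + k) ζ (v 0)) (Fin.tail v)

theorem contract_smul (m k : ℕ) (c : ℝ) (η : Λ[m + k]) (v : Fin k → E4) :
    contract m k (c • η) v = c • contract m k η v := by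
  induction k with
  | zero => rfl
  | succ k ih =>
    exact ih (ContinuousAlternatingMap.curryLeft (n := m + k) η (v 0)) (Fin.tail v)

theorem contract_sum (m k : ℕ) {ι : Type*} (s : Finset ι) (η : ι → Λ[m + k])
    (v : Fin k → E4) : contract m k (∑ i ∈ s, η i) v = ∑ i ∈ s, contract m k (η i) v := by
  classical
  induction s using Finset.induction_on with
  | empty =>
    simp only [Finset.sum_empty]
    have := contract_smul m k 0 0 v
    simpa using this
  | insert a s ha ih => rw [Finset.sum_insert ha, Finset.sum_insert ha, contract_add, ih]

theorem contract_eq_sum (m k : ℕ) (η : Λ[m + k]) (v : Fin k → E4) :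
    contract m k η v =
      ∑ j : Fin k → Fin 4, (∏ a, v a (j a)) • contract m k η (fun a => stdVec (j a)) := by
  induction k with
  | zero => simp [contract]
  | succ k ih =>
    have h1 : contract m (k + 1) η v =
        contract m k (ContinuousAlternatingMap.curryLeft (n := m + k) η (v 0)) (Fin.tail v) := rfl
    rw [h1, ← sum_coord_smul_stdVec (v 0), map_sum, contract_sum]
    rw [← (Fin.consEquiv fun _ : Fin (k + 1) => Fin 4).sum_comp, Fintype.sum_prod_type]
    refine Finset.sum_congr rfl fun i _ => ?_
    rw [map_smul, contract_smul, ih, Finset.smul_sum]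
    refine Finset.sum_congr rfl fun j _ => ?_
    rw [smul_smul, Fin.prod_univ_succ]
    rfl

theorem contract_two_two (η : Λ[4]) (v w : Fin 2 → E4) :
    contract 2 2 η v w = η ![v 0, v 1, w 0, w 1] := by
  change η (Matrix.vecCons (v 0) (Matrix.vecCons (v 1) w)) = _
  congr 1
  ext i
  fin_cases i <;> rfl

theorem contract_one_three (η : Λ[4]) (v : Fin 3 → E4) (w : Fin 1 → E4) :
    contract 1 3 η v w = η ![v 0, v 1, v 2, w 0] := by
  change η (Matrix.vecCons (v 0) (Matrix.vecCons (v 1) (Matrix.vecCons (v 2) w))) = _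
  congr 1
  ext i
  fin_cases i <;> rfl

end Contract

/-! ### Orthonormal frames, the Hodge star and linear algebra of self-dual forms -/

section Frame

/-- The linear isomorphism `A` maps the standard basis to an orthonormal basis for the Gram
matrix `G`. -/
def IsOrtho (G : Matrix (Fin 4) (Fin 4) ℝ) (A : E4 ≃L[ℝ] E4) : Prop :=
  ∀ i j, G⁻¹ i j = ∑ l, A (stdVec l) i * A (stdVec l) j

open scoped MatrixOrder Matrix in
-- The inverse Gram matrix is positive, hence of the form `Bᵀ B`; the rows of `B` are the vectors of
-- the frame.
theorem exists_isOrtho {G : Matrix (Fin 4) (Fin 4) ℝ} (hG : G.PosDef) : ∃ A, IsOrtho G A := by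
  obtain ⟨B, hB⟩ := CStarAlgebra.nonneg_iff_eq_star_mul_self.1 hG.inv.posSemidef.nonneg
  have hdet : IsUnit B.det := by
    have h1 : IsUnit (G⁻¹).det := hG.inv.isUnit.map Matrix.detMonoidHom
    rw [hB, Matrix.det_mul] at h1
    exact isUnit_of_mul_isUnit_right h1
  let L : (Fin 4 → ℝ) ≃ₗ[ℝ] (Fin 4 → ℝ) := Matrix.toLinearEquiv' Bᵀ
    (Matrix.invertibleOfIsUnitDet _ (by simpa using hdet))
  let e : E4 ≃L[ℝ] (Fin 4 → ℝ) := EuclideanSpace.equiv (Fin 4) ℝ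
  refine ⟨(e.trans L.toContinuousLinearEquiv).trans e.symm, fun i j => ?_⟩
  have h2 : ∀ l k, ((e.trans L.toContinuousLinearEquiv).trans e.symm) (stdVec l) k = B l k := by
    intro l k
    have : (L (e (stdVec l))) k = B l k := by
      change (Bᵀ.mulVec (Pi.single l 1)) k = B l k
      simp
    exact this
  simp_rw [h2]
  rw [hB, Matrix.mul_apply]
  simp

/-- Expanding each frame vector in coordinates and summing over the frame yields, slot by slot, the
entries of `G⁻¹`. The index formula thus becomes a sum over one orthonormal frame, which can be
evaluated by hand. -/
theorem hodgeStar_of_isOrtho {G : Matrix (Fin 4) (Fin 4) ℝ} {A : E4 ≃L[ℝ] E4} (hA : IsOrtho G A)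
    (k m : ℕ) (vol : Λ[m + k]) (α : Λ[k]) :
    hodgeStar k m G vol α = ((k.factorial : ℝ)⁻¹) • ∑ l : Fin k → Fin 4,
      α (fun a => A (stdVec (l a))) • contract m k vol (fun a => A (stdVec (l a))) := by
  unfold hodgeStar
  congr 1
  have h1 : ∀ l : Fin k → Fin 4,
      α (fun a => A (stdVec (l a))) • contract m k vol (fun a => A (stdVec (l a))) =
      ∑ i : Fin k → Fin 4, ∑ j : Fin k → Fin 4,
        ((∏ a, A (stdVec (l a)) (i a) * A (stdVec (l a)) (j a)) * α (fun a => stdVec (i a))) •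
          contract m k vol (fun a => stdVec (j a)) := by
    intro l
    rw [apply_eq_sum α, contract_eq_sum, Finset.sum_smul]
    refine Finset.sum_congr rfl fun i _ => ?_
    rw [Finset.smul_sum]
    refine Finset.sum_congr rfl fun j _ => ?_
    rw [smul_smul, Finset.prod_mul_distrib]
    congr 1
    ring
  simp_rw [h1]
  conv_rhs => rw [Finset.sum_comm]
  refine Finset.sum_congr rfl fun i _ => ?_
  conv_rhs => rw [Finset.sum_comm]
  refine Finset.sum_congr rfl fun j _ => ?_
  rw [← Finset.sum_smul, ← Finset.sum_mul]
  congr 1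
  congr 1
  rw [Finset.prod_congr rfl fun a _ => hA (i a) (j a)]
  rw [Finset.prod_univ_sum, Fintype.piFinset_univ]

/-- The sign of a map `Fin 4 → Fin 4`, zero if it is not a permutation. -/
def eps (i j k l : Fin 4) : ℤ :=
  -- The Vandermonde product of `0, 1, 2, 3` is `12`, and a permutation of the entries changes it by
  -- its sign.
  ((j : ℤ) - i) * ((k : ℤ) - i) * ((l : ℤ) - i) * ((k : ℤ) - j) * ((l : ℤ) - j) * ((l : ℤ) - k) / 12

theorem eps_perm : ∀ p : Equiv.Perm (Fin 4), eps (p 0) (p 1) (p 2) (p 3) = Equiv.Perm.sign p := by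
  decide

theorem eps_of_eq : ∀ f0 f1 f2 f3 : Fin 4,
    (f0 = f1 ∨ f0 = f2 ∨ f0 = f3 ∨ f1 = f2 ∨ f1 = f3 ∨ f2 = f3) → eps f0 f1 f2 f3 = 0 := by
  decide

theorem apply_frame (η : Λ[4]) (u : Fin 4 → E4) (i j k l : Fin 4) :
    η ![u i, u j, u k, u l] = eps i j k l * η u := by
  have h0 : (![u i, u j, u k, u l] : Fin 4 → E4) = u ∘ ![i, j, k, l] := by
    ext a
    fin_cases a <;> rfl
  rw [h0]
  by_cases h : Function.Injective ![i, j, k, l]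
  · let p : Equiv.Perm (Fin 4) := Equiv.ofBijective _ (Finite.injective_iff_bijective.1 h)
    have h1 := η.toAlternatingMap.map_perm u p
    have h2 := eps_perm p
    have h3 : eps i j k l = Equiv.Perm.sign p := h2
    rw [h3]
    change η (u ∘ p) = _
    change η (u ∘ p) = Equiv.Perm.sign p • η u at h1
    rw [h1, Units.smul_def, zsmul_eq_mul]
  · have h1 : η (u ∘ ![i, j, k, l]) = 0 := by
      rw [Function.Injective] at h
      push Not at h
      obtain ⟨a, b, hab, hne⟩ := h
      exact η.map_eq_zero_of_eq _ (congrArg u hab) hne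
    rw [h1, eps_of_eq]
    · simp
    · by_contra hc
      push Not at hc
      obtain ⟨c1, c2, c3, c4, c5, c6⟩ := hc
      apply h
      intro a b hab
      fin_cases a <;> fin_cases b <;> simp_all

theorem form_swap (α : Λ[2]) (v w : E4) : α ![v, w] = -α ![w, v] := by
  have h := α.map_add_swap ![w, v] (i := 0) (j := 1) (by decide)
  have h2 : (![w, v] ∘ Equiv.swap (0 : Fin 2) 1 : Fin 2 → E4) = ![v, w] := by
    ext a
    fin_cases a <;> simp
  rw [h2] at h
  change α ![w, v] + α ![v, w] = 0 at h
  linarith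

theorem form_self (α : Λ[2]) (v : E4) : α ![v, v] = 0 := by
  have := form_swap α v v
  linarith

theorem form3_swap01 (β : Λ[3]) (u v w : E4) : β ![u, v, w] = -β ![v, u, w] := by
  have h := β.map_add_swap ![v, u, w] (i := 0) (j := 1) (by decide)
  have h2 : (![v, u, w] ∘ Equiv.swap (0 : Fin 3) 1 : Fin 3 → E4) = ![u, v, w] := by
    ext a
    fin_cases a <;> simp [Equiv.swap_apply_def]
  rw [h2] at h
  change β ![v, u, w] + β ![u, v, w] = 0 at h
  linarith

theorem form3_swap12 (β : Λ[3]) (u v w : E4) : β ![u, v, w] = -β ![u, w, v] := by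
  have h := β.map_add_swap ![u, w, v] (i := 1) (j := 2) (by decide)
  have h2 : (![u, w, v] ∘ Equiv.swap (1 : Fin 3) 2 : Fin 3 → E4) = ![u, v, w] := by
    ext a
    fin_cases a <;> simp [Equiv.swap_apply_def]
  rw [h2] at h
  change β ![u, w, v] + β ![u, v, w] = 0 at h
  linarith

theorem form3_perms (β : Λ[3]) (u v w : E4) :
    β ![v, u, w] = -β ![u, v, w] ∧ β ![u, w, v] = -β ![u, v, w] ∧ β ![w, v, u] = -β ![u, v, w] ∧
      β ![v, w, u] = β ![u, v, w] ∧ β ![w, u, v] = β ![u, v, w] := by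
  have h1 := form3_swap01 β u v w
  have h2 := form3_swap12 β u v w
  have h3 := form3_swap12 β v u w
  have h4 := form3_swap01 β w u v
  have h5 := form3_swap01 β w v u
  refine ⟨?_, ?_, ?_, ?_, ?_⟩ <;> linarith

theorem sum_two (F : (Fin 2 → Fin 4) → ℝ) :
    ∑ l : Fin 2 → Fin 4, F l = ∑ i : Fin 4, ∑ j : Fin 4, F ![i, j] := by
  rw [← (finTwoArrowEquiv (Fin 4)).symm.sum_comp, Fintype.sum_prod_type]
  rfl

theorem sum_three (F : (Fin 3 → Fin 4) → ℝ) :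
    ∑ l : Fin 3 → Fin 4, F l = ∑ i : Fin 4, ∑ j : Fin 4, ∑ k : Fin 4, F ![i, j, k] := by
  rw [← (Fin.consEquiv fun _ : Fin 3 => Fin 4).sum_comp, Fintype.sum_prod_type]
  refine Finset.sum_congr rfl fun i _ => ?_
  rw [sum_two]
  rfl

variable {G : Matrix (Fin 4) (Fin 4) ℝ} {A : E4 ≃L[ℝ] E4} (hA : IsOrtho G A)
include hA

theorem star22_frame (vol : Λ[4]) (α : Λ[2]) (a b : Fin 4) :
    hodgeStar 2 2 G vol α ![A (stdVec a), A (stdVec b)] =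
      (1 / 2) * ∑ i : Fin 4, ∑ j : Fin 4, α ![A (stdVec i), A (stdVec j)] *
        (eps i j a b * vol (fun i => A (stdVec i))) := by
  rw [hodgeStar_of_isOrtho hA 2 2, ContinuousAlternatingMap.smul_apply,
    ContinuousAlternatingMap.sum_apply, sum_two]
  simp only [Nat.factorial, smul_eq_mul]
  congr 1
  · norm_num
  refine Finset.sum_congr rfl fun i _ => Finset.sum_congr rfl fun j _ => ?_
  rw [ContinuousAlternatingMap.smul_apply, contract_two_two, smul_eq_mul]
  congr 1
  · congr 1; ext c; fin_cases c <;> rfl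
  · exact apply_frame vol (fun i => A (stdVec i)) i j a b

theorem star31_frame (vol : Λ[4]) (α : Λ[3]) (a : Fin 4) :
    hodgeStar 3 1 G vol α ![A (stdVec a)] =
      (1 / 6) * ∑ i : Fin 4, ∑ j : Fin 4, ∑ k : Fin 4,
        α ![A (stdVec i), A (stdVec j), A (stdVec k)] *
        (eps i j k a * vol (fun i => A (stdVec i))) := by
  rw [hodgeStar_of_isOrtho hA 3 1, ContinuousAlternatingMap.smul_apply,
    ContinuousAlternatingMap.sum_apply, sum_three]
  simp only [Nat.factorial, smul_eq_mul]
  congr 1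
  · norm_num
  refine Finset.sum_congr rfl fun i _ => Finset.sum_congr rfl fun j _ =>
    Finset.sum_congr rfl fun k _ => ?_
  rw [ContinuousAlternatingMap.smul_apply, contract_one_three, smul_eq_mul]
  congr 1
  · congr 1; ext c; fin_cases c <;> rfl
  · exact apply_frame vol (fun i => A (stdVec i)) i j k a

/-- Only the complementary index pair survives in the frame formula. The volume `s` of the frame is
kept as a variable; only the dimension count for self-dual forms needs `s ^ 2 = 1`. -/
theorem star22_values (vol : Λ[4]) (α : Λ[2]) :
    let s := vol (fun i => A (stdVec i))
    let u := fun i => A (stdVec i)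
    hodgeStar 2 2 G vol α ![u 0, u 1] = s * α ![u 2, u 3] ∧
    hodgeStar 2 2 G vol α ![u 0, u 2] = -(s * α ![u 1, u 3]) ∧
    hodgeStar 2 2 G vol α ![u 0, u 3] = s * α ![u 1, u 2] ∧
    hodgeStar 2 2 G vol α ![u 1, u 2] = s * α ![u 0, u 3] ∧
    hodgeStar 2 2 G vol α ![u 1, u 3] = -(s * α ![u 0, u 2]) ∧
    hodgeStar 2 2 G vol α ![u 2, u 3] = s * α ![u 0, u 1] := by
  intro s u
  refine ⟨?_, ?_, ?_, ?_, ?_, ?_⟩ <;>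
  · simp only [u, s, star22_frame hA, Fin.sum_univ_four, eps]
    norm_num
    first
    | rw [form_swap α (A (stdVec 3)) (A (stdVec 2))]
    | rw [form_swap α (A (stdVec 3)) (A (stdVec 1))]
    | rw [form_swap α (A (stdVec 2)) (A (stdVec 1))]
    | rw [form_swap α (A (stdVec 3)) (A (stdVec 0))]
    | rw [form_swap α (A (stdVec 2)) (A (stdVec 0))]
    | rw [form_swap α (A (stdVec 1)) (A (stdVec 0))]
    ring

theorem star31_values (vol : Λ[4]) (β : Λ[3]) :
    let s := vol (fun i => A (stdVec i))
    let u := fun i => A (stdVec i)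
    hodgeStar 3 1 G vol β ![u 0] = -(s * β ![u 1, u 2, u 3]) ∧
    hodgeStar 3 1 G vol β ![u 1] = s * β ![u 0, u 2, u 3] ∧
    hodgeStar 3 1 G vol β ![u 2] = -(s * β ![u 0, u 1, u 3]) ∧
    hodgeStar 3 1 G vol β ![u 3] = s * β ![u 0, u 1, u 2] := by
  intro s u
  obtain ⟨a1, a2, a3, a4, a5⟩ := form3_perms β (u 1) (u 2) (u 3)
  obtain ⟨b1, b2, b3, b4, b5⟩ := form3_perms β (u 0) (u 2) (u 3)
  obtain ⟨c1, c2, c3, c4, c5⟩ := form3_perms β (u 0) (u 1) (u 3)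
  obtain ⟨d1, d2, d3, d4, d5⟩ := form3_perms β (u 0) (u 1) (u 2)
  refine ⟨?_, ?_, ?_, ?_⟩ <;>
  · simp only [u, s, star31_frame hA, Fin.sum_univ_four, eps] at *
    norm_num
    simp only [a1, a2, a3, a4, a5, b1, b2, b3, b4, b5, c1, c2, c3, c4, c5, d1, d2, d3, d4, d5]
    ring

omit hA in
theorem ext_frame2 (A : E4 ≃L[ℝ] E4) {α β : Λ[2]}
    (h : ∀ i j, i < j → α ![A (stdVec i), A (stdVec j)] = β ![A (stdVec i), A (stdVec j)]) :
    α = β := by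
  have h1 : α.compContinuousLinearMap (A : E4 →L[ℝ] E4) =
      β.compContinuousLinearMap (A : E4 →L[ℝ] E4) := by
    refine ext_stdVec fun i => ?_
    simp only [ContinuousAlternatingMap.compContinuousLinearMap_apply]
    have h0 : (⇑(A : E4 →L[ℝ] E4) ∘ fun a => stdVec (i a)) =
        ![A (stdVec (i 0)), A (stdVec (i 1))] := by
      ext a
      fin_cases a <;> rfl
    rw [h0]
    rcases lt_trichotomy (i 0) (i 1) with hl | hl | hl
    · exact h _ _ hl
    · rw [hl, form_self, form_self]
    · rw [form_swap α, form_swap β, h _ _ hl]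
  ext v
  have := congrArg (fun γ : Λ[2] => γ (fun a => A.symm (v a))) h1
  simpa [Function.comp_def] using this

omit hA in
theorem ext_six (A : E4 ≃L[ℝ] E4) {α β : Λ[2]}
    (h01 : α ![A (stdVec 0), A (stdVec 1)] = β ![A (stdVec 0), A (stdVec 1)])
    (h02 : α ![A (stdVec 0), A (stdVec 2)] = β ![A (stdVec 0), A (stdVec 2)])
    (h03 : α ![A (stdVec 0), A (stdVec 3)] = β ![A (stdVec 0), A (stdVec 3)])
    (h12 : α ![A (stdVec 1), A (stdVec 2)] = β ![A (stdVec 1), A (stdVec 2)])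
    (h13 : α ![A (stdVec 1), A (stdVec 3)] = β ![A (stdVec 1), A (stdVec 3)])
    (h23 : α ![A (stdVec 2), A (stdVec 3)] = β ![A (stdVec 2), A (stdVec 3)]) : α = β := by
  refine ext_frame2 A fun i j hij => ?_
  fin_cases i <;> fin_cases j <;> first | exact absurd hij (by decide) | assumption

omit hA in
theorem ext_frame3 (A : E4 ≃L[ℝ] E4) {β : Λ[3]}
    (h : ∀ i j k, i < j → j < k → β ![A (stdVec i), A (stdVec j), A (stdVec k)] = 0) :
    β = 0 := by
  have h2 : ∀ i j k : Fin 4, β ![A (stdVec i), A (stdVec j), A (stdVec k)] = 0 := by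
    have key : ∀ i j k : Fin 4, i < j → ∀ l : Fin 4, l = k →
        β ![A (stdVec i), A (stdVec j), A (stdVec l)] = 0 := by
      rintro i j k hij l rfl
      rcases lt_trichotomy j l with hl | hl | hl
      · exact h _ _ _ hij hl
      · subst hl
        have := form3_swap12 β (A (stdVec i)) (A (stdVec j)) (A (stdVec j))
        linarith
      · rw [form3_swap12]
        rcases lt_trichotomy i l with hl' | hl' | hl'
        · rw [h _ _ _ hl' hl, neg_zero]
        · subst hl'
          have := form3_swap01 β (A (stdVec i)) (A (stdVec i)) (A (stdVec j))
          linarith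
        · rw [form3_swap01, h _ _ _ hl' hij]; simp
    intro i j k
    rcases lt_trichotomy i j with hl | hl | hl
    · exact key _ _ _ hl _ rfl
    · subst hl
      have := form3_swap01 β (A (stdVec i)) (A (stdVec i)) (A (stdVec k))
      linarith
    · rw [form3_swap01, key _ _ _ hl _ rfl, neg_zero]
  have h1 : β.compContinuousLinearMap (A : E4 →L[ℝ] E4) = 0 := by
    refine ext_stdVec fun i => ?_
    simp only [ContinuousAlternatingMap.compContinuousLinearMap_apply]
    have h0 : (⇑(A : E4 →L[ℝ] E4) ∘ fun a => stdVec (i a)) =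
        ![A (stdVec (i 0)), A (stdVec (i 1)), A (stdVec (i 2))] := by
      ext a
      fin_cases a <;> rfl
    rw [h0, h2]
    rfl
  ext v
  have := congrArg (fun γ : Λ[3] => γ (fun a => A.symm (v a))) h1
  simpa [Function.comp_def] using this

omit hA in
-- Both forms are multiples of the determinant. This transfers signs between the standard basis, in
-- which the orientation is expressed, and orthonormal frames, in which stars are computed.
theorem topForm_proportional (η ζ : Λ[4]) (u : Fin 4 → E4) :
    η u * ζ stdVec = η stdVec * ζ u := by
  let e := (EuclideanSpace.basisFun (Fin 4) ℝ).toBasis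
  have he : ⇑e = stdVec := by
    ext i
    simp [e, stdVec]
  have h1 := η.toAlternatingMap.eq_smul_basis_det e
  have h2 := ζ.toAlternatingMap.eq_smul_basis_det e
  have h3 : η u = η stdVec * e.det u := by
    have := congrArg (fun f => f u) h1
    rw [he] at this
    exact this
  have h4 : ζ u = ζ stdVec * e.det u := by
    have := congrArg (fun f => f u) h2
    rw [he] at this
    exact this
  rw [h3, h4]
  ring

omit hA in
theorem topForm_apply_ne_zero {η : Λ[4]} (hη : η ≠ 0) (A : E4 ≃L[ℝ] E4) :
    η (fun i => A (stdVec i)) ≠ 0 := by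
  intro h
  apply hη
  let e := (EuclideanSpace.basisFun (Fin 4) ℝ).toBasis.map A.toLinearEquiv
  have he : ⇑e = fun i => A (stdVec i) := by
    ext i
    simp [e, stdVec]
  have h1 := η.toAlternatingMap.eq_smul_basis_det e
  ext v
  have := congrArg (fun f => f v) h1
  rw [he] at this
  change η v = η (fun i => A (stdVec i)) * e.det v at this
  rw [this, h]
  simp

/-- The wedge product of a 1-form with a `k`-form. -/
def wedgeOne {k : ℕ} (h : Λ[1]) (β : Λ[k]) :
    Λ[k + 1] :=
  ContinuousAlternatingMap.alternatizeUncurryFin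
    (ContinuousLinearMap.smulRight
      (LinearMap.toContinuousLinearMap (h.toAlternatingMap.toMultilinearMap.toLinearMap ![0] 0)) β)

omit hA in
theorem wedgeOne_apply {k : ℕ} (h : Λ[1]) (β : Λ[k])
    (v : Fin (k + 1) → E4) :
    wedgeOne h β v = ∑ i : Fin (k + 1), (-1 : ℝ) ^ (i : ℕ) * (h ![v i] * β (i.removeNth v)) := by
  rw [wedgeOne, ContinuousAlternatingMap.alternatizeUncurryFin_apply]
  refine Finset.sum_congr rfl fun i _ => ?_
  have : Function.update ![(0 : E4)] 0 (v i) = ![v i] := by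
    ext a
    fin_cases a
    simp
  simp [this]

omit hA in
theorem wedgeOne_three (h : Λ[1]) (β : Λ[3]) (u : Fin 4 → E4) :
    wedgeOne h β u = h ![u 0] * β ![u 1, u 2, u 3] - h ![u 1] * β ![u 0, u 2, u 3] +
      h ![u 2] * β ![u 0, u 1, u 3] - h ![u 3] * β ![u 0, u 1, u 2] := by
  rw [wedgeOne_apply, Fin.sum_univ_four]
  have e0 : Fin.removeNth 0 u = ![u 1, u 2, u 3] := by ext a; fin_cases a <;> rfl
  have e1 : Fin.removeNth 1 u = ![u 0, u 2, u 3] := by ext a; fin_cases a <;> rfl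
  have e2 : Fin.removeNth 2 u = ![u 0, u 1, u 3] := by ext a; fin_cases a <;> rfl
  have e3 : Fin.removeNth 3 u = ![u 0, u 1, u 2] := by ext a; fin_cases a <;> rfl
  rw [e0, e1, e2, e3]
  simp
  ring

/-- `⋆β ∧ β` is a nonpositive multiple of the volume form, zero only if `β = 0`. -/
theorem wedge_star_three {vol : Λ[4]} (hvol : vol ≠ 0)
    (β : Λ[3]) :
    wedgeOne (hodgeStar 3 1 G vol β) β stdVec * vol stdVec ≤ 0 ∧
    (wedgeOne (hodgeStar 3 1 G vol β) β stdVec = 0 → β = 0) := by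
  obtain ⟨h0, h1, h2, h3⟩ := star31_values hA vol β
  have hs := topForm_apply_ne_zero hvol A
  have hp := topForm_proportional (wedgeOne (hodgeStar 3 1 G vol β) β) vol
    (fun i => A (stdVec i))
  have hb : vol stdVec ≠ 0 := topForm_apply_ne_zero hvol (ContinuousLinearEquiv.refl ℝ E4)
  have hw := wedgeOne_three (hodgeStar 3 1 G vol β) β (fun i => A (stdVec i))
  simp only [h0, h1, h2, h3] at hw
  set s := vol (fun i => A (stdVec i)) with hsdef
  set w := wedgeOne (hodgeStar 3 1 G vol β) β stdVec
  -- `Q` is the squared norm of `β`, and the wedge product is `-Q` times the volume form.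
  set Q := β ![A (stdVec 1), A (stdVec 2), A (stdVec 3)] ^ 2 +
    β ![A (stdVec 0), A (stdVec 2), A (stdVec 3)] ^ 2 +
    β ![A (stdVec 0), A (stdVec 1), A (stdVec 3)] ^ 2 +
    β ![A (stdVec 0), A (stdVec 1), A (stdVec 2)] ^ 2 with hQ
  have hw' : w = -(Q * vol stdVec) := by
    have h4 : w * s = (-(Q * vol stdVec)) * s := by
      rw [← hp, hw, hQ]; ring
    exact mul_right_cancel₀ hs h4
  refine ⟨?_, fun hz => ?_⟩
  · rw [hw']
    have : 0 ≤ Q * (vol stdVec) ^ 2 := by positivity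
    linarith
  · have hQ0 : Q = 0 := by
      rw [hw'] at hz
      simpa [hb] using hz
    have q1 : β ![A (stdVec 1), A (stdVec 2), A (stdVec 3)] = 0 := by nlinarith
    have q2 : β ![A (stdVec 0), A (stdVec 2), A (stdVec 3)] = 0 := by nlinarith
    have q3 : β ![A (stdVec 0), A (stdVec 1), A (stdVec 3)] = 0 := by nlinarith
    have q4 : β ![A (stdVec 0), A (stdVec 1), A (stdVec 2)] = 0 := by nlinarith
    refine ext_frame3 A fun i j k hij hjk => ?_
    fin_cases i <;> fin_cases j <;> fin_cases k <;> first
      | exact absurd hij (by decide) | exact absurd hjk (by decide) | assumption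

omit hA in
theorem dydy_apply (i j : Fin 4) (v : Fin 2 → E4) :
    dydy i j v = v 0 i * v 1 j - v 0 j * v 1 i := rfl

omit hA in
theorem form_eq_zero_of_frame (A : E4 ≃L[ℝ] E4) {α : Λ[2]} {s : ℝ}
    (h01 : α ![A (stdVec 0), A (stdVec 1)] = 0) (h02 : α ![A (stdVec 0), A (stdVec 2)] = 0)
    (h03 : α ![A (stdVec 0), A (stdVec 3)] = 0)
    (h23 : α ![A (stdVec 2), A (stdVec 3)] = s * α ![A (stdVec 0), A (stdVec 1)])
    (h13 : α ![A (stdVec 1), A (stdVec 3)] = -(s * α ![A (stdVec 0), A (stdVec 2)]))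
    (h12 : α ![A (stdVec 1), A (stdVec 2)] = s * α ![A (stdVec 0), A (stdVec 3)]) : α = 0 := by
  refine ext_frame2 A fun i j hij => ?_
  rw [h01, mul_zero] at h23
  rw [h02, mul_zero, neg_zero] at h13
  rw [h03, mul_zero] at h12
  fin_cases i <;> fin_cases j <;> first | exact absurd hij (by decide) | assumption

omit hA in
theorem form_apply_sum_left (α : Λ[2]) (c : Fin 4 → ℝ) (u : Fin 4 → E4) (w : E4) :
    α ![∑ i, c i • u i, w] = ∑ i, c i * α ![u i, w] := by
  have h := map_sum (α.toAlternatingMap.toMultilinearMap.toLinearMap ![0, w] 0)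
    (fun i => c i • u i) Finset.univ
  have h0 : ∀ z : E4, Function.update ![(0 : E4), w] 0 z = ![z, w] := by
    intro z
    ext a
    fin_cases a <;> simp
  change α (Function.update ![0, w] 0 _) = ∑ i, α (Function.update ![0, w] 0 (c i • u i)) at h
  simp only [h0] at h
  rw [h]
  refine Finset.sum_congr rfl fun i _ => ?_
  have h2 := map_smul (α.toAlternatingMap.toMultilinearMap.toLinearMap ![0, w] 0) (c i) (u i)
  change α (Function.update ![0, w] 0 _) = c i * α (Function.update ![0, w] 0 (u i)) at h2
  simpa only [h0] using h2

omit hA in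
theorem frame_expand (A : E4 ≃L[ℝ] E4) (v : E4) :
    ∃ c : Fin 4 → ℝ, v = ∑ i, c i • A (stdVec i) := by
  refine ⟨fun i => A.symm v i, ?_⟩
  have := sum_coord_smul_stdVec (A.symm v)
  conv_lhs => rw [← A.apply_symm_apply v, ← this]
  rw [map_sum]
  simp

/-- A nonzero self-dual form is nondegenerate. -/
theorem selfDual_nondegenerate {vol : Λ[4]} (hvol : vol ≠ 0)
    {α : Λ[2]} (hα : hodgeStar 2 2 G vol α = α) (hne : α ≠ 0)
    {v : E4} (hv : ∀ w, α ![v, w] = 0) : v = 0 := by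
  obtain ⟨h01, h02, h03, h12, h13, h23⟩ := star22_values hA vol α
  have hs := topForm_apply_ne_zero hvol A
  rw [hα] at h01 h02 h03 h12 h13 h23
  set s := vol (fun i => A (stdVec i)) with hsdef
  obtain ⟨c, rfl⟩ := frame_expand A v
  have e := fun j =>
    (form_apply_sum_left α c (fun i => A (stdVec i)) (A (stdVec j))).symm.trans (hv _)
  simp only [Fin.sum_univ_four] at e
  have e0 := e 0
  have e1 := e 1
  have e2 := e 2
  have e3 := e 3
  rw [form_swap α (A (stdVec 1)) (A (stdVec 0)), form_swap α (A (stdVec 2)) (A (stdVec 0)),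
    form_swap α (A (stdVec 3)) (A (stdVec 0)), form_self] at e0
  rw [form_swap α (A (stdVec 2)) (A (stdVec 1)), form_swap α (A (stdVec 3)) (A (stdVec 1)),
    form_self, h12, h13] at e1
  rw [form_swap α (A (stdVec 3)) (A (stdVec 2)), form_self, h12, h23] at e2
  rw [form_self, h13, h23] at e3
  set x := α ![A (stdVec 0), A (stdVec 1)] with hx
  set y := α ![A (stdVec 0), A (stdVec 2)] with hy
  set z := α ![A (stdVec 0), A (stdVec 3)] with hz
  -- The numbers `x, y, z` determine a self-dual form. Suitable combinations of the equations for
  -- the kernel vector isolate each coordinate times `x ^ 2 + y ^ 2 + z ^ 2`.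
  have hQ : x ^ 2 + y ^ 2 + z ^ 2 ≠ 0 := by
    intro hq
    have hx0 : x = 0 := by nlinarith
    have hy0 : y = 0 := by nlinarith
    have hz0 : z = 0 := by nlinarith
    exact hne (form_eq_zero_of_frame A hx0 hy0 hz0 h23 h13 h12)
  have f0 : c 0 * (x ^ 2 + y ^ 2 + z ^ 2) = 0 := by
    linear_combination x * e1 + y * e2 + z * e3
  have c0 : c 0 = 0 := by simpa [hQ] using f0
  rw [c0] at e0 e1 e2 e3
  have g1 : c 3 * y - c 2 * z = 0 := by
    refine (mul_right_inj' hs).1 ?_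
    linear_combination e1
  have g2 : c 1 * z - c 3 * x = 0 := by
    refine (mul_right_inj' hs).1 ?_
    linear_combination e2
  have g3 : c 2 * x - c 1 * y = 0 := by
    refine (mul_right_inj' hs).1 ?_
    linear_combination e3
  have f1 : c 1 * (x ^ 2 + y ^ 2 + z ^ 2) = 0 := by
    linear_combination (-x) * e0 - y * g3 + z * g2
  have f2 : c 2 * (x ^ 2 + y ^ 2 + z ^ 2) = 0 := by
    linear_combination (-y) * e0 + x * g3 - z * g1
  have f3 : c 3 * (x ^ 2 + y ^ 2 + z ^ 2) = 0 := by
    linear_combination (-z) * e0 - x * g2 + y * g1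
  have c1 : c 1 = 0 := by simpa [hQ] using f1
  have c2 : c 2 = 0 := by simpa [hQ] using f2
  have c3 : c 3 = 0 := by simpa [hQ] using f3
  simp [Fin.sum_univ_four, c0, c1, c2, c3]

/-- The coefficient `(α ∧ β)(u₀, u₁, u₂, u₃)` of the wedge product of two 2-forms. -/
def wedgeTwoTwo (α β : Λ[2]) (u : Fin 4 → E4) : ℝ :=
  α ![u 0, u 1] * β ![u 2, u 3] - α ![u 0, u 2] * β ![u 1, u 3] + α ![u 0, u 3] * β ![u 1, u 2] +
  α ![u 2, u 3] * β ![u 0, u 1] - α ![u 1, u 3] * β ![u 0, u 2] + α ![u 1, u 2] * β ![u 0, u 3]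

/-- The wedge product of a self-dual and an anti-self-dual form vanishes. -/
theorem wedgeTwoTwo_eq_zero {vol : Λ[4]} {α β : Λ[2]}
    (hα : hodgeStar 2 2 G vol α = α) (hβ : hodgeStar 2 2 G vol β = -β) :
    wedgeTwoTwo α β (fun i => A (stdVec i)) = 0 := by
  obtain ⟨h01, h02, h03, h12, h13, h23⟩ := star22_values hA vol α
  obtain ⟨k01, k02, k03, k12, k13, k23⟩ := star22_values hA vol β
  rw [hα] at h01 h02 h03 h12 h13 h23
  rw [hβ] at k01 k02 k03 k12 k13 k23
  simp only [ContinuousAlternatingMap.neg_apply] at k01 k02 k03 k12 k13 k23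
  unfold wedgeTwoTwo
  rw [h23, h13, h12]
  linear_combination (-α ![A (stdVec 0), A (stdVec 1)]) * k23 +
    α ![A (stdVec 0), A (stdVec 2)] * k13 - α ![A (stdVec 0), A (stdVec 3)] * k12

omit hA in
theorem exists_form_frame (A : E4 ≃L[ℝ] E4) (s x y z : ℝ) : ∃ α : Λ[2],
    α ![A (stdVec 0), A (stdVec 1)] = x ∧ α ![A (stdVec 0), A (stdVec 2)] = y ∧
    α ![A (stdVec 0), A (stdVec 3)] = z ∧ α ![A (stdVec 1), A (stdVec 2)] = s * z ∧
    α ![A (stdVec 1), A (stdVec 3)] = -(s * y) ∧ α ![A (stdVec 2), A (stdVec 3)] = s * x := by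
  have hval : ∀ (ω₀ : Λ[2]) (i j : Fin 4),
      ω₀.compContinuousLinearMap (A.symm : E4 →L[ℝ] E4) ![A (stdVec i), A (stdVec j)] =
        ω₀ ![stdVec i, stdVec j] := by
    intro ω₀ i j
    rw [ContinuousAlternatingMap.compContinuousLinearMap_apply]
    congr 1
    ext a
    fin_cases a <;> simp
  refine ⟨(x • (dydy 0 1 + s • dydy 2 3) + y • (dydy 0 2 - s • dydy 1 3) +
      z • (dydy 0 3 + s • dydy 1 2)).compContinuousLinearMap (A.symm : E4 →L[ℝ] E4),
      ?_, ?_, ?_, ?_, ?_, ?_⟩ <;>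
  · rw [hval]
    simp [dydy_apply, stdVec]
    try ring

/-- The space of self-dual forms is 3-dimensional. -/
theorem finrank_selfDual {vol : Λ[4]}
    (hs : vol (fun i => A (stdVec i)) ^ 2 = 1) {S : Submodule ℝ (Λ[2])}
    (hS : ∀ α, α ∈ S ↔ hodgeStar 2 2 G vol α = α) : Module.finrank ℝ S = 3 := by
  set s := vol (fun i => A (stdVec i)) with hsdef
  -- Self-duality determines the remaining three values from these, and `s ^ 2 = 1` makes every
  -- prescription of these three consistent.
  let ev : S →ₗ[ℝ] (Fin 3 → ℝ) :=
    { toFun := fun α => ![α.1 ![A (stdVec 0), A (stdVec 1)], α.1 ![A (stdVec 0), A (stdVec 2)],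
        α.1 ![A (stdVec 0), A (stdVec 3)]]
      map_add' := by intro α β; ext i; fin_cases i <;> simp
      map_smul' := by intro c α; ext i; fin_cases i <;> simp }
  have hinj : Function.Injective ev := by
    rintro ⟨α, hα⟩ ⟨β, hβ⟩ h0
    obtain ⟨h01, h02, h03, h12, h13, h23⟩ := star22_values hA vol α
    rw [(hS α).1 hα] at h01 h02 h03 h12 h13 h23
    obtain ⟨k01, k02, k03, k12, k13, k23⟩ := star22_values hA vol β
    rw [(hS β).1 hβ] at k01 k02 k03 k12 k13 k23
    have e0 : α ![A (stdVec 0), A (stdVec 1)] = β ![A (stdVec 0), A (stdVec 1)] := congrFun h0 0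
    have e1 : α ![A (stdVec 0), A (stdVec 2)] = β ![A (stdVec 0), A (stdVec 2)] := congrFun h0 1
    have e2 : α ![A (stdVec 0), A (stdVec 3)] = β ![A (stdVec 0), A (stdVec 3)] := congrFun h0 2
    refine Subtype.ext (ext_six A e0 e1 e2 ?_ ?_ ?_)
    · exact h12.trans ((congrArg (s * ·) e2).trans k12.symm)
    · exact h13.trans ((congrArg (fun t => -(s * t)) e1).trans k13.symm)
    · exact h23.trans ((congrArg (s * ·) e0).trans k23.symm)
  have hsurj : Function.Surjective ev := by
    intro c
    obtain ⟨α, v01, v02, v03, v12, v13, v23⟩ := exists_form_frame A s (c 0) (c 1) (c 2)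
    refine ⟨⟨α, (hS α).2 ?_⟩, ?_⟩
    · obtain ⟨h01, h02, h03, h12, h13, h23⟩ := star22_values hA vol α
      refine ext_six A (h01.trans ?_) (h02.trans ?_) (h03.trans ?_) (h12.trans ?_) (h13.trans ?_)
        (h23.trans ?_)
      · change s * α ![A (stdVec 2), A (stdVec 3)] = _
        rw [v23, v01]; linear_combination (c 0) * hs
      · change -(s * α ![A (stdVec 1), A (stdVec 3)]) = _
        rw [v13, v02]; linear_combination (c 1) * hs
      · change s * α ![A (stdVec 1), A (stdVec 2)] = _
        rw [v12, v03]; linear_combination (c 2) * hs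
      · change s * α ![A (stdVec 0), A (stdVec 3)] = _
        rw [v12, v03]
      · change -(s * α ![A (stdVec 0), A (stdVec 2)]) = _
        rw [v13, v02]
      · change s * α ![A (stdVec 0), A (stdVec 1)] = _
        rw [v23, v01]
    · ext i
      fin_cases i
      · exact v01
      · exact v02
      · exact v03
  have := (LinearEquiv.ofBijective ev ⟨hinj, hsurj⟩).finrank_eq
  rw [this]
  simp

end Frame

/-! ### Covariance of the star and of the volume form under linear isomorphisms -/

section StarCovariance

/-- The matrix of a linear automorphism of `E4` in the standard basis. -/
def mat (A : E4 ≃L[ℝ] E4) : Matrix (Fin 4) (Fin 4) ℝ := Matrix.of fun i l => A (stdVec l) i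

theorem mat_mul (A B : E4 ≃L[ℝ] E4) : mat (A.trans B) = mat B * mat A := by
  ext i l
  have h := sum_coord_smul_stdVec (A (stdVec l))
  have h2 : B (A (stdVec l)) = ∑ j, A (stdVec l) j • B (stdVec j) := by
    conv_lhs => rw [← h, map_sum]
    simp
  change B (A (stdVec l)) i = _
  rw [h2, Matrix.mul_apply]
  simp [mat, mul_comm]

theorem mat_refl : mat (ContinuousLinearEquiv.refl ℝ E4) = 1 := by
  ext i l
  simp [mat, stdVec, Matrix.one_apply]

theorem mat_symm_mul (A : E4 ≃L[ℝ] E4) : mat A.symm * mat A = 1 := by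
  rw [← mat_mul, ContinuousLinearEquiv.self_trans_symm, mat_refl]

theorem mat_mul_symm (A : E4 ≃L[ℝ] E4) : mat A * mat A.symm = 1 := by
  rw [← mat_mul, ContinuousLinearEquiv.symm_trans_self, mat_refl]

theorem isOrtho_iff {G : Matrix (Fin 4) (Fin 4) ℝ} {A : E4 ≃L[ℝ] E4} :
    IsOrtho G A ↔ G⁻¹ = mat A * (mat A).transpose := by
  rw [IsOrtho, ← Matrix.ext_iff]
  rfl

theorem IsOrtho.congr {G : Matrix (Fin 4) (Fin 4) ℝ} {B : E4 ≃L[ℝ] E4} (hB : IsOrtho G B)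
    (A : E4 ≃L[ℝ] E4) : IsOrtho ((mat A).transpose * G * mat A) (B.trans A.symm) := by
  rw [isOrtho_iff] at hB ⊢
  have h1 : (mat A)⁻¹ = mat A.symm := Matrix.inv_eq_left_inv (mat_symm_mul A)
  rw [Matrix.mul_inv_rev, Matrix.mul_inv_rev, hB, mat_mul, Matrix.transpose_mul,
    ← Matrix.transpose_nonsing_inv, h1]
  simp only [Matrix.mul_assoc]

theorem contract_comp (m k : ℕ) (η : Λ[m + k]) (A : E4 →L[ℝ] E4)
    (v : Fin k → E4) : contract m k (η.compContinuousLinearMap A) v =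
      (contract m k η (fun a => A (v a))).compContinuousLinearMap A := by
  induction k with
  | zero => rfl
  | succ k ih =>
    have h1 : ContinuousAlternatingMap.curryLeft (n := m + k) (η.compContinuousLinearMap A) (v 0) =
      (ContinuousAlternatingMap.curryLeft (n := m + k) η (A (v 0))).compContinuousLinearMap A :=
      ContinuousAlternatingMap.curryLeft_compContinuousLinearMap (n := m + k) η A (v 0)
    change contract m k (ContinuousAlternatingMap.curryLeft (n := m + k)
      (η.compContinuousLinearMap A) (v 0)) (Fin.tail v) = _
    rw [h1, ih]
    rfl

/-- In the frame formula the metric enters only through the frame, and `A` maps the frame `B.trans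
A.symm` of the pulled back metric to the frame `B`. -/
theorem hodgeStar_comp {G : Matrix (Fin 4) (Fin 4) ℝ} {B : E4 ≃L[ℝ] E4} (hB : IsOrtho G B)
    (A : E4 ≃L[ℝ] E4) (k m : ℕ) (vol : Λ[m + k]) (α : Λ[k]) :
    hodgeStar k m ((mat A).transpose * G * mat A) (vol.compContinuousLinearMap (A : E4 →L[ℝ] E4))
      (α.compContinuousLinearMap (A : E4 →L[ℝ] E4)) =
      (hodgeStar k m G vol α).compContinuousLinearMap (A : E4 →L[ℝ] E4) := by
  rw [hodgeStar_of_isOrtho (hB.congr A), hodgeStar_of_isOrtho hB]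
  ext w
  simp only [contract_comp, ContinuousAlternatingMap.smul_apply,
    ContinuousAlternatingMap.sum_apply, ContinuousAlternatingMap.compContinuousLinearMap_apply,
    Function.comp_def]
  simp

theorem det_mat_apply (η : Λ[4]) (A : E4 ≃L[ℝ] E4) :
    η (fun i => A (stdVec i)) = (mat A).det * η stdVec := by
  let e := (EuclideanSpace.basisFun (Fin 4) ℝ).toBasis
  have he : ⇑e = stdVec := by
    ext i
    simp [e, stdVec]
  have h1 := η.toAlternatingMap.eq_smul_basis_det e
  have h3 : η (fun i => A (stdVec i)) = η stdVec * e.det (fun i => A (stdVec i)) := by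
    have := congrArg (fun f => f (fun i => A (stdVec i))) h1
    rw [he] at this
    exact this
  rw [h3, mul_comm]
  congr 1

/-- The volume form attached to a Gram matrix and an orientation form. -/
def volOf (G : Matrix (Fin 4) (Fin 4) ℝ) (η : Λ[4]) : Λ[4] :=
  (Real.sqrt G.det / |η stdVec|) • η

/-- The square root produces `|det A|`, which cancels against the normalising denominator; the sign
of `det A` stays in the orientation form. -/
theorem volOf_comp (G : Matrix (Fin 4) (Fin 4) ℝ) (η : Λ[4]) (A : E4 ≃L[ℝ] E4) :
    volOf ((mat A).transpose * G * mat A) (η.compContinuousLinearMap (A : E4 →L[ℝ] E4)) =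
      (volOf G η).compContinuousLinearMap (A : E4 →L[ℝ] E4) := by
  have h1 : (η.compContinuousLinearMap (A : E4 →L[ℝ] E4)) stdVec = (mat A).det * η stdVec :=
    det_mat_apply η A
  have hd : (mat A).det ≠ 0 := by
    intro h
    have := congrArg Matrix.det (mat_mul_symm A)
    rw [Matrix.det_mul, h] at this
    simp at this
  have h2 : Real.sqrt ((mat A).transpose * G * mat A).det = |(mat A).det| * Real.sqrt G.det := by
    rw [Matrix.det_mul, Matrix.det_mul, Matrix.det_transpose,
      show (mat A).det * G.det * (mat A).det = (mat A).det ^ 2 * G.det by ring,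
      Real.sqrt_mul (sq_nonneg _), Real.sqrt_sq_eq_abs]
  unfold volOf
  rw [h1, h2, abs_mul, mul_div_mul_left _ _ (abs_ne_zero.2 hd)]
  rfl

theorem volOf_ne_zero {G : Matrix (Fin 4) (Fin 4) ℝ} (hG : G.PosDef) {η : Λ[4]}
    (hη : η ≠ 0) : volOf G η ≠ 0 := by
  have hb : η stdVec ≠ 0 := topForm_apply_ne_zero hη (ContinuousLinearEquiv.refl ℝ E4)
  have h1 : 0 < Real.sqrt G.det := Real.sqrt_pos.2 hG.det_pos
  exact smul_ne_zero (div_ne_zero h1.ne' (abs_ne_zero.2 hb)) hη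

theorem volOf_frame_sq {G : Matrix (Fin 4) (Fin 4) ℝ} (hG : G.PosDef) {η : Λ[4]}
    (hη : η ≠ 0) {A : E4 ≃L[ℝ] E4} (hA : IsOrtho G A) :
    volOf G η (fun i => A (stdVec i)) ^ 2 = 1 := by
  have hb : η stdVec ≠ 0 := topForm_apply_ne_zero hη (ContinuousLinearEquiv.refl ℝ E4)
  have hd := hG.det_pos
  have h1 : (mat A).det ^ 2 * G.det = 1 := by
    have := congrArg Matrix.det (isOrtho_iff.1 hA)
    rw [Matrix.det_mul, Matrix.det_transpose, Matrix.det_nonsing_inv, Ring.inverse_eq_inv'] at this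
    field_simp at this
    linarith
  rw [det_mat_apply]
  change ((mat A).det * (Real.sqrt G.det / |η stdVec| * η stdVec)) ^ 2 = 1
  rw [mul_pow, mul_pow, div_pow, Real.sq_sqrt hd.le, sq_abs]
  field_simp
  linarith

end StarCovariance

/-! ### The metric and the star in one fixed chart -/

section MetricCharts

variable {M : Type*} [TopologicalSpace M] [ChartedSpace E4 M] [IsManifold (𝓡 4) ∞ M]

/-- A coordinate field is the tangent map of the inverse chart applied to a constant field on `E4`.
Feeding such fields to the metric makes the Gram matrix smooth. -/
theorem contMDiffAt_coordinate_field (x : M) (v : E4) {y : E4}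
    (hy : y ∈ (chart x).target) :
    ContMDiffAt (𝓡 4) (𝓡 4).tangent ∞
      (fun z => (⟨(chart x).symm z, tder (chart x).symm z v⟩ :
        TangentBundle (𝓡 4) M)) y := by
  have h1 := (contMDiffOn_symm x).contMDiffOn_tangentMapWithin (m := ∞) (by simp)
    (isOpen_target x).uniqueMDiffOn
  have h2 : ContMDiffAt (𝓡 4) (𝓡 4).tangent ∞ (fun z => (⟨z, v⟩ : TangentBundle (𝓡 4) E4)) y :=
    contMDiffAt_vectorSpace_iff_contDiffAt.2 contDiffAt_const
  have h3 : ContMDiffAt (𝓡 4) (𝓡 4).tangent ∞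
      (fun z => tangentMapWithin (𝓡 4) (𝓡 4) (chart x).symm
        (chart x).target (⟨z, v⟩ : TangentBundle (𝓡 4) E4)) y := by
    refine ContMDiffAt.comp y (h1.contMDiffAt ?_) h2
    exact (FiberBundle.continuous_proj E4 (TangentSpace (𝓡 4))).continuousAt.preimage_mem_nhds
      ((isOpen_target x).mem_nhds hy)
  refine h3.congr_of_eventuallyEq ?_
  filter_upwards [(isOpen_target x).mem_nhds hy] with z hz
  simp only [tangentMapWithin]
  rw [mfderivWithin_of_mem_nhds ((isOpen_target x).mem_nhds hz)]
  rfl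

/-- The Gram matrix of `g` in the preferred chart at `x`. -/
def gramChart (g : Metric M) (x : M) (y : E4) : Matrix (Fin 4) (Fin 4) ℝ :=
  Matrix.of fun i j => g.inner ((chart x).symm y)
    (tder (chart x).symm y (stdVec i)) (tder (chart x).symm y (stdVec j))

theorem contDiffAt_gramChart (g : Metric M) (x : M) {y : E4}
    (hy : y ∈ (chart x).target) (i j : Fin 4) :
    ContDiffAt ℝ ∞ (fun z => gramChart g x z i j) y := by
  have h1 := contMDiffAt_coordinate_field x (stdVec i) hy
  have h2 := contMDiffAt_coordinate_field x (stdVec j) hy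
  have h0 := ContMDiffAt.comp y (g.contMDiff.contMDiffAt (x := (chart x).symm y))
    ((contMDiffOn_symm x).contMDiffAt ((isOpen_target x).mem_nhds hy))
  have h3 : ContMDiffAt (𝓡 4) ((𝓡 4).prod 𝓘(ℝ, ℝ)) ∞
      (fun z => (⟨(chart x).symm z, gramChart g x z i j⟩ :
        Bundle.TotalSpace ℝ (Bundle.Trivial M ℝ))) y := by
    apply ContMDiffAt.clm_bundle_apply₂ (F₁ := E4) (F₂ := E4)
    · exact h0
    · exact h1
    · exact h2
  rw [Bundle.contMDiffAt_totalSpace] at h3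
  exact h3.2.contDiffAt

theorem tder_symm_injective (x : M) {y : E4} (hy : y ∈ (chart x).target) :
    Function.Injective (tder (chart x).symm y) := by
  have h1 : chart x ∘ (chart x).symm =ᶠ[𝓝 y] id := by
    filter_upwards [(isOpen_target x).mem_nhds hy] with z hz
    exact (chart x).right_inv hz
  have h2 := mfderiv_comp y ((contMDiffAt_chart x ((chart x).map_target hy)).mdifferentiableAt
    (by simp)) (mdifferentiableAt_symm x hy)
  have h3 : ∀ v : E4, mfderiv (𝓡 4) (𝓡 4) (chart x) ((chart x).symm y)
      (tder (chart x).symm y v) = v := by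
    intro v
    have h4 := DFunLike.congr_fun h2 v
    rw [h1.mfderiv_eq, mfderiv_id] at h4
    exact h4.symm
  intro v w hvw
  rw [← h3 v, ← h3 w, hvw]

/-- The derivative of the inverse of a chart, as an isomorphism. -/
def chartIso (x : M) {y : E4} (hy : y ∈ (chart x).target) : E4 ≃L[ℝ] E4 :=
  (LinearEquiv.ofInjectiveEndo (tder (chart x).symm y : E4 →ₗ[ℝ] E4)
    (tder_symm_injective x hy)).toContinuousLinearEquiv

/-- The inner product of `g` at `p`, on the model space. -/
def innerAt (g : Metric M) (p : M) : E4 →L[ℝ] E4 →L[ℝ] ℝ := g.inner p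

theorem bilin_gram (b : E4 →L[ℝ] E4 →L[ℝ] ℝ) (A : E4 ≃L[ℝ] E4) :
    (Matrix.of fun i j => b (A (stdVec i)) (A (stdVec j))) =
      (mat A).transpose * (Matrix.of fun i j => b (stdVec i) (stdVec j)) * mat A := by
  ext i j
  have h1 : ∀ l, A (stdVec l) = ∑ k, mat A k l • stdVec k := fun l =>
    (sum_coord_smul_stdVec (A (stdVec l))).symm
  simp only [Matrix.of_apply]
  rw [h1, h1]
  simp only [map_sum, map_smul, sum_apply, smul_apply,
    Matrix.mul_apply, Matrix.transpose_apply, Matrix.of_apply, smul_eq_mul, Finset.sum_mul,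
    Finset.mul_sum]
  refine Finset.sum_congr rfl fun k _ => Finset.sum_congr rfl fun l _ => ?_
  ring

theorem gramChart_eq (g : Metric M) (x : M) {y : E4} (hy : y ∈ (chart x).target) :
    gramChart g x y = (mat (chartIso x hy)).transpose * gram g ((chart x).symm y) *
      mat (chartIso x hy) :=
  bilin_gram (innerAt g ((chart x).symm y)) (chartIso x hy)

theorem gram_posDef (g : Metric M) (p : M) : (gram g p).PosDef := by
  refine Matrix.PosDef.of_dotProduct_mulVec_pos ?_ fun v hv => ?_
  · ext i j
    exact g.symm p (stdVec j) (stdVec i)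
  · let w : E4 := ∑ i, v i • stdVec i
    have hw : w ≠ 0 := by
      intro h
      apply hv
      ext i
      have := congrArg (fun u : E4 => u i) h
      fin_cases i <;> simpa [w, stdVec, Fin.sum_univ_four] using this
    have h1 : 0 < innerAt g p w w := g.pos p w hw
    have h2 : innerAt g p w w = dotProduct (star v) ((gram g p).mulVec v) := by
      simp only [w, map_sum, map_smul, sum_apply,
        smul_apply, dotProduct, Matrix.mulVec, smul_eq_mul, Finset.mul_sum]
      rw [Finset.sum_comm]
      refine Finset.sum_congr rfl fun i _ => Finset.sum_congr rfl fun j _ => ?_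
      have : (gram g p) i j = innerAt g p (stdVec i) (stdVec j) := rfl
      rw [this]
      simp
      ring
    rwa [← h2]

/-- At each point the star is defined in the preferred chart of that point. Covariance under
`chartIso` converts it to the star of one fixed chart, in which dependence on the point can be
discussed. -/
theorem localRep_star2 (o : OrientationForm M) (g : Metric M) (x : M) {y : E4}
    (hy : y ∈ (chart x).target) (σ : DiffForm M 2) :
    localRep (star2 o g σ) x y = hodgeStar 2 2 (gramChart g x y)
      (volOf (gramChart g x y) (localRep o.form x y)) (localRep σ x y) := by
  obtain ⟨B, hB⟩ := exists_isOrtho (gram_posDef g ((chart x).symm y))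
  rw [gramChart_eq g x hy]
  have h1 : ∀ {k : ℕ} (σ : DiffForm M k), localRep σ x y =
      (valAt σ ((chart x).symm y)).compContinuousLinearMap
        (chartIso x hy : E4 →L[ℝ] E4) := fun σ => rfl
  rw [h1 o.form, h1 σ, volOf_comp]
  exact (hodgeStar_comp hB (chartIso x hy) 2 2
    (volAt o g ((chart x).symm y)) (valAt σ ((chart x).symm y))).symm

theorem localRep_star3 (o : OrientationForm M) (g : Metric M) (x : M) {y : E4}
    (hy : y ∈ (chart x).target) (σ : DiffForm M 3) :
    localRep (star3 o g σ) x y = hodgeStar 3 1 (gramChart g x y)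
      (volOf (gramChart g x y) (localRep o.form x y)) (localRep σ x y) := by
  obtain ⟨B, hB⟩ := exists_isOrtho (gram_posDef g ((chart x).symm y))
  rw [gramChart_eq g x hy]
  have h1 : ∀ {k : ℕ} (σ : DiffForm M k), localRep σ x y =
      (valAt σ ((chart x).symm y)).compContinuousLinearMap
        (chartIso x hy : E4 →L[ℝ] E4) := fun σ => rfl
  rw [h1 o.form, h1 σ, volOf_comp]
  exact (hodgeStar_comp hB (chartIso x hy) 3 1
    (volAt o g ((chart x).symm y)) (valAt σ ((chart x).symm y))).symm

theorem gramChart_posDef (g : Metric M) (x : M) {y : E4} (hy : y ∈ (chart x).target) :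
    (gramChart g x y).PosDef := by
  rw [gramChart_eq g x hy]
  have hu : IsUnit (mat (chartIso x hy)) :=
    ⟨⟨_, _, mat_mul_symm (chartIso x hy), mat_symm_mul (chartIso x hy)⟩, rfl⟩
  have := (gram_posDef g ((chart x).symm y)).conjTranspose_mul_mul_same
    (B := mat (chartIso x hy)) (Matrix.mulVec_injective_of_isUnit hu)
  rwa [Matrix.conjTranspose_eq_transpose_of_trivial] at this

theorem localRep_orientation_ne_zero (o : OrientationForm M) (x : M) {y : E4}
    (hy : y ∈ (chart x).target) : localRep o.form x y ≠ 0 := by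
  intro h
  apply topForm_apply_ne_zero (o.ne_zero ((chart x).symm y)) (chartIso x hy)
  exact DFunLike.congr_fun h stdVec

theorem localRep_orientation_stdVec (o : OrientationForm M) (x : M) {y : E4}
    (hy : y ∈ (chart x).target) : localRep o.form x y stdVec ≠ 0 :=
  topForm_apply_ne_zero (localRep_orientation_ne_zero o x hy) (ContinuousLinearEquiv.refl ℝ E4)

end MetricCharts

/-! ### Smoothness of the star -/

section StarSmooth

theorem ContDiffAt.matrix_det {F : Type*} [NormedAddCommGroup F] [NormedSpace ℝ F]
    {G : F → Matrix (Fin 4) (Fin 4) ℝ} {y : F}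
    (h : ∀ i j, ContDiffAt ℝ ∞ (fun z => G z i j) y) : ContDiffAt ℝ ∞ (fun z => (G z).det) y := by
  simp only [Matrix.det_apply]
  exact ContDiffAt.sum (𝕜 := ℝ) fun p _ => (contDiffAt_prod fun i _ => h _ _).const_smul _

theorem ContDiffAt.matrix_inv {F : Type*} [NormedAddCommGroup F] [NormedSpace ℝ F]
    {G : F → Matrix (Fin 4) (Fin 4) ℝ} {y : F}
    (h : ∀ i j, ContDiffAt ℝ ∞ (fun z => G z i j) y) (hd : (G y).det ≠ 0) (i j : Fin 4) :
    ContDiffAt ℝ ∞ (fun z => (G z)⁻¹ i j) y := by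
  simp only [Matrix.inv_def, Ring.inverse_eq_inv', Matrix.smul_apply, smul_eq_mul,
    Matrix.adjugate_apply]
  refine ((ContDiffAt.matrix_det h).inv hd).mul (ContDiffAt.matrix_det fun a b => ?_)
  by_cases hj : a = j
  · subst hj
    simp only [Matrix.updateRow_self]
    exact contDiffAt_const
  · simp only [Matrix.updateRow_ne hj]
    exact h a b

theorem contDiffAt_volOf {F : Type*} [NormedAddCommGroup F] [NormedSpace ℝ F]
    {G : F → Matrix (Fin 4) (Fin 4) ℝ} {η : F → Λ[4]} {y : F}
    (h : ∀ i j, ContDiffAt ℝ ∞ (fun z => G z i j) y) (hη : ContDiffAt ℝ ∞ η y)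
    (hd : (G y).det ≠ 0) (h0 : η y stdVec ≠ 0) :
    ContDiffAt ℝ ∞ (fun z => volOf (G z) (η z)) y := by
  unfold volOf
  have h1 : ContDiffAt ℝ ∞ (fun z => η z stdVec) y :=
    ((evalForm stdVec).contDiff.contDiffAt).comp y hη
  exact (((ContDiffAt.matrix_det h).sqrt hd).div (h1.abs h0) (abs_ne_zero.2 h0)).smul hη

theorem contDiffAt_contract {F : Type*} [NormedAddCommGroup F] [NormedSpace ℝ F] (m k : ℕ)
    {η : F → Λ[m + k]} {y : F} (hη : ContDiffAt ℝ ∞ η y) (v : Fin k → E4) :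
    ContDiffAt ℝ ∞ (fun z => contract m k (η z) v) y := by
  let L : (Λ[m + k]) →ₗ[ℝ] (E4 [⋀^Fin m]→L[ℝ] ℝ) :=
    { toFun := fun η => contract m k η v
      map_add' := fun a b => contract_add m k a b v
      map_smul' := fun c a => contract_smul m k c a v }
  exact (L.toContinuousLinearMap.contDiff.contDiffAt).comp y hη

theorem contDiffAt_hodgeStar {F : Type*} [NormedAddCommGroup F] [NormedSpace ℝ F] (k m : ℕ)
    {G : F → Matrix (Fin 4) (Fin 4) ℝ} {η : F → Λ[m + k]}
    {α : F → Λ[k]} {y : F}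
    (h : ∀ i j, ContDiffAt ℝ ∞ (fun z => G z i j) y) (hd : (G y).det ≠ 0)
    (hη : ContDiffAt ℝ ∞ η y) (hα : ContDiffAt ℝ ∞ α y) :
    ContDiffAt ℝ ∞ (fun z => hodgeStar k m (G z) (η z) (α z)) y := by
  unfold hodgeStar
  refine ContDiffAt.const_smul _ ?_
  refine ContDiffAt.sum (𝕜 := ℝ) fun i _ => ContDiffAt.sum (𝕜 := ℝ) fun j _ => ?_
  refine ((contDiffAt_prod fun a _ => ContDiffAt.matrix_inv h hd _ _).mul ?_).smul
    (contDiffAt_contract m k hη _)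
  exact ((evalForm fun a => stdVec (i a)).contDiff.contDiffAt).comp y hα

variable {M : Type*} [TopologicalSpace M] [ChartedSpace E4 M] [IsManifold (𝓡 4) ∞ M]

theorem isSmoothForm_star3 (o : OrientationForm M) (g : Metric M) {σ : DiffForm M 3}
    (hσ : IsSmoothForm σ) : IsSmoothForm (star3 o g σ) := by
  intro x y hy
  have hG := contDiffAt_gramChart g x hy
  have hd := (gramChart_posDef g x hy).det_pos.ne'
  have h1 := contDiffAt_hodgeStar 3 1 hG hd (contDiffAt_volOf hG
    (localRep_differentiable o.smooth x hy) hd (localRep_orientation_stdVec o x hy))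
    (localRep_differentiable hσ x hy)
  refine (h1.congr_of_eventuallyEq ?_).contDiffWithinAt
  filter_upwards [(isOpen_target x).mem_nhds hy] with z hz
  exact localRep_star3 o g x hz σ

end StarSmooth

/-! ### The Leibniz rule for a 1-form and a 2-form -/

section Leibniz

theorem extDeriv_one {h : E4 → Λ[1]} {y : E4} (hh : DifferentiableAt ℝ h y)
    (u v : E4) : extDeriv h y ![u, v] =
      fderiv ℝ (fun z => h z ![v]) y u - fderiv ℝ (fun z => h z ![u]) y v := by
  rw [extDeriv_apply hh, Fin.sum_univ_two]
  have e0 : Fin.removeNth 0 ![u, v] = ![v] := by ext a; fin_cases a; rfl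
  have e1 : Fin.removeNth 1 ![u, v] = ![u] := by ext a; fin_cases a; rfl
  rw [e0, e1]
  simp [sub_eq_add_neg]

theorem extDeriv_two {σ : E4 → Λ[2]} {y : E4} (hσ : DifferentiableAt ℝ σ y)
    (u v w : E4) : extDeriv σ y ![u, v, w] =
      fderiv ℝ (fun z => σ z ![v, w]) y u - fderiv ℝ (fun z => σ z ![u, w]) y v +
        fderiv ℝ (fun z => σ z ![u, v]) y w := by
  rw [extDeriv_apply hσ, Fin.sum_univ_three]
  have e0 : Fin.removeNth 0 ![u, v, w] = ![v, w] := by ext a; fin_cases a <;> rfl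
  have e1 : Fin.removeNth 1 ![u, v, w] = ![u, w] := by ext a; fin_cases a <;> rfl
  have e2 : Fin.removeNth 2 ![u, v, w] = ![u, v] := by ext a; fin_cases a <;> rfl
  rw [e0, e1, e2]
  simp [sub_eq_add_neg]

theorem wedgeOne_two (h : Λ[1]) (β : Λ[2]) (u v w : E4) :
    wedgeOne h β ![u, v, w] =
      h ![u] * β ![v, w] - h ![v] * β ![u, w] + h ![w] * β ![u, v] := by
  rw [wedgeOne_apply, Fin.sum_univ_three]
  have e0 : Fin.removeNth 0 ![u, v, w] = ![v, w] := by ext a; fin_cases a <;> rfl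
  have e1 : Fin.removeNth 1 ![u, v, w] = ![u, w] := by ext a; fin_cases a <;> rfl
  have e2 : Fin.removeNth 2 ![u, v, w] = ![u, v] := by ext a; fin_cases a <;> rfl
  rw [e0, e1, e2]
  simp [sub_eq_add_neg]

theorem contDiff_wedgeOne {k : ℕ} : ContDiff ℝ ∞
    (fun p : (Λ[1]) × (Λ[k]) => wedgeOne p.1 p.2) := by
  rw [contDiff_iff_contDiffAt]
  intro p
  refine contDiffAt_form_of_coeffs fun i => ?_
  simp only [wedgeOne_apply]
  refine ContDiffWithinAt.sum fun j _ => contDiffWithinAt_const.mul ?_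
  exact ((evalForm _).contDiff.comp contDiff_fst).contDiffWithinAt.mul
    ((evalForm _).contDiff.comp contDiff_snd).contDiffWithinAt

theorem extDeriv_wedgeOne {h : E4 → Λ[1]} {σ : E4 → Λ[2]} {y : E4}
    (hh : DifferentiableAt ℝ h y) (hσ : DifferentiableAt ℝ σ y) (v : Fin 4 → E4) :
    extDeriv (fun z => wedgeOne (h z) (σ z)) y v =
      wedgeTwoTwo (extDeriv h y) (σ y) v - wedgeOne (h y) (extDeriv σ y) v := by
  have hT : DifferentiableAt ℝ (fun z => wedgeOne (h z) (σ z)) y :=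
    DifferentiableAt.comp (g := fun p : (Λ[1]) × (Λ[2]) =>
      wedgeOne p.1 p.2) (f := fun z => (h z, σ z)) y
      (contDiff_wedgeOne.differentiable (by simp) (h y, σ y)) (hh.prodMk hσ)
  have h1 : ∀ u : E4, DifferentiableAt ℝ (fun z => h z ![u]) y := fun u =>
    (evalForm ![u]).differentiableAt.comp y hh
  have h2 : ∀ u w : E4, DifferentiableAt ℝ (fun z => σ z ![u, w]) y := fun u w =>
    (evalForm ![u, w]).differentiableAt.comp y hσ
  have h3 : ∀ a u w b : E4, fderiv ℝ (fun z => h z ![u] * σ z ![w, b]) y a =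
      h y ![u] * fderiv ℝ (fun z => σ z ![w, b]) y a +
        fderiv ℝ (fun z => h z ![u]) y a * σ y ![w, b] := by
    intro a u w b
    rw [fderiv_fun_mul (h1 u) (h2 w b)]
    simp [mul_comm]
  have h4 : ∀ a u w b : E4, fderiv ℝ (fun z => wedgeOne (h z) (σ z) ![u, w, b]) y a =
      fderiv ℝ (fun z => h z ![u] * σ z ![w, b]) y a -
      fderiv ℝ (fun z => h z ![w] * σ z ![u, b]) y a +
      fderiv ℝ (fun z => h z ![b] * σ z ![u, w]) y a := by
    intro a u w b
    simp only [wedgeOne_two]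
    have m1 : ∀ u w b : E4, DifferentiableAt ℝ (fun z => h z ![u] * σ z ![w, b]) y := fun u w b =>
      (h1 u).mul (h2 w b)
    rw [fderiv_fun_add ((m1 u w b).fun_sub (m1 w u b)) (m1 b u w),
      fderiv_fun_sub (m1 u w b) (m1 w u b)]
    rfl
  rw [extDeriv_apply hT, Fin.sum_univ_four, wedgeOne_three]
  have e0 : Fin.removeNth 0 v = ![v 1, v 2, v 3] := by ext a; fin_cases a <;> rfl
  have e1 : Fin.removeNth 1 v = ![v 0, v 2, v 3] := by ext a; fin_cases a <;> rfl
  have e2 : Fin.removeNth 2 v = ![v 0, v 1, v 3] := by ext a; fin_cases a <;> rfl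
  have e3 : Fin.removeNth 3 v = ![v 0, v 1, v 2] := by ext a; fin_cases a <;> rfl
  rw [e0, e1, e2, e3]
  simp only [wedgeTwoTwo, h4, h3, extDeriv_one hh, extDeriv_two hσ]
  simp
  ring

end Leibniz

/-! ### Stokes' theorem on a closed oriented 4-manifold -/

section Integration

open MeasureTheory

variable {M : Type*} [TopologicalSpace M] [ChartedSpace E4 M] [IsManifold (𝓡 4) ∞ M]

theorem topForm_comp_stdVec (η : Λ[4]) (A : E4 →L[ℝ] E4) :
    η.compContinuousLinearMap A stdVec = A.det * η stdVec := by
  let e := (EuclideanSpace.basisFun (Fin 4) ℝ).toBasis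
  have he : ⇑e = stdVec := by
    ext i
    simp [e, stdVec]
  have h1 := η.toAlternatingMap.eq_smul_basis_det e
  have h3 : η (fun i => A (stdVec i)) = η stdVec * e.det (fun i => A (stdVec i)) := by
    have := congrArg (fun f => f (fun i => A (stdVec i))) h1
    rw [he] at this
    exact this
  change η (fun i => A (stdVec i)) = _
  have h4 := e.det_comp (A : E4 →ₗ[ℝ] E4) e
  rw [e.det_self, he] at h4
  rw [h3, mul_comm, ContinuousLinearMap.det]
  congr 1
  simpa [Function.comp_def] using h4

omit [IsManifold (𝓡 4) ∞ M] in
theorem localRep_eq_zero {k : ℕ} {σ : DiffForm M k} {x : M} {y : E4}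
    (h : valAt σ ((chart x).symm y) = 0) : localRep σ x y = 0 := by
  rw [localRep, pullback_def, h]
  rfl

/-- The density of a 4-form with respect to the orientation, in the preferred chart at `x`. -/
def density (o : OrientationForm M) (x : M) (μ : DiffForm M 4) (y : E4) : ℝ :=
  localRep o.form x y stdVec / |localRep o.form x y stdVec| * localRep μ x y stdVec

/-- Change of variables along the transition map. A 4-form acquires the Jacobian determinant and the
sign of the orientation form turns it into its absolute value, so no oriented atlas is needed. Off
the overlap the integrands vanish. -/
theorem integral_density_eq (o : OrientationForm M) (x x' : M) (μ : DiffForm M 4)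
    (hx : ∀ p, p ∉ (chart x).source → valAt μ p = 0)
    (hx' : ∀ p, p ∉ (chart x').source → valAt μ p = 0) :
    ∫ y in (chart x).target, density o x μ y =
      ∫ y in (chart x').target, density o x' μ y := by
  let s := (chart x).target ∩
    (chart x).symm ⁻¹' (chart x').source
  let s' := (chart x').target ∩
    (chart x').symm ⁻¹' (chart x).source
  have hs : IsOpen s := (continuousOn_extChartAt_symm x).isOpen_inter_preimage (isOpen_target x)
      (isOpen_extChartAt_source x')
  have hzero : ∀ (a b : M), (∀ p, p ∉ (chart b).source → valAt μ p = 0) →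
      ∫ y in (chart a).target, density o a μ y =
      ∫ y in (chart a).target ∩
        (chart a).symm ⁻¹' (chart b).source, density o a μ y := by
    intro a b hb
    refine (setIntegral_eq_of_subset_of_forall_sdiff_eq_zero (isOpen_target a).measurableSet
      inter_subset_left ?_)
    intro y hy
    have : valAt μ ((chart a).symm y) = 0 := hb _ fun h => hy.2 ⟨hy.1, h⟩
    rw [density, localRep_eq_zero this]
    simp
  rw [hzero x x' hx', hzero x' x hx]
  let τ : E4 → E4 := chartRep (chart x).symm x'
  have hτ : ∀ y ∈ s, ContDiffAt ℝ ∞ τ y := fun y hy =>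
    contDiffAt_chartRep ((contMDiffOn_symm x).contMDiffAt ((isOpen_target x).mem_nhds hy.1)) hy.2
  have himg : τ '' s = s' := by
    ext w
    constructor
    · rintro ⟨y, hy, rfl⟩
      refine ⟨(chart x').map_source hy.2, ?_⟩
      change (chart x').symm (chart x' ((chart x).symm y)) ∈
        (chart x).source
      rw [(chart x').left_inv hy.2]
      exact (chart x).map_target hy.1
    · rintro ⟨hw, hw2⟩
      refine ⟨chart x ((chart x').symm w),
        ⟨(chart x).map_source hw2, ?_⟩, ?_⟩
      · change (chart x).symm (chart x ((chart x').symm w)) ∈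
          (chart x').source
        rw [(chart x).left_inv hw2]
        exact (chart x').map_target hw
      · change chart x' ((chart x).symm _) = w
        rw [(chart x).left_inv hw2, (chart x').right_inv hw]
  have hinj : InjOn τ s := by
    intro y hy z hz h
    have h1 := (chart x').injOn hy.2 hz.2 h
    exact (chart x).symm.injOn hy.1 hz.1 h1
  have key := integral_image_eq_integral_abs_det_fderiv_smul volume hs.measurableSet
    (fun y hy => ((hτ y hy).differentiableAt (by simp)).hasFDerivAt.hasFDerivWithinAt) hinj
    (density o x' μ)
  change ∫ y in s, _ = ∫ y in s', _
  rw [← himg, key]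
  refine setIntegral_congr_fun hs.measurableSet fun y hy => ?_
  have hrep : ∀ ν : DiffForm M 4, localRep ν x y stdVec =
      (fderiv ℝ τ y).det * localRep ν x' (τ y) stdVec := by
    intro ν
    rw [← topForm_comp_stdVec, localRep, pullback_eq_localRep ν (mdifferentiableAt_symm x hy.1) hy.2]
  have h0 := localRep_orientation_stdVec o x hy.1
  rw [hrep] at h0
  have hd : (fderiv ℝ τ y).det ≠ 0 := left_ne_zero_of_mul h0
  have ho : localRep o.form x' (τ y) stdVec ≠ 0 := right_ne_zero_of_mul h0
  simp only [density, hrep, smul_eq_mul, abs_mul]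
  have := abs_ne_zero.2 ho
  have := abs_ne_zero.2 hd
  field_simp
  rw [sq_abs]

omit [IsManifold (𝓡 4) ∞ M] in
theorem contDiff_indicator_of_compact {F : Type*} [NormedAddCommGroup F] [NormedSpace ℝ F]
    {t K : Set E4} (ht : IsOpen t) (hK : IsCompact K) (hKt : K ⊆ t) {f : E4 → F}
    (hf : ∀ y ∈ t, ContDiffAt ℝ ∞ f y) (h0 : ∀ y ∈ t, y ∉ K → f y = 0) :
    ContDiff ℝ ∞ (t.indicator f) ∧ HasCompactSupport (t.indicator f) := by
  have hz : ∀ y, y ∉ K → t.indicator f y = 0 := by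
    intro y hy
    by_cases h : y ∈ t
    · rw [indicator_of_mem h, h0 y h hy]
    · exact indicator_of_notMem h f
  refine ⟨contDiff_iff_contDiffAt.2 fun y => ?_, HasCompactSupport.intro hK hz⟩
  by_cases h : y ∈ t
  · refine (hf y h).congr_of_eventuallyEq ?_
    filter_upwards [ht.mem_nhds h] with z hz using indicator_of_mem hz f
  · refine contDiffAt_const (c := (0 : F)) |>.congr_of_eventuallyEq ?_
    filter_upwards [hK.isClosed.isOpen_compl.mem_nhds fun h' => h (hKt h')] with z hz' using hz z hz'

/-- Integration by parts against the constant function `1`. -/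
theorem integral_fderiv_eq_zero {f : E4 → ℝ} (hf : ContDiff ℝ ∞ f) (hc : HasCompactSupport f)
    (v : E4) : ∫ y, fderiv ℝ f y v = 0 := by
  have hc' : HasCompactSupport fun y => fderiv ℝ f y v := hc.fderiv_apply ℝ v
  have hcont : Continuous fun y => fderiv ℝ f y v :=
    (hf.continuous_fderiv (by simp)).clm_apply continuous_const
  have := integral_mul_fderiv_eq_neg_fderiv_mul_of_integrable (μ := volume) (f := f)
    (g := fun _ : E4 => (1 : ℝ)) (v := v)
    (by simpa using hcont.integrable_of_hasCompactSupport hc')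
    (by simp) (by simpa using hf.continuous.integrable_of_hasCompactSupport hc)
    (fun y _ => hf.differentiable (by simp) y) (fun y _ => differentiableAt_const _)
  simpa using this

theorem integral_extDeriv_eq_zero {β : E4 → Λ[3]} (hβ : ContDiff ℝ ∞ β)
    (hc : HasCompactSupport β) (v : Fin 4 → E4) : ∫ y, extDeriv β y v = 0 := by
  have h1 : ∀ i : Fin 4, ContDiff ℝ ∞ fun y => β y (i.removeNth v) := fun i =>
    (evalForm (i.removeNth v)).contDiff.comp hβ
  have h2 : ∀ i : Fin 4, HasCompactSupport fun y => β y (i.removeNth v) := fun i =>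
    hc.comp_left (g := fun α : Λ[3] => α (i.removeNth v)) (by simp)
  have h3 : ∀ y, extDeriv β y v =
      ∑ i : Fin 4, (-1 : ℝ) ^ i.val * fderiv ℝ (fun z => β z (i.removeNth v)) y (v i) := by
    intro y
    rw [extDeriv_apply (hβ.differentiable (by simp) y)]
    simp
  simp only [h3]
  rw [integral_finsetSum _ fun i _ => ?_]
  · simp [integral_const_mul, integral_fderiv_eq_zero (h1 _) (h2 _)]
  · refine Integrable.const_mul ?_ _
    exact (((h1 i).continuous_fderiv (by simp)).clm_apply
      continuous_const).integrable_of_hasCompactSupport ((h2 i).fderiv_apply ℝ _)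

/-- A form multiplied by a function. -/
def smulForm {k : ℕ} (ρ : M → ℝ) (S : DiffForm M k) : DiffForm M k := fun p => ρ p • S p

omit [IsManifold (𝓡 4) ∞ M] in
theorem localRep_smulForm {k : ℕ} (ρ : M → ℝ) (S : DiffForm M k) (x : M) (y : E4) :
    localRep (smulForm ρ S) x y = ρ ((chart x).symm y) • localRep S x y := rfl

theorem isSmoothForm_smulForm {k : ℕ} {ρ : M → ℝ} (hρ : ContMDiff (𝓡 4) 𝓘(ℝ, ℝ) ∞ ρ)
    {S : DiffForm M k} (hS : IsSmoothForm S) : IsSmoothForm (smulForm ρ S) := by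
  intro x
  have h1 : ContDiffOn ℝ ∞ (fun y => ρ ((chart x).symm y)) (chart x).target :=
    (hρ.comp_contMDiffOn (contMDiffOn_symm x)).contDiffOn
  exact h1.smul (hS x)

/-- The sign of the orientation form is locally constant, so it can be moved inside the
differential. Extension by zero then gives a compactly supported 3-form on `E4`. -/
theorem integral_density_dForm_eq_zero (o : OrientationForm M) (x : M) {S : DiffForm M 3}
    (hS : IsSmoothForm S) {K : Set M} (hK : IsCompact K) (hKx : K ⊆ (chart x).source)
    (h0 : ∀ p, p ∉ K → valAt S p = 0) :
    ∫ y in (chart x).target, density o x (dForm S) y = 0 := by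
  set t := (chart x).target with ht
  have hto : IsOpen t := isOpen_target x
  let a : E4 → ℝ := fun y => localRep o.form x y stdVec
  have ha0 : ∀ y ∈ t, a y ≠ 0 := fun y hy => localRep_orientation_stdVec o x hy
  have haC : ∀ y ∈ t, ContDiffAt ℝ ∞ a y := fun y hy =>
    (evalForm stdVec).contDiff.contDiffAt.comp y (localRep_differentiable o.smooth x hy)
  let β : E4 → Λ[3] := fun y => (a y / |a y|) • localRep S x y
  have hβ : ∀ y ∈ t, ContDiffAt ℝ ∞ β y := fun y hy =>
    ((haC y hy).div ((haC y hy).abs (ha0 y hy)) (abs_ne_zero.2 (ha0 y hy))).smul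
      (localRep_differentiable hS x hy)
  let K' := chart x '' K
  have hK' : IsCompact K' := hK.image_of_continuousOn ((continuousOn_extChartAt x).mono hKx)
  have hK't : K' ⊆ t := by
    rintro _ ⟨p, hp, rfl⟩
    exact (chart x).map_source (hKx hp)
  have hS0 : ∀ y ∈ t, y ∉ K' → localRep S x y = 0 := by
    intro y hy hyK
    have : valAt S ((chart x).symm y) = 0 := by
      apply h0
      intro h
      exact hyK ⟨_, h, (chart x).right_inv hy⟩
    rw [localRep, pullback_def, this]
    rfl
  obtain ⟨hc, hcs⟩ := contDiff_indicator_of_compact hto hK' hK't hβ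
    (fun y hy hyK => by simp only [β, hS0 y hy hyK, smul_zero])
  have hint := integral_extDeriv_eq_zero hc hcs stdVec
  rw [← integral_indicator hto.measurableSet, ← hint]
  congr 1
  funext y
  by_cases hy : y ∈ t
  · rw [indicator_of_mem hy]
    have h1 : t.indicator β =ᶠ[𝓝 y] (a y / |a y|) • localRep S x := by
      have h2 : ∀ᶠ z in 𝓝 y, 0 < a z * a y :=
        ((haC y hy).continuousAt.mul continuousAt_const).eventually
          (lt_mem_nhds (mul_self_pos.2 (ha0 y hy)))
      filter_upwards [hto.mem_nhds hy, h2] with z hz hz2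
      rw [indicator_of_mem hz]
      change (a z / |a z|) • localRep S x z = (a y / |a y|) • localRep S x z
      congr 1
      rcases mul_pos_iff.1 hz2 with ⟨h3, h4⟩ | ⟨h3, h4⟩
      · rw [abs_of_pos h3, abs_of_pos h4, div_self h3.ne', div_self h4.ne']
      · rw [abs_of_neg h3, abs_of_neg h4, div_neg, div_neg, div_self h3.ne, div_self h4.ne]
    rw [h1.extDeriv_eq, extDeriv_smul, density, localRep_dForm hS x hy]
    rfl
  · rw [indicator_of_notMem hy]
    have h1 : t.indicator β =ᶠ[𝓝 y] fun _ => 0 := by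
      filter_upwards [hK'.isClosed.isOpen_compl.mem_nhds fun h' => hy (hK't h')] with z hz
      by_cases hzt : z ∈ t
      · rw [indicator_of_mem hzt]
        simp only [β, hS0 z hzt hz, smul_zero]
      · exact indicator_of_notMem hzt β
    rw [h1.extDeriv_eq]
    have : extDeriv (fun _ : E4 => (0 : Λ[3])) y = 0 := by
      ext v
      rw [extDeriv_apply (differentiableAt_const _)]
      simp
    rw [this]
    rfl

omit [IsManifold (𝓡 4) ∞ M] in
theorem localRep_sum {k : ℕ} {ι : Type*} (s : Finset ι) (S : ι → DiffForm M k) (x : M) :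
    localRep (∑ i ∈ s, S i) x = ∑ i ∈ s, localRep (S i) x := by
  classical
  induction s using Finset.induction_on with
  | empty => rfl
  | insert a s ha ih => rw [Finset.sum_insert ha, Finset.sum_insert ha, localRep_add, ih]

omit [IsManifold (𝓡 4) ∞ M] in
theorem isSmoothForm_zero {k : ℕ} : IsSmoothForm (0 : DiffForm M k) := fun _ =>
  contDiffOn_const (c := (0 : Λ[k]))

omit [IsManifold (𝓡 4) ∞ M] in
theorem dForm_zero {k : ℕ} : dForm (0 : DiffForm M k) = 0 := by
  have := dForm_smul (0 : ℝ) (0 : DiffForm M k)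
  simpa using this

omit [IsManifold (𝓡 4) ∞ M] in
theorem dForm_sum {k : ℕ} {ι : Type*} (s : Finset ι) {S : ι → DiffForm M k}
    (hS : ∀ i ∈ s, IsSmoothForm (S i)) :
    IsSmoothForm (∑ i ∈ s, S i) ∧ dForm (∑ i ∈ s, S i) = ∑ i ∈ s, dForm (S i) := by
  classical
  induction s using Finset.induction_on with
  | empty => exact ⟨isSmoothForm_zero, dForm_zero⟩
  | insert a s ha ih =>
    have h1 := hS a (Finset.mem_insert_self a s)
    obtain ⟨h2, h3⟩ := ih fun i hi => hS i (Finset.mem_insert_of_mem hi)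
    rw [Finset.sum_insert ha, Finset.sum_insert ha]
    exact ⟨isSmoothForm_add h1 h2, by rw [dForm_add h1 h2, h3]⟩

omit [IsManifold (𝓡 4) ∞ M] in
theorem density_smulForm (o : OrientationForm M) (x : M) (ρ : M → ℝ) (μ : DiffForm M 4) (y : E4) :
    density o x (smulForm ρ μ) y = ρ ((chart x).symm y) * density o x μ y := by
  rw [density, density, localRep_smulForm, ContinuousAlternatingMap.smul_apply, smul_eq_mul]
  ring

theorem continuousOn_density (o : OrientationForm M) (x : M) {μ : DiffForm M 4}
    (hμ : IsSmoothForm μ) : ContinuousOn (density o x μ) (chart x).target := by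
  have h1 : ∀ {μ : DiffForm M 4}, IsSmoothForm μ →
      ContinuousOn (fun y => localRep μ x y stdVec) (chart x).target := fun hμ =>
    (evalForm stdVec).continuous.comp_continuousOn (hμ x).continuousOn
  exact ((h1 o.smooth).div (h1 o.smooth).abs fun y hy =>
    abs_ne_zero.2 (localRep_orientation_stdVec o x hy)).mul (h1 hμ)

theorem integrableOn_density (o : OrientationForm M) (x : M) {μ : DiffForm M 4}
    (hμ : IsSmoothForm μ) {K : Set M} (hK : IsCompact K) (hKx : K ⊆ (chart x).source)
    (h0 : ∀ p, p ∉ K → valAt μ p = 0) :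
    IntegrableOn (density o x μ) (chart x).target := by
  have hK' : IsCompact (chart x '' K) :=
    hK.image_of_continuousOn ((continuousOn_extChartAt x).mono hKx)
  have hK't : chart x '' K ⊆ (chart x).target := by
    rintro _ ⟨p, hp, rfl⟩
    exact (chart x).map_source (hKx hp)
  refine IntegrableOn.of_forall_sdiff_eq_zero
    (((continuousOn_density o x hμ).mono hK't).integrableOn_compact hK')
    (isOpen_target x).measurableSet fun y hy => ?_
  have : valAt μ ((chart x).symm y) = 0 :=
    h0 _ fun h => hy.2 ⟨_, h, (chart x).right_inv hy.1⟩
  rw [density, localRep_eq_zero this]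
  simp

/-- On a closed oriented manifold an exact top-degree form that is nowhere negative vanishes. -/
theorem dForm_eq_zero_of_nonneg [T2Space M] [CompactSpace M] (o : OrientationForm M)
    {T : DiffForm M 3} (hT : IsSmoothForm T)
    (hnn : ∀ p, 0 ≤ valAt o.form p stdVec * valAt (dForm T) p stdVec) : dForm T = 0 := by
  obtain ⟨t, ht⟩ := isCompact_univ.elim_finite_subcover (fun x : M => (chartAt E4 x).source)
    (fun x => (chartAt E4 x).open_source) (fun x _ => mem_iUnion_of_mem x (mem_chart_source E4 x))
  obtain ⟨ρ, hρ⟩ := SmoothPartitionOfUnity.exists_isSubordinate (ι := t) (𝓡 4)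
    (isClosed_univ (X := M)) (fun x => (chartAt E4 (x : M)).source)
    (fun x => (chartAt E4 (x : M)).open_source) (fun p hp => by
      obtain ⟨x, hx, hpx⟩ := mem_iUnion₂.1 (ht hp)
      exact mem_iUnion_of_mem ⟨x, hx⟩ hpx)
  have hsum : ∀ p, ∑ i, ρ i p = 1 := fun p => by
    rw [← finsum_eq_sum_of_fintype]
    exact ρ.sum_eq_one (mem_univ p)
  have hρs : ∀ i : t, tsupport (ρ i) ⊆ (chart (i : M)).source := fun i => by
    rw [extChartAt_source]
    exact hρ i
  have hρ0 : ∀ (i : t) p, p ∉ tsupport (ρ i) → ρ i p = 0 := fun i p hp =>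
    image_eq_zero_of_notMem_tsupport hp
  have hKc : ∀ i : t, IsCompact (tsupport (ρ i)) := fun i => (isClosed_tsupport _).isCompact
  have hsmooth : ∀ i : t, IsSmoothForm (smulForm (ρ i) T) := fun i =>
    isSmoothForm_smulForm (ρ i).contMDiff hT
  have hTsum : T = ∑ i, smulForm (ρ i) T := by
    funext p
    rw [Finset.sum_apply]
    change T p = ∑ i, ρ i p • T p
    rw [← Finset.sum_smul, hsum, one_smul]
  have hdT : dForm T = ∑ i, dForm (smulForm (ρ i) T) := by
    conv_lhs => rw [hTsum]
    exact (dForm_sum _ fun i _ => hsmooth i).2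
  have hd0 : ∀ (i : t) p, p ∉ tsupport (ρ i) → valAt (dForm (smulForm (ρ i) T)) p = 0 := by
    intro i p hp
    have h1 : localRep (smulForm (ρ i) T) p =ᶠ[𝓝 (chart p p)] 0 := by
      have h2 : ContinuousAt (chart p).symm (chart p p) :=
        continuousAt_extChartAt_symm p
      have h3 : (tsupport (ρ i))ᶜ ∈ 𝓝 ((chart p).symm (chart p p)) := by
        rw [extChartAt_to_inv]
        exact (isClosed_tsupport _).isOpen_compl.mem_nhds hp
      filter_upwards [h2.preimage_mem_nhds h3] with z hz
      rw [localRep_smulForm, hρ0 i _ hz, zero_smul]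
      rfl
    change extDeriv (localRep (smulForm (ρ i) T) p) (chart p p) = 0
    rw [h1.extDeriv_eq]
    have h5 := congrFun (dForm_zero (M := M) (k := 3)) p
    exact h5
  -- The form `ρ_j d(ρ_i T)` is supported in both chart domains, so its integral may be moved from
  -- chart `j` to chart `i`. There the sum over `j` reassembles `d(ρ_i T)`, whose integral is zero.
  have hcomm : ∀ i j : t,
      ∫ y in (chart (j : M)).target,
        density o j (smulForm (ρ j) (dForm (smulForm (ρ i) T))) y =
      ∫ y in (chart (i : M)).target,
        density o i (smulForm (ρ j) (dForm (smulForm (ρ i) T))) y := by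
    intro i j
    refine integral_density_eq o _ _ _ (fun p hp => ?_) (fun p hp => ?_)
    · change ρ j p • valAt (dForm (smulForm (ρ i) T)) p = 0
      rw [hρ0 j p fun h => hp (hρs j h), zero_smul]
    · change ρ j p • valAt (dForm (smulForm (ρ i) T)) p = 0
      rw [hd0 i p fun h => hp (hρs i h), smul_zero]
  have hdens_sum : ∀ (x : M) (S : t → DiffForm M 4) (y : E4),
      density o x (∑ i, S i) y = ∑ i, density o x (S i) y := by
    intro x S y
    rw [density, localRep_sum, Finset.sum_apply, ContinuousAlternatingMap.sum_apply,
      Finset.mul_sum]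
    rfl
  have hint1 : ∀ i j : t, IntegrableOn
      (density o j (smulForm (ρ j) (dForm (smulForm (ρ i) T)))) (chart (j : M)).target := by
    intro i j
    refine integrableOn_density o j (isSmoothForm_smulForm (ρ j).contMDiff
      (isSmoothForm_dForm (hsmooth i))) (hKc j) (hρs j) fun p hp => ?_
    change ρ j p • valAt (dForm (smulForm (ρ i) T)) p = 0
    rw [hρ0 j p hp, zero_smul]
  have hint2 : ∀ i j : t, IntegrableOn
      (density o i (smulForm (ρ j) (dForm (smulForm (ρ i) T)))) (chart (i : M)).target := by
    intro i j
    refine integrableOn_density o i (isSmoothForm_smulForm (ρ j).contMDiff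
      (isSmoothForm_dForm (hsmooth i))) (hKc i) (hρs i) fun p hp => ?_
    change ρ j p • valAt (dForm (smulForm (ρ i) T)) p = 0
    rw [hd0 i p hp, smul_zero]
  have hJ1 : ∀ j : t, ∫ y in (chart (j : M)).target,
      density o j (smulForm (ρ j) (dForm T)) y =
      ∑ i, ∫ y in (chart (j : M)).target,
        density o j (smulForm (ρ j) (dForm (smulForm (ρ i) T))) y := by
    intro j
    rw [← integral_finsetSum _ fun i _ => hint1 i j]
    congr 1
    funext y
    rw [← hdens_sum]
    congr 1
    rw [hdT]
    funext p
    rw [Finset.sum_apply]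
    change ρ j p • (∑ i, dForm (smulForm (ρ i) T)) p = ∑ i, ρ j p • (dForm (smulForm (ρ i) T)) p
    rw [Finset.sum_apply, Finset.smul_sum]
  have hJ2 : ∀ i : t, ∑ j, ∫ y in (chart (i : M)).target,
        density o i (smulForm (ρ j) (dForm (smulForm (ρ i) T))) y = 0 := by
    intro i
    rw [← integral_finsetSum _ fun j _ => hint2 i j,
      ← integral_density_dForm_eq_zero o (i : M) (hsmooth i) (hKc i) (hρs i) (fun p hp => by
        change ρ i p • valAt T p = 0
        rw [hρ0 i p hp, zero_smul])]
    congr 1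
    funext y
    simp only [density_smulForm]
    rw [← Finset.sum_mul, hsum, one_mul]
  have htotal : ∑ j : t, ∫ y in (chart (j : M)).target,
      density o j (smulForm (ρ j) (dForm T)) y = 0 := by
    rw [Finset.sum_congr rfl fun j _ => (hJ1 j).trans (Finset.sum_congr rfl fun i _ => hcomm i j),
      Finset.sum_comm]
    exact Finset.sum_eq_zero fun i _ => hJ2 i
  have hdn : ∀ (x : M) (y : E4), y ∈ (chart x).target → 0 ≤ density o x (dForm T) y := by
    intro x y hy
    have h1 : ∀ ν : DiffForm M 4, localRep ν x y stdVec =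
        (tder (chart x).symm y).det *
          valAt ν ((chart x).symm y) stdVec := fun ν => topForm_comp_stdVec _ _
    rw [density, div_mul_eq_mul_div]
    refine div_nonneg ?_ (abs_nonneg _)
    rw [h1, h1]
    have := mul_nonneg (sq_nonneg (tder (chart x).symm y).det)
      (hnn ((chart x).symm y))
    calc _ ≤ _ := this
      _ = _ := by ring
  have hnn' : ∀ (j : t) (y : E4), y ∈ (chart (j : M)).target →
      0 ≤ density o j (smulForm (ρ j) (dForm T)) y := by
    intro j y hy
    rw [density_smulForm]
    exact mul_nonneg (ρ.nonneg j _) (hdn j y hy)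
  have hzero : ∀ j : t, ∫ y in (chart (j : M)).target,
      density o j (smulForm (ρ j) (dForm T)) y = 0 := fun j =>
    (Finset.sum_eq_zero_iff_of_nonneg fun (i : t) _ =>
      setIntegral_nonneg (isOpen_target (i : M)).measurableSet (hnn' i)).1 htotal j
        (Finset.mem_univ j)
  -- A continuous nonnegative density with zero integral vanishes at every point.
  have hpt : ∀ (j : t) (y : E4), y ∈ (chart (j : M)).target →
      density o j (smulForm (ρ j) (dForm T)) y = 0 := by
    intro j y hy
    have hsm := isSmoothForm_smulForm (ρ j).contMDiff (isSmoothForm_dForm hT)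
    have hi : IntegrableOn (density o j (smulForm (ρ j) (dForm T)))
        (chart (j : M)).target := by
      refine integrableOn_density o j hsm (hKc j) (hρs j) fun p hp => ?_
      change ρ j p • valAt (dForm T) p = 0
      rw [hρ0 j p hp, zero_smul]
    have h1 := (setIntegral_eq_zero_iff_of_nonneg_ae
      ((ae_restrict_iff' (isOpen_target (j : M)).measurableSet).2
        (Filter.Eventually.of_forall (hnn' j))) hi).1 (hzero j)
    exact Measure.eqOn_open_of_ae_eq h1 (isOpen_target (j : M)) (continuousOn_density o j hsm)
      continuousOn_const hy
  funext p
  have hval : ∀ j : t, ρ j p = 0 ∨ valAt (dForm T) p = 0 := by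
    intro j
    by_cases hp : p ∈ (chart (j : M)).source
    · have hy := (chart (j : M)).map_source hp
      have h1 := hpt j _ hy
      rw [density_smulForm, (chart (j : M)).left_inv hp] at h1
      rcases mul_eq_zero.1 h1 with h2 | h2
      · exact Or.inl h2
      · right
        have ha := localRep_orientation_stdVec o (j : M) hy
        have h3 : localRep (dForm T) j (chart (j : M) p) stdVec = 0 :=
          (mul_eq_zero.1 h2).resolve_left (div_ne_zero ha (abs_ne_zero.2 ha))
        have h4 : (tder (chart (j : M)).symm (chart (j : M) p)).det *
          valAt (dForm T) ((chart (j : M)).symm (chart (j : M) p)) stdVec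
            = 0 := by
          rw [← topForm_comp_stdVec]
          exact h3
        rw [(chart (j : M)).left_inv hp] at h4
        have h5 : (tder (chart (j : M)).symm (chart (j : M) p)).det ≠ 0 := by
          intro h
          apply ha
          change (valAt o.form _).compContinuousLinearMap (tder (chart (j : M)).symm _) stdVec = 0
          rw [topForm_comp_stdVec, h, zero_mul]
        by_contra hne
        exact topForm_apply_ne_zero hne (ContinuousLinearEquiv.refl ℝ E4)
          ((mul_eq_zero.1 h4).resolve_left h5)
    · exact Or.inl (hρ0 j p fun h => hp (hρs j h))
  by_contra hne
  have : ∑ j, ρ j p = 0 := Finset.sum_eq_zero fun j _ => (hval j).resolve_right hne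
  rw [hsum] at this
  exact one_ne_zero this

end Integration

/-! ### From self-dual harmonic to near-symplectic forms -/

section Harmonic

theorem wedgeOne_comp {k : ℕ} (h : Λ[1]) (β : Λ[k]) (A : E4 →L[ℝ] E4) :
    (wedgeOne h β).compContinuousLinearMap A =
      wedgeOne (h.compContinuousLinearMap A) (β.compContinuousLinearMap A) := by
  ext v
  rw [ContinuousAlternatingMap.compContinuousLinearMap_apply, wedgeOne_apply, wedgeOne_apply]
  refine Finset.sum_congr rfl fun i _ => ?_
  congr 2
  rw [ContinuousAlternatingMap.compContinuousLinearMap_apply]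
  congr 1
  ext a
  fin_cases a
  rfl

theorem wedgeTwoTwo_comm (α β : Λ[2]) (u : Fin 4 → E4) :
    wedgeTwoTwo α β u = wedgeTwoTwo β α u := by
  unfold wedgeTwoTwo
  ring

theorem hodgeStar_smul (k m : ℕ) (G : Matrix (Fin 4) (Fin 4) ℝ) (vol : Λ[m + k])
    (c : ℝ) (α : Λ[k]) :
    hodgeStar k m G vol (c • α) = c • hodgeStar k m G vol α := by
  simp only [hodgeStar, ContinuousAlternatingMap.smul_apply, Finset.smul_sum, smul_smul, smul_eq_mul]
  refine Finset.sum_congr rfl fun i _ => Finset.sum_congr rfl fun j _ => ?_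
  congr 1
  ring

variable {M : Type*} [TopologicalSpace M] [ChartedSpace E4 M] [IsManifold (𝓡 4) ∞ M]

theorem valAt_star3 (o : OrientationForm M) (g : Metric M) (S : DiffForm M 3) (p : M) :
    valAt (star3 o g S) p = star3At o g p (valAt S p) := by
  unfold star3
  unfold valAt
  rfl

/-- Put `h = ⋆dσ`. Since `⋆σ = σ`, the equation `Δσ = 0` reads `dh + ⋆dh = 0`; thus `dh` is
anti-self-dual and `dh ∧ σ = 0`. Then `d(h ∧ σ) = -h ∧ dσ` is a nonnegative multiple of the volume
form, vanishes by Stokes, and so does `dσ`. -/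
theorem IsSelfDualHarmonic.closed [T2Space M] [CompactSpace M] {o : OrientationForm M}
    {g : Metric M} {σ : DiffForm M 2} (hσ : IsSelfDualHarmonic o g σ) : dForm σ = 0 := by
  let h : DiffForm M 1 := star3 o g (dForm σ)
  have hh : IsSmoothForm h := isSmoothForm_star3 o g (isSmoothForm_dForm hσ.smooth)
  let T : DiffForm M 3 := fun p => wedgeOne (valAt h p) (valAt σ p)
  have hTrep : ∀ x y, localRep T x y = wedgeOne (localRep h x y) (localRep σ x y) := fun x y =>
    wedgeOne_comp _ _ _
  have hT : IsSmoothForm T := by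
    intro x
    have h1 : localRep T x = fun y => wedgeOne (localRep h x y) (localRep σ x y) :=
      funext (hTrep x)
    rw [h1]
    exact ContDiff.comp_contDiffOn (g := fun p : (Λ[1]) × (Λ[2]) =>
      wedgeOne p.1 p.2) (f := fun y => (localRep h x y, localRep σ x y))
      contDiff_wedgeOne ((hh x).prodMk (hσ.smooth x))
  have hdT : ∀ p v, valAt (dForm T) p v =
      wedgeTwoTwo (valAt (dForm h) p) (valAt σ p) v - wedgeOne (valAt h p) (valAt (dForm σ) p) v := by
    intro p v
    have hx := mem_extChartAt_target (I := 𝓡 4) p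
    have h1 : localRep T p = fun y => wedgeOne (localRep h p y) (localRep σ p y) :=
      funext (hTrep p)
    change extDeriv (localRep T p) (chart p p) v = _
    rw [h1, extDeriv_wedgeOne ((localRep_differentiable hh p hx).differentiableAt (by simp))
      ((localRep_differentiable hσ.smooth p hx).differentiableAt (by simp)), localRep_self,
      localRep_self]
    rfl
  have hanti : ∀ p, star2At o g p (valAt (dForm h) p) = -valAt (dForm h) p := by
    intro p
    have hneg : ∀ {k : ℕ} (S : DiffForm M k), (-1 : ℝ) • S = -S := fun S =>
      funext fun q => neg_one_smul ℝ (valAt S q)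
    have h1 : laplacian o g σ = -dForm h + -star2 o g (dForm h) := by
      have h2 : codiff2 o g σ = (-1 : ℝ) • h := by
        rw [codiff2, hσ.selfDual, hneg]
      rw [laplacian, h2, dForm_smul, hneg]
      rfl
    have h3 := congrFun (h1.symm.trans hσ.harmonic) p
    have h4 : -valAt (dForm h) p + -star2At o g p (valAt (dForm h) p) = 0 := h3
    rw [← sub_eq_add_neg, sub_eq_zero] at h4
    exact h4.symm
  have hsd : ∀ p, star2At o g p (valAt σ p) = valAt σ p := fun p => congrFun hσ.selfDual p
  have hvol : ∀ p, volAt o g p ≠ 0 := fun p => volOf_ne_zero (gram_posDef g p) (o.ne_zero p)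
  have hval : ∀ p, valAt (dForm T) p stdVec = -wedgeOne (valAt h p) (valAt (dForm σ) p) stdVec := by
    intro p
    obtain ⟨A, hA⟩ := exists_isOrtho (gram_posDef g p)
    have h1 := hdT p (fun i => A (stdVec i))
    rw [wedgeTwoTwo_comm, wedgeTwoTwo_eq_zero hA (hsd p) (hanti p), zero_sub] at h1
    have h2 := topForm_proportional (valAt (dForm T) p) (volAt o g p) (fun i => A (stdVec i))
    have h3 := topForm_proportional (wedgeOne (valAt h p) (valAt (dForm σ) p)) (volAt o g p)
      (fun i => A (stdVec i))
    have h4 := topForm_apply_ne_zero (hvol p) A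
    have alg : ∀ a b c d e f : ℝ, a ≠ 0 → c = -d → c * b = e * a → d * b = f * a → e = -f := by
      intro a b c d e f ha h1 h2 h3
      refine mul_right_cancel₀ ha ?_
      linear_combination -h2 + b * h1 - h3
    exact alg _ _ _ _ _ _ h4 h1 h2 h3
  have hsgn : ∀ p, wedgeOne (valAt h p) (valAt (dForm σ) p) stdVec * volAt o g p stdVec ≤ 0 ∧
      (wedgeOne (valAt h p) (valAt (dForm σ) p) stdVec = 0 → valAt (dForm σ) p = 0) := by
    intro p
    obtain ⟨A, hA⟩ := exists_isOrtho (gram_posDef g p)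
    have he : valAt h p = star3At o g p (valAt (dForm σ) p) := valAt_star3 o g (dForm σ) p
    rw [he, star3At]
    generalize valAt (dForm σ) p = β
    have hv := hvol p
    generalize volAt o g p = vol at hv ⊢
    exact wedge_star_three hA hv β
  have hd0 : dForm T = 0 := by
    refine dForm_eq_zero_of_nonneg o hT fun p => ?_
    have h1 := (hsgn p).1
    have h2 : volAt o g p stdVec =
      (Real.sqrt (gram g p).det / |valAt o.form p stdVec|) * valAt o.form p stdVec := rfl
    have h3 : 0 < Real.sqrt (gram g p).det / |valAt o.form p stdVec| :=
      div_pos (Real.sqrt_pos.2 (gram_posDef g p).det_pos)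
        (abs_pos.2 (topForm_apply_ne_zero (o.ne_zero p) (ContinuousLinearEquiv.refl ℝ E4)))
    rw [hval]
    rw [h2] at h1
    nlinarith [h1, h3]
  funext p
  refine (hsgn p).2 ?_
  have := hval p
  rw [hd0] at this
  have h5 : valAt (0 : DiffForm M 4) p stdVec = 0 := rfl
  rw [h5] at this
  linarith

/-- A 2-form on `E4` has trivial kernel. -/
def Nondeg (α : Λ[2]) : Prop := ∀ v, (∀ w, α ![v, w] = 0) → v = 0

/-- The properties of self-dual harmonic forms used to deform them. -/
structure IsNearSymplectic (σ : DiffForm M 2) : Prop where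
  smooth : IsSmoothForm σ
  closed : dForm σ = 0
  nondeg : ∀ p, valAt σ p ≠ 0 → Nondeg (valAt σ p)
  derivAt_nondeg : ∀ p ∈ zeroLocus σ, ∀ v, derivAt σ p v ≠ 0 → Nondeg (derivAt σ p v)
  rank_eq : ∀ p ∈ zeroLocus σ, Module.finrank ℝ (derivAt σ p).range = 3

theorem gramChart_self (g : Metric M) (x : M) : gramChart g x (chart x x) = gram g x := by
  have h : gramChart g x (chart x x) =
    Matrix.of fun i j => innerAt g ((chart x).symm (chart x x))
      (tder (chart x).symm (chart x x) (stdVec i))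
      (tder (chart x).symm (chart x x) (stdVec j)) := rfl
  rw [h, tder_symm_self, extChartAt_to_inv]
  rfl

/-- Because `σ` vanishes at `x`, its derivative is a limit of the quotients `t⁻¹ σ(c + t v)`. Each
is self-dual for the metric at its own base point, and the star in the chart is jointly continuous
in the point and the form. -/
theorem star2At_derivAt {o : OrientationForm M} {g : Metric M} {σ : DiffForm M 2}
    (hsm : IsSmoothForm σ) (hsd : star2 o g σ = σ) {x : M} (hx : x ∈ zeroLocus σ) (v : E4) :
    star2At o g x (derivAt σ x v) = derivAt σ x v := by
  set c := chart x x with hc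
  have hct : c ∈ (chart x).target := mem_extChartAt_target x
  have hf0 : localRep σ x c = 0 := by rw [hc, localRep_self]; exact hx
  have hfd : HasFDerivAt (localRep σ x) (derivAt σ x) c :=
    ((localRep_differentiable hsm x hct).differentiableAt (by simp)).hasFDerivAt
  have hline : HasDerivAt (fun t : ℝ => c + t • v) v 0 := by
    simpa using ((hasDerivAt_id (0 : ℝ)).smul_const v).const_add c
  have hcv : c + (0 : ℝ) • v = c := by simp
  have hd : HasDerivAt (fun t : ℝ => localRep σ x (c + t • v)) (derivAt σ x v) 0 := by
    have : HasFDerivAt (localRep σ x) (derivAt σ x) (c + (0 : ℝ) • v) := by rwa [hcv]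
    exact this.comp_hasDerivAt (0 : ℝ) hline
  rw [hasDerivAt_iff_tendsto_slope_zero] at hd
  simp only [zero_add, hcv, hf0, sub_zero] at hd
  let N : E4 × (Λ[2]) → Λ[2] := fun q =>
    hodgeStar 2 2 (gramChart g x q.1) (volOf (gramChart g x q.1) (localRep o.form x q.1)) q.2
  have hN : ContinuousAt N (c, derivAt σ x v) := by
    have h1 : ∀ i j, ContDiffAt ℝ ∞ (fun q : E4 × (Λ[2]) => gramChart g x q.1 i j)
        (c, derivAt σ x v) := fun i j =>
      (contDiffAt_gramChart g x hct i j).comp (c, derivAt σ x v) contDiffAt_fst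
    have h2 := (gramChart_posDef g x hct).det_pos.ne'
    exact (contDiffAt_hodgeStar 2 2 h1 h2 (contDiffAt_volOf h1
      ((localRep_differentiable o.smooth x hct).comp (c, derivAt σ x v) contDiffAt_fst) h2
      (localRep_orientation_stdVec o x hct)) contDiffAt_snd).continuousAt
  have hlim : Filter.Tendsto (fun t : ℝ => (c + t • v, t⁻¹ • localRep σ x (c + t • v)))
      (𝓝[≠] 0) (𝓝 (c, derivAt σ x v)) := by
    refine Filter.Tendsto.prodMk_nhds ?_ hd
    have := hline.continuousAt.tendsto
    rw [hcv] at this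
    exact this.mono_left nhdsWithin_le_nhds
  have hNlim := hN.tendsto.comp hlim
  have heq : ∀ᶠ t : ℝ in 𝓝[≠] 0, t⁻¹ • localRep σ x (c + t • v) =
      (N ∘ fun t : ℝ => (c + t • v, t⁻¹ • localRep σ x (c + t • v))) t := by
    have h1 : ∀ᶠ t : ℝ in 𝓝 0, c + t • v ∈ (chart x).target := by
      refine hline.continuousAt.eventually ((isOpen_target x).mem_nhds ?_)
      simpa using hct
    filter_upwards [nhdsWithin_le_nhds h1] with t ht
    simp only [Function.comp_apply, N]
    rw [hodgeStar_smul, ← localRep_star2 o g x ht, hsd]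
  have h3 := tendsto_nhds_unique hd (hNlim.congr' (heq.mono fun t ht => ht.symm))
  have h4 : N (c, derivAt σ x v) = star2At o g x (derivAt σ x v) := by
    change hodgeStar 2 2 (gramChart g x c) (volOf (gramChart g x c) (localRep o.form x c))
      (derivAt σ x v) = _
    rw [hc, gramChart_self, localRep_self]
    rfl
  rw [← h4, ← h3]

/-- Values and derivatives are self-dual, hence zero or nondegenerate, and transversality makes the
image of the derivative the whole 3-dimensional space of self-dual forms. Beyond this lemma the
metric `g` plays no role. -/
theorem IsSelfDualHarmonic.isNearSymplectic [T2Space M] [CompactSpace M] {o : OrientationForm M}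
    {g : Metric M} {σ : DiffForm M 2} (hσ : IsSelfDualHarmonic o g σ) (htr : IsTransverse o g σ) :
    IsNearSymplectic σ := by
  have hvol : ∀ p, volAt o g p ≠ 0 := fun p => volOf_ne_zero (gram_posDef g p) (o.ne_zero p)
  have hnd : ∀ p α, star2At o g p α = α → α ≠ 0 → Nondeg α := by
    intro p α hα hne v hv
    obtain ⟨A, hA⟩ := exists_isOrtho (gram_posDef g p)
    exact selfDual_nondegenerate hA (hvol p) hα hne hv
  refine ⟨hσ.smooth, hσ.closed, fun p hp => hnd p _ (congrFun hσ.selfDual p) hp,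
    fun p hp v hv => hnd p _ (star2At_derivAt hσ.smooth hσ.selfDual hp v) hv, fun p hp => ?_⟩
  obtain ⟨A, hA⟩ := exists_isOrtho (gram_posDef g p)
  refine finrank_selfDual hA (volOf_frame_sq (gram_posDef g p) (o.ne_zero p) hA)
    (S := (derivAt σ p).range) fun α => ⟨?_, fun hα => ?_⟩
  · rintro ⟨v, rfl⟩
    exact star2At_derivAt hσ.smooth hσ.selfDual hp v
  · obtain ⟨v, hv⟩ := htr p hp α hα
    exact ⟨v, hv⟩

end Harmonic

/-! ### Pfaffians and the linearisation at a zero -/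

section Pfaffian

/-- The Pfaffian of a 2-form on a frame. -/
def pf (α : Λ[2]) (u : Fin 4 → E4) : ℝ :=
  α ![u 0, u 1] * α ![u 2, u 3] - α ![u 0, u 2] * α ![u 1, u 3] + α ![u 0, u 3] * α ![u 1, u 2]

theorem form_expand_left (α : Λ[2]) (b : Module.Basis (Fin 4) ℝ E4) (v w : E4) :
    α ![v, w] = ∑ i, b.repr v i * α ![b i, w] := by
  conv_lhs => rw [← b.sum_repr v]
  exact form_apply_sum_left α (fun i => b.repr v i) b w

theorem form_expand_right (α : Λ[2]) (b : Module.Basis (Fin 4) ℝ E4) (v w : E4) :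
    α ![v, w] = ∑ i, b.repr w i * α ![v, b i] := by
  rw [form_swap, form_expand_left α b, ← Finset.sum_neg_distrib]
  exact Finset.sum_congr rfl fun i _ => by rw [form_swap α v]; ring

/-- When the Pfaffian vanishes, vectors such as `α₂₃ b₁ - α₁₃ b₂ + α₁₂ b₃` lie in the kernel.
Nondegeneracy then makes every coefficient of `α` zero, a contradiction. -/
theorem pf_ne_zero {α : Λ[2]} (hα : Nondeg α) (b : Module.Basis (Fin 4) ℝ E4) :
    pf α b ≠ 0 := by
  intro h
  unfold pf at h
  have key : ∀ v, (∀ i, α ![v, b i] = 0) → v = 0 := fun v hv => hα v fun w => by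
    rw [form_expand_right α b]
    simp [hv]
  have lin : ∀ (c : Fin 4 → ℝ), (∀ j, ∑ i, c i * α ![b i, b j] = 0) → ∀ i, c i = 0 := by
    intro c hc
    have h0 : ∑ i, c i • b i = 0 := key _ fun j => by rw [form_apply_sum_left]; exact hc j
    exact fun i => Fintype.linearIndependent_iff.1 b.linearIndependent c h0 i
  have s10 := form_swap α (b 1) (b 0)
  have s20 := form_swap α (b 2) (b 0)
  have s30 := form_swap α (b 3) (b 0)
  have s21 := form_swap α (b 2) (b 1)
  have s31 := form_swap α (b 3) (b 1)
  have s32 := form_swap α (b 3) (b 2)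
  have e1 := lin ![0, α ![b 2, b 3], -α ![b 1, b 3], α ![b 1, b 2]] (fun j => by
    fin_cases j <;> simp [Fin.sum_univ_four, form_self, s10, s20, s30, s21, s31, s32] <;>
      first | ring1 | linear_combination -h)
  have e2 := lin ![α ![b 2, b 3], 0, -α ![b 0, b 3], α ![b 0, b 2]] (fun j => by
    fin_cases j <;> simp [Fin.sum_univ_four, form_self, s10, s20, s30, s21, s31, s32] <;>
      first | ring1 | linear_combination h)
  have e3 := lin ![α ![b 1, b 2], -α ![b 0, b 2], α ![b 0, b 1], 0] (fun j => by
    fin_cases j <;> simp [Fin.sum_univ_four, form_self, s10, s20, s30, s21, s31, s32] <;>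
      first | ring1 | linear_combination h)
  have z23 : α ![b 2, b 3] = 0 := e1 1
  have z13 : α ![b 1, b 3] = 0 := neg_eq_zero.1 (e1 2)
  have z12 : α ![b 1, b 2] = 0 := e1 3
  have z03 : α ![b 0, b 3] = 0 := neg_eq_zero.1 (e2 2)
  have z02 : α ![b 0, b 2] = 0 := e2 3
  have z01 : α ![b 0, b 1] = 0 := e3 2
  refine b.ne_zero 0 (key (b 0) fun i => ?_)
  fin_cases i
  · exact form_self α _
  · exact z01
  · exact z02
  · exact z03

/-- The matrix of `α` has a Pfaffian adjoint, with product the Pfaffian times the identity; the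
combinations below are its rows. -/
theorem coeff_eq_zero_of_pf_ne_zero {α : Λ[2]} {u : Fin 4 → E4} (h : pf α u ≠ 0)
    {c : Fin 4 → ℝ} (e : ∀ j, ∑ i, c i * α ![u i, u j] = 0) : c = 0 := by
  simp only [Fin.sum_univ_four] at e
  have e0 := e 0
  have e1 := e 1
  have e2 := e 2
  have e3 := e 3
  rw [form_swap α (u 1) (u 0), form_swap α (u 2) (u 0), form_swap α (u 3) (u 0), form_self] at e0
  rw [form_swap α (u 2) (u 1), form_swap α (u 3) (u 1), form_self] at e1
  rw [form_swap α (u 3) (u 2), form_self] at e2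
  rw [form_self] at e3
  unfold pf at h
  refine funext fun i => mul_right_cancel₀ h ?_
  change c i * _ = 0 * _
  match i with
  | 0 => linear_combination α ![u 2, u 3] * e1 - α ![u 1, u 3] * e2 + α ![u 1, u 2] * e3
  | 1 => linear_combination -α ![u 2, u 3] * e0 + α ![u 0, u 3] * e2 - α ![u 0, u 2] * e3
  | 2 => linear_combination α ![u 1, u 3] * e0 - α ![u 0, u 3] * e1 + α ![u 0, u 1] * e3
  | 3 => linear_combination -α ![u 1, u 2] * e0 + α ![u 0, u 2] * e1 - α ![u 0, u 1] * e2

theorem nondeg_of_pf_ne_zero {α : Λ[2]} (b : Module.Basis (Fin 4) ℝ E4)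
    (h : pf α b ≠ 0) : Nondeg α := fun v hv => by
  have hc := coeff_eq_zero_of_pf_ne_zero h (c := fun i => b.repr v i) fun j => by
    rw [← form_expand_left]; exact hv _
  rw [← b.sum_repr v]
  exact Finset.sum_eq_zero fun i _ => by rw [congrFun hc i]; exact zero_smul _ _

theorem linearIndependent_of_pf_ne_zero {α : Λ[2]} {u : Fin 4 → E4}
    (h : pf α u ≠ 0) : LinearIndependent ℝ u :=
  Fintype.linearIndependent_iff.2 fun c hc => congrFun <| coeff_eq_zero_of_pf_ne_zero h fun j => by
    rw [← form_apply_sum_left, hc]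
    simpa using form_apply_sum_left α 0 u (u j)

/-- The linearisation at a zero of a closed 2-form, each value of which is zero or nondegenerate,
and whose kernel is the line spanned by `X`. -/
structure IsNearSymplecticGerm (D : E4 →L[ℝ] Λ[2]) (X : E4) : Prop where
  ne_zero : X ≠ 0
  kernel : ∀ u, D u = 0 ↔ ∃ c : ℝ, u = c • X
  nondeg : ∀ u, D u ≠ 0 → Nondeg (D u)
  closed : ∀ u v w, D u ![v, w] - D v ![u, w] + D w ![u, v] = 0

namespace IsNearSymplecticGerm

variable {D : E4 →L[ℝ] Λ[2]} {X : E4} (h : IsNearSymplecticGerm D X)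
include h

theorem apply_self : D X = 0 := (h.kernel X).2 ⟨1, (one_smul _ _).symm⟩

theorem smul {c : ℝ} (hc : c ≠ 0) : IsNearSymplecticGerm D (c • X) where
  ne_zero := smul_ne_zero hc h.ne_zero
  kernel u := by
    rw [h.kernel]
    constructor
    · rintro ⟨a, rfl⟩
      exact ⟨a / c, by rw [smul_smul, div_mul_cancel₀ _ hc]⟩
    · rintro ⟨a, rfl⟩
      exact ⟨a * c, by rw [smul_smul]⟩
  nondeg := h.nondeg
  closed := h.closed

/-- This is closedness on `u, X, w`, where the middle term drops out because `D X = 0`. -/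
theorem symm (u w : E4) : D u ![X, w] = D w ![X, u] := by
  have h1 := h.closed u X w
  rw [h.apply_self, form_swap (D w)] at h1
  simp at h1
  linarith

end IsNearSymplecticGerm

theorem form_add_right (α : Λ[2]) (v w w' : E4) :
    α ![v, w + w'] = α ![v, w] + α ![v, w'] := by
  have e : ∀ x : E4, Function.update ![v, 0] 1 x = ![v, x] := fun x => by
    ext i; fin_cases i <;> rfl
  have := α.map_update_add ![v, 0] 1 w w'
  rwa [e, e, e] at this

theorem form_smul_right (α : Λ[2]) (v w : E4) (c : ℝ) :
    α ![v, c • w] = c * α ![v, w] := by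
  have e : ∀ x : E4, Function.update ![v, 0] 1 x = ![v, x] := fun x => by
    ext i; fin_cases i <;> rfl
  have := α.map_update_smul ![v, 0] 1 c w
  rwa [e, e] at this

theorem form_smul_left (α : Λ[2]) (v w : E4) (c : ℝ) :
    α ![c • v, w] = c * α ![v, w] := by
  rw [form_swap, form_smul_right, form_swap α w]
  ring

/-- The bilinear form `(u, w) ↦ D u (X, w)`. -/
def germForm (D : E4 →L[ℝ] Λ[2]) (X : E4) : LinearMap.BilinForm ℝ E4 :=
  LinearMap.mk₂ ℝ (fun u w => D u ![X, w]) (fun u u' w => by simp) (fun c u w => by simp)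
    (fun u w w' => form_add_right _ _ _ _) (fun c u w => form_smul_right _ _ _ _)

theorem germForm_apply (D : E4 →L[ℝ] Λ[2]) (X u w : E4) :
    germForm D X u w = D u ![X, w] := rfl

theorem germForm_smul_left (D : E4 →L[ℝ] Λ[2]) (X u w : E4) (c : ℝ) :
    germForm D (c • X) u w = c * germForm D X u w := form_smul_left _ _ _ _

theorem contDiff_pf (b : Fin 4 → E4) : ContDiff ℝ ∞ fun α : Λ[2] => pf α b := by
  have h : ∀ v : Fin 2 → E4, ContDiff ℝ ∞ fun α : Λ[2] => α v := fun v =>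
    (evalForm v).contDiff
  unfold pf
  exact (((h _).mul (h _)).sub ((h _).mul (h _))).add ((h _).mul (h _))

namespace IsNearSymplecticGerm

variable {D : E4 →L[ℝ] Λ[2]} {X : E4} (h : IsNearSymplecticGerm D X)
include h

/-- Along the segment the Pfaffian is continuous and has no zero. -/
theorem pf_same_sign (b : Module.Basis (Fin 4) ℝ E4) {u w : E4}
    (huw : ∀ t ∈ Icc (0 : ℝ) 1, D (u + t • (w - u)) ≠ 0) : 0 < pf (D u) b * pf (D w) b := by
  have hc : Continuous fun t : ℝ => pf (D (u + t • (w - u))) b := by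
    refine (contDiff_pf b).continuous.comp (D.continuous.comp ?_)
    fun_prop
  have h0 : pf (D u) b ≠ 0 := by
    have := huw 0 (by simp)
    simp only [zero_smul, add_zero] at this
    exact pf_ne_zero (h.nondeg _ this) b
  have h1 : pf (D w) b ≠ 0 := by
    have := huw 1 (by simp)
    simp only [one_smul, add_sub_cancel] at this
    exact pf_ne_zero (h.nondeg _ this) b
  by_contra hneg
  have hz : ∃ t ∈ Icc (0 : ℝ) 1, pf (D (u + t • (w - u))) b = 0 := by
    have e0 : pf (D (u + (0 : ℝ) • (w - u))) b = pf (D u) b := by simp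
    have e1 : pf (D (u + (1 : ℝ) • (w - u))) b = pf (D w) b := by simp
    rcases lt_or_gt_of_ne h0 with h2 | h2
    · have h3 : 0 ≤ pf (D w) b := by nlinarith
      exact intermediate_value_Icc zero_le_one hc.continuousOn ⟨by rw [e0]; exact h2.le, by rwa [e1]⟩
    · have h3 : pf (D w) b ≤ 0 := by nlinarith
      exact intermediate_value_Icc' zero_le_one hc.continuousOn ⟨by rwa [e1], by rw [e0]; exact h2.le⟩
  obtain ⟨t, ht, hz⟩ := hz
  exact pf_ne_zero (h.nondeg _ (huw t ht)) b hz

/-- A basis `(cX, b₁, b₂, b₃)` which is orthogonal for `germForm D X`, with one of the three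
diagonal entries of the opposite sign to the two others. -/
theorem exists_basis : ∃ b : Module.Basis (Fin 4) ℝ E4, (∃ c : ℝ, c ≠ 0 ∧ b 0 = c • X) ∧
    (∀ i j, i ≠ j → germForm D X (b i) (b j) = 0) ∧
    ((0 < germForm D X (b 1) (b 1) ∧ 0 < germForm D X (b 2) (b 2) ∧ germForm D X (b 3) (b 3) < 0) ∨
    (germForm D X (b 1) (b 1) < 0 ∧ germForm D X (b 2) (b 2) < 0 ∧ 0 < germForm D X (b 3) (b 3))) := by
  have hsym : LinearMap.IsSymm (germForm D X) := ⟨fun u w => h.symm u w⟩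
  obtain ⟨b', hb'⟩ := LinearMap.BilinForm.exists_orthogonal_basis (B := germForm D X) hsym
  have hfr : Module.finrank ℝ E4 = 4 := by simp
  let b0 : Module.Basis (Fin 4) ℝ E4 := b'.reindex (finCongr hfr)
  have hb0 : ∀ i j, i ≠ j → germForm D X (b0 i) (b0 j) = 0 := by
    intro i j hij
    have : (finCongr hfr).symm i ≠ (finCongr hfr).symm j := fun e => hij ((finCongr hfr).symm.injective e)
    simpa [b0] using hb' this
  -- the null vector
  have hnull : ∃ i, germForm D X (b0 i) (b0 i) = 0 := by
    by_contra hne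
    push Not at hne
    have hX : ∀ i, b0.repr X i = 0 := by
      intro i
      have h1 : germForm D X X (b0 i) = 0 := by rw [germForm_apply, h.apply_self]; rfl
      rw [← b0.sum_repr X, map_sum, LinearMap.sum_apply, Finset.sum_eq_single i] at h1
      · simpa [hne i] using h1
      · intro j _ hj
        simp [hb0 j i hj]
      · simp
    apply h.ne_zero
    rw [← b0.sum_repr X]
    simp [hX]
  obtain ⟨i0, hi0⟩ := hnull
  -- An isotropic vector of an orthogonal basis lies in the radical, so its image under `D` has `X`
  -- in its kernel and, being degenerate, is zero.
  have hrad : ∀ (b1 : Module.Basis (Fin 4) ℝ E4), (∀ i j, i ≠ j → germForm D X (b1 i) (b1 j) = 0) →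
      ∀ i, germForm D X (b1 i) (b1 i) = 0 → D (b1 i) = 0 := by
    intro b1 hb1 i hi
    by_contra hne
    apply h.ne_zero
    refine h.nondeg _ hne X fun w => ?_
    rw [form_expand_right _ b1]
    refine Finset.sum_eq_zero fun j _ => ?_
    have : D (b1 i) ![X, b1 j] = 0 := by
      by_cases hij : i = j
      · rw [← hij]; exact hi
      · exact hb1 i j hij
    rw [this, mul_zero]
  let b1 := b0.reindex (Equiv.swap i0 0)
  have hb1o : ∀ i j, i ≠ j → germForm D X (b1 i) (b1 j) = 0 := by
    intro i j hij
    simp only [b1, Module.Basis.reindex_apply]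
    exact hb0 _ _ fun e => hij ((Equiv.swap i0 0).symm.injective e)
  have hb10 : b1 0 = b0 i0 := by simp [b1]
  obtain ⟨c, hc⟩ := (h.kernel _).1 (hrad b0 hb0 i0 hi0)
  have hc0 : c ≠ 0 := by
    rintro rfl
    rw [zero_smul] at hc
    exact b0.ne_zero i0 hc
  have hne : ∀ i, i ≠ 0 → germForm D X (b1 i) (b1 i) ≠ 0 := by
    intro i hi hz
    obtain ⟨c', hc'⟩ := (h.kernel _).1 (hrad b1 hb1o i hz)
    have h2 : c • b1 i = c' • b1 0 := by
      rw [hc', hb10, hc, smul_smul, smul_smul, mul_comm]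
    have h3 := congrArg (fun v => b1.repr v i) h2
    simp [hi.symm, hc0] at h3
  have hbX : b1 0 = c • X := hb10.trans hc
  -- nonvanishing along segments
  have hseg : ∀ i j : Fin 4, i ≠ 0 → j ≠ 0 → i ≠ j → ∀ t ∈ Icc (0 : ℝ) 1,
      D (b1 i + t • (b1 j - b1 i)) ≠ 0 := by
    intro i j hi hj hij t _ hz
    have h1 : germForm D X (b1 i + t • (b1 j - b1 i)) (b1 i) = 0 := by
      rw [germForm_apply, hz]; rfl
    have h2 : germForm D X (b1 i + t • (b1 j - b1 i)) (b1 j) = 0 := by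
      rw [germForm_apply, hz]; rfl
    simp only [map_add, map_smul, map_sub, LinearMap.add_apply, LinearMap.smul_apply,
      LinearMap.sub_apply, hb1o j i hij.symm, hb1o i j hij, smul_eq_mul] at h1 h2
    have h3 : t = 0 := by
      have : t * germForm D X (b1 j) (b1 j) = 0 := by linarith
      exact (mul_eq_zero.1 this).resolve_right (hne j hj)
    rw [h3] at h1
    apply hne i hi
    linarith
  have P := fun (i j : Fin 4) (hi : i ≠ 0) (hj : j ≠ 0) (hij : i ≠ j) =>
    h.pf_same_sign b1 (hseg i j hi hj hij)
  -- Since `b1 0 = c • X`, half of the coefficients in the Pfaffian are values of `germForm`.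
  -- Orthogonality then leaves a single product for each basis vector.
  have hpf : ∀ u, pf (D u) b1 = c * (germForm D X u (b1 1) * D u ![b1 2, b1 3] -
      germForm D X u (b1 2) * D u ![b1 1, b1 3] + germForm D X u (b1 3) * D u ![b1 1, b1 2]) := by
    intro u
    simp only [pf, hbX, form_smul_left, germForm_apply]
    ring
  have P12 := P 1 2 (by decide) (by decide) (by decide)
  have P23 := P 2 3 (by decide) (by decide) (by decide)
  have P13 := P 1 3 (by decide) (by decide) (by decide)
  have hcl := h.closed (b1 1) (b1 2) (b1 3)
  rw [hpf, hpf] at P12 P23 P13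
  simp only [hb1o 1 2 (by decide), hb1o 1 3 (by decide), hb1o 2 1 (by decide), hb1o 2 3 (by decide),
    hb1o 3 1 (by decide), hb1o 3 2 (by decide), zero_mul, sub_zero, zero_sub, add_zero, zero_add]
    at P12 P23 P13
  have n1 := hne 1 (by decide)
  have n2 := hne 2 (by decide)
  have n3 := hne 3 (by decide)
  set d1 := germForm D X (b1 1) (b1 1) with hd1
  set d2 := germForm D X (b1 2) (b1 2) with hd2
  set d3 := germForm D X (b1 3) (b1 3) with hd3
  set k1 := D (b1 1) ![b1 2, b1 3]
  set k2 := D (b1 2) ![b1 1, b1 3]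
  set k3 := D (b1 3) ![b1 1, b1 2]
  have hc2 : 0 < c ^ 2 := by positivity
  have Q12 : 0 < (d1 * k1) * (d2 * -k2) := by
    have : 0 < c ^ 2 * ((d1 * k1) * (d2 * -k2)) := by linarith
    exact pos_of_mul_pos_right this hc2.le
  have Q13 : 0 < (d1 * k1) * (d3 * k3) := by
    have : 0 < c ^ 2 * ((d1 * k1) * (d3 * k3)) := by linarith
    exact pos_of_mul_pos_right this hc2.le
  -- If the three diagonal entries had one sign, the constant sign of the Pfaffian would give `k1`,
  -- `-k2` and `k3` a common sign, although closedness says that their sum is zero.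
  have hnot : ¬ (0 < d1 * d2 ∧ 0 < d1 * d3) := by
    rintro ⟨q1, q2⟩
    have r1 : 0 < k1 * -k2 := by
      have : 0 < (d1 * d2) * (k1 * -k2) := by linarith
      exact pos_of_mul_pos_right this q1.le
    have r2 : 0 < k1 * k3 := by
      have : 0 < (d1 * d3) * (k1 * k3) := by linarith
      exact pos_of_mul_pos_right this q2.le
    have : k1 * (k1 - k2 + k3) = 0 := by rw [hcl, mul_zero]
    nlinarith [sq_nonneg k1]
  let S : (Fin 4 → E4) → Prop := fun v => (0 < germForm D X (v 1) (v 1) ∧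
    0 < germForm D X (v 2) (v 2) ∧ germForm D X (v 3) (v 3) < 0) ∨ (germForm D X (v 1) (v 1) < 0 ∧
    germForm D X (v 2) (v 2) < 0 ∧ 0 < germForm D X (v 3) (v 3))
  -- A permutation of the basis puts the entry of exceptional sign last.
  have out : ∀ π : Equiv.Perm (Fin 4), π 0 = 0 → S (fun i => b1 (π i)) →
      ∃ b : Module.Basis (Fin 4) ℝ E4, (∃ c : ℝ, c ≠ 0 ∧ b 0 = c • X) ∧
        (∀ i j, i ≠ j → germForm D X (b i) (b j) = 0) ∧ S b := fun π hπ hs =>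
    have e : ⇑(b1.reindex π.symm) = fun i => b1 (π i) := funext fun i => by
      rw [Module.Basis.reindex_apply, Equiv.symm_symm]
    ⟨b1.reindex π.symm, ⟨c, hc0, by rw [e, ← hbX]; exact congrArg b1 hπ⟩,
      fun i j hij => by rw [e]; exact hb1o _ _ (π.injective.ne hij), by rwa [e]⟩
  rcases lt_or_gt_of_ne n1 with m1 | m1 <;> rcases lt_or_gt_of_ne n2 with m2 | m2 <;>
    rcases lt_or_gt_of_ne n3 with m3 | m3
  · exact absurd ⟨mul_pos_of_neg_of_neg m1 m2, mul_pos_of_neg_of_neg m1 m3⟩ hnot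
  · exact out 1 rfl (Or.inr ⟨m1, m2, m3⟩)
  · exact out (Equiv.swap 2 3) (by decide) (Or.inr ⟨m1, m3, m2⟩)
  · exact out (Equiv.swap 1 3) (by decide) (Or.inl ⟨m3, m2, m1⟩)
  · exact out (Equiv.swap 1 3) (by decide) (Or.inr ⟨m3, m2, m1⟩)
  · exact out (Equiv.swap 2 3) (by decide) (Or.inl ⟨m1, m3, m2⟩)
  · exact out 1 rfl (Or.inl ⟨m1, m2, m3⟩)
  · exact absurd ⟨mul_pos m1 m2, mul_pos m1 m3⟩ hnot

end IsNearSymplecticGerm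

/-- Cauchy–Schwarz for the positive part bounds the product of the negative parts of `n` and `q`. As
`n` is strictly negative, no room is left for a nonzero `q`. -/
theorem lorentz_null {d1 d2 d3 n1 n2 n3 q1 q2 q3 : ℝ} (s1 : 0 < d1) (s2 : 0 < d2) (s3 : d3 < 0)
    (hn : d1 * (n1 * n1) + d2 * (n2 * n2) + d3 * (n3 * n3) < 0)
    (hq : d1 * (n1 * q1) + d2 * (n2 * q2) + d3 * (n3 * q3) = 0)
    (hle : d1 * (q1 * q1) + d2 * (q2 * q2) + d3 * (q3 * q3) ≤ 0) : q1 = 0 ∧ q2 = 0 ∧ q3 = 0 := by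
  have cs : (d1 * (n1 * q1) + d2 * (n2 * q2)) ^ 2 =
      (d1 * (n1 * n1) + d2 * (n2 * n2)) * (d1 * (q1 * q1) + d2 * (q2 * q2)) -
        d1 * d2 * (n1 * q2 - n2 * q1) ^ 2 := by ring
  have e1 : d1 * (n1 * q1) + d2 * (n2 * q2) = -(d3 * (n3 * q3)) := by linarith
  set p := d1 * (n1 * n1) + d2 * (n2 * n2) with hp
  set p' := d1 * (q1 * q1) + d2 * (q2 * q2) with hp'
  have hp0 : 0 ≤ p := add_nonneg (mul_nonneg s1.le (mul_self_nonneg _)) (mul_nonneg s2.le (mul_self_nonneg _))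
  have hp0' : 0 ≤ p' := add_nonneg (mul_nonneg s1.le (mul_self_nonneg _)) (mul_nonneg s2.le (mul_self_nonneg _))
  have e2 : (-(d3 * (n3 * n3))) * (-(d3 * (q3 * q3))) ≤ p * p' := by
    have : 0 ≤ d1 * d2 * (n1 * q2 - n2 * q1) ^ 2 := by positivity
    have e : (-(d3 * (n3 * n3))) * (-(d3 * (q3 * q3))) = (-(d3 * (n3 * q3))) ^ 2 := by ring
    rw [e, ← e1, cs]
    linarith
  set x := -(d3 * (n3 * n3)) with hx
  set x' := -(d3 * (q3 * q3)) with hx'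
  have hx0' : 0 ≤ x' := by nlinarith [mul_self_nonneg q3]
  have hxp : p < x := by linarith
  have hxp' : p' ≤ x' := by linarith
  have e3 : x' = 0 := by
    by_contra hne
    have : 0 < x' := lt_of_le_of_ne hx0' (Ne.symm hne)
    linarith [mul_le_mul_of_nonneg_left hxp' hp0, mul_lt_mul_of_pos_right hxp this]
  have e4 : p' = 0 := le_antisymm (by linarith) hp0'
  have z3 : q3 = 0 := by
    have : q3 * q3 = 0 := by
      have h1 : d3 * (q3 * q3) = 0 := by linarith
      exact (mul_eq_zero.1 h1).resolve_left s3.ne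
    exact mul_self_eq_zero.1 this
  have z1 : q1 = 0 := by
    have : d1 * (q1 * q1) = 0 := by
      linarith [mul_nonneg s1.le (mul_self_nonneg q1), mul_nonneg s2.le (mul_self_nonneg q2)]
    exact mul_self_eq_zero.1 ((mul_eq_zero.1 this).resolve_left s1.ne')
  have z2 : q2 = 0 := by
    have : d2 * (q2 * q2) = 0 := by
      linarith [mul_nonneg s1.le (mul_self_nonneg q1), mul_nonneg s2.le (mul_self_nonneg q2)]
    exact mul_self_eq_zero.1 ((mul_eq_zero.1 this).resolve_left s2.ne')
  exact ⟨z1, z2, z3⟩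

/-- The form `germForm D X` is positive definite on some plane. -/
def PosDir (D : E4 →L[ℝ] Λ[2]) (X : E4) : Prop :=
  ∃ a b : E4, 0 < germForm D X a a ∧
    germForm D X a b * germForm D X b a < germForm D X a a * germForm D X b b

theorem PosDir.smul {D : E4 →L[ℝ] Λ[2]} {X : E4} (h : PosDir D X) {c : ℝ}
    (hc : 0 < c) : PosDir D (c • X) := by
  obtain ⟨a, b, h1, h2⟩ := h
  refine ⟨a, b, ?_, ?_⟩
  · rw [germForm_smul_left]; positivity
  · simp only [germForm_smul_left]
    have : 0 < c ^ 2 * (germForm D X a a * germForm D X b b -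
      germForm D X a b * germForm D X b a) := mul_pos (by positivity) (by linarith)
    linarith

namespace IsNearSymplecticGerm

variable {D : E4 →L[ℝ] Λ[2]} {X : E4} (h : IsNearSymplecticGerm D X)
include h

theorem germForm_symm (u w : E4) : germForm D X u w = germForm D X w u := h.symm u w

theorem germForm_eq_sum {b : Module.Basis (Fin 4) ℝ E4} {c : ℝ} (hb0 : b 0 = c • X)
    (ho : ∀ i j, i ≠ j → germForm D X (b i) (b j) = 0) (u w : E4) :
    germForm D X u w = germForm D X (b 1) (b 1) * (b.repr u 1 * b.repr w 1) +
      germForm D X (b 2) (b 2) * (b.repr u 2 * b.repr w 2) +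
      germForm D X (b 3) (b 3) * (b.repr u 3 * b.repr w 3) := by
  have h00 : germForm D X (b 0) (b 0) = 0 := by
    rw [germForm_apply, hb0, map_smul, h.apply_self, smul_zero]; rfl
  conv_lhs => rw [← b.sum_repr u, ← b.sum_repr w]
  simp only [Fin.sum_univ_four, map_add, map_smul, LinearMap.add_apply, LinearMap.smul_apply,
    smul_eq_mul, h00, ho 0 1 (by decide), ho 0 2 (by decide), ho 0 3 (by decide),
    ho 1 0 (by decide), ho 1 2 (by decide), ho 1 3 (by decide), ho 2 0 (by decide),
    ho 2 1 (by decide), ho 2 3 (by decide), ho 3 0 (by decide), ho 3 1 (by decide),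
    ho 3 2 (by decide)]
  ring

/-- In signature `(1, 2)` the vectors with vanishing last coordinate form a hyperplane on which the
form is nonpositive, and every plane meets it. -/
theorem posDir_basis (hpos : PosDir D X) :
    ∃ b : Module.Basis (Fin 4) ℝ E4, (∃ c : ℝ, c ≠ 0 ∧ b 0 = c • X) ∧
    (∀ i j, i ≠ j → germForm D X (b i) (b j) = 0) ∧
    0 < germForm D X (b 1) (b 1) ∧ 0 < germForm D X (b 2) (b 2) ∧ germForm D X (b 3) (b 3) < 0 := by
  obtain ⟨b, ⟨c, hc, hb0⟩, ho, hs | ⟨s1, s2, s3⟩⟩ := h.exists_basis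
  · exact ⟨b, ⟨c, hc, hb0⟩, ho, hs⟩
  · exfalso
    obtain ⟨u, w, h1, h2⟩ := hpos
    have hneg : ∀ v, b.repr v 3 = 0 → germForm D X v v ≤ 0 := by
      intro v hv
      rw [h.germForm_eq_sum hb0 ho, hv]
      nlinarith [mul_self_nonneg (b.repr v 1), mul_self_nonneg (b.repr v 2)]
    by_cases hu : b.repr u 3 = 0
    · linarith [hneg u hu]
    · have h3 := hneg (b.repr w 3 • u - b.repr u 3 • w) (by simp; ring)
      simp only [map_sub, map_smul, LinearMap.sub_apply, LinearMap.smul_apply, smul_eq_mul,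
        h.germForm_symm w u] at h3 h2
      set A := germForm D X u u
      set B := germForm D X u w
      set C := germForm D X w w
      set x := b.repr w 3
      set y := b.repr u 3
      have h4 : A * (x * (x * A - y * B) - y * (x * B - y * C)) =
        (x * A - y * B) ^ 2 + y ^ 2 * (A * C - B * B) := by ring
      have h5 : 0 < y ^ 2 * (A * C - B * B) := mul_pos (by positivity) (by linarith)
      nlinarith [sq_nonneg (x * A - y * B)]

/-- The same intersection argument, with the positive plane for `X` and a hyperplane adapted to
`-X`. Together with `posDir_or` it singles out one direction of the kernel line, hence an
orientation of the zero circles. -/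
theorem not_posDir_neg (hpos : PosDir D X) : ¬ PosDir D (-X) := by
  intro hneg
  obtain ⟨b, ⟨c, hc, hb0⟩, ho, s1, s2, s3⟩ := h.posDir_basis hpos
  have h' := h.smul (c := -1) (by norm_num)
  rw [neg_one_smul] at h'
  have hn : ∀ u w, germForm D (-X) u w = -germForm D X u w := by
    intro u w
    have := germForm_smul_left D X u w (-1)
    rw [neg_one_smul] at this
    rw [this, neg_one_mul]
  obtain ⟨b', ⟨c', hc', hb0'⟩, ho', t1, t2, t3⟩ := h'.posDir_basis hneg
  have key : ∀ v, b'.repr v 3 = 0 → germForm D X v v ≤ 0 := by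
    intro v hv
    have := h'.germForm_eq_sum hb0' ho' v v
    rw [hn, hv] at this
    nlinarith [mul_self_nonneg (b'.repr v 1), mul_self_nonneg (b'.repr v 2)]
  have d12 := ho 1 2 (by decide)
  have d21 := ho 2 1 (by decide)
  by_cases hu : b'.repr (b 1) 3 = 0
  · linarith [key (b 1) hu]
  · have h3 := key (b'.repr (b 2) 3 • b 1 - b'.repr (b 1) 3 • b 2) (by simp; ring)
    simp only [map_sub, map_smul, LinearMap.sub_apply, LinearMap.smul_apply, smul_eq_mul, d12, d21]
      at h3
    have h4 : 0 < (b'.repr (b 1) 3) ^ 2 * germForm D X (b 2) (b 2) := mul_pos (by positivity) s2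
    nlinarith [mul_self_nonneg (b'.repr (b 2) 3)]

theorem posDir_or : PosDir D X ∨ PosDir D (-X) := by
  obtain ⟨b, -, ho, ⟨s1, s2, s3⟩ | ⟨s1, s2, s3⟩⟩ := h.exists_basis
  · exact Or.inl ⟨b 1, b 2, s1, by rw [ho 1 2 (by decide)]; nlinarith⟩
  · right
    have hn : ∀ u w, germForm D (-X) u w = -germForm D X u w := by
      intro u w
      have := germForm_smul_left D X u w (-1)
      rw [neg_one_smul] at this
      rw [this, neg_one_mul]
    refine ⟨b 1, b 2, by rw [hn]; linarith, ?_⟩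
    rw [hn, hn, hn, hn, ho 1 2 (by decide)]
    nlinarith

theorem exists_neg (hpos : PosDir D X) : ∃ n, germForm D X n n < 0 := by
  obtain ⟨b, -, -, -, -, h3⟩ := h.posDir_basis hpos
  exact ⟨b 3, h3⟩

/-- On the orthogonal complement of a negative vector the form is positive modulo its radical. -/
theorem pos_of_orthogonal (hpos : PosDir D X) {n q : E4} (hn : germForm D X n n < 0)
    (hq : germForm D X n q = 0) : 0 < germForm D X q q ∨ D q = 0 := by
  obtain ⟨b, ⟨c, hc, hb0⟩, ho, s1, s2, s3⟩ := h.posDir_basis hpos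
  rw [or_iff_not_imp_left, not_lt]
  intro hle
  rw [h.germForm_eq_sum hb0 ho] at hn hq hle
  obtain ⟨z1, z2, z3⟩ := lorentz_null s1 s2 s3 hn hq hle
  rw [h.kernel]
  refine ⟨b.repr q 0 * c, ?_⟩
  conv_lhs => rw [← b.sum_repr q, Fin.sum_univ_four, z1, z2, z3, hb0]
  simp [smul_smul]

end IsNearSymplecticGerm

end Pfaffian

/-! ### The intrinsic derivative at a zero -/

section Zeros

variable {M : Type*} [TopologicalSpace M] [ChartedSpace E4 M]

theorem fderiv_form_apply {F : Type*} [NormedAddCommGroup F] [NormedSpace ℝ F] {k : ℕ}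
    {α : F → Λ[k]} {y : F} (hα : DifferentiableAt ℝ α y) (v : Fin k → E4) (u : F) :
    fderiv ℝ (fun z => α z v) y u = fderiv ℝ α y u v := by
  have := ((evalForm v).hasFDerivAt.comp y hα.hasFDerivAt).fderiv
  exact DFunLike.congr_fun this u

/-- At a zero of the form, the derivative of a pulled back form is tensorial. -/
theorem fderiv_compContinuousLinearMap_of_zero {k : ℕ} {α : E4 → Λ[k]}
    {A : E4 → E4 →L[ℝ] E4} {y : E4} (hα : DifferentiableAt ℝ α y) (hA : DifferentiableAt ℝ A y)
    (hd : DifferentiableAt ℝ (fun z => (α z).compContinuousLinearMap (A z)) y)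
    (h0 : α y = 0) (u : E4) :
    fderiv ℝ (fun z => (α z).compContinuousLinearMap (A z)) y u =
      (fderiv ℝ α y u).compContinuousLinearMap (A y) := by
  ext v
  rw [← fderiv_form_apply hd]
  have h1 : ∀ z, (α z).compContinuousLinearMap (A z) v =
      ∑ i : Fin k → Fin 4, (∏ a, A z (v a) (i a)) * α z (fun a => stdVec (i a)) := fun z =>
    apply_eq_sum (α z) (fun a => A z (v a))
  have h2 : (fderiv ℝ α y u).compContinuousLinearMap (A y) v =
      ∑ i : Fin k → Fin 4, (∏ a, A y (v a) (i a)) * fderiv ℝ α y u (fun a => stdVec (i a)) :=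
    apply_eq_sum _ (fun a => A y (v a))
  rw [h2]
  simp only [h1]
  have hg : ∀ i : Fin k → Fin 4, DifferentiableAt ℝ (fun z => ∏ a, A z (v a) (i a)) y := by
    intro i
    have h3 : ∀ a, DifferentiableAt ℝ (fun z => A z (v a) (i a)) y := fun a =>
      (EuclideanSpace.proj (i a) : E4 →L[ℝ] ℝ).differentiableAt.comp y
        (hA.clm_apply (differentiableAt_const (v a)))
    exact (HasFDerivAt.finsetProd (u := Finset.univ) fun a _ => (h3 a).hasFDerivAt).differentiableAt
  have hh : ∀ i : Fin k → Fin 4, DifferentiableAt ℝ (fun z => α z (fun a => stdVec (i a))) y :=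
    fun i => (evalForm _).differentiableAt.comp y hα
  rw [fderiv_fun_sum fun i _ => (hg i).fun_mul (hh i), sum_apply]
  refine Finset.sum_congr rfl fun i _ => ?_
  rw [fderiv_fun_mul (hg i) (hh i)]
  simp only [add_apply, smul_apply, fderiv_form_apply hα, h0]
  simp

variable [IsManifold (𝓡 4) ∞ M]

theorem tder_eq_fderiv_chartRep {f : E4 → M} {y : E4} (hf : ContMDiffAt (𝓡 4) (𝓡 4) ∞ f y) :
    tder f y = fderiv ℝ (chartRep f (f y)) y := by
  have hx := mem_extChartAt_source (I := 𝓡 4) (f y)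
  have heq : f =ᶠ[𝓝 y] (chart (f y)).symm ∘ chartRep f (f y) := by
    filter_upwards [hf.continuousAt.preimage_mem_nhds
      ((isOpen_extChartAt_source (f y)).mem_nhds hx)] with z hz
    exact ((chart (f y)).left_inv hz).symm
  rw [tder_congr heq, tder_comp (mdifferentiableAt_symm _ ((chart (f y)).map_source hx))
    ((contDiffAt_chartRep hf hx).differentiableAt (by simp))]
  change (tder (chart (f y)).symm (chart (f y) (f y))).comp _ = _
  rw [tder_symm_self]
  rfl

/-- At a zero of `σ` the derivative of `tder f` drops out of the product rule, so `derivAt` pulls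
back like a tensor. -/
theorem fderiv_pullback_of_zero {k : ℕ} {σ : DiffForm M k} (hσ : IsSmoothForm σ) {f : E4 → M}
    {y : E4} (hf : ContMDiffAt (𝓡 4) (𝓡 4) ∞ f y) (h0 : valAt σ (f y) = 0) (u : E4) :
    fderiv ℝ (pullback f σ) y u =
      (derivAt σ (f y) (tder f y u)).compContinuousLinearMap (tder f y) := by
  have hx := mem_extChartAt_source (I := 𝓡 4) (f y)
  have hy := (chart (f y)).map_source hx
  have hev := pullback_eventuallyEq σ hf hx
  have hφ := contDiffAt_chartRep hf hx
  have hα : DifferentiableAt ℝ (localRep σ (f y)) (chartRep f (f y) y) :=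
    (localRep_differentiable hσ _ hy).differentiableAt (by simp)
  have hα' : DifferentiableAt ℝ (fun z => localRep σ (f y) (chartRep f (f y) z)) y :=
    hα.comp y (hφ.differentiableAt (by simp))
  have hA : DifferentiableAt ℝ (fderiv ℝ (chartRep f (f y))) y :=
    (hφ.fderiv_right (m := 1) (by exact two_le_infty)).differentiableAt (by simp)
  have hd : DifferentiableAt ℝ (fun z => (localRep σ (f y) (chartRep f (f y) z)).compContinuousLinearMap
      (fderiv ℝ (chartRep f (f y)) z)) y :=
    ((contDiffAt_pullback hσ hf).differentiableAt (by simp)).congr_of_eventuallyEq hev.symm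
  have hz : localRep σ (f y) (chartRep f (f y) y) = 0 := (localRep_self σ (f y)).trans h0
  rw [hev.fderiv_eq, fderiv_compContinuousLinearMap_of_zero hα' hA hd hz, tder_eq_fderiv_chartRep hf]
  congr 1
  have := (hα.hasFDerivAt.comp y (hφ.differentiableAt (by simp)).hasFDerivAt).fderiv
  exact DFunLike.congr_fun this u

namespace IsNearSymplectic

variable {σ : DiffForm M 2} (h : IsNearSymplectic σ)
include h

omit [IsManifold (𝓡 4) ∞ M] in
theorem derivAt_closed (p : M) (u v w : E4) :
    derivAt σ p u ![v, w] - derivAt σ p v ![u, w] + derivAt σ p w ![u, v] = 0 := by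
  have hd := (localRep_differentiable h.smooth p (mem_extChartAt_target (I := 𝓡 4) p)).differentiableAt
    (by simp)
  have h1 := extDeriv_two hd u v w
  have h2 : extDeriv (localRep σ p) (chart p p) = 0 := congrFun h.closed p
  rw [h2, fderiv_form_apply hd, fderiv_form_apply hd, fderiv_form_apply hd] at h1
  exact h1.symm

omit [IsManifold (𝓡 4) ∞ M] in
theorem finrank_ker {p : M} (hp : p ∈ zeroLocus σ) :
    Module.finrank ℝ (LinearMap.ker (derivAt σ p : E4 →ₗ[ℝ] Λ[2])) = 1 := by
  have h1 := LinearMap.finrank_range_add_finrank_ker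
    (derivAt σ p : E4 →ₗ[ℝ] Λ[2])
  have h2 : Module.finrank ℝ (LinearMap.range (derivAt σ p : E4 →ₗ[ℝ] Λ[2])) = 3 :=
    h.rank_eq p hp
  have h3 : Module.finrank ℝ E4 = 4 := by simp
  omega

omit [IsManifold (𝓡 4) ∞ M] in
theorem germ {p : M} (hp : p ∈ zeroLocus σ) {X : E4} (hX : X ≠ 0) (hD : derivAt σ p X = 0) :
    IsNearSymplecticGerm (derivAt σ p) X where
  ne_zero := hX
  kernel u := by
    constructor
    · intro hu
      obtain ⟨c, hc⟩ := exists_smul_eq_of_finrank_eq_one (h.finrank_ker hp)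
        (x := ⟨X, hD⟩) (fun e => hX (congrArg Subtype.val e)) ⟨u, hu⟩
      exact ⟨c, (congrArg Subtype.val hc).symm⟩
    · rintro ⟨c, rfl⟩
      rw [map_smul, hD, smul_zero]
  nondeg u hu := h.derivAt_nondeg p hp u hu
  closed := h.derivAt_closed p

omit [IsManifold (𝓡 4) ∞ M] in
theorem exists_germ {p : M} (hp : p ∈ zeroLocus σ) :
    ∃ X, IsNearSymplecticGerm (derivAt σ p) X := by
  have h1 := h.finrank_ker hp
  obtain ⟨⟨X, hD⟩, hX⟩ := (Module.finrank_pos_iff_exists_ne_zero (R := ℝ)).1 (h1 ▸ one_pos :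
    0 < Module.finrank ℝ (LinearMap.ker (derivAt σ p : E4 →ₗ[ℝ] Λ[2])))
  exact ⟨X, h.germ hp (fun e => hX (Subtype.ext e)) hD⟩

end IsNearSymplectic

end Zeros

/-! ### Charts that straighten the zero locus -/

section StraightChart

variable {M : Type*} [TopologicalSpace M] [ChartedSpace E4 M]

/-- A local parametrization `f` of `M` near `z`, defined on the ball of radius `r`, with inverse `e`,
that maps the first coordinate axis to the zero locus of `σ`. -/
structure IsStraightChart (σ : DiffForm M 2) (z : M) (r : ℝ) (f : E4 → M) (e : M → E4) : Prop where
  pos : 0 < r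
  zero : f 0 = z
  smooth : ∀ w ∈ Metric.ball (0 : E4) r, ContMDiffAt (𝓡 4) (𝓡 4) ∞ f w
  inj : ∀ w ∈ Metric.ball (0 : E4) r, Function.Injective (tder f w)
  smooth_inv : ∀ w ∈ Metric.ball (0 : E4) r, ContMDiffAt (𝓡 4) (𝓡 4) ∞ e (f w)
  left_inv : ∀ w ∈ Metric.ball (0 : E4) r, e (f w) = w
  image_mem_nhds : ∀ w ∈ Metric.ball (0 : E4) r, ∀ V ∈ 𝓝 w, f '' V ∈ 𝓝 (f w)
  zero_iff : ∀ w ∈ Metric.ball (0 : E4) r,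
    valAt σ (f w) = 0 ↔ (w 1 = 0 ∧ w 2 = 0 ∧ w 3 = 0)
  posDir : ∀ w ∈ Metric.ball (0 : E4) r, w 1 = 0 → w 2 = 0 → w 3 = 0 →
    PosDir (derivAt σ (f w)) (tder f w (stdVec 0))

theorem comp_eq_zero_iff {k : ℕ} {α : Λ[k]} {A : E4 →L[ℝ] E4}
    (hA : Function.Injective A) : α.compContinuousLinearMap A = 0 ↔ α = 0 := by
  constructor
  · intro h
    ext v
    have hs : Function.Surjective A := LinearMap.surjective_of_injective (f := (A : E4 →ₗ[ℝ] E4)) hA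
    choose g hg using hs
    have := DFunLike.congr_fun h (fun i => g (v i))
    simpa [Function.comp_def, hg] using this
  · rintro rfl
    rfl

theorem stdVec_ne_zero (i : Fin 4) : stdVec i ≠ 0 := by
  intro h
  have := congrArg (fun v : E4 => v i) h
  simp [stdVec] at this

/-- The standard basis as a basis. -/
def stdBasis : Module.Basis (Fin 4) ℝ E4 := (EuclideanSpace.basisFun (Fin 4) ℝ).toBasis

@[simp] theorem stdBasis_apply (i : Fin 4) : stdBasis i = stdVec i := by simp [stdBasis, stdVec]

theorem form_eq_zero_of_stdVec {α : Λ[2]} {v : E4}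
    (h : ∀ i, α ![v, stdVec i] = 0) (w : E4) : α ![v, w] = 0 := by
  rw [form_expand_right α stdBasis]
  simp [h]

variable [IsManifold (𝓡 4) ∞ M]

/-- The pull-back of `σ` vanishes along the line through `w`, so its derivative in that direction
does too. -/
theorem IsNearSymplectic.derivAt_axis {σ : DiffForm M 2} (h : IsNearSymplectic σ) {f : E4 → M}
    {w v : E4} (hf : ContMDiffAt (𝓡 4) (𝓡 4) ∞ f w) (hinj : Function.Injective (tder f w))
    (hz : ∀ᶠ t : ℝ in 𝓝 0, valAt σ (f (w + t • v)) = 0) : derivAt σ (f w) (tder f w v) = 0 := by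
  have h0 : valAt σ (f w) = 0 := by simpa using hz.self_of_nhds
  have h1 := fderiv_pullback_of_zero h.smooth hf h0 v
  have hd := (contDiffAt_pullback h.smooth hf).differentiableAt (by simp)
  have hline : HasDerivAt (fun t : ℝ => w + t • v) v 0 := by
    simpa using ((hasDerivAt_id (0 : ℝ)).smul_const v).const_add w
  have hcv : w + (0 : ℝ) • v = w := by simp
  have h2 : HasDerivAt (fun t : ℝ => pullback f σ (w + t • v)) (fderiv ℝ (pullback f σ) w v) 0 := by
    have : HasFDerivAt (pullback f σ) (fderiv ℝ (pullback f σ) w) (w + (0 : ℝ) • v) := by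
      rw [hcv]; exact hd.hasFDerivAt
    exact this.comp_hasDerivAt (0 : ℝ) hline
  have h3 : HasDerivAt (fun t : ℝ => pullback f σ (w + t • v)) 0 0 := by
    refine (hasDerivAt_const (0 : ℝ) (0 : Λ[2])).congr_of_eventuallyEq ?_
    filter_upwards [hz] with t ht
    rw [pullback_def, ht]
    rfl
  rw [h2.unique h3] at h1
  exact (comp_eq_zero_iff hinj).1 h1.symm

theorem IsNearSymplectic.germForm_pullback {σ : DiffForm M 2} (h : IsNearSymplectic σ) {f : E4 → M}
    {w : E4} (hf : ContMDiffAt (𝓡 4) (𝓡 4) ∞ f w) (h0 : valAt σ (f w) = 0) (X a b : E4) :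
    germForm (derivAt σ (f w)) (tder f w X) (tder f w a) (tder f w b) =
      fderiv ℝ (pullback f σ) w a ![X, b] := by
  rw [fderiv_pullback_of_zero h.smooth hf h0, germForm_apply]
  rw [ContinuousAlternatingMap.compContinuousLinearMap_apply]
  congr 1
  ext i
  fin_cases i <;> rfl

theorem tder_symm_comp {x : M} {ψ : E4 → E4} {w : E4} (hψ : DifferentiableAt ℝ ψ w)
    (hx : ψ w ∈ (chart x).target) :
    tder ((chart x).symm ∘ ψ) w =
      (tder (chart x).symm (ψ w)).comp (fderiv ℝ ψ w) :=
  tder_comp (mdifferentiableAt_symm x hx) hψ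

/-- The chart inverts `F = (⟨X, y - c⟩, σ(e₀, e₁), σ(e₀, e₂), σ(e₀, e₃))`. The last three entries
vanish when `e₀` is in the kernel of `σ`, and since nonzero values of `σ` are nondegenerate this
happens exactly at the zeros. The same argument for the derivative makes `dF` injective, the first
entry detecting the kernel direction. `PosDir` is an open condition and persists along the axis. -/
theorem IsNearSymplectic.exists_straightChart {σ : DiffForm M 2} (h : IsNearSymplectic σ) {z : M}
    (hz : z ∈ zeroLocus σ) : ∃ r f e, IsStraightChart σ z r f e := by
  obtain ⟨X, hg, hpos⟩ : ∃ X, IsNearSymplecticGerm (derivAt σ z) X ∧ PosDir (derivAt σ z) X := by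
    obtain ⟨X, hX⟩ := h.exists_germ hz
    rcases hX.posDir_or with h1 | h1
    · exact ⟨X, hX, h1⟩
    · have h2 := hX.smul (c := -1) (by norm_num)
      rw [neg_one_smul] at h2
      exact ⟨-X, h2, h1⟩
  set c := chart z z with hc
  set t := (chart z).target with ht
  have hto : IsOpen t := isOpen_target z
  have hct : c ∈ t := mem_extChartAt_target z
  let s := localRep σ z
  have hs : ∀ y ∈ t, ContDiffAt ℝ ∞ s y := fun y hy => localRep_differentiable h.smooth z hy
  have hsc : s c = 0 := (localRep_self σ z).trans hz
  let F : E4 → E4 := fun y => WithLp.toLp 2 ![inner ℝ X (y - c), s y ![stdVec 0, stdVec 1],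
    s y ![stdVec 0, stdVec 2], s y ![stdVec 0, stdVec 3]]
  have hF : ∀ y ∈ t, ContDiffAt ℝ ∞ F y := by
    intro y hy
    rw [contDiffAt_euclidean]
    have h1 : ∀ v : Fin 2 → E4, ContDiffAt ℝ ∞ (fun y => s y v) y := fun v =>
      (evalForm v).contDiff.contDiffAt.comp y (hs y hy)
    intro i
    fin_cases i
    · exact contDiffAt_const.inner ℝ (contDiffAt_id.sub contDiffAt_const)
    · exact h1 _
    · exact h1 _
    · exact h1 _
  have hFc : F c = 0 := by
    ext i
    fin_cases i
    · simp [F]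
    all_goals simp [F, hsc]
  have hdF : ∀ y ∈ t, ∀ (u : E4) (i : Fin 4), fderiv ℝ F y u i = fderiv ℝ (fun y => F y i) y u := by
    intro y hy u i
    have := ((EuclideanSpace.proj i : E4 →L[ℝ] ℝ).hasFDerivAt.comp y
      ((hF y hy).differentiableAt (by simp)).hasFDerivAt).fderiv
    exact (DFunLike.congr_fun this u).symm
  have hD0 : ∀ u, fderiv ℝ F c u 0 = inner ℝ X u := by
    intro u
    rw [hdF c hct]
    have : HasFDerivAt (fun y : E4 => inner ℝ X (y - c)) (innerSL ℝ X) c :=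
      (innerSL ℝ X).hasFDerivAt.comp c ((hasFDerivAt_id c).sub_const c)
    exact DFunLike.congr_fun this.fderiv u
  have hDi : ∀ u (i : Fin 4), i ≠ 0 → fderiv ℝ F c u i = derivAt σ z u ![stdVec 0, stdVec i] := by
    intro u i hi
    rw [hdF c hct]
    have h2 := fderiv_form_apply ((hs c hct).differentiableAt (by simp)) ![stdVec 0, stdVec i] u
    rw [show derivAt σ z u ![stdVec 0, stdVec i] = fderiv ℝ s c u ![stdVec 0, stdVec i] from rfl, ← h2]
    fin_cases i
    · exact absurd rfl hi
    · rfl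
    · rfl
    · rfl
  have hinj : Function.Injective (fderiv ℝ F c) := by
    rw [injective_iff_map_eq_zero]
    intro u hu
    have hu' : ∀ i, fderiv ℝ F c u i = 0 := fun i => by rw [hu]; rfl
    have h1 : derivAt σ z u = 0 := by
      by_contra hne
      refine stdVec_ne_zero 0 (hg.nondeg u hne _ fun w => form_eq_zero_of_stdVec (fun i => ?_) w)
      by_cases hi : i = 0
      · rw [hi, form_self]
      · rw [← hDi u i hi]; exact hu' i
    obtain ⟨a, rfl⟩ := (hg.kernel u).1 h1
    have h2 := hu' 0
    rw [hD0, inner_smul_right] at h2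
    have h3 : inner ℝ X X ≠ 0 := inner_self_ne_zero.2 hg.ne_zero
    rw [(mul_eq_zero.1 h2).resolve_right h3, zero_smul]
  let L : E4 ≃L[ℝ] E4 := (LinearEquiv.ofInjectiveEndo (fderiv ℝ F c).toLinearMap
    hinj).toContinuousLinearEquiv
  have hL : HasFDerivAt F (L : E4 →L[ℝ] E4) c := ((hF c hct).differentiableAt (by simp)).hasFDerivAt
  let G := (hF c hct).toOpenPartialHomeomorph F hL (by simp)
  have hGF : ∀ y, G y = F y := fun y => rfl
  have hcG : c ∈ G.source := (hF c hct).mem_toOpenPartialHomeomorph_source hL (by simp)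
  -- nearby derivatives are invertible
  have hinv : ∀ᶠ y in 𝓝 c, fderiv ℝ F y ∈ range ((↑) : (E4 ≃L[ℝ] E4) → E4 →L[ℝ] E4) := by
    have hcont : ContinuousAt (fderiv ℝ F) c :=
      ((hF c hct).fderiv_right (m := 0) (by simp)).continuousAt
    refine hcont.eventually (ContinuousLinearEquiv.isOpen.mem_nhds ⟨L, ?_⟩)
    exact hL.fderiv.symm
  let ψ : E4 → E4 := G.symm
  have hψ0 : ψ 0 = c := by
    rw [← hFc, ← hGF]
    exact G.left_inv hcG
  have h0G : (0 : E4) ∈ G.target := by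
    rw [← hFc, ← hGF]
    exact G.map_source hcG
  have hψc : ContinuousAt ψ 0 := G.symm.continuousAt h0G
  -- the positive plane
  have hkerX : fderiv ℝ F c X = (inner ℝ X X) • stdVec 0 := by
    ext i
    by_cases hi : i = 0
    · subst hi
      rw [hD0]
      simp [stdVec]
    · rw [hDi X i hi, hg.apply_self]
      simp [stdVec, hi]
  let f : E4 → M := (chart z).symm ∘ ψ
  let e : M → E4 := fun p => F (chart z p)
  have hf0 : f 0 = z := by
    change (chart z).symm (ψ 0) = z
    rw [hψ0, hc, extChartAt_to_inv]
  have hgood : ∀ᶠ w in 𝓝 (0 : E4), w ∈ G.target ∧ ψ w ∈ t ∧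
      fderiv ℝ F (ψ w) ∈ range ((↑) : (E4 ≃L[ℝ] E4) → E4 →L[ℝ] E4) := by
    have h1 : ∀ᶠ w in 𝓝 (0 : E4), w ∈ G.target := G.open_target.mem_nhds h0G
    have h2 : ∀ᶠ y in 𝓝 (ψ 0), y ∈ t := by rw [hψ0]; exact hto.mem_nhds hct
    rw [← hψ0] at hinv
    exact h1.and ((hψc.eventually h2).and (hψc.eventually hinv))
  have hψd : ∀ w, w ∈ G.target → ψ w ∈ t →
      fderiv ℝ F (ψ w) ∈ range ((↑) : (E4 ≃L[ℝ] E4) → E4 →L[ℝ] E4) → ContDiffAt ℝ ∞ ψ w := by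
    rintro w h1 h2 ⟨B, hB⟩
    refine G.contDiffAt_symm h1 (f₀' := B) ?_ (hF _ h2)
    change HasFDerivAt F (B : E4 →L[ℝ] E4) (ψ w)
    rw [hB]
    exact ((hF _ h2).differentiableAt (by simp)).hasFDerivAt
  have hψ' : ∀ w, w ∈ G.target → ψ w ∈ t → ContDiffAt ℝ ∞ ψ w →
      ∀ u, fderiv ℝ F (ψ w) (fderiv ℝ ψ w u) = u := by
    intro w h1 h2 h3 u
    have h4 : F ∘ ψ =ᶠ[𝓝 w] id := by
      filter_upwards [G.open_target.mem_nhds h1] with w' hw'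
      exact G.right_inv hw'
    have h5 := (((hF _ h2).differentiableAt (by simp)).hasFDerivAt.comp w
      (h3.differentiableAt (by simp)).hasFDerivAt).fderiv
    rw [h4.fderiv_eq, fderiv_id] at h5
    exact (DFunLike.congr_fun h5 u).symm
  have hfs : ∀ w, w ∈ G.target → ψ w ∈ t → ContDiffAt ℝ ∞ ψ w →
      ContMDiffAt (𝓡 4) (𝓡 4) ∞ f w := fun w h1 h2 h3 =>
    ContMDiffAt.comp w ((contMDiffOn_symm z).contMDiffAt (hto.mem_nhds h2)) h3.contMDiffAt
  have hfi : ∀ w, w ∈ G.target → ψ w ∈ t → ContDiffAt ℝ ∞ ψ w →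
      Function.Injective (tder f w) := by
    intro w h1 h2 h3
    rw [tder_symm_comp (h3.differentiableAt (by simp)) h2]
    refine (tder_symm_injective z h2).comp fun a b hab => ?_
    have hab' : fderiv ℝ ψ w a = fderiv ℝ ψ w b := hab
    rw [← hψ' w h1 h2 h3 a, hab', hψ' w h1 h2 h3 b]
  have hzero : ∀ w, w ∈ G.target → ψ w ∈ t →
      (valAt σ (f w) = 0 ↔ (w 1 = 0 ∧ w 2 = 0 ∧ w 3 = 0)) := by
    intro w h1 h2
    have hFw : F (ψ w) = w := G.right_inv h1
    have hsv : s (ψ w) = (valAt σ (f w)).compContinuousLinearMap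
      (tder (chart z).symm (ψ w)) := rfl
    have hwi : ∀ i : Fin 4, i ≠ 0 → w i = s (ψ w) ![stdVec 0, stdVec i] := by
      intro i hi
      conv_lhs => rw [← hFw]
      fin_cases i
      · exact absurd rfl hi
      · rfl
      · rfl
      · rfl
    constructor
    · intro hv
      have hs0 : s (ψ w) = 0 := by rw [hsv, hv]; rfl
      refine ⟨?_, ?_, ?_⟩ <;> · rw [hwi _ (by decide), hs0]; rfl
    · rintro ⟨w1, w2, w3⟩
      by_contra hne
      have hnd : Nondeg (valAt σ (f w)) := h.nondeg _ hne
      have hBi := tder_symm_injective z h2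
      set B := tder (chart z).symm (ψ w)
      have hBs : Function.Surjective B := LinearMap.surjective_of_injective (f := (B : E4 →ₗ[ℝ] E4)) hBi
      have hB0 : B (stdVec 0) = 0 := by
        refine hnd _ fun v => ?_
        obtain ⟨v', rfl⟩ := hBs v
        have h4 : s (ψ w) ![stdVec 0, v'] = 0 := by
          refine form_eq_zero_of_stdVec (fun i => ?_) v'
          by_cases hi : i = 0
          · rw [hi, form_self]
          · rw [← hwi i hi]
            fin_cases i
            · exact absurd rfl hi
            · exact w1
            · exact w2
            · exact w3
        rw [hsv, ContinuousAlternatingMap.compContinuousLinearMap_apply] at h4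
        rw [← h4]
        congr 1
        ext i
        fin_cases i <;> rfl
      exact stdVec_ne_zero 0 (hBi (hB0.trans (map_zero B).symm))
  -- positivity near `z`
  have h0t : ψ 0 ∈ t := by rw [hψ0]; exact hct
  have hψ0d : ContDiffAt ℝ ∞ ψ 0 := by
    obtain ⟨a1, a2, a3⟩ := hgood.self_of_nhds
    exact hψd 0 a1 a2 a3
  have hf0s := hfs 0 h0G h0t hψ0d
  have hf0i := hfi 0 h0G h0t hψ0d
  -- The axis is a positive multiple of `X` at the centre, so it inherits the chosen orientation.
  have hX0 : tder f 0 (stdVec 0) = (inner ℝ X X)⁻¹ • X := by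
    have hXX : inner ℝ X X ≠ 0 := inner_self_ne_zero.2 hg.ne_zero
    have h5 : fderiv ℝ ψ 0 (stdVec 0) = (inner ℝ X X)⁻¹ • X := by
      apply hinj
      have := hψ' 0 h0G h0t hψ0d (stdVec 0)
      rw [hψ0] at this
      rw [this, map_smul, hkerX, smul_smul, inv_mul_cancel₀ hXX, one_smul]
    rw [tder_symm_comp (hψ0d.differentiableAt (by simp)) h0t, ContinuousLinearMap.comp_apply, h5,
      hψ0, hc, tder_symm_self]
    rfl
  have hposev : ∀ᶠ w in 𝓝 (0 : E4), ContMDiffAt (𝓡 4) (𝓡 4) ∞ f w → valAt σ (f w) = 0 →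
      PosDir (derivAt σ (f w)) (tder f w (stdVec 0)) := by
    have hp0 : PosDir (derivAt σ (f 0)) (tder f 0 (stdVec 0)) := by
      rw [hX0, hf0]
      exact hpos.smul (inv_pos.2 (real_inner_self_pos.2 hg.ne_zero))
    obtain ⟨a, b, q1, q2⟩ := hp0
    have hsurj : Function.Surjective (tder f 0) :=
      LinearMap.surjective_of_injective (f := (tder f 0 : E4 →ₗ[ℝ] E4)) hf0i
    obtain ⟨a, rfl⟩ := hsurj a
    obtain ⟨b, rfl⟩ := hsurj b
    have hv0 : valAt σ (f 0) = 0 := by rw [hf0]; exact hz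
    simp only [h.germForm_pullback hf0s hv0] at q1 q2
    have hcont : ∀ u v : E4, ContinuousAt (fun w => fderiv ℝ (pullback f σ) w u ![stdVec 0, v]) 0 := by
      intro u v
      have h6 : ContinuousAt (fderiv ℝ (pullback f σ)) 0 :=
        ((contDiffAt_pullback h.smooth hf0s).fderiv_right (m := 0) (by simp)).continuousAt
      exact (evalForm ![stdVec 0, v]).continuous.continuousAt.comp
        (h6.clm_apply continuousAt_const)
    filter_upwards [(hcont a a).eventually (lt_mem_nhds q1),
      (((hcont a b).mul (hcont b a)).sub ((hcont a a).mul (hcont b b))).eventually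
        (gt_mem_nhds (sub_neg.2 q2))] with w r1 r2 hw hvw
    refine ⟨tder f w a, tder f w b, ?_, ?_⟩
    · rw [h.germForm_pullback hw hvw]; exact r1
    · simp only [h.germForm_pullback hw hvw]
      exact sub_neg.1 r2
  obtain ⟨r, hr, hball⟩ := Metric.eventually_nhds_iff_ball.1 (hgood.and hposev)
  refine ⟨r, f, e, hr, hf0, ?_, ?_, ?_, ?_, ?_, ?_, ?_⟩
  · intro w hw
    obtain ⟨⟨a1, a2, a3⟩, -⟩ := hball w hw
    exact hfs w a1 a2 (hψd w a1 a2 a3)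
  · intro w hw
    obtain ⟨⟨a1, a2, a3⟩, -⟩ := hball w hw
    exact hfi w a1 a2 (hψd w a1 a2 a3)
  · intro w hw
    obtain ⟨⟨a1, a2, a3⟩, -⟩ := hball w hw
    have h1 : f w ∈ (chart z).source := (chart z).map_target a2
    have h2 : ContMDiffAt (𝓡 4) (𝓡 4) ∞ F (chart z (f w)) :=
      (hF _ ((chart z).map_source h1)).contMDiffAt
    exact ContMDiffAt.comp (g := F) (f := chart z) (f w) h2 (contMDiffAt_chart z h1)
  · intro w hw
    obtain ⟨⟨a1, a2, a3⟩, -⟩ := hball w hw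
    change F (chart z ((chart z).symm (ψ w))) = w
    rw [(chart z).right_inv a2]
    exact G.right_inv a1
  · intro w hw V hV
    obtain ⟨⟨a1, a2, a3⟩, -⟩ := hball w hw
    let H := G.symm.trans (chartAt E4 z).symm
    have hwH : w ∈ H.source := by
      refine ⟨a1, ?_⟩
      have : ψ w ∈ (chartAt E4 z).target := by
        have := a2
        rw [ht, extChartAt_target] at this
        simpa using this
      exact this
    have hHf : ∀ w, H w = f w := fun w => by
      change (chartAt E4 z).symm (ψ w) = (chart z).symm (ψ w)
      simp [extChartAt]
    have h1 := H.image_mem_nhds hwH hV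
    rw [hHf] at h1
    convert h1 using 1
    exact Set.image_congr fun w _ => (hHf w).symm
  · intro w hw
    obtain ⟨⟨a1, a2, a3⟩, -⟩ := hball w hw
    exact hzero w a1 a2
  · intro w hw w1 w2 w3
    obtain ⟨⟨a1, a2, a3⟩, a4⟩ := hball w hw
    exact a4 (hfs w a1 a2 (hψd w a1 a2 a3)) ((hzero w a1 a2).2 ⟨w1, w2, w3⟩)

end StraightChart

/-! ### A global vector field tangent to the zero locus -/

section AxisField

variable {M : Type*} [TopologicalSpace M] [ChartedSpace E4 M] [IsManifold (𝓡 4) ∞ M]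

omit [IsManifold (𝓡 4) ∞ M] in
/-- The value of a vector field at a point, on the model space. -/
def vecAt (X : ∀ x : M, TangentSpace (𝓡 4) x) (p : M) : E4 := X p

/-- `X` is a smooth vector field that is tangent to the zero locus of `σ`, and positively oriented
there. -/
structure IsAxisField (σ : DiffForm M 2) (X : ∀ x : M, TangentSpace (𝓡 4) x) : Prop where
  smooth : ContMDiff (𝓡 4) (𝓡 4).tangent ∞ (fun x => (⟨x, X x⟩ : TangentBundle (𝓡 4) M))
  ne_zero : ∀ p ∈ zeroLocus σ, vecAt X p ≠ 0
  tangent : ∀ p ∈ zeroLocus σ, derivAt σ p (vecAt X p) = 0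
  posDir : ∀ p ∈ zeroLocus σ, PosDir (derivAt σ p) (vecAt X p)

omit [IsManifold (𝓡 4) ∞ M] in
theorem mem_zeroLocus {k : ℕ} {σ : DiffForm M k} {p : M} : p ∈ zeroLocus σ ↔ valAt σ p = 0 := Iff.rfl

/-- The kernel is a line and by `not_posDir_neg` only one of its open rays is admissible. Convexity
is what allows local tangent fields to be glued. -/
theorem convex_posDir {D : E4 →L[ℝ] Λ[2]}
    (h : ∀ X, X ≠ 0 → D X = 0 → IsNearSymplecticGerm D X) :
    Convex ℝ {v : E4 | v ≠ 0 ∧ D v = 0 ∧ PosDir D v} := by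
  rintro v ⟨v0, v1, v2⟩ w ⟨w0, w1, w2⟩ a b ha hb hab
  have hg := h v v0 v1
  obtain ⟨c, rfl⟩ := (hg.kernel w).1 w1
  have hc : 0 < c := by
    rcases lt_trichotomy c 0 with hc | rfl | hc
    · have := w2.smul (c := -c⁻¹) (by simpa using hc)
      rw [smul_smul, neg_mul, inv_mul_cancel₀ hc.ne, neg_one_smul] at this
      exact absurd this (hg.not_posDir_neg v2)
    · simp at w0
    · exact hc
  have hp : 0 < a + b * c := by
    rcases ha.eq_or_lt with rfl | ha
    · have : b = 1 := by linarith
      simpa [this] using hc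
    · have := mul_nonneg hb hc.le
      linarith
  have e : a • v + b • c • v = (a + b * c) • v := by rw [smul_smul, add_smul]
  rw [e]
  exact ⟨smul_ne_zero hp.ne' v0, by rw [map_smul, v1, smul_zero], v2.smul hp⟩

theorem isClosed_zeroLocus {k : ℕ} {σ : DiffForm M k} (hσ : IsSmoothForm σ) :
    IsClosed (zeroLocus σ) := by
  rw [← isOpen_compl_iff, isOpen_iff_mem_nhds]
  intro x hx
  have h1 : ContinuousAt (localRep σ x) (chart x x) :=
    (localRep_differentiable hσ x (mem_extChartAt_target x)).continuousAt
  have h2 : localRep σ x (chart x x) ≠ 0 := by rw [localRep_self]; exact hx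
  have h3 := (continuousAt_extChartAt (I := 𝓡 4) x).eventually (h1.eventually_ne h2)
  filter_upwards [h3, (isOpen_extChartAt_source x).mem_nhds (mem_extChartAt_source (I := 𝓡 4) x)]
    with p hp hps hp0
  apply hp
  rw [localRep, pullback_def, (chart x).left_inv hps, mem_zeroLocus.1 hp0]
  rfl

namespace IsStraightChart

variable {σ : DiffForm M 2} {z : M} {r : ℝ} {f : E4 → M} {e : M → E4}
  (hf : IsStraightChart σ z r f e)
include hf

omit [IsManifold (𝓡 4) ∞ M] in
theorem right_inv {p : M} (hp : p ∈ f '' Metric.ball 0 r) : f (e p) = p := by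
  obtain ⟨w, hw, rfl⟩ := hp
  rw [hf.left_inv w hw]

omit [IsManifold (𝓡 4) ∞ M] in
theorem isOpen_image : IsOpen (f '' Metric.ball 0 r) := by
  rw [isOpen_iff_mem_nhds]
  rintro _ ⟨w, hw, rfl⟩
  exact hf.image_mem_nhds w hw _ (Metric.isOpen_ball.mem_nhds hw)

omit [IsManifold (𝓡 4) ∞ M] in
theorem mem_image_self : z ∈ f '' Metric.ball 0 r := ⟨0, Metric.mem_ball_self hf.pos, hf.zero⟩

theorem contMDiffAt_axis {p : M} (hp : p ∈ f '' Metric.ball 0 r) :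
    ContMDiffAt (𝓡 4) (𝓡 4).tangent ∞
      (fun q => (⟨q, tder f (e q) (stdVec 0)⟩ : TangentBundle (𝓡 4) M)) p := by
  obtain ⟨w, hw, rfl⟩ := hp
  have hfo : ContMDiffOn (𝓡 4) (𝓡 4) ∞ f (Metric.ball 0 r) := fun w hw =>
    (hf.smooth w hw).contMDiffWithinAt
  have h1 := hfo.contMDiffOn_tangentMapWithin (m := ∞) (by simp) Metric.isOpen_ball.uniqueMDiffOn
  have h0 : ContMDiffAt (𝓡 4) (𝓡 4).tangent ∞ (fun y : E4 => (⟨y, stdVec 0⟩ : TangentBundle (𝓡 4) E4))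
      (e (f w)) := contMDiffAt_vectorSpace_iff_contDiffAt.2 contDiffAt_const
  have h2 : ContMDiffAt (𝓡 4) (𝓡 4).tangent ∞
      (fun q => (⟨e q, stdVec 0⟩ : TangentBundle (𝓡 4) E4)) (f w) :=
    ContMDiffAt.comp (f w) h0 (hf.smooth_inv w hw)
  have h3 : ContMDiffAt (𝓡 4) (𝓡 4).tangent ∞
      (fun q => tangentMapWithin (𝓡 4) (𝓡 4) f (Metric.ball 0 r)
        (⟨e q, stdVec 0⟩ : TangentBundle (𝓡 4) E4)) (f w) := by
    refine ContMDiffAt.comp (f w) (h1.contMDiffAt ?_) h2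
    refine (FiberBundle.continuous_proj E4 (TangentSpace (𝓡 4))).continuousAt.preimage_mem_nhds
      (Metric.isOpen_ball.mem_nhds ?_)
    change e (f w) ∈ _
    rwa [hf.left_inv w hw]
  refine h3.congr_of_eventuallyEq ?_
  filter_upwards [hf.isOpen_image.mem_nhds ⟨w, hw, rfl⟩] with q hq
  have hq' : e q ∈ Metric.ball (0 : E4) r := by
    obtain ⟨w', hw', rfl⟩ := hq
    rwa [hf.left_inv w' hw']
  simp only [tangentMapWithin]
  rw [mfderivWithin_of_mem_nhds (Metric.isOpen_ball.mem_nhds hq'), hf.right_inv hq]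
  rfl

end IsStraightChart

theorem IsNearSymplectic.axis_ker {σ : DiffForm M 2} (h : IsNearSymplectic σ) {z : M} {r : ℝ}
    {f : E4 → M} {e : M → E4} (hf : IsStraightChart σ z r f e) {w : E4}
    (hw : w ∈ Metric.ball (0 : E4) r) (hwz : f w ∈ zeroLocus σ) :
    tder f w (stdVec 0) ≠ 0 ∧ derivAt σ (f w) (tder f w (stdVec 0)) = 0 ∧
      PosDir (derivAt σ (f w)) (tder f w (stdVec 0)) := by
  obtain ⟨w1, w2, w3⟩ := (hf.zero_iff w hw).1 hwz
  refine ⟨fun h0 => stdVec_ne_zero 0 (hf.inj w hw (h0.trans (map_zero _).symm)), ?_,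
    hf.posDir w hw w1 w2 w3⟩
  refine h.derivAt_axis (hf.smooth w hw) (hf.inj w hw) ?_
  have hc : ContinuousAt (fun t : ℝ => w + t • stdVec 0) 0 := by fun_prop
  have hev : ∀ᶠ t : ℝ in 𝓝 0, w + t • stdVec 0 ∈ Metric.ball (0 : E4) r := by
    refine hc.eventually (Metric.isOpen_ball.mem_nhds ?_)
    simpa using hw
  filter_upwards [hev] with t ht
  refine (hf.zero_iff _ ht).2 ⟨?_, ?_, ?_⟩ <;> simp [stdVec, w1, w2, w3]

/-- The axis fields of straight charts, and the zero field away from the zeros, are glued by a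
partition of unity; the convex condition constrains the field only on the zero locus. -/
theorem IsNearSymplectic.exists_axisField [T2Space M] [CompactSpace M] {σ : DiffForm M 2}
    (h : IsNearSymplectic σ) : ∃ X, IsAxisField σ X := by
  have hloc : ∀ x₀ : M, ∃ U ∈ 𝓝 x₀, ∃ s : (x : M) → TangentSpace (𝓡 4) x,
      ContMDiffOn (𝓡 4) (𝓡 4).tangent ∞ (fun x => (⟨x, s x⟩ : TangentBundle (𝓡 4) M)) U ∧
      ∀ y ∈ U, s y ∈ {v : TangentSpace (𝓡 4) y | y ∈ zeroLocus σ → (v : E4) ∈ {v : E4 | v ≠ 0 ∧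
        derivAt σ y v = 0 ∧ PosDir (derivAt σ y) v}} := by
    intro x₀
    by_cases hx : x₀ ∈ zeroLocus σ
    · obtain ⟨r, f, e, hf⟩ := h.exists_straightChart hx
      refine ⟨_, hf.isOpen_image.mem_nhds hf.mem_image_self, fun q => tder f (e q) (stdVec 0),
        fun p hp => (hf.contMDiffAt_axis hp).contMDiffWithinAt, ?_⟩
      rintro _ ⟨w, hw, rfl⟩ hz
      have := h.axis_ker hf hw hz
      change (tder f (e (f w)) (stdVec 0) : E4) ≠ 0 ∧
        derivAt σ (f w) (tder f (e (f w)) (stdVec 0) : E4) = 0 ∧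
        PosDir _ (tder f (e (f w)) (stdVec 0))
      rw [hf.left_inv w hw]
      exact this
    · refine ⟨_, (isClosed_zeroLocus h.smooth).isOpen_compl.mem_nhds hx, fun _ => 0, ?_, ?_⟩
      · exact (Bundle.contMDiff_zeroSection ℝ (TangentSpace (𝓡 4) : M → Type _)).contMDiffOn
      · exact fun y hy hy' => absurd hy' hy
  obtain ⟨s, hs⟩ := exists_contMDiffSection_forall_mem_convex_of_local (𝓡 4) (n := ⊤)
    (F_fiber := E4) (TangentSpace (𝓡 4) : M → Type _)
    (fun y => {v : TangentSpace (𝓡 4) y | y ∈ zeroLocus σ → (v : E4) ∈ {v : E4 | v ≠ 0 ∧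
        derivAt σ y v = 0 ∧ PosDir (derivAt σ y) v}}) (fun y => by
      by_cases hy : y ∈ zeroLocus σ
      · simp only [hy, true_imp_iff]
        exact convex_posDir fun X hX hD => h.germ hy hX hD
      · simp only [hy, false_imp_iff]
        exact convex_univ) hloc
  exact ⟨s, s.contMDiff, fun p hp => (hs p hp).1, fun p hp => (hs p hp).2.1,
    fun p hp => (hs p hp).2.2⟩

/-- A point of the axis of a straight chart. -/
def axisPt (s : ℝ) : E4 := s • stdVec 0

theorem contDiff_axisPt : ContDiff ℝ ∞ axisPt := contDiff_id.smul contDiff_const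

theorem hasDerivAt_axisPt (s : ℝ) : HasDerivAt axisPt (stdVec 0) s := by
  have h := (hasDerivAt_id s).smul_const (stdVec 0)
  rw [one_smul] at h
  exact h

theorem axisPt_mem_ball {s r : ℝ} : axisPt s ∈ Metric.ball (0 : E4) r ↔ |s| < r := by
  simp [axisPt, norm_smul, stdVec]

namespace IsStraightChart

variable {σ : DiffForm M 2} {z : M} {r : ℝ} {f : E4 → M} {e : M → E4}
  (hf : IsStraightChart σ z r f e)
include hf

omit [IsManifold (𝓡 4) ∞ M] in
theorem axis_mem {s : ℝ} (hs : |s| < r) : f (axisPt s) ∈ zeroLocus σ := by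
  refine (hf.zero_iff _ (axisPt_mem_ball.2 hs)).2 ⟨?_, ?_, ?_⟩ <;> simp [axisPt, stdVec]

/-- On the axis, an axis field is a smooth multiple of the coordinate field. -/
theorem exists_axis_speed (h : IsNearSymplectic σ) {X : ∀ x : M, TangentSpace (𝓡 4) x}
    (hX : IsAxisField σ X) : ∃ l : ℝ → ℝ, ∀ s, |s| < r → ContDiffAt ℝ ∞ l s ∧ l s ≠ 0 ∧
      vecAt X (f (axisPt s)) = l s • tder f (axisPt s) (stdVec 0) := by
  let V : M → E4 := fun p => (mfderiv (𝓡 4) (𝓡 4) e p (X p) : E4)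
  refine ⟨fun s => V (f (axisPt s)) 0, fun s hs => ?_⟩
  have hw := axisPt_mem_ball.2 hs
  set w := axisPt s
  have hmap : ContMDiffOn (𝓡 4) (𝓡 4) ∞ e (f '' Metric.ball 0 r) := by
    rintro _ ⟨w, hw, rfl⟩
    exact (hf.smooth_inv w hw).contMDiffWithinAt
  have h1 := hmap.contMDiffOn_tangentMapWithin (m := ∞) (by simp) hf.isOpen_image.uniqueMDiffOn
  have h2 : ContMDiffAt (𝓡 4) (𝓡 4).tangent ∞ (fun p => tangentMapWithin (𝓡 4) (𝓡 4) e
      (f '' Metric.ball 0 r) (⟨p, X p⟩ : TangentBundle (𝓡 4) M)) (f w) := by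
    refine ContMDiffAt.comp (f w) (h1.contMDiffAt ?_) hX.smooth.contMDiffAt
    exact (FiberBundle.continuous_proj E4 (TangentSpace (𝓡 4))).continuousAt.preimage_mem_nhds
      (hf.isOpen_image.mem_nhds ⟨w, hw, rfl⟩)
  have h3 : ContMDiffAt (𝓡 4) (𝓡 4).tangent ∞
      (fun y => (⟨e (f y), V (f y)⟩ : TangentBundle (𝓡 4) E4)) w := by
    refine (ContMDiffAt.comp w h2 (hf.smooth w hw)).congr_of_eventuallyEq ?_
    filter_upwards [Metric.isOpen_ball.mem_nhds hw] with y hy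
    simp only [Function.comp_def, tangentMapWithin]
    rw [mfderivWithin_of_mem_nhds (hf.isOpen_image.mem_nhds ⟨y, hy, rfl⟩)]
  have h4 : ContDiffAt ℝ ∞ (fun y => V (f y)) w := by
    rw [Bundle.contMDiffAt_totalSpace] at h3
    have := h3.2.contDiffAt
    simpa using this
  have h5 : ContDiffAt ℝ ∞ (fun y => V (f y) 0) w := (contDiffAt_euclidean.1 h4) 0
  obtain ⟨k0, k1, -⟩ := h.axis_ker hf hw (hf.axis_mem hs)
  obtain ⟨c, hc⟩ := ((h.germ (hf.axis_mem hs) k0 k1).kernel _).1 (hX.tangent _ (hf.axis_mem hs))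
  have h6 : V (f w) = c • stdVec 0 := by
    have hcomp := mfderiv_comp w ((hf.smooth_inv w hw).mdifferentiableAt (by simp))
      ((hf.smooth w hw).mdifferentiableAt (by simp))
    have hid : e ∘ f =ᶠ[𝓝 w] id := by
      filter_upwards [Metric.isOpen_ball.mem_nhds hw] with y hy using hf.left_inv y hy
    rw [hid.mfderiv_eq, mfderiv_id] at hcomp
    have h7 : (mfderiv (𝓡 4) (𝓡 4) e (f w) (tder f w (stdVec 0)) : E4) = stdVec 0 :=
      (DFunLike.congr_fun hcomp (stdVec 0 : E4)).symm
    let B : E4 →L[ℝ] E4 := mfderiv (𝓡 4) (𝓡 4) e (f w)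
    change B (vecAt X (f w)) = _
    rw [hc, map_smul]
    exact congrArg (c • ·) h7
  have h8 : V (f w) 0 = c := by rw [h6]; simp [stdVec]
  refine ⟨ContDiffAt.comp (g := fun y => V (f y) 0) (f := axisPt) s h5 contDiff_axisPt.contDiffAt, ?_, ?_⟩
  · change V (f w) 0 ≠ 0
    rw [h8]
    rintro rfl
    rw [zero_smul] at hc
    exact hX.ne_zero _ (hf.axis_mem hs) hc
  · change _ = V (f w) 0 • _
    rw [h8, hc]

end IsStraightChart

end AxisField

/-! ### Components of the zero locus as periodic integral curves -/

section Circles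

/-- Bootstrapping: if `α` is of class `Cⁿ`, so is its derivative `l ∘ α`. -/
theorem contDiffOn_of_autonomous {l α : ℝ → ℝ} {s : Set ℝ} (hs : IsOpen s)
    (hα : ∀ t ∈ s, HasDerivAt α (l (α t)) t) (hl : ∀ t ∈ s, ContDiffAt ℝ ∞ l (α t)) :
    ContDiffOn ℝ ∞ α s := by
  rw [contDiffOn_infty]
  intro n
  induction n with
  | zero => exact contDiffOn_zero.2 fun t ht => (hα t ht).continuousAt.continuousWithinAt
  | succ n ih =>
    rw [Nat.cast_succ, contDiffOn_succ_iff_deriv_of_isOpen hs]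
    refine ⟨fun t ht => (hα t ht).differentiableAt.differentiableWithinAt, by simp, ?_⟩
    have h1 : ContDiffOn ℝ n (fun t => l (α t)) s := fun t ht =>
      ((hl t ht).of_le (by exact_mod_cast le_top)).comp_contDiffWithinAt t (ih t ht)
    exact h1.congr fun t ht => (hα t ht).deriv

variable {M : Type*} [TopologicalSpace M] [ChartedSpace E4 M] [IsManifold (𝓡 4) ∞ M]
  {σ : DiffForm M 2} {X : ∀ x : M, TangentSpace (𝓡 4) x}

/-- On the axis of a straight chart the flow equation is the scalar equation `α' = l(α)`. Solving it
there keeps the curve inside the zero locus, and `l ≠ 0` makes `α` a local diffeomorphism of the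
line, which gives injectivity and the neighbourhood property. -/
theorem IsAxisField.exists_local_curve (hX : IsAxisField σ X) (h : IsNearSymplectic σ) {z : M}
    (hz : z ∈ zeroLocus σ) : ∃ ε > 0, ∃ γ : ℝ → M, γ 0 = z ∧
      (∀ t, |t| < ε → HasMFDerivAt 𝓘(ℝ) (𝓡 4) γ t ((1 : ℝ →L[ℝ] ℝ).smulRight (X (γ t))) ∧
        ContMDiffAt 𝓘(ℝ) (𝓡 4) ∞ γ t ∧ γ t ∈ zeroLocus σ) ∧
      InjOn γ (Ioo (-ε) ε) ∧ ∀ δ > 0, γ '' Ioo (-δ) δ ∈ 𝓝[zeroLocus σ] z := by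
  obtain ⟨r, f, e, hf⟩ := h.exists_straightChart hz
  obtain ⟨l, hl⟩ := hf.exists_axis_speed h hX
  have hl0 := hl 0 (by simpa using hf.pos)
  obtain ⟨α, hα0, ε₁, hε₁, hα⟩ :=
    (hl0.1.of_le (m := 1) (by simp)).exists_forall_mem_closedBall_exists_eq_forall_mem_Ioo_hasDerivAt₀ 0
  simp only [zero_sub, zero_add] at hα
  have hαc : ContinuousAt α 0 := (hα 0 ⟨by linarith, hε₁⟩).continuousAt
  have hr0 : ∀ᶠ t in 𝓝 (0 : ℝ), |α t| < r := by
    have : ContinuousAt (fun t => |α t|) 0 := hαc.abs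
    refine this.eventually (gt_mem_nhds ?_)
    simpa [hα0] using hf.pos
  obtain ⟨ε₂, hε₂, hr⟩ := Metric.eventually_nhds_iff_ball.1 hr0
  set ε₃ := min ε₁ ε₂ with hε₃
  have hε₃0 : 0 < ε₃ := lt_min hε₁ hε₂
  have hd : ∀ t ∈ Ioo (-ε₃) ε₃, HasDerivAt α (l (α t)) t := fun t ht =>
    hα t ⟨by linarith [ht.1, min_le_left ε₁ ε₂], ht.2.trans_le (min_le_left _ _)⟩
  have hlt : ∀ t ∈ Ioo (-ε₃) ε₃, |α t| < r := fun t ht => hr t (by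
    rw [Metric.mem_ball, Real.dist_eq, sub_zero, abs_lt]
    exact ⟨by linarith [ht.1, min_le_right ε₁ ε₂], ht.2.trans_le (min_le_right _ _)⟩)
  have hsm := contDiffOn_of_autonomous isOpen_Ioo hd fun t ht => (hl _ (hlt t ht)).1
  have h0mem : (0 : ℝ) ∈ Ioo (-ε₃) ε₃ := ⟨by linarith, hε₃0⟩
  have hstrict : HasStrictDerivAt α (l 0) 0 := by
    have h1 := (hsm.contDiffAt (isOpen_Ioo.mem_nhds h0mem)).hasStrictDerivAt (by simp)
    rwa [(hd 0 h0mem).deriv, hα0] at h1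
  have hinj : ∀ᶠ t in 𝓝 (0 : ℝ), hstrict.localInverse α (l 0) 0 hl0.2.1 (α t) = t :=
    HasStrictFDerivAt.eventually_left_inverse
      (f' := ContinuousLinearEquiv.unitsEquivAut ℝ (Units.mk0 _ hl0.2.1)) hstrict
  obtain ⟨ε₄, hε₄, hinj⟩ := Metric.eventually_nhds_iff_ball.1 hinj
  set ε := min ε₃ ε₄ with hε
  have hsub : ∀ t, |t| < ε → t ∈ Ioo (-ε₃) ε₃ := fun t ht =>
    abs_lt.1 (ht.trans_le (min_le_left _ _))
  refine ⟨ε, lt_min hε₃0 hε₄, fun t => f (axisPt (α t)), ?_, ?_, ?_, ?_⟩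
  · simp [hα0, axisPt, hf.zero]
  · intro t ht
    have ht' := hsub t ht
    have hw := axisPt_mem_ball.2 (hlt t ht')
    have hcd : ContDiffAt ℝ ∞ (fun t => axisPt (α t)) t :=
      contDiff_axisPt.contDiffAt.comp t (hsm.contDiffAt (isOpen_Ioo.mem_nhds ht'))
    refine ⟨?_, ContMDiffAt.comp t (hf.smooth _ hw) hcd.contMDiffAt, hf.axis_mem (hlt t ht')⟩
    have h1 : HasDerivAt (fun t => axisPt (α t)) (l (α t) • stdVec 0) t :=
      HasDerivAt.scomp t (hasDerivAt_axisPt (α t)) (hd t ht')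
    have h2 := HasMFDerivAt.comp t ((hf.smooth _ hw).mdifferentiableAt (by simp)).hasMFDerivAt
      h1.hasFDerivAt.hasMFDerivAt
    refine h2.congr_mfderiv ?_
    have h3 : (tder f (axisPt (α t))).comp
        ((1 : ℝ →L[ℝ] ℝ).smulRight (l (α t) • stdVec 0)) =
        (1 : ℝ →L[ℝ] ℝ).smulRight (vecAt X (f (axisPt (α t)))) := by
      rw [(hl _ (hlt t ht')).2.2]
      ext1
      simp
    exact h3
  · intro t ht t' ht' heq
    have h1 := hsub t (abs_lt.2 ht)
    have h2 := hsub t' (abs_lt.2 ht')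
    have h3 : axisPt (α t) = axisPt (α t') := by
      rw [← hf.left_inv _ (axisPt_mem_ball.2 (hlt t h1)),
        ← hf.left_inv _ (axisPt_mem_ball.2 (hlt t' h2))]
      exact congrArg e heq
    have h4 : α t = α t' := smul_left_injective ℝ (stdVec_ne_zero 0) h3
    have hb : ∀ s : ℝ, s ∈ Ioo (-ε) ε → s ∈ Metric.ball (0 : ℝ) ε₄ := fun s hs => by
      rw [Metric.mem_ball, Real.dist_eq, sub_zero]
      exact (abs_lt.2 hs).trans_le (min_le_right _ _)
    rw [← hinj t (hb t ht), ← hinj t' (hb t' ht'), h4]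
  · intro δ hδ
    have h1 : α '' Ioo (-δ) δ ∈ 𝓝 (0 : ℝ) := by
      have := hstrict.map_nhds_eq hl0.2.1
      rw [hα0] at this
      rw [← this]
      exact Filter.image_mem_map (Ioo_mem_nhds (by linarith) hδ)
    obtain ⟨ρ, hρ, hball⟩ := Metric.mem_nhds_iff.1 h1
    have h2 := hf.image_mem_nhds 0 (Metric.mem_ball_self hf.pos) _
      (Metric.ball_mem_nhds (0 : E4) (lt_min hρ hf.pos))
    rw [hf.zero] at h2
    filter_upwards [mem_nhdsWithin_of_mem_nhds h2, self_mem_nhdsWithin] with p hp hpz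
    obtain ⟨w, hw, rfl⟩ := hp
    obtain ⟨w1, w2, w3⟩ := (hf.zero_iff w
      (Metric.ball_subset_ball (min_le_right _ _) hw)).1 hpz
    have hwa : w = axisPt (w 0) := by
      ext i
      fin_cases i <;> simp [axisPt, stdVec, w1, w2, w3]
    have hw0 : |w 0| < ρ := by
      have h3 := Metric.ball_subset_ball (min_le_left _ _) hw
      rw [hwa] at h3
      exact axisPt_mem_ball.1 h3
    obtain ⟨t, ht, hte⟩ := hball (show w 0 ∈ Metric.ball (0 : ℝ) ρ by simpa using hw0)
    exact ⟨t, ht, by simp only [hte, ← hwa]⟩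

theorem IsAxisField.contMDiff_one (hX : IsAxisField σ X) :
    ContMDiff (𝓡 4) (𝓡 4).tangent 1 (fun x => (⟨x, X x⟩ : TangentBundle (𝓡 4) M)) :=
  hX.smooth.of_le (by simp)

/-- There is an integral curve of `X` in the zero locus through `x` on `(-a, a)`. -/
def HasCurve (σ : DiffForm M 2) (X : ∀ x : M, TangentSpace (𝓡 4) x) (a : ℝ) (x : M) : Prop :=
  ∃ γ : ℝ → M, γ 0 = x ∧ IsMIntegralCurveOn γ X (Ioo (-a) a) ∧ ∀ t ∈ Ioo (-a) a, γ t ∈ zeroLocus σ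

omit [IsManifold (𝓡 4) ∞ M] in
theorem HasCurve.mono {a b : ℝ} {x : M} (h : HasCurve σ X b x) (hab : a ≤ b) : HasCurve σ X a x := by
  obtain ⟨γ, h0, h1, h2⟩ := h
  have hs : Ioo (-a) a ⊆ Ioo (-b) b := Ioo_subset_Ioo (neg_le_neg hab) hab
  exact ⟨γ, h0, h1.mono hs, fun t ht => h2 t (hs ht)⟩

/-- A curve through `z` of lifetime `ε` serves, after a shift of time, all its points up to time `ε
/ 2`. These fill a neighbourhood of `z` in the zero locus, which is compact. -/
theorem IsAxisField.exists_uniform_time [CompactSpace M] (hX : IsAxisField σ X)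
    (h : IsNearSymplectic σ) : ∃ ε > 0, ∀ x ∈ zeroLocus σ, HasCurve σ X ε x := by
  refine (isClosed_zeroLocus h.smooth).isCompact.induction_on
    (p := fun s => ∃ ε > 0, ∀ x ∈ s, HasCurve σ X ε x) ⟨1, one_pos, by simp⟩ ?_ ?_ ?_
  · rintro s t hst ⟨ε, hε, ht⟩
    exact ⟨ε, hε, fun x hx => ht x (hst hx)⟩
  · rintro s t ⟨ε, hε, hs⟩ ⟨ε', hε', ht⟩
    refine ⟨min ε ε', lt_min hε hε', fun x hx => ?_⟩
    rcases hx with hx | hx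
    · exact (hs x hx).mono (min_le_left _ _)
    · exact (ht x hx).mono (min_le_right _ _)
  · intro z hz
    obtain ⟨ε, hε, γ, -, hγ, -, hn⟩ := hX.exists_local_curve h hz
    refine ⟨_, hn (ε / 2) (by linarith), ε / 2, by linarith, ?_⟩
    rintro _ ⟨t, ht, rfl⟩
    have hon : IsMIntegralCurveOn γ X (Ioo (-ε) ε) := fun t ht =>
      (hγ t (abs_lt.2 ht)).1.hasMFDerivWithinAt
    refine ⟨γ ∘ (· + t), by simp, (hon.comp_add t).mono ?_, ?_⟩
    · intro s hs
      exact ⟨by linarith [hs.1, ht.1], by linarith [hs.2, ht.2]⟩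
    · intro s hs
      exact (hγ (s + t) (abs_lt.2 ⟨by linarith [hs.1, ht.1], by linarith [hs.2, ht.2]⟩)).2.2

/-- The curves starting at the points of times `± a / 2` are glued on; each lives for time `a`, so
the lifetime grows to `a + a / 2`. -/
theorem IsAxisField.hasCurve_extend [T2Space M] (hX : IsAxisField σ X) {a : ℝ} (ha : 0 < a)
    (hc : ∀ x ∈ zeroLocus σ, HasCurve σ X a x) {x : M} (hx : x ∈ zeroLocus σ) :
    HasCurve σ X (3 / 2 * a) x := by
  have hv := hX.contMDiff_one
  obtain ⟨γ, h0, h1, h2⟩ := hc x hx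
  obtain ⟨γ₁, a0, a1, a2⟩ := hc (γ (a / 2)) (h2 _ ⟨by linarith, by linarith⟩)
  obtain ⟨γ₂, b0, b1, b2⟩ := hc (γ (-(a / 2))) (h2 _ ⟨by linarith, by linarith⟩)
  have a1' : IsMIntegralCurveOn (γ₁ ∘ (· + -(a / 2))) X (Ioo (-(a / 2)) (3 / 2 * a)) :=
    (a1.comp_add (-(a / 2))).mono fun t ht => ⟨by linarith [ht.1], by linarith [ht.2]⟩
  have b1' : IsMIntegralCurveOn (γ₂ ∘ (· + a / 2)) X (Ioo (-(3 / 2 * a)) (a / 2)) :=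
    (b1.comp_add (a / 2)).mono fun t ht => ⟨by linarith [ht.1], by linarith [ht.2]⟩
  have c1 := isMIntegralCurveOn_piecewise hv h1 a1' (t₀ := a / 2)
    ⟨⟨by linarith, by linarith⟩, by linarith, by linarith⟩ (by simp [a0])
  have c1' := c1.mono (s' := Ioo (-a) (3 / 2 * a)) fun t ht => by
    by_cases hta : t < a
    · exact Or.inl ⟨ht.1, hta⟩
    · exact Or.inr ⟨by linarith, ht.2⟩
  have c2 := isMIntegralCurveOn_piecewise hv c1' b1' (t₀ := -(a / 2))
    ⟨⟨by linarith, by linarith⟩, by linarith, by linarith⟩ (by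
      rw [piecewise_eq_of_mem _ _ _ (show -(a / 2) ∈ Ioo (-a) a from ⟨by linarith, by linarith⟩)]
      simp [b0])
  refine ⟨_, ?_, c2.mono ?_, ?_⟩
  · rw [piecewise_eq_of_mem _ _ _ (show (0 : ℝ) ∈ Ioo (-a) (3 / 2 * a) from ⟨by linarith, by linarith⟩),
      piecewise_eq_of_mem _ _ _ (show (0 : ℝ) ∈ Ioo (-a) a from ⟨by linarith, by linarith⟩), h0]
  · intro t ht
    by_cases hta : -a < t
    · exact Or.inl ⟨hta, ht.2⟩
    · exact Or.inr ⟨ht.1, by linarith⟩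
  · intro t ht
    by_cases h3 : t ∈ Ioo (-a) (3 / 2 * a)
    · rw [piecewise_eq_of_mem _ _ _ h3]
      by_cases h4 : t ∈ Ioo (-a) a
      · rw [piecewise_eq_of_mem _ _ _ h4]
        exact h2 t h4
      · rw [piecewise_eq_of_notMem _ _ _ h4]
        have : a ≤ t := by
          by_contra hlt
          exact h4 ⟨h3.1, not_le.1 hlt⟩
        exact a2 _ ⟨by linarith, by linarith [h3.2]⟩
    · rw [piecewise_eq_of_notMem _ _ _ h3]
      have : t ≤ -a := by
        by_contra hlt
        exact h3 ⟨not_le.1 hlt, ht.2⟩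
      exact b2 _ ⟨by linarith [ht.1], by linarith⟩

theorem IsAxisField.exists_global_curve [T2Space M] [CompactSpace M] (hX : IsAxisField σ X)
    (h : IsNearSymplectic σ) {x : M} (hx : x ∈ zeroLocus σ) :
    ∃ γ : ℝ → M, γ 0 = x ∧ IsMIntegralCurve γ X ∧ ∀ t, γ t ∈ zeroLocus σ := by
  obtain ⟨ε, hε, hc⟩ := hX.exists_uniform_time h
  -- The extension factor does not depend on the point, so iterating it gives arbitrarily long
  -- lifetimes.
  have hpow : ∀ n : ℕ, ∀ x ∈ zeroLocus σ, HasCurve σ X ((3 / 2) ^ n * ε) x := by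
    intro n
    induction n with
    | zero => simpa using hc
    | succ n ih =>
      intro x hx
      have := hX.hasCurve_extend (by positivity) ih hx
      rwa [← mul_assoc, ← pow_succ'] at this
  have hall : ∀ a, HasCurve σ X a x := by
    intro a
    obtain ⟨n, hn⟩ := pow_unbounded_of_one_lt (a / ε) (show (1 : ℝ) < 3 / 2 by norm_num)
    exact (hpow n x hx).mono ((div_lt_iff₀ hε).1 hn).le
  choose γ h0 h1 h2 using hall
  refine ⟨fun t => γ (|t| + 1) t, by simp [h0],
    isMIntegralCurve_abs_add_one_of_isMIntegralCurveOn_Ioo hX.contMDiff_one γ h0 fun a _ => h1 a,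
    fun t => h2 _ t (abs_lt.1 (lt_add_one _))⟩

variable [T2Space M]

/-- Uniqueness of integral curves identifies `γ` near `t₀` with the curve of `exists_local_curve`.
-/
theorem IsAxisField.curve_local (hX : IsAxisField σ X) (h : IsNearSymplectic σ) {γ : ℝ → M}
    (hγ : IsMIntegralCurve γ X) (hz : ∀ t, γ t ∈ zeroLocus σ) (t₀ : ℝ) :
    ContMDiffAt 𝓘(ℝ) (𝓡 4) ∞ γ t₀ ∧
      (∀ δ > 0, γ '' Ioo (t₀ - δ) (t₀ + δ) ∈ 𝓝[zeroLocus σ] (γ t₀)) ∧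
      ∃ ε > 0, InjOn γ (Ioo (t₀ - ε) (t₀ + ε)) := by
  obtain ⟨ε, hε, γ₁, h0, h1, hinj, hn⟩ := hX.exists_local_curve h (hz t₀)
  have heq : EqOn (γ ∘ (· + t₀)) γ₁ (Ioo (-ε) ε) :=
    isMIntegralCurveOn_Ioo_eqOn_of_contMDiff_boundaryless (t₀ := 0) ⟨by linarith, hε⟩ hX.contMDiff_one
      ((hγ.comp_add t₀).isMIntegralCurveOn _)
      (fun t ht => (h1 t (abs_lt.2 ht)).1.hasMFDerivWithinAt) (by simp [h0])
  have heq' : ∀ t ∈ Ioo (t₀ - ε) (t₀ + ε), γ t = γ₁ (t - t₀) := fun t ht => by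
    rw [← heq (x := t - t₀) ⟨by linarith [ht.1], by linarith [ht.2]⟩]
    simp
  refine ⟨?_, fun δ hδ => ?_, ε, hε, ?_⟩
  · have hev : γ =ᶠ[𝓝 t₀] γ₁ ∘ (· - t₀) := by
      filter_upwards [Ioo_mem_nhds (show t₀ - ε < t₀ by linarith) (show t₀ < t₀ + ε by linarith)]
        with t ht using heq' t ht
    refine ContMDiffAt.congr_of_eventuallyEq ?_ hev
    have h2 : ContMDiffAt 𝓘(ℝ) 𝓘(ℝ) ∞ (fun t : ℝ => t - t₀) t₀ :=
      (contDiff_id.sub contDiff_const).contDiffAt.contMDiffAt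
    have h3 : ContMDiffAt 𝓘(ℝ) (𝓡 4) ∞ γ₁ ((fun t : ℝ => t - t₀) t₀) := by
      simpa using (h1 0 (by simpa using hε)).2.1
    exact ContMDiffAt.comp t₀ h3 h2
  · refine Filter.mem_of_superset (hn (min δ ε) (lt_min hδ hε)) ?_
    rintro _ ⟨t, ht, rfl⟩
    have htε : t ∈ Ioo (-ε) ε :=
      ⟨by linarith [ht.1, min_le_right δ ε], ht.2.trans_le (min_le_right _ _)⟩
    exact ⟨t + t₀, ⟨by linarith [ht.1, min_le_left δ ε], by linarith [ht.2, min_le_left δ ε]⟩,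
      heq htε⟩
  · intro t ht t' ht' e
    rw [heq' t ht, heq' t' ht'] at e
    have := hinj (x₁ := t - t₀) ⟨by linarith [ht.1], by linarith [ht.2]⟩
      (x₂ := t' - t₀) ⟨by linarith [ht'.1], by linarith [ht'.2]⟩ e
    linarith

/-- The range is open in the zero locus by `curve_local`. It is closed because the integral curve
through a limit point covers a neighbourhood there, meets the range, and hence is a time shift of
`γ`. A nonempty connected set that is open and closed is a component. -/
theorem IsAxisField.range_eq_component [CompactSpace M] (hX : IsAxisField σ X)
    (h : IsNearSymplectic σ) {γ : ℝ → M} (hγ : IsMIntegralCurve γ X) (hz : ∀ t, γ t ∈ zeroLocus σ) :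
    IsClosed (range γ) ∧ range γ = connectedComponentIn (zeroLocus σ) (γ 0) := by
  have hcl : IsClosed (range γ) := by
    refine isClosed_of_closure_subset fun x hx => ?_
    have hxz : x ∈ zeroLocus σ := (isClosed_zeroLocus h.smooth).closure_subset_iff.2
      (range_subset_iff.2 hz) hx
    obtain ⟨β, hβ0, hβ, hβz⟩ := hX.exists_global_curve h hxz
    have hn := (hX.curve_local h hβ hβz 0).2.1 1 one_pos
    rw [hβ0] at hn
    have hx' : x ∈ closure (range γ ∩ zeroLocus σ) := by
      rwa [inter_eq_left.2 (range_subset_iff.2 hz)]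
    obtain ⟨u, hu, huz⟩ := mem_nhdsWithin_iff_exists_mem_nhds_inter.1 hn
    obtain ⟨y, hyu, ⟨t, rfl⟩, hyz⟩ := mem_closure_iff_nhds.1 hx' u hu
    obtain ⟨s, -, hs⟩ := huz ⟨hyu, hyz⟩
    have heq := isMIntegralCurve_Ioo_eq_of_contMDiff_boundaryless (t₀ := 0) hX.contMDiff_one
      (hγ.comp_add t) (hβ.comp_add s) (by simp [hs])
    have := congrFun heq (-s)
    simp only [Function.comp_apply, neg_add_cancel, hβ0] at this
    exact ⟨_, this⟩
  refine ⟨hcl, Subset.antisymm ?_ fun x hx => ?_⟩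
  · exact (isPreconnected_range hγ.continuous).subset_connectedComponentIn ⟨0, rfl⟩
      (range_subset_iff.2 hz)
  · have hopen : ∀ t, ∃ u, IsOpen u ∧ γ t ∈ u ∧ u ∩ zeroLocus σ ⊆ range γ := by
      intro t
      obtain ⟨u, hu, hut, huz⟩ := mem_nhdsWithin.1 ((hX.curve_local h hγ hz t).2.1 1 one_pos)
      exact ⟨u, hu, hut, huz.trans (image_subset_range _ _)⟩
    choose u huo hut huz using hopen
    by_contra hxr
    obtain ⟨y, hy, hyu, hyr⟩ := (isPreconnected_connectedComponentIn (F := zeroLocus σ) (x := γ 0))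
      (⋃ t, u t) (range γ)ᶜ (isOpen_iUnion huo) hcl.isOpen_compl (fun y _ => by
        by_cases hyr : y ∈ range γ
        · obtain ⟨t, rfl⟩ := hyr
          exact Or.inl (mem_iUnion.2 ⟨t, hut t⟩)
        · exact Or.inr hyr)
      ⟨γ 0, mem_connectedComponentIn (hz 0), mem_iUnion.2 ⟨0, hut 0⟩⟩ ⟨x, hx, hxr⟩
    obtain ⟨t, ht⟩ := mem_iUnion.1 hyu
    exact hyr (huz t ⟨ht, connectedComponentIn_subset _ _ hy⟩)

/-- Positive period of an integral curve in the zero locus. -/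
theorem IsAxisField.exists_period [CompactSpace M] (hX : IsAxisField σ X)
    (h : IsNearSymplectic σ) {γ : ℝ → M} (hγ : IsMIntegralCurve γ X) (hz : ∀ t, γ t ∈ zeroLocus σ) :
    ∃ T > 0, ∀ s t, γ s = γ t ↔ ∃ n : ℤ, t = s + n * T := by
  -- The compact range is covered by finitely many arcs with bounded parameters; for an injective
  -- `γ` this would bound all parameters.
  have hni : ¬ Function.Injective γ := by
    intro hinj
    have hcpt : IsCompact (range γ) := (hX.range_eq_component h hγ hz).1.isCompact
    obtain ⟨N, hN⟩ : ∃ N : ℝ, ∀ y ∈ range γ, ∃ t, |t| ≤ N ∧ γ t = y := by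
      refine hcpt.induction_on (p := fun s => ∃ N : ℝ, ∀ y ∈ s, ∃ t, |t| ≤ N ∧ γ t = y)
        ⟨0, by simp⟩ ?_ ?_ ?_
      · rintro s t hst ⟨N, hN⟩
        exact ⟨N, fun y hy => hN y (hst hy)⟩
      · rintro s t ⟨N, hN⟩ ⟨N', hN'⟩
        refine ⟨max N N', fun y hy => ?_⟩
        rcases hy with hy | hy
        · obtain ⟨a, ha, rfl⟩ := hN y hy
          exact ⟨a, ha.trans (le_max_left _ _), rfl⟩
        · obtain ⟨a, ha, rfl⟩ := hN' y hy
          exact ⟨a, ha.trans (le_max_right _ _), rfl⟩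
      · rintro _ ⟨t, rfl⟩
        refine ⟨_, nhdsWithin_mono _ (range_subset_iff.2 hz)
          ((hX.curve_local h hγ hz t).2.1 1 one_pos), |t| + 1, ?_⟩
        rintro _ ⟨s, hs, rfl⟩
        refine ⟨s, ?_, rfl⟩
        have : |s - t| ≤ 1 := abs_le.2 ⟨by linarith [hs.1], by linarith [hs.2]⟩
        linarith [abs_sub_abs_le_abs_sub s t]
    obtain ⟨t, ht, he⟩ := hN (γ (|N| + 1)) ⟨_, rfl⟩
    rw [hinj he, abs_of_pos (by positivity)] at ht
    linarith [le_abs_self N]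
  let P : AddSubgroup ℝ :=
    { carrier := {T | Function.Periodic γ T}
      add_mem' := fun ha hb => ha.add_period hb
      zero_mem' := fun t => by simp
      neg_mem' := fun ha => ha.neg }
  have hP : ∀ s t, γ s = γ t ↔ t - s ∈ P := by
    intro s t
    constructor
    · intro e
      exact hγ.periodic_of_eq hX.contMDiff_one e.symm
    · intro hp
      have := (show Function.Periodic γ (t - s) from hp) s
      rw [add_sub_cancel] at this
      exact this.symm
  obtain ⟨ε, hε, hinj⟩ := (hX.curve_local h hγ hz 0).2.2
  -- Local injectivity isolates zero in the group of periods, so the group is cyclic. The generator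
  -- `b` may be negative.
  obtain ⟨b, hb⟩ := AddSubgroup.cyclic_of_isolated_zero (H := P) hε (by
    rw [Set.disjoint_left]
    intro T hT hTε
    have e : γ 0 = γ T := (hP 0 T).2 (by simpa using hT)
    have := hinj ⟨by linarith, by linarith⟩ ⟨by linarith [hTε.1], by linarith [hTε.2]⟩ e
    exact hTε.1.ne this)
  have hmem : ∀ s t, γ s = γ t ↔ ∃ n : ℤ, t = s + n * b := by
    intro s t
    rw [hP, hb, AddSubgroup.mem_closure_singleton]
    refine exists_congr fun n => ?_
    rw [zsmul_eq_mul]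
    constructor <;> intro e <;> linarith
  have hb0 : b ≠ 0 := by
    rintro rfl
    refine hni fun s t e => ?_
    obtain ⟨n, hn⟩ := (hmem s t).1 e
    simpa using hn.symm
  refine ⟨|b|, abs_pos.2 hb0, fun s t => ?_⟩
  rw [hmem]
  rcases abs_choice b with hb' | hb'
  · rw [hb']
  · rw [hb']
    constructor
    · rintro ⟨n, rfl⟩
      exact ⟨-n, by push_cast; ring⟩
    · rintro ⟨n, rfl⟩
      exact ⟨-n, by push_cast; ring⟩

omit [IsManifold (𝓡 4) ∞ M] [T2Space M] in
/-- The velocity of a curve, on the model space. -/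
def velocity (γ : ℝ → M) (t : ℝ) : E4 := mfderiv 𝓘(ℝ) (𝓡 4) γ t (1 : ℝ)

/-- `γ` is a `2π`-periodic parametrization of the circle `C` of zeros of `σ`. -/
structure IsLoop (σ : DiffForm M 2) (γ : ℝ → M) (C : Set M) : Prop where
  smooth : ContMDiff 𝓘(ℝ) (𝓡 4) ∞ γ
  eq_iff : ∀ s t, γ s = γ t ↔ ∃ n : ℤ, t = s + 2 * Real.pi * n
  range_eq : range γ = C
  zero : ∀ t, γ t ∈ zeroLocus σ
  nhds : ∀ t, C ∈ 𝓝[zeroLocus σ] (γ t)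
  velocity_ne_zero : ∀ t, velocity γ t ≠ 0
  tangent : ∀ t, derivAt σ (γ t) (velocity γ t) = 0
  posDir : ∀ t, PosDir (derivAt σ (γ t)) (velocity γ t)

/-- Time is rescaled so that the period becomes `2π`; the factor is positive and therefore respects
`PosDir`. -/
theorem IsNearSymplectic.exists_loop [CompactSpace M] (h : IsNearSymplectic σ) {z : M}
    (hz : z ∈ zeroLocus σ) : ∃ γ, IsLoop σ γ (connectedComponentIn (zeroLocus σ) z) := by
  obtain ⟨X, hX⟩ := h.exists_axisField
  obtain ⟨γ, h0, hγ, hγz⟩ := hX.exists_global_curve h hz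
  obtain ⟨T, hT, hper⟩ := hX.exists_period h hγ hγz
  set a := T / (2 * Real.pi) with ha
  have ha0 : 0 < a := by positivity
  have hTa : T = 2 * Real.pi * a := by rw [ha]; field_simp
  have hrange : range (γ ∘ (· * a)) = range γ := by
    rw [Function.Surjective.range_comp]
    exact mul_right_surjective₀ ha0.ne'
  have hvel : ∀ t, velocity (γ ∘ (· * a)) t = a • vecAt X (γ (t * a)) := by
    intro t
    have h1 := (hγ.comp_mul a t).mfderiv
    have h2 : (mfderiv 𝓘(ℝ) (𝓡 4) (γ ∘ (· * a)) t : ℝ →L[ℝ] E4) =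
      (1 : ℝ →L[ℝ] ℝ).smulRight (a • vecAt X (γ (t * a))) := h1
    have h3 : velocity (γ ∘ (· * a)) t =
      ((1 : ℝ →L[ℝ] ℝ).smulRight (a • vecAt X (γ (t * a)))) 1 := DFunLike.congr_fun h2 (1 : ℝ)
    rw [h3, ContinuousLinearMap.smulRight_apply, one_apply_eq_self, one_smul]
  have hloc := hX.curve_local h hγ hγz
  refine ⟨γ ∘ (· * a), ⟨fun t => ?_, fun s t => ?_, ?_, fun t => hγz _, fun t => ?_, fun t => ?_,
    fun t => ?_, fun t => ?_⟩⟩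
  · have h2 : ContMDiffAt 𝓘(ℝ) 𝓘(ℝ) ∞ (fun t : ℝ => t * a) t :=
      (contDiff_id.mul contDiff_const).contDiffAt.contMDiffAt
    exact ContMDiffAt.comp t (hloc _).1 h2
  · rw [Function.comp_apply, Function.comp_apply, hper]
    refine exists_congr fun n => ?_
    rw [hTa]
    constructor
    · intro e
      have : (t - (s + 2 * Real.pi * n)) * a = 0 := by linarith
      linarith [(mul_eq_zero.1 this).resolve_right ha0.ne']
    · rintro rfl
      ring
  · rw [hrange, (hX.range_eq_component h hγ hγz).2, h0]
  · rw [← h0, ← (hX.range_eq_component h hγ hγz).2]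
    exact Filter.mem_of_superset ((hloc (t * a)).2.1 1 one_pos) (image_subset_range _ _)
  · rw [hvel]
    exact smul_ne_zero ha0.ne' (hX.ne_zero _ (hγz _))
  · rw [hvel, map_smul]
    exact (congrArg (a • ·) (hX.tangent _ (hγz _))).trans (smul_zero a)
  · rw [hvel]
    exact (hX.posDir _ (hγz _)).smul ha0

end Circles

/-! ### The Moore–Penrose inverse and its smooth dependence -/

section PseudoInverse

variable {V : Type*} [NormedAddCommGroup V] [InnerProductSpace ℝ V] [FiniteDimensional ℝ V]

/-- The Moore–Penrose inverse of an injective linear map. -/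
def pinv (A : E4 →L[ℝ] V) : V →L[ℝ] E4 :=
  (ContinuousLinearMap.inverse (A.adjoint.comp A)).comp A.adjoint

theorem exists_gramIso {A : E4 →L[ℝ] V} (hA : Function.Injective A) :
    ∃ G : E4 ≃L[ℝ] E4, (G : E4 →L[ℝ] E4) = A.adjoint.comp A := by
  have hinj : Function.Injective (A.adjoint.comp A : E4 →L[ℝ] E4) := by
    rw [injective_iff_map_eq_zero]
    intro x hx
    have h1 : inner ℝ (A.adjoint (A x)) x = inner ℝ (A x) (A x) := A.adjoint_inner_left x (A x)
    rw [show A.adjoint (A x) = 0 from hx, inner_zero_left] at h1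
    exact hA ((inner_self_eq_zero.1 h1.symm).trans (map_zero A).symm)
  refine ⟨(LinearEquiv.ofInjectiveEndo (A.adjoint.comp A : E4 →L[ℝ] E4).toLinearMap
    hinj).toContinuousLinearEquiv, ?_⟩
  ext1 x
  rfl

theorem eq_pinv_iff {A : E4 →L[ℝ] V} (hA : Function.Injective A) {x : E4} {c : V} :
    x = pinv A c ↔ A.adjoint (A x) = A.adjoint c := by
  obtain ⟨G, hG⟩ := exists_gramIso hA
  have h1 : A.adjoint (A x) = G x := (DFunLike.congr_fun hG x).symm
  rw [h1, pinv, ← hG, ContinuousLinearMap.inverse_equiv]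
  exact (ContinuousLinearEquiv.eq_symm_apply G)

theorem pinv_apply_self {A : E4 →L[ℝ] V} (hA : Function.Injective A) (x : E4) : pinv A (A x) = x :=
  ((eq_pinv_iff hA).2 rfl).symm

theorem contDiffAt_pinv {A : E4 →L[ℝ] V} (hA : Function.Injective A) :
    ContDiffAt ℝ ∞ (pinv : (E4 →L[ℝ] V) → V →L[ℝ] E4) A := by
  let adj : (E4 →L[ℝ] V) →ₗ[ℝ] (V →L[ℝ] E4) :=
    { toFun := fun B => B.adjoint
      map_add' := fun B C => map_add _ B C
      map_smul' := fun c B => by simp }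
  have h1 : ContDiff ℝ ∞ (fun B : E4 →L[ℝ] V => B.adjoint) :=
    (LinearMap.toContinuousLinearMap adj).contDiff
  obtain ⟨G, hG⟩ := exists_gramIso hA
  have h2 : ContDiffAt ℝ ∞ (fun B : E4 →L[ℝ] V => ContinuousLinearMap.inverse (B.adjoint.comp B)) A := by
    have h3 := contDiffAt_map_inverse (n := ∞) G
    rw [hG] at h3
    exact ContDiffAt.comp (g := ContinuousLinearMap.inverse)
      (f := fun B : E4 →L[ℝ] V => (B.adjoint.comp B : E4 →L[ℝ] E4)) A h3
      (h1.clm_comp contDiff_id).contDiffAt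
  exact h2.clm_comp h1.contDiffAt

/-- The normal equations see only the image of `A`. So the tangential component of an ambient vector
may be computed in any chart. -/
theorem apply_pinv_comp {A : E4 →L[ℝ] V} (hA : Function.Injective A) {B : E4 →L[ℝ] E4}
    (hB : Function.Injective B) (c : V) : B (pinv (A.comp B) c) = pinv A c := by
  have hs : Function.Surjective B := LinearMap.surjective_of_injective (f := (B : E4 →ₗ[ℝ] E4)) hB
  rw [eq_pinv_iff hA]
  have h1 := (eq_pinv_iff (A := A.comp B) (hA.comp hB) (x := pinv (A.comp B) c) (c := c)).1 rfl
  refine ext_inner_right ℝ fun y => ?_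
  obtain ⟨x, rfl⟩ := hs y
  have h2 := congrArg (fun v => inner ℝ v x) h1
  simp only [ContinuousLinearMap.adjoint_inner_left] at h2 ⊢
  exact h2

end PseudoInverse

/-! ### Smooth fields along a curve, seen through a Euclidean immersion -/

section Along

variable {M : Type*} [TopologicalSpace M] [ChartedSpace E4 M]
  {V : Type*} [NormedAddCommGroup V] [InnerProductSpace ℝ V]

/-- The derivative of a map to a vector space, on the model space. -/
def dAt (e : M → V) (p : M) : E4 →L[ℝ] V := mfderiv (𝓡 4) 𝓘(ℝ, V) e p

/-- A smooth injective immersion. -/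
structure IsInjImmersion (e : M → V) : Prop where
  smooth : ContMDiff (𝓡 4) 𝓘(ℝ, V) ∞ e
  inj : Function.Injective e
  inj_der : ∀ p, Function.Injective (dAt e p)

/-- A field of tangent vectors along `γ` is smooth. -/
def SmoothAlong (e : M → V) (γ : ℝ → M) (u : ℝ → E4) : Prop :=
  ContDiff ℝ ∞ fun t => dAt e (γ t) (u t)

variable {e : M → V} {γ : ℝ → M} {u v w : ℝ → E4}

theorem SmoothAlong.add (hu : SmoothAlong e γ u) (hv : SmoothAlong e γ v) :
    SmoothAlong e γ (fun t => u t + v t) := by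
  have := ContDiff.add hu hv
  simpa only [SmoothAlong, map_add] using this

theorem SmoothAlong.smul {a : ℝ → ℝ} (ha : ContDiff ℝ ∞ a) (hu : SmoothAlong e γ u) :
    SmoothAlong e γ (fun t => a t • u t) := by
  unfold SmoothAlong
  simp only [map_smul]
  exact ContDiff.smul ha hu

theorem SmoothAlong.sub (hu : SmoothAlong e γ u) (hv : SmoothAlong e γ v) :
    SmoothAlong e γ (fun t => u t - v t) := by
  have := ContDiff.sub hu hv
  simpa only [SmoothAlong, map_sub] using this

variable [IsManifold (𝓡 4) ∞ M]

/-- The derivative of `e` in the preferred chart at `x`. -/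
theorem dAt_comp_symm (he : IsInjImmersion e) (x : M) {y : E4} (hy : y ∈ (chart x).target) :
    fderiv ℝ (e ∘ (chart x).symm) y =
      (dAt e ((chart x).symm y)).comp (tder (chart x).symm y) := by
  have := mfderiv_comp y (he.smooth.mdifferentiable (by simp) _) (mdifferentiableAt_symm x hy)
  rw [mfderiv_eq_fderiv] at this
  exact this

theorem contDiffAt_comp_symm (he : IsInjImmersion e) (x : M) {y : E4}
    (hy : y ∈ (chart x).target) :
    ContDiffAt ℝ ∞ (e ∘ (chart x).symm) y :=
  (ContMDiffAt.comp y he.smooth.contMDiffAt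
    ((contMDiffOn_symm x).contMDiffAt ((isOpen_target x).mem_nhds hy))).contDiffAt

/-- Data of a curve in the preferred chart at `γ t₀`, near `t₀`. -/
theorem exists_chart_along (he : IsInjImmersion e) (hγ : ContMDiff 𝓘(ℝ) (𝓡 4) ∞ γ) (t₀ : ℝ) :
    ∃ (y : ℝ → E4) (A : ℝ → E4 →L[ℝ] V), ContDiffAt ℝ ∞ y t₀ ∧ ContDiffAt ℝ ∞ A t₀ ∧
      Function.Injective (A t₀) ∧ ∀ᶠ t in 𝓝 t₀, y t ∈ (chart (γ t₀)).target ∧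
        (chart (γ t₀)).symm (y t) = γ t ∧
        A t = (dAt e (γ t)).comp (tder (chart (γ t₀)).symm (y t)) := by
  set x := γ t₀ with hx
  have hxs := mem_extChartAt_source (I := 𝓡 4) x
  have hsrc : ∀ᶠ t in 𝓝 t₀, γ t ∈ (chart x).source :=
    hγ.continuous.continuousAt.preimage_mem_nhds ((isOpen_extChartAt_source x).mem_nhds hxs)
  have hy : ContDiffAt ℝ ∞ (fun t => chart x (γ t)) t₀ :=
    (ContMDiffAt.comp t₀ (contMDiffAt_chart x hxs) hγ.contMDiffAt).contDiffAt
  have hyt := (chart x).map_source hxs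
  refine ⟨fun t => chart x (γ t),
    fun t => fderiv ℝ (e ∘ (chart x).symm) (chart x (γ t)), hy, ?_, ?_, ?_⟩
  · exact ContDiffAt.comp (g := fderiv ℝ (e ∘ (chart x).symm)) t₀
      ((contDiffAt_comp_symm he x hyt).fderiv_right (by simp)) hy
  · change Function.Injective (fderiv ℝ (e ∘ (chart x).symm) (chart x (γ t₀)))
    rw [dAt_comp_symm he x hyt]
    exact (he.inj_der _).comp (tder_symm_injective x hyt)
  · filter_upwards [hsrc] with t ht
    have h1 := (chart x).map_source ht
    have h2 := (chart x).left_inv ht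
    refine ⟨h1, h2, ?_⟩
    change fderiv ℝ (e ∘ (chart x).symm) _ = _
    rw [dAt_comp_symm he x h1, h2]

variable [FiniteDimensional ℝ V]

/-- The orthogonal projection to the tangent space depends smoothly on the point of a curve. -/
theorem contDiff_proj_along (he : IsInjImmersion e) (hγ : ContMDiff 𝓘(ℝ) (𝓡 4) ∞ γ) :
    ContDiff ℝ ∞ fun t => (dAt e (γ t)).comp (pinv (dAt e (γ t))) := by
  rw [contDiff_iff_contDiffAt]
  intro t₀
  obtain ⟨y, A, hy, hA, hinj, hev⟩ := exists_chart_along he hγ t₀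
  have h1 : ContDiffAt ℝ ∞ (fun t => (A t).comp (pinv (A t))) t₀ :=
    hA.clm_comp (ContDiffAt.comp t₀ (contDiffAt_pinv hinj) hA)
  refine h1.congr_of_eventuallyEq ?_
  filter_upwards [hev] with t ⟨ht1, ht2, ht3⟩
  ext1 c
  rw [ContinuousLinearMap.comp_apply, ContinuousLinearMap.comp_apply,
    ← apply_pinv_comp (he.inj_der _) (tder_symm_injective _ ht1), ht3]
  rfl

theorem smoothAlong_pinv (he : IsInjImmersion e) (hγ : ContMDiff 𝓘(ℝ) (𝓡 4) ∞ γ) (c : V) :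
    SmoothAlong e γ (fun t => pinv (dAt e (γ t)) c) :=
  (contDiff_proj_along he hγ).clm_apply contDiff_const

omit [IsManifold (𝓡 4) ∞ M] [FiniteDimensional ℝ V] in
theorem smoothAlong_velocity (he : IsInjImmersion e) (hγ : ContMDiff 𝓘(ℝ) (𝓡 4) ∞ γ) :
    SmoothAlong e γ (velocity γ) := by
  have h1 : ContDiff ℝ ∞ (e ∘ γ) := (he.smooth.comp hγ).contDiff
  have h2 : ∀ t, dAt e (γ t) (velocity γ t) = deriv (e ∘ γ) t := by
    intro t
    have := mfderiv_comp t (he.smooth.mdifferentiable (by simp) (γ t))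
      (hγ.mdifferentiable (by simp) t)
    rw [mfderiv_eq_fderiv] at this
    rw [← fderiv_apply_one_eq_deriv]
    exact (DFunLike.congr_fun this (1 : ℝ)).symm
  unfold SmoothAlong
  simp only [h2]
  exact (contDiff_infty_iff_deriv.1 h1).2

/-- `derivAt` refers to a chart that moves with the point. Near `t₀` the fields are carried to the
chart at `γ t₀` by `pinv`, and the derivative by `fderiv_pullback_of_zero`, which applies because
`σ` vanishes along `γ`. -/
theorem contDiff_derivAt_along (he : IsInjImmersion e) (hγ : ContMDiff 𝓘(ℝ) (𝓡 4) ∞ γ)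
    {σ : DiffForm M 2} (hσ : IsSmoothForm σ) (hz : ∀ t, γ t ∈ zeroLocus σ)
    (hu : SmoothAlong e γ u) (hv : SmoothAlong e γ v) (hw : SmoothAlong e γ w) :
    ContDiff ℝ ∞ fun t => derivAt σ (γ t) (u t) ![v t, w t] := by
  rw [contDiff_iff_contDiffAt]
  intro t₀
  obtain ⟨y, A, hy, hA, hinj, hev⟩ := exists_chart_along he hγ t₀
  set x := γ t₀
  have hloc : ∀ {u : ℝ → E4}, SmoothAlong e γ u →
      ContDiffAt ℝ ∞ (fun t => pinv (A t) (dAt e (γ t) (u t))) t₀ := fun hu =>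
    ((contDiffAt_pinv hinj).comp t₀ hA).clm_apply hu.contDiffAt
  have hy0 := hev.self_of_nhds.1
  have h1 : ContDiffAt ℝ ∞ (fun t => fderiv ℝ (localRep σ x) (y t)) t₀ :=
    ContDiffAt.comp (g := fderiv ℝ (localRep σ x)) t₀
      ((localRep_differentiable hσ x hy0).fderiv_right (by simp)) hy
  have h2 := (h1.clm_apply (hloc hu)).contDiffWithinAt (s := univ)
  have h3 := ContDiffWithinAt.form_apply (k := 2) h2 (v := fun t =>
    ![pinv (A t) (dAt e (γ t) (v t)), pinv (A t) (dAt e (γ t) (w t))]) (fun a => by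
      fin_cases a
      · exact (hloc hv).contDiffWithinAt
      · exact (hloc hw).contDiffWithinAt)
  refine (contDiffWithinAt_univ.1 h3).congr_of_eventuallyEq ?_
  filter_upwards [hev] with t ⟨ht1, ht2, ht3⟩
  have hf := (contMDiffOn_symm x).contMDiffAt ((isOpen_target x).mem_nhds ht1)
  have key : ∀ a : E4, tder (chart x).symm (y t) (pinv (A t) (dAt e (γ t) a)) = a := by
    intro a
    rw [ht3, apply_pinv_comp (he.inj_der _) (tder_symm_injective x ht1),
      pinv_apply_self (he.inj_der _)]
  have h4 : valAt σ ((chart x).symm (y t)) = 0 := by rw [ht2]; exact hz t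
  have h5 := fderiv_pullback_of_zero hσ hf h4 (pinv (A t) (dAt e (γ t) (u t)))
  change _ = fderiv ℝ (pullback (chart x).symm σ) (y t) _ _
  rw [h5, key, ContinuousAlternatingMap.compContinuousLinearMap_apply, ht2]
  congr 1
  ext i
  fin_cases i
  · exact congrArg (fun z : E4 => z _) (key (v t)).symm
  · exact congrArg (fun z : E4 => z _) (key (w t)).symm

end Along

/-! ### Smooth and periodic selections in families of convex cones -/

section Patching

/-- Partial products of the given signs in both directions from `0`; going backwards one multiplies
as well, since a sign is its own inverse. -/
theorem exists_sign_sequence (η : ℤ → ℝ) (hη : ∀ k, η k = 1 ∨ η k = -1) :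
    ∃ s : ℤ → ℝ, (∀ k, s k = 1 ∨ s k = -1) ∧ ∀ k, s (k + 1) = s k * η k := by
  have hprod : ∀ (f : ℕ → ℝ), (∀ n, f n = 1 ∨ f n = -1) → ∀ n,
      ∏ i ∈ Finset.range n, f i = 1 ∨ ∏ i ∈ Finset.range n, f i = -1 := by
    intro f hf n
    induction n with
    | zero => simp
    | succ n ih =>
      rw [Finset.prod_range_succ]
      rcases ih with h | h <;> rcases hf n with h' | h' <;> simp [h, h']
  refine ⟨fun k => match k with
    | Int.ofNat n => ∏ i ∈ Finset.range n, η i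
    | Int.negSucc n => ∏ i ∈ Finset.range (n + 1), η (-(i + 1 : ℕ)), ?_, ?_⟩
  · rintro (n | n)
    · exact hprod (fun i => η i) (fun i => hη i) n
    · exact hprod (fun i => η (-(i + 1 : ℕ))) (fun i => hη _) (n + 1)
  · rintro (n | n | n)
    · exact Finset.prod_range_succ (fun i : ℕ => η i) n
    · change ∏ i ∈ Finset.range 0, η i = (∏ i ∈ Finset.range 1, η (-(i + 1 : ℕ))) * η (-1)
      have hsq : η (-1) * η (-1) = 1 := by rcases hη (-1) with h | h <;> simp [h]
      simp [hsq]
    · change ∏ i ∈ Finset.range (n + 1), η (-(i + 1 : ℕ)) =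
        (∏ i ∈ Finset.range (n + 1 + 1), η (-(i + 1 : ℕ))) * η (-((n + 1 : ℕ) + 1 : ℕ))
      have hsq : ∀ k, η k * η k = 1 := fun k => by rcases hη k with h | h <;> simp [h]
      rw [Finset.prod_range_succ _ (n + 1), mul_assoc, hsq, mul_one]

variable {V : Type*} [NormedAddCommGroup V] [NormedSpace ℝ V]

/-- The path `u` is smooth after applying the family `L` of linear maps. -/
def SmoothVia (L : ℝ → E4 →L[ℝ] V) (u : ℝ → E4) : Prop := ContDiff ℝ ∞ fun t => L t (u t)

variable {L : ℝ → E4 →L[ℝ] V} {T : ℝ}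

theorem period_zsmul {α : Type*} {f : ℝ → α} (hL : ∀ t, f (t + T) = f t) (k : ℤ) (t : ℝ) :
    f (t + k * T) = f t := by
  have : Function.Periodic f T := hL
  simpa using (this.zsmul k) t

theorem SmoothVia.shift {u : ℝ → E4} (hu : SmoothVia L u) {c : ℝ} (hc : ∀ t, L (t + c) = L t) :
    SmoothVia L fun t => u (t + c) := by
  have := ContDiff.comp hu (contDiff_id.add contDiff_const : ContDiff ℝ ∞ fun t : ℝ => t + c)
  simpa only [SmoothVia, Function.comp_def, id, hc] using this

theorem SmoothVia.const_smul {u : ℝ → E4} (hu : SmoothVia L u) (c : ℝ) :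
    SmoothVia L fun t => c • u t := by
  unfold SmoothVia
  simp only [map_smul]
  exact ContDiff.const_smul c hu

theorem convex_of_cone {K : Set E4}
    (hK : ∀ x y (a b : ℝ), x ∈ K → y ∈ K → 0 ≤ a → 0 < b → a • x + b • y ∈ K) : Convex ℝ K := by
  intro x hx y hy a b ha hb hab
  rcases hb.eq_or_lt with rfl | hb
  · rw [add_comm]
    exact hK y x _ _ hy hx le_rfl (by linarith)
  · exact hK x y a b hx hy ha hb

/-- Convexity survives the linear maps `L t`, so local selections are glued in the fixed space `V`
and lifted back pointwise. -/
theorem exists_smooth_selection {K : ℝ → Set E4}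
    (hK : ∀ t x y (a b : ℝ), x ∈ K t → y ∈ K t → 0 ≤ a → 0 < b → a • x + b • y ∈ K t)
    (hloc : ∀ t₀, ∃ u, SmoothVia L u ∧ ∀ᶠ t in 𝓝 t₀, u t ∈ K t) :
    ∃ u, SmoothVia L u ∧ ∀ t, u t ∈ K t := by
  obtain ⟨g, hg⟩ := exists_contMDiffMap_forall_mem_convex_of_local 𝓘(ℝ, ℝ) (n := ⊤)
    (t := fun t => L t '' K t) (fun t => (convex_of_cone (hK t)).is_linear_image (L t).isBoundedLinearMap.toIsLinearMap)
    (fun t₀ => by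
      obtain ⟨u, hu, hev⟩ := hloc t₀
      exact ⟨_, hev, fun t => L t (u t), hu.contMDiff.contMDiffOn, fun t ht => ⟨u t, ht, rfl⟩⟩)
  choose u hu hug using hg
  refine ⟨u, ?_, hu⟩
  unfold SmoothVia
  simp only [hug]
  exact g.contMDiff.contDiff

/-- A smooth function, positive exactly on `(0, 2T)`. -/
def plateau (T t : ℝ) : ℝ := Real.smoothTransition t * Real.smoothTransition (2 * T - t)

theorem contDiff_plateau (T : ℝ) : ContDiff ℝ ∞ (plateau T) :=
  Real.smoothTransition.contDiff.mul
    (Real.smoothTransition.contDiff.comp (contDiff_const.sub contDiff_id))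

theorem plateau_nonneg (T t : ℝ) : 0 ≤ plateau T t :=
  mul_nonneg (Real.smoothTransition.nonneg _) (Real.smoothTransition.nonneg _)

theorem plateau_pos {T t : ℝ} (h0 : 0 < t) (h1 : t < 2 * T) : 0 < plateau T t :=
  mul_pos (Real.smoothTransition.pos_of_pos h0) (Real.smoothTransition.pos_of_pos (by linarith))

theorem plateau_of_nonpos {T t : ℝ} (h0 : t ≤ 0) : plateau T t = 0 := by
  rw [plateau, Real.smoothTransition.zero_of_nonpos h0, zero_mul]

theorem plateau_of_le {T t : ℝ} (h0 : 2 * T ≤ t) : plateau T t = 0 := by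
  rw [plateau, Real.smoothTransition.zero_of_nonpos (x := 2 * T - t) (by linarith), mul_zero]

/-- A smooth selection of a family of convex cones can be made (skew-)periodic. -/
theorem exists_periodic_selection {K : ℝ → Set E4}
    (hK : ∀ t x y (a b : ℝ), x ∈ K t → y ∈ K t → 0 ≤ a → 0 < b → a • x + b • y ∈ K t)
    (hT : 0 < T) (hL : ∀ t, L (t + T) = L t) {ε : ℝ} (hε : ε = 1 ∨ ε = -1)
    (hinv : ∀ t x, x ∈ K t → ε • x ∈ K (t + T)) (hinv' : ∀ t x, x ∈ K (t + T) → ε • x ∈ K t)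
    {u : ℝ → E4} (hu : SmoothVia L u) (huK : ∀ t, u t ∈ K t) :
    ∃ n, SmoothVia L n ∧ (∀ t, n t ∈ K t) ∧ ∀ t, n (t + T) = ε • n t := by
  have hεε : ε * ε = 1 := by rcases hε with rfl | rfl <;> norm_num
  have hε0 : ε ≠ 0 := by rcases hε with rfl | rfl <;> norm_num
  -- This is the sum over all `k` of `ε ^ k * plateau (s + k T)` times `u (s + k T)`: for `|s| < T`
  -- only `k = 0, 1, 2` contribute, and `ε ^ 2 = 1`.
  let m : ℝ → E4 := fun s => plateau T s • u s + (ε * plateau T (s + T)) • u (s + T) +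
    plateau T (s + 2 * T) • u (s + 2 * T)
  let n : ℝ → E4 := fun t => ε ^ ⌊t / T⌋ • m (t - ⌊t / T⌋ * T)
  have hfloor : ∀ t, ⌊t / T⌋ * T ≤ t ∧ t < (⌊t / T⌋ + 1) * T := fun t =>
    ⟨(le_div_iff₀ hT).1 (Int.floor_le _), (div_lt_iff₀ hT).1 (Int.lt_floor_add_one _)⟩
  -- The formulas of two consecutive periods agree on their overlap, so `n` is smooth across the
  -- multiples of `T`.
  have hn : ∀ (j : ℤ) t, |t - j * T| < T → n t = ε ^ j • m (t - j * T) := by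
    intro j t ht
    obtain ⟨h1, h2⟩ := abs_lt.1 ht
    obtain ⟨f1, f2⟩ := hfloor t
    have c1 : ⌊t / T⌋ < j + 1 := by
      have : (⌊t / T⌋ : ℝ) * T < (j + 1) * T := by linarith
      exact_mod_cast lt_of_mul_lt_mul_right this hT.le
    have c2 : j < ⌊t / T⌋ + 2 := by
      have : (j : ℝ) * T < (⌊t / T⌋ + 2) * T := by linarith
      exact_mod_cast lt_of_mul_lt_mul_right this hT.le
    rcases (show ⌊t / T⌋ = j ∨ ⌊t / T⌋ = j - 1 by omega) with hj | hj
    · simp only [n, hj]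
    · have hs : t - ((j - 1 : ℤ) : ℝ) * T = t - j * T + T := by push_cast; ring
      simp only [n, hj, hs]
      rw [hj] at f2
      push_cast at f2
      have e1 : t - j * T + T + T = t - j * T + 2 * T := by ring
      simp only [m, e1]
      rw [plateau_of_nonpos (T := T) (t := t - j * T) (by linarith),
        plateau_of_le (T := T) (t := t - j * T + T + 2 * T) (by linarith), zpow_sub_one₀ hε0,
        show ε⁻¹ = ε from inv_eq_of_mul_eq_one_left hεε]
      simp only [zero_smul, zero_add, add_zero, smul_add, smul_smul]
      congr 2
      · ring
      · linear_combination (ε ^ j * plateau T (t - j * T + 2 * T)) * hεε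
  have hLk : ∀ (k : ℤ) t, L (t + k * T) = L t := fun k t => period_zsmul hL k t
  have hmK : ∀ s, 0 ≤ s → s < T → m s ∈ K s := by
    intro s h0 h1
    have e1 : m s = plateau T s • u s + plateau T (s + T) • ε • u (s + T) := by
      simp only [m]
      rw [plateau_of_le (T := T) (t := s + 2 * T) (by linarith), zero_smul, add_zero, smul_smul,
        mul_comm ε]
    rw [e1]
    exact hK _ _ _ _ _ (huK s) (hinv' _ _ (huK _)) (plateau_nonneg _ _)
      (plateau_pos (by linarith) (by linarith))
  have hzpow : ∀ (k : ℤ) t x, x ∈ K t → ε ^ k • x ∈ K (t + k * T) := by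
    intro k
    induction k with
    | zero => intro t x hx; simpa using hx
    | succ k ih =>
      intro t x hx
      have := hinv _ _ (ih t x hx)
      rw [smul_smul, mul_comm ε, ← zpow_add_one₀ hε0] at this
      convert this using 2
      push_cast
      ring
    | pred k ih =>
      intro t x hx
      have := hinv' (t + ((-k - 1 : ℤ) : ℝ) * T) _ (by
        have := ih t x hx
        convert this using 2
        push_cast
        ring)
      rwa [smul_smul, mul_comm ε, show ε ^ (-(k : ℤ)) * ε = ε ^ (-(k : ℤ) - 1) by
        rw [zpow_sub_one₀ hε0, show ε⁻¹ = ε from inv_eq_of_mul_eq_one_left hεε]] at this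
  refine ⟨n, ?_, fun t => ?_, fun t => ?_⟩
  · unfold SmoothVia
    rw [contDiff_iff_contDiffAt]
    intro t₀
    obtain ⟨f1, f2⟩ := hfloor t₀
    set j := ⌊t₀ / T⌋
    have hev : (fun t => L t (n t)) =ᶠ[𝓝 t₀] fun t => ε ^ j • L t (m (t - j * T)) := by
      filter_upwards [Ioo_mem_nhds (show j * T - T < t₀ by linarith)
        (show t₀ < j * T + T by linarith)] with t ht
      rw [hn j t (abs_lt.2 ⟨by linarith [ht.1], by linarith [ht.2]⟩), map_smul]
    refine ContDiffAt.congr_of_eventuallyEq ?_ hev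
    have hterm : ∀ (k : ℤ) (a : ℝ → ℝ), ContDiff ℝ ∞ a →
        ContDiff ℝ ∞ fun t => a t • L t (u (t + k * T)) := fun k a ha =>
      ha.smul (SmoothVia.shift hu (hLk k))
    have hp : ∀ c : ℝ, ContDiff ℝ ∞ fun t : ℝ => plateau T (t + c) := fun c =>
      (contDiff_plateau T).comp (contDiff_id.add contDiff_const)
    have h1 := hterm (-j) _ (hp ((-j : ℤ) * T))
    have h2 := hterm (-j + 1) _ (contDiff_const.mul (hp ((-j + 1 : ℤ) * T)) : ContDiff ℝ ∞ fun t => ε * _)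
    have h3 := hterm (-j + 2) _ (hp ((-j + 2 : ℤ) * T))
    have h4 := (((h1.add h2).add h3).const_smul (ε ^ j)).contDiffAt (x := t₀)
    refine h4.congr_of_eventuallyEq (Filter.Eventually.of_forall fun t => ?_)
    have a1 : t + ((-j : ℤ) : ℝ) * T = t - j * T := by push_cast; ring
    have a2 : t + ((-j + 1 : ℤ) : ℝ) * T = t - j * T + T := by push_cast; ring
    have a3 : t + ((-j + 2 : ℤ) : ℝ) * T = t - j * T + 2 * T := by push_cast; ring
    simp only [m, map_add, map_smul, a1, a2, a3]
  · obtain ⟨f1, f2⟩ := hfloor t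
    have := hzpow ⌊t / T⌋ _ _ (hmK (t - ⌊t / T⌋ * T) (by linarith) (by linarith))
    rwa [sub_add_cancel] at this
  · have e1 : (t + T) / T = t / T + 1 := by field_simp
    have e2 : t + T - ((⌊t / T⌋ + 1 : ℤ) : ℝ) * T = t - ⌊t / T⌋ * T := by push_cast; ring
    simp only [n, e1, Int.floor_add_one, e2]
    rw [smul_smul, zpow_add_one₀ hε0, mul_comm]

end Patching

/-! ### A negative vector field along a periodic Lorentzian family -/

section NegativeField

variable {V : Type*} [NormedAddCommGroup V] [NormedSpace ℝ V] {L : ℝ → E4 →L[ℝ] V} {T : ℝ}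
  {b : ℝ → LinearMap.BilinForm ℝ E4}

/-- Negative vectors form two opposite half-cones, and a negative pairing means the same half. If
`x` and `y` paired positively, a convex combination of `y` and `h` would be negative and orthogonal
to `x`, against `h1`. -/
theorem neg_trans {B : LinearMap.BilinForm ℝ E4} (hs : ∀ x y, B x y = B y x)
    (h1 : ∀ x y, B x x < 0 → B y y < 0 → B x y ≠ 0) {h x y : E4} (hh : B h h < 0) (hx : B x x < 0)
    (hy : B y y < 0) (hxh : B x h < 0) (hyh : B y h < 0) : B x y < 0 := by
  by_contra hle
  have hpos : 0 < B x y := lt_of_le_of_ne (not_lt.1 hle) (h1 x y hx hy).symm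
  set s := B x y / (B x y - B x h) with hs'
  have hd : 0 < B x y - B x h := by linarith
  have hs0 : 0 < s := div_pos hpos hd
  have hs1 : s < 1 := (div_lt_one hd).2 (by linarith)
  have hz : B x ((1 - s) • y + s • h) = 0 := by
    rw [map_add, map_smul, map_smul, smul_eq_mul, smul_eq_mul]
    have : s * (B x y - B x h) = B x y := div_mul_cancel₀ _ hd.ne'
    linarith
  refine h1 x _ hx ?_ hz
  simp only [map_add, map_smul, LinearMap.add_apply, LinearMap.smul_apply, smul_eq_mul, hs h y]
  have a1 : 0 < 1 - s := by linarith
  nlinarith [mul_pos (mul_pos a1 a1) (neg_pos.2 hy), mul_pos (mul_pos hs0 hs0) (neg_pos.2 hh),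
    mul_pos (mul_pos a1 hs0) (neg_pos.2 hyh)]

theorem sign_const_of_ne_zero {g : ℝ → ℝ} {s : Set ℝ} (hs : IsPreconnected s) (hc : ContinuousOn g s)
    (h0 : ∀ t ∈ s, g t ≠ 0) {a c : ℝ} (ha : a ∈ s) (hcs : c ∈ s) (hneg : g a < 0) : g c < 0 := by
  by_contra hle
  obtain ⟨t, ht, h⟩ := hs.intermediate_value ha hcs hc ⟨hneg.le, not_lt.1 hle⟩
  exact h0 t ht h

/-- A periodic family of Lorentzian forms has a smooth field of negative vectors that is periodic up
to sign. -/
theorem exists_negative_field (hT : 0 < T) (hL : ∀ t, L (t + T) = L t) (hb : ∀ t, b (t + T) = b t)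
    (hs : ∀ t x y, b t x y = b t y x)
    (h1 : ∀ t x y, b t x x < 0 → b t y y < 0 → b t x y ≠ 0)
    (hneg : ∀ t, ∃ x, b t x x < 0)
    (hext : ∀ t x, ∃ u, SmoothVia L u ∧ u t = x)
    (hcont : ∀ u w, SmoothVia L u → SmoothVia L w → Continuous fun t => b t (u t) (w t)) :
    ∃ ε : ℝ, (ε = 1 ∨ ε = -1) ∧ ∃ n, SmoothVia L n ∧ (∀ t, b t (n t) (n t) < 0) ∧
      ∀ t, n (t + T) = ε • n t := by
  have hLk : ∀ (k : ℤ) t, L (t + k * T) = L t := fun k t => period_zsmul hL k t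
  have hbk : ∀ (k : ℤ) t, b (t + k * T) = b t := fun k t => period_zsmul hb k t
  -- local negative fields on intervals of a fixed length
  obtain ⟨δ, hδ, hloc⟩ : ∃ δ > 0, ∀ t₀, ∃ u, SmoothVia L u ∧ ∀ t, |t - t₀| < δ → b t (u t) (u t) < 0 := by
    obtain ⟨δ, hδ, h⟩ := (isCompact_Icc (a := (0 : ℝ)) (b := T)).induction_on
      (p := fun s => ∃ δ > 0, ∀ t₀ ∈ s, ∃ u, SmoothVia L u ∧ ∀ t, |t - t₀| < δ → b t (u t) (u t) < 0)
      ⟨1, one_pos, by simp⟩ (by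
        rintro s t hst ⟨δ, hδ, h⟩
        exact ⟨δ, hδ, fun t₀ ht₀ => h t₀ (hst ht₀)⟩) (by
        rintro s t ⟨δ, hδ, h⟩ ⟨δ', hδ', h'⟩
        refine ⟨min δ δ', lt_min hδ hδ', ?_⟩
        rintro t₀ (ht₀ | ht₀)
        · obtain ⟨u, hu, hu'⟩ := h t₀ ht₀
          exact ⟨u, hu, fun t ht => hu' t (ht.trans_le (min_le_left _ _))⟩
        · obtain ⟨u, hu, hu'⟩ := h' t₀ ht₀
          exact ⟨u, hu, fun t ht => hu' t (ht.trans_le (min_le_right _ _))⟩) (by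
        intro t₀ _
        obtain ⟨x, hx⟩ := hneg t₀
        obtain ⟨u, hu, rfl⟩ := hext t₀ x
        obtain ⟨δ, hδ, hball⟩ := Metric.eventually_nhds_iff_ball.1
          ((hcont u u hu hu).continuousAt.eventually (gt_mem_nhds hx))
        refine ⟨_, mem_nhdsWithin_of_mem_nhds (Metric.ball_mem_nhds t₀ (half_pos hδ)), δ / 2,
          half_pos hδ, fun t₁ ht₁ => ⟨u, hu, fun t ht => hball t ?_⟩⟩
        rw [Metric.mem_ball, Real.dist_eq] at ht₁ ⊢
        calc |t - t₀| ≤ |t - t₁| + |t₁ - t₀| := abs_sub_le _ _ _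
          _ < δ := by linarith)
    refine ⟨δ, hδ, fun t₀ => ?_⟩
    set k := ⌊t₀ / T⌋
    have f1 : k * T ≤ t₀ := (le_div_iff₀ hT).1 (Int.floor_le _)
    have f2 : t₀ < (k + 1) * T := (div_lt_iff₀ hT).1 (Int.lt_floor_add_one _)
    obtain ⟨u, hu, hu'⟩ := h (t₀ - k * T) ⟨by linarith, by linarith⟩
    refine ⟨_, SmoothVia.shift hu (hLk (-k)), fun t ht => ?_⟩
    have e1 : t + ((-k : ℤ) : ℝ) * T = t - k * T := by push_cast; ring
    have := hu' (t - k * T) (by rwa [sub_sub_sub_cancel_right])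
    rw [← e1, hbk] at this
    exact this
  -- consistent signs
  set d := δ / 2 with hd
  have hd0 : 0 < d := half_pos hδ
  choose u hu hun using fun k : ℤ => hloc (k * d)
  -- On their common interval two neighbouring fields are never orthogonal, so their pairing keeps
  -- one sign.
  have hη : ∀ k : ℤ, ∃ η : ℝ, (η = 1 ∨ η = -1) ∧ ∀ t, k * d - d < t → t < k * d + 2 * d →
      η * b t (u k t) (u (k + 1) t) < 0 := by
    intro k
    have hne : ∀ t ∈ Ioo (k * d - d) (k * d + 2 * d), b t (u k t) (u (k + 1) t) ≠ 0 := by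
      intro t ht
      refine h1 t _ _ (hun k t (abs_lt.2 ⟨by linarith [ht.1], by linarith [ht.2]⟩))
        (hun (k + 1) t (abs_lt.2 ⟨?_, ?_⟩)) <;> push_cast <;> linarith [ht.1, ht.2]
    have hc := (hcont _ _ (hu k) (hu (k + 1)))
    have hm : (k * d : ℝ) ∈ Ioo (k * d - d) (k * d + 2 * d) := ⟨by linarith, by linarith⟩
    rcases lt_or_gt_of_ne (hne _ hm) with h | h
    · refine ⟨1, Or.inl rfl, fun t ht1 ht2 => ?_⟩
      rw [one_mul]
      exact sign_const_of_ne_zero isPreconnected_Ioo hc.continuousOn hne hm ⟨ht1, ht2⟩ h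
    · refine ⟨-1, Or.inr rfl, fun t ht1 ht2 => ?_⟩
      have := sign_const_of_ne_zero (g := fun t => -b t (u k t) (u (k + 1) t)) isPreconnected_Ioo
        hc.neg.continuousOn (fun t ht => neg_ne_zero.2 (hne t ht)) hm ⟨ht1, ht2⟩ (neg_lt_zero.2 h)
      simpa using this
  choose η hη1 hη2 using hη
  -- Corrected successively by these signs, neighbouring local fields lie in the same half-cone.
  obtain ⟨s, hs1, hs2⟩ := exists_sign_sequence η hη1
  have hss : ∀ k, s k * s k = 1 := fun k => by rcases hs1 k with h | h <;> rw [h] <;> norm_num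
  have hself : ∀ (k : ℤ) t, |t - k * d| < δ → b t (s k • u k t) (s k • u k t) < 0 := by
    intro k t ht
    simp only [map_smul, LinearMap.smul_apply, smul_eq_mul, ← mul_assoc, hss, one_mul]
    exact hun k t ht
  have hnext : ∀ (k : ℤ) t, k * d - d < t → t < k * d + 2 * d →
      b t (s k • u k t) (s (k + 1) • u (k + 1) t) < 0 := by
    intro k t ht1 ht2
    simp only [map_smul, LinearMap.smul_apply, smul_eq_mul, hs2]
    rw [mul_comm (s k) (η k), mul_assoc, ← mul_assoc (s k), hss, one_mul]
    exact hη2 k t ht1 ht2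
  -- No continuity of `h` is needed: it only marks one half-cone at each `t`, which is an open
  -- convex condition on negative vectors.
  let h : ℝ → E4 := fun t => s ⌊t / d⌋ • u ⌊t / d⌋ t
  have hfloor : ∀ t, ⌊t / d⌋ * d ≤ t ∧ t < (⌊t / d⌋ + 1) * d := fun t =>
    ⟨(le_div_iff₀ hd0).1 (Int.floor_le _), (div_lt_iff₀ hd0).1 (Int.lt_floor_add_one _)⟩
  have hh : ∀ t, b t (h t) (h t) < 0 := fun t => by
    obtain ⟨f1, f2⟩ := hfloor t
    exact hself _ t (abs_lt.2 ⟨by linarith, by linarith⟩)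
  have hloc' : ∀ (j : ℤ) t, |t - j * d| < d → b t (s j • u j t) (h t) < 0 := by
    intro j t ht
    obtain ⟨a1, a2⟩ := abs_lt.1 ht
    obtain ⟨f1, f2⟩ := hfloor t
    have c1 : ⌊t / d⌋ < j + 1 := by
      have : (⌊t / d⌋ : ℝ) * d < (j + 1) * d := by linarith
      exact_mod_cast lt_of_mul_lt_mul_right this hd0.le
    have c2 : j < ⌊t / d⌋ + 2 := by
      have : (j : ℝ) * d < (⌊t / d⌋ + 2) * d := by linarith
      exact_mod_cast lt_of_mul_lt_mul_right this hd0.le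
    rcases (show ⌊t / d⌋ = j ∨ j = ⌊t / d⌋ + 1 by omega) with hj | hj
    · simp only [h, hj]
      exact hself j t (by linarith)
    · rw [hs, hj]
      exact hnext _ t (by linarith) (by linarith)
  have hcone : ∀ (h : ℝ → E4), ∀ t x y (p q : ℝ), x ∈ {x | b t x x < 0 ∧ b t x (h t) < 0} →
      y ∈ {x | b t x x < 0 ∧ b t x (h t) < 0} → b t (h t) (h t) < 0 → 0 ≤ p → 0 < q →
      p • x + q • y ∈ {x | b t x x < 0 ∧ b t x (h t) < 0} := by
    rintro h t x y p q ⟨x1, x2⟩ ⟨y1, y2⟩ hh hp hq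
    have hxy := neg_trans (hs t) (h1 t) hh x1 y1 x2 y2
    simp only [mem_ofPred_eq, map_add, map_smul, LinearMap.add_apply, LinearMap.smul_apply,
      smul_eq_mul, hs t y x]
    constructor
    · nlinarith [mul_nonneg (mul_nonneg hp hp) (neg_pos.2 x1).le, mul_pos (mul_pos hq hq) (neg_pos.2 y1),
        mul_nonneg (mul_nonneg hp hq.le) (neg_pos.2 hxy).le]
    · nlinarith [mul_nonneg hp (neg_pos.2 x2).le, mul_pos hq (neg_pos.2 y2)]
  obtain ⟨n₀, hn₀, hn₀K⟩ := exists_smooth_selection (L := L)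
    (K := fun t => {x | b t x x < 0 ∧ b t x (h t) < 0})
    (fun t x y p q hx hy hp hq => hcone h t x y p q hx hy (hh t) hp hq) (fun t₀ => by
      obtain ⟨f1, f2⟩ := hfloor t₀
      set j := ⌊t₀ / d⌋
      refine ⟨_, (hu j).const_smul (s j), ?_⟩
      filter_upwards [Ioo_mem_nhds (show j * d - d < t₀ by linarith)
        (show t₀ < j * d + d by linarith)] with t ht
      have : |t - j * d| < d := abs_lt.2 ⟨by linarith [ht.1], by linarith [ht.2]⟩
      exact ⟨hself j t (by linarith), hloc' j t this⟩)
  -- the monodromy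
  have hneg₀ : ∀ t, b t (n₀ t) (n₀ t) < 0 := fun t => (hn₀K t).1
  have hnegT : ∀ t, b t (n₀ (t + T)) (n₀ (t + T)) < 0 := fun t => by
    have := hneg₀ (t + T)
    rwa [hb] at this
  -- `ε` records whether one turn preserves or exchanges the two halves of the negative cone. This
  -- is the invariant that decides between the two models.
  obtain ⟨ε, hε, hmono⟩ : ∃ ε : ℝ, (ε = 1 ∨ ε = -1) ∧ ∀ t, b t (n₀ t) (ε • n₀ (t + T)) < 0 := by
    have hc := hcont _ _ hn₀ (hn₀.shift hL)
    have hne : ∀ t ∈ univ, b t (n₀ t) (n₀ (t + T)) ≠ 0 := fun t _ => h1 t _ _ (hneg₀ t) (hnegT t)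
    rcases lt_or_gt_of_ne (hne 0 (mem_univ _)) with h | h
    · refine ⟨1, Or.inl rfl, fun t => ?_⟩
      rw [one_smul]
      exact sign_const_of_ne_zero isPreconnected_univ hc.continuousOn hne (mem_univ 0) (mem_univ t) h
    · refine ⟨-1, Or.inr rfl, fun t => ?_⟩
      have := sign_const_of_ne_zero (g := fun t => -b t (n₀ t) (n₀ (t + T))) isPreconnected_univ
        hc.neg.continuousOn (fun t ht => neg_ne_zero.2 (hne t ht)) (mem_univ 0) (mem_univ t)
        (neg_lt_zero.2 h)
      simpa using this
  have hεε : ε * ε = 1 := by rcases hε with rfl | rfl <;> norm_num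
  have hsq : ∀ t x, b t (ε • x) (ε • x) = b t x x := fun t x => by
    simp only [map_smul, LinearMap.smul_apply, smul_eq_mul, ← mul_assoc, hεε, one_mul]
  obtain ⟨n, hn, hnK, hnT⟩ := exists_periodic_selection (L := L)
    (K := fun t => {x | b t x x < 0 ∧ b t x (n₀ t) < 0})
    (fun t x y p q hx hy hp hq => hcone n₀ t x y p q hx hy (hneg₀ t) hp hq) hT hL hε
    (by
      rintro t x ⟨x1, x2⟩
      refine ⟨by rw [hb, hsq]; exact x1, ?_⟩
      have := neg_trans (hs t) (h1 t) (hneg₀ t) x1 (by rw [hsq]; exact hnegT t) x2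
        (by rw [hs]; exact hmono t)
      simpa only [hb, map_smul, LinearMap.smul_apply] using this)
    (by
      rintro t x ⟨x1, x2⟩
      rw [hb] at x1 x2
      refine ⟨by rw [hsq]; exact x1, ?_⟩
      refine neg_trans (hs t) (h1 t) (h := ε • n₀ (t + T)) (by rw [hsq]; exact hnegT t)
        (by rw [hsq]; exact x1) (hneg₀ t) ?_ (hmono t)
      simpa only [map_smul, LinearMap.smul_apply, smul_eq_mul, ← mul_assoc, hεε, one_mul] using x2)
    hn₀ (fun t => ⟨hneg₀ t, hneg₀ t⟩)
  exact ⟨ε, hε, n, hn, fun t => (hnK t).1, hnT⟩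

end NegativeField

/-! ### General position by a dimension count -/

section Transverse

variable {V : Type*} [NormedAddCommGroup V] [InnerProductSpace ℝ V] [FiniteDimensional ℝ V]

/-- A generic constant vector projects to a section that avoids two given sections. -/
theorem exists_generic_vector {L : ℝ → E4 →L[ℝ] V} (hinj : ∀ t, Function.Injective (L t))
    (hP : ContDiff ℝ ∞ fun t => (L t).comp (pinv (L t))) {u w : ℝ → E4} (hu : SmoothVia L u)
    (hw : SmoothVia L w) : ∃ c : V, ∀ t (a b : ℝ), pinv (L t) c ≠ a • u t + b • w t := by
  let P : ℝ → V →L[ℝ] V := fun t => (L t).comp (pinv (L t))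
  have hPL : ∀ t x, P t (L t x) = L t x := fun t x => by
    simp only [P, ContinuousLinearMap.comp_apply, pinv_apply_self (hinj t)]
  have hPP : ∀ t x, P t (P t x) = P t x := fun t x => hPL t _
  have hV : 4 ≤ Module.finrank ℝ V := by
    have := LinearMap.finrank_le_finrank_of_injective (f := (L 0 : E4 →ₗ[ℝ] V)) (hinj 0)
    simpa using this
  have hloc : ∀ t₀ : ℝ, ∃ N ∈ 𝓝 t₀, dimH {c : V | ∃ t ∈ N, ∃ a b : ℝ,
      pinv (L t) c = a • u t + b • w t} ≤ (Module.finrank ℝ V - 1 : ℕ) := by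
    intro t₀
    -- `S t` is the identity at `t₀` and hence invertible nearby. It allows `P t₀ c` to be recovered
    -- from `P t c` and the kernel component `c - P t₀ c`.
    let S : ℝ → V →L[ℝ] V := fun t => (P t₀).comp ((P t).comp (P t₀)) +
      (ContinuousLinearMap.id ℝ V - P t₀)
    have hS : ContDiff ℝ ∞ S :=
      (contDiff_const.clm_comp (hP.clm_comp contDiff_const)).add contDiff_const
    have hS0 : S t₀ = ((ContinuousLinearEquiv.refl ℝ V : V ≃L[ℝ] V) : V →L[ℝ] V) := by
      ext1 x
      simp [S, hPP]
    have hinvS : ∀ᶠ t in 𝓝 t₀, S t ∈ range ((↑) : (V ≃L[ℝ] V) → V →L[ℝ] V) := by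
      refine hS.continuous.continuousAt.eventually (ContinuousLinearEquiv.isOpen.mem_nhds ?_)
      rw [hS0]
      exact ⟨_, rfl⟩
    obtain ⟨δ, hδ, hball⟩ := Metric.eventually_nhds_iff_ball.1 hinvS
    let K := LinearMap.ker (pinv (L t₀) : V →ₗ[ℝ] E4)
    let F : (ℝ × ℝ × ℝ) × K → V := fun q => (q.2 : V) +
      ContinuousLinearMap.inverse (S q.1.1)
        (P t₀ (q.1.2.1 • L q.1.1 (u q.1.1) + q.1.2.2 • L q.1.1 (w q.1.1) - P q.1.1 q.2))
    let s : Set ((ℝ × ℝ × ℝ) × K) := (Metric.ball t₀ δ ×ˢ univ) ×ˢ univ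
    have hF : ContDiffOn ℝ 1 F s := by
      rintro ⟨⟨t, a, b⟩, k⟩ hq
      have ht : t ∈ Metric.ball t₀ δ := hq.1.1
      refine ContDiffAt.contDiffWithinAt ?_
      have h1 : ContDiffAt ℝ ∞ (fun q : (ℝ × ℝ × ℝ) × K => q.1.1) ((t, a, b), k) :=
        (contDiff_fst.comp contDiff_fst).contDiffAt
      have h2 : ContDiffAt ℝ ∞ (fun q : (ℝ × ℝ × ℝ) × K => q.1.2.1) ((t, a, b), k) :=
        (contDiff_fst.comp (contDiff_snd.comp contDiff_fst)).contDiffAt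
      have h3 : ContDiffAt ℝ ∞ (fun q : (ℝ × ℝ × ℝ) × K => q.1.2.2) ((t, a, b), k) :=
        (contDiff_snd.comp (contDiff_snd.comp contDiff_fst)).contDiffAt
      have h4 : ContDiffAt ℝ ∞ (fun q : (ℝ × ℝ × ℝ) × K => (q.2 : V)) ((t, a, b), k) :=
        (K.subtypeL.contDiff.comp contDiff_snd).contDiffAt
      have h5 : ContDiffAt ℝ ∞ (fun t => ContinuousLinearMap.inverse (S t)) t := by
        obtain ⟨B, hB⟩ := hball t ht
        have := contDiffAt_map_inverse (n := ∞) B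
        rw [hB] at this
        exact ContDiffAt.comp (g := ContinuousLinearMap.inverse) (f := S) t this hS.contDiffAt
      have hu' : ContDiffAt ℝ ∞ (fun t => L t (u t)) t := hu.contDiffAt
      have hw' : ContDiffAt ℝ ∞ (fun t => L t (w t)) t := hw.contDiffAt
      have hP' : ContDiffAt ℝ ∞ P t := hP.contDiffAt
      have c1 := h2.smul (ContDiffAt.comp (g := fun t => L t (u t)) ((t, a, b), k) hu' h1)
      have c2 := h3.smul (ContDiffAt.comp (g := fun t => L t (w t)) ((t, a, b), k) hw' h1)
      have c3 := (ContDiffAt.comp (g := P) ((t, a, b), k) hP' h1).clm_apply h4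
      have c4 := (P t₀).contDiff.contDiffAt.comp ((t, a, b), k) ((c1.add c2).sub c3)
      exact (h4.add ((ContDiffAt.comp (g := fun t => ContinuousLinearMap.inverse (S t))
        ((t, a, b), k) h5 h1).clm_apply c4)).of_le (by simp)
    have hs : Convex ℝ s := ((convex_ball _ _).prod convex_univ).prod convex_univ
    refine ⟨_, Metric.ball_mem_nhds t₀ hδ, ?_⟩
    have hsub : {c : V | ∃ t ∈ Metric.ball t₀ δ, ∃ a b : ℝ, pinv (L t) c = a • u t + b • w t} ⊆
        F '' s := by
      rintro c ⟨t, ht, a, b, hc⟩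
      have hPc : P t c = a • L t (u t) + b • L t (w t) := by
        simp only [P, ContinuousLinearMap.comp_apply, hc, map_add, map_smul]
      have hk : pinv (L t₀) (c - P t₀ c) = 0 := by
        simp only [P, map_sub, ContinuousLinearMap.comp_apply, pinv_apply_self (hinj t₀), sub_self]
      refine ⟨((t, a, b), ⟨c - P t₀ c, hk⟩), ⟨⟨ht, mem_univ _⟩, mem_univ _⟩, ?_⟩
      obtain ⟨B, hB⟩ := hball t ht
      simp only [F, ← hPc, ← hB, ContinuousLinearMap.inverse_equiv]
      have h6 : P t₀ (P t c - P t (c - P t₀ c)) = B (P t₀ c) := by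
        have : B (P t₀ c) = S t (P t₀ c) := DFunLike.congr_fun hB _
        rw [this]
        simp [S, hPP]
      rw [h6]
      simp
    refine (dimH_mono hsub).trans ((hF.dimH_image_le hs subset_rfl).trans ?_)
    refine (dimH_mono (subset_univ s)).trans ?_
    rw [Real.dimH_univ_eq_finrank]
    have hsurj : Function.Surjective (pinv (L t₀)) := fun x => ⟨L t₀ x, pinv_apply_self (hinj t₀) x⟩
    have hrk := LinearMap.finrank_range_add_finrank_ker (pinv (L t₀) : V →ₗ[ℝ] E4)
    rw [LinearMap.range_eq_top.2 hsurj, finrank_top] at hrk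
    have h4 : Module.finrank ℝ E4 = 4 := by simp
    have h7 : Module.finrank ℝ ((ℝ × ℝ × ℝ) × K) ≤ Module.finrank ℝ V - 1 := by
      rw [Module.finrank_prod, Module.finrank_prod, Module.finrank_prod, Module.finrank_self]
      change _ + Module.finrank ℝ (LinearMap.ker (pinv (L t₀) : V →ₗ[ℝ] E4)) ≤ _
      omega
    exact_mod_cast h7
  choose N hN hdim using hloc
  obtain ⟨I, hI, hcov⟩ := TopologicalSpace.countable_cover_nhds hN
  have hsub : {c : V | ∃ t, ∃ a b : ℝ, pinv (L t) c = a • u t + b • w t} ⊆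
      ⋃ t₀ ∈ I, {c : V | ∃ t ∈ N t₀, ∃ a b : ℝ, pinv (L t) c = a • u t + b • w t} := by
    rintro c ⟨t, hc⟩
    have : t ∈ ⋃ x ∈ I, N x := by rw [hcov]; trivial
    obtain ⟨t₀, ht₀, ht⟩ := mem_iUnion₂.1 this
    exact mem_iUnion₂.2 ⟨t₀, ht₀, t, ht, hc⟩
  have hbad : dimH {c : V | ∃ t, ∃ a b : ℝ, pinv (L t) c = a • u t + b • w t} <
      Module.finrank ℝ V := by
    refine (dimH_mono hsub).trans_lt ?_
    rw [dimH_bUnion hI]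
    refine (iSup₂_le fun t₀ _ => hdim t₀).trans_lt ?_
    exact_mod_cast (by omega : Module.finrank ℝ V - 1 < Module.finrank ℝ V)
  obtain ⟨c, hc⟩ := (dense_compl_of_dimH_lt_finrank hbad).nonempty
  exact ⟨c, fun t a b h => hc ⟨t, a, b, h⟩⟩

end Transverse

/-! ### The Lorentzian form and a normal frame along a loop -/

section Frames

variable {M : Type*} [TopologicalSpace M] [ChartedSpace E4 M]
  {V : Type*} [NormedAddCommGroup V] [InnerProductSpace ℝ V]
  {σ : DiffForm M 2} {γ : ℝ → M} {C : Set M} {e : M → V}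

namespace IsLoop

theorem periodic (hl : IsLoop σ γ C) (t : ℝ) : γ (t + 2 * Real.pi) = γ t :=
  ((hl.eq_iff t _).2 ⟨1, by simp⟩).symm

theorem velocity_periodic (hl : IsLoop σ γ C) (t : ℝ) :
    velocity γ (t + 2 * Real.pi) = velocity γ t := by
  have h1 : γ ∘ (fun t => t + 2 * Real.pi) = γ := funext hl.periodic
  have hd : HasFDerivAt (fun t : ℝ => t + 2 * Real.pi) (ContinuousLinearMap.id ℝ ℝ) t :=
    (hasFDerivAt_id t).add_const _
  have h2 := HasMFDerivAt.comp t
    (hl.smooth.mdifferentiable (by simp) (t + 2 * Real.pi)).hasMFDerivAt hd.hasMFDerivAt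
  rw [h1] at h2
  have h3 : (mfderiv 𝓘(ℝ) (𝓡 4) γ t : ℝ →L[ℝ] E4) = mfderiv 𝓘(ℝ) (𝓡 4) γ (t + 2 * Real.pi) :=
    h2.mfderiv
  exact (DFunLike.congr_fun h3 (1 : ℝ)).symm

theorem germ [IsManifold (𝓡 4) ∞ M] (hl : IsLoop σ γ C) (h : IsNearSymplectic σ) (t : ℝ) :
    IsNearSymplecticGerm (derivAt σ (γ t)) (velocity γ t) :=
  h.germ (hl.zero t) (hl.velocity_ne_zero t) (hl.tangent t)

end IsLoop

/-- The quadratic form of the normal derivative of `σ` along a loop of zeros. -/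
def loopForm (σ : DiffForm M 2) (γ : ℝ → M) (t : ℝ) : LinearMap.BilinForm ℝ E4 :=
  germForm (derivAt σ (γ t)) (velocity γ t)

theorem loopForm_periodic (hl : IsLoop σ γ C) (t : ℝ) :
    loopForm σ γ (t + 2 * Real.pi) = loopForm σ γ t := by
  rw [loopForm, hl.velocity_periodic, hl.periodic]
  rfl

variable [IsManifold (𝓡 4) ∞ M] [FiniteDimensional ℝ V]

theorem contDiff_loopForm (he : IsInjImmersion e) (h : IsNearSymplectic σ) (hl : IsLoop σ γ C)
    {u w : ℝ → E4} (hu : SmoothAlong e γ u) (hw : SmoothAlong e γ w) :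
    ContDiff ℝ ∞ fun t => loopForm σ γ t (u t) (w t) :=
  contDiff_derivAt_along he hl.smooth h.smooth hl.zero hu (smoothAlong_velocity he hl.smooth) hw

theorem contDiff_pf_along (he : IsInjImmersion e) (h : IsNearSymplectic σ) (hl : IsLoop σ γ C)
    {u : ℝ → E4} {f : Fin 4 → ℝ → E4} (hu : SmoothAlong e γ u) (hf : ∀ i, SmoothAlong e γ (f i)) :
    ContDiff ℝ ∞ fun t => pf (derivAt σ (γ t) (u t)) (fun i => f i t) := by
  have h1 : ∀ i j, ContDiff ℝ ∞ fun t => derivAt σ (γ t) (u t) ![f i t, f j t] := fun i j =>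
    contDiff_derivAt_along he hl.smooth h.smooth hl.zero hu (hf i) (hf j)
  unfold pf
  exact (((h1 _ _).mul (h1 _ _)).sub ((h1 _ _).mul (h1 _ _))).add ((h1 _ _).mul (h1 _ _))

/-- Linear independence as a basis. -/
theorem exists_basis_of_linearIndependent {f : Fin 4 → E4} (hf : LinearIndependent ℝ f) :
    ∃ b : Module.Basis (Fin 4) ℝ E4, ⇑b = f :=
  ⟨basisOfLinearIndependentOfCardEqFinrank hf (by simp), by simp⟩

/-- The negative field is `n`, with monodromy `ε`. Projecting a generic constant vector to the
tangent spaces gives `v`, periodic because `γ` is, and independent of the velocity and `n`.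
Positivity of the Pfaffian of `D n` on the frame confines the last vector to a half-space, so `q`
can be selected; this condition is unchanged when `n` and `q` are both multiplied by `ε`, so `q` has
the monodromy of `n`. -/
theorem IsLoop.exists_orthogonal_fields (hl : IsLoop σ γ C) (he : IsInjImmersion e)
    (h : IsNearSymplectic σ) : ∃ ε : ℝ, (ε = 1 ∨ ε = -1) ∧ ∃ v q n : ℝ → E4,
      SmoothAlong e γ v ∧ SmoothAlong e γ q ∧ SmoothAlong e γ n ∧
      (∀ t, v (t + 2 * Real.pi) = v t) ∧ (∀ t, q (t + 2 * Real.pi) = ε • q t) ∧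
      (∀ t, n (t + 2 * Real.pi) = ε • n t) ∧
      ∀ t, loopForm σ γ t (n t) (n t) < 0 ∧
        LinearIndependent ℝ ![velocity γ t, n t, v t, q t] := by
  have hL : ∀ t, dAt e (γ (t + 2 * Real.pi)) = dAt e (γ t) := fun t => by rw [hl.periodic]
  have hconst : ∀ t x, ∃ u, SmoothAlong e γ u ∧ u t = x := fun t x =>
    ⟨_, smoothAlong_pinv he hl.smooth (dAt e (γ t) x), pinv_apply_self (he.inj_der _) x⟩
  have hG := hl.germ h
  have hrad : ∀ t x, derivAt σ (γ t) x = 0 → loopForm σ γ t x x = 0 := fun t x hx => by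
    rw [loopForm, germForm_apply, hx]; rfl
  obtain ⟨ε, hε, n, hn, hnn, hnp⟩ := exists_negative_field (L := fun t => dAt e (γ t))
    (b := loopForm σ γ) Real.two_pi_pos hL (loopForm_periodic hl)
    (fun t x y => (hG t).germForm_symm x y) (fun t x y hx hy hxy => by
      rcases (hG t).pos_of_orthogonal (hl.posDir t) hx hxy with h1 | h1
      · exact absurd hy (not_lt.2 (le_of_lt h1))
      · exact hy.ne (hrad t y h1))
    (fun t => (hG t).exists_neg (hl.posDir t)) hconst
    (fun u w hu hw => (contDiff_loopForm he h hl hu hw).continuous)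
  have hεε : ε * ε = 1 := by rcases hε with rfl | rfl <;> norm_num
  have hτ := smoothAlong_velocity he hl.smooth
  obtain ⟨c, hc⟩ := exists_generic_vector (L := fun t => dAt e (γ t)) (fun t => he.inj_der _)
    (contDiff_proj_along he hl.smooth) hτ hn
  let v : ℝ → E4 := fun t => pinv (dAt e (γ t)) c
  have hv : SmoothAlong e γ v := smoothAlong_pinv he hl.smooth c
  have hvp : ∀ t, v (t + 2 * Real.pi) = v t := fun t => by simp only [v, hl.periodic]
  have hDn : ∀ t, derivAt σ (γ t) (n t) ≠ 0 := fun t h0 => (hnn t).ne (hrad t _ h0)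
  have hli : ∀ t, LinearIndependent ℝ ![velocity γ t, n t, v t] := by
    intro t
    have h1 : LinearIndependent ℝ ![velocity γ t, n t] := by
      rw [LinearIndependent.pair_iff' (hl.velocity_ne_zero t)]
      intro a ha
      apply hDn t
      rw [← ha, map_smul, hl.tangent, smul_zero]
    rw [show ![velocity γ t, n t, v t] = Fin.snoc ![velocity γ t, n t] (v t) by simp,
      linearIndependent_finSnoc]
    refine ⟨h1, fun hm => ?_⟩
    rw [Matrix.range_cons_cons_empty, Submodule.mem_span_pair] at hm
    obtain ⟨a, b, hab⟩ := hm
    exact hc t a b hab.symm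
  let K : ℝ → Set E4 := fun t => {x | 0 < pf (derivAt σ (γ t) (n t)) ![velocity γ t, n t, v t, x]}
  have hpf : ∀ (α : Λ[2]) (x y z w : E4), pf α ![x, y, z, w] =
      α ![x, y] * α ![z, w] - α ![x, z] * α ![y, w] + α ![x, w] * α ![y, z] := fun _ _ _ _ _ => rfl
  have hK : ∀ t x y (a b : ℝ), x ∈ K t → y ∈ K t → 0 ≤ a → 0 < b → a • x + b • y ∈ K t := by
    intro t x y a b hx hy ha hb
    have e1 : pf (derivAt σ (γ t) (n t)) ![velocity γ t, n t, v t, a • x + b • y] =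
        a * pf (derivAt σ (γ t) (n t)) ![velocity γ t, n t, v t, x] +
        b * pf (derivAt σ (γ t) (n t)) ![velocity γ t, n t, v t, y] := by
      simp only [hpf, form_add_right, form_smul_right]
      ring
    change 0 < pf (derivAt σ (γ t) (n t)) ![velocity γ t, n t, v t, a • x + b • y]
    rw [e1]
    exact add_pos_of_nonneg_of_pos (mul_nonneg ha (le_of_lt hx)) (mul_pos hb hy)
  have hinv : ∀ t x, pf (derivAt σ (γ (t + 2 * Real.pi)) (n (t + 2 * Real.pi)))
      ![velocity γ (t + 2 * Real.pi), n (t + 2 * Real.pi), v (t + 2 * Real.pi), ε • x] =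
      pf (derivAt σ (γ t) (n t)) ![velocity γ t, n t, v t, x] := by
    intro t x
    rw [hnp, hvp, hl.velocity_periodic, hl.periodic]
    simp only [hpf, form_smul_right, form_smul_left, map_smul, ContinuousAlternatingMap.smul_apply,
      smul_eq_mul]
    rcases hε with rfl | rfl <;> ring
  have hcontpf : ∀ q, SmoothAlong e γ q → Continuous fun t =>
      pf (derivAt σ (γ t) (n t)) ![velocity γ t, n t, v t, q t] := fun q hq =>
    (contDiff_pf_along he h hl hn (f := ![velocity γ, n, v, q]) (fun i => by
      fin_cases i
      · exact hτ
      · exact hn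
      · exact hv
      · exact hq)).continuous
  obtain ⟨q₀, hq₀, hq₀K⟩ := exists_smooth_selection (L := fun t => dAt e (γ t)) hK (fun t₀ => by
    obtain ⟨x, hx⟩ : ∃ x, x ∈ K t₀ := by
      obtain ⟨x, hx⟩ : ∃ x, x ∉ Submodule.span ℝ (range ![velocity γ t₀, n t₀, v t₀]) := by
        by_contra! hall
        have h1 := finrank_span_eq_card (hli t₀)
        rw [(Submodule.eq_top_iff').2 hall, finrank_top] at h1
        simp at h1
      have h4 : LinearIndependent ℝ (Fin.snoc ![velocity γ t₀, n t₀, v t₀] x : Fin 4 → E4) :=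
        linearIndependent_finSnoc.2 ⟨hli t₀, hx⟩
      obtain ⟨b, hb⟩ := exists_basis_of_linearIndependent h4
      have h5 := pf_ne_zero ((hG t₀).nondeg _ (hDn t₀)) b
      rw [hb, show (Fin.snoc ![velocity γ t₀, n t₀, v t₀] x : Fin 4 → E4) =
        ![velocity γ t₀, n t₀, v t₀, x] by simp] at h5
      rcases lt_or_gt_of_ne h5 with h5 | h5
      · refine ⟨(-1 : ℝ) • x, ?_⟩
        change 0 < pf _ _
        rw [hpf, form_smul_right, form_smul_right, form_smul_right]
        rw [hpf] at h5
        linarith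
      · exact ⟨x, h5⟩
    obtain ⟨u, hu, rfl⟩ := hconst t₀ x
    exact ⟨u, hu, (hcontpf u hu).continuousAt.eventually (lt_mem_nhds hx)⟩)
  obtain ⟨q, hq, hqK, hqp⟩ := exists_periodic_selection (L := fun t => dAt e (γ t)) hK
    Real.two_pi_pos hL hε (fun t x hx => by
      change 0 < pf (derivAt σ (γ (t + 2 * Real.pi)) (n (t + 2 * Real.pi)))
        ![velocity γ (t + 2 * Real.pi), n (t + 2 * Real.pi), v (t + 2 * Real.pi), ε • x]
      rw [hinv]
      exact hx) (fun t x hx => by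
      change 0 < pf (derivAt σ (γ t) (n t)) ![velocity γ t, n t, v t, ε • x]
      rw [← hinv, smul_smul, hεε, one_smul]
      exact hx) hq₀ hq₀K
  exact ⟨ε, hε, v, q, n, hv, hq, hn, hvp, hqp, hnp, fun t => ⟨hnn t,
    linearIndependent_of_pf_ne_zero (ne_of_gt (hqK t))⟩⟩

end Frames

/-! ### The two model forms along the axis -/

section ModelForms

/-- The form `a σ₁ + b σ₂ + c σ₃`. -/
def sd (a b c : ℝ) : Λ[2] := a • sigma1 + b • sigma2 + c • sigma3

theorem sd_apply (a b c : ℝ) (u v : E4) : sd a b c ![u, v] =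
    a * (u 0 * v 1 - u 1 * v 0 + (u 2 * v 3 - u 3 * v 2)) +
    b * (u 0 * v 2 - u 2 * v 0 + (u 3 * v 1 - u 1 * v 3)) +
    c * (u 0 * v 3 - u 3 * v 0 + (u 1 * v 2 - u 2 * v 1)) := by
  simp only [sd, sigma1, sigma2, sigma3, ContinuousAlternatingMap.add_apply,
    ContinuousAlternatingMap.smul_apply, dydy_apply, smul_eq_mul, Matrix.cons_val_zero,
    Matrix.cons_val_one]

theorem pf_sd (a b c : ℝ) : pf (sd a b c) stdVec = a ^ 2 + b ^ 2 + c ^ 2 := by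
  simp only [pf, sd_apply, stdVec, PiLp.single_apply, EuclideanSpace.single]
  simp
  ring

/-- A form on `ℝ⁴`, `2π`-periodic in `y 0`, vanishing on the axis with definite normal derivative. -/
structure IsAxisForm (m : E4 → Λ[2]) : Prop where
  smooth : ContDiff ℝ ∞ m
  periodic : ∀ y, m (y + (2 * Real.pi) • stdVec 0) = m y
  zero : ∀ t : ℝ, m (t • stdVec 0) = 0
  pos : ∀ (t : ℝ) (u : E4), (u 1 ≠ 0 ∨ u 2 ≠ 0 ∨ u 3 ≠ 0) →
    0 < pf (fderiv ℝ m (t • stdVec 0) u) stdVec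

/-- A closed axis form. -/
structure IsModelForm (m : E4 → Λ[2]) : Prop extends IsAxisForm m where
  closed : ∀ y u v w, fderiv ℝ m y u ![v, w] - fderiv ℝ m y v ![u, w] +
    fderiv ℝ m y w ![u, v] = 0

theorem hasFDerivAt_sd {a b c : E4 → ℝ} {a' b' c' : E4 →L[ℝ] ℝ} {y : E4}
    (ha : HasFDerivAt a a' y) (hb : HasFDerivAt b b' y) (hc : HasFDerivAt c c' y) (u : E4) :
    fderiv ℝ (fun y => sd (a y) (b y) (c y)) y u = sd (a' u) (b' u) (c' u) := by
  have h := ((ha.smul_const sigma1).add (hb.smul_const sigma2)).add (hc.smul_const sigma3)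
  have h' : HasFDerivAt (fun y => sd (a y) (b y) (c y)) _ y := h
  rw [h'.fderiv]
  rfl

theorem omegaA_eq (y : E4) : omegaA y = sd (y 1) (y 2) (-2 * y 3) := by
  simp only [omegaA, sd]
  module

theorem omegaB_eq (R : ℝ) (y : E4) : omegaB R y =
    sd ((y 1 * Real.cos (y 0) + y 2 * Real.sin (y 0)) * Real.exp (y 3) - R * y 1)
      ((y 1 * Real.sin (y 0) - y 2 * Real.cos (y 0)) * Real.exp (y 3)) (R * y 3) := by
  simp only [omegaB, sd]
  module

theorem fderiv_omegaA (y u : E4) : fderiv ℝ omegaA y u = sd (u 1) (u 2) (-2 * u 3) := by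
  have h : ∀ i : Fin 4, HasFDerivAt (fun y : E4 => y i) (EuclideanSpace.proj i : E4 →L[ℝ] ℝ) y :=
    fun i => (EuclideanSpace.proj i : E4 →L[ℝ] ℝ).hasFDerivAt
  rw [show omegaA = fun y => sd (y 1) (y 2) (-2 * y 3) from funext omegaA_eq,
    hasFDerivAt_sd (h 1) (h 2) ((h 3).const_mul (-2)) u]
  rfl

theorem fderiv_omegaB (R : ℝ) (y u : E4) : fderiv ℝ (omegaB R) y u =
    sd ((u 1 * Real.cos (y 0) + u 2 * Real.sin (y 0) +
        (y 2 * Real.cos (y 0) - y 1 * Real.sin (y 0)) * u 0 +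
        (y 1 * Real.cos (y 0) + y 2 * Real.sin (y 0)) * u 3) * Real.exp (y 3) - R * u 1)
      ((u 1 * Real.sin (y 0) - u 2 * Real.cos (y 0) +
        (y 1 * Real.cos (y 0) + y 2 * Real.sin (y 0)) * u 0 +
        (y 1 * Real.sin (y 0) - y 2 * Real.cos (y 0)) * u 3) * Real.exp (y 3)) (R * u 3) := by
  have h : ∀ i : Fin 4, HasFDerivAt (fun y : E4 => y i) (EuclideanSpace.proj i : E4 →L[ℝ] ℝ) y :=
    fun i => (EuclideanSpace.proj i : E4 →L[ℝ] ℝ).hasFDerivAt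
  rw [show omegaB R = _ from funext (omegaB_eq R)]
  refine (hasFDerivAt_sd
    (((((h 1).mul (h 0).cos).add ((h 2).mul (h 0).sin)).mul (h 3).exp).sub ((h 1).const_mul R))
    ((((h 1).mul (h 0).sin).sub ((h 2).mul (h 0).cos)).mul (h 3).exp)
    ((h 3).const_mul R) u).trans ?_
  have hp : ∀ i : Fin 4, (EuclideanSpace.proj i : E4 →L[ℝ] ℝ) u = u i := fun _ => rfl
  simp only [_root_.add_apply, _root_.sub_apply, _root_.smul_apply, smul_eq_mul, Pi.mul_apply,
    Pi.add_apply, Pi.sub_apply, hp]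
  congr 1 <;> ring

theorem isModelForm_omegaA : IsModelForm omegaA where
  smooth := by
    have h : ∀ i : Fin 4, ContDiff ℝ ∞ fun y : E4 => y i := fun i =>
      (EuclideanSpace.proj i : E4 →L[ℝ] ℝ).contDiff
    rw [show omegaA = _ from funext omegaA_eq]
    exact (((h 1).smul contDiff_const).add ((h 2).smul contDiff_const)).add
      ((contDiff_const.mul (h 3)).smul contDiff_const)
  closed y u v w := by
    simp only [fderiv_omegaA, sd_apply]
    ring
  periodic y := by simp [omegaA_eq, stdVec]
  zero t := by simp [omegaA_eq, stdVec, sd]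
  pos t u hu := by
    rw [fderiv_omegaA, pf_sd]
    rcases hu with h | h | h <;> have := sq_pos_of_ne_zero h <;>
      nlinarith [sq_nonneg (u 1), sq_nonneg (u 2), sq_nonneg (u 3)]

theorem isModelForm_omegaB {R : ℝ} (hR0 : 0 < R) (hR1 : R < 1) : IsModelForm (omegaB R) where
  smooth := by
    have h : ∀ i : Fin 4, ContDiff ℝ ∞ fun y : E4 => y i := fun i =>
      (EuclideanSpace.proj i : E4 →L[ℝ] ℝ).contDiff
    rw [show omegaB R = _ from funext (omegaB_eq R)]
    exact (((((((h 1).mul (h 0).cos).add ((h 2).mul (h 0).sin)).mul (h 3).exp).sub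
      (contDiff_const.mul (h 1))).smul contDiff_const).add
      (((((h 1).mul (h 0).sin).sub ((h 2).mul (h 0).cos)).mul (h 3).exp).smul contDiff_const)).add
      ((contDiff_const.mul (h 3)).smul contDiff_const)
  closed y u v w := by
    simp only [fderiv_omegaB, sd_apply]
    ring
  periodic y := by simp [omegaB_eq, stdVec]
  zero t := by simp [omegaB_eq, stdVec, sd]
  pos t u hu := by
    rw [fderiv_omegaB, pf_sd]
    simp only [stdVec, PiLp.smul_apply, EuclideanSpace.single, PiLp.single_apply, smul_eq_mul]
    simp only [Fin.reduceEq, if_false, if_true, mul_zero, mul_one, Real.exp_zero, zero_mul, sub_zero,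
      add_zero]
    have hcs := Real.sin_sq_add_cos_sq t
    set c := Real.cos t
    set s := Real.sin t
    by_contra hle
    have q1 := sq_nonneg (u 1 * c + u 2 * s - R * u 1)
    have q2 := sq_nonneg (u 1 * s - u 2 * c)
    have q3 := sq_nonneg (R * u 3)
    have h3 : R * u 3 = 0 := pow_eq_zero_iff two_ne_zero |>.1 (by linarith)
    have h2 : u 1 * s - u 2 * c = 0 := pow_eq_zero_iff two_ne_zero |>.1 (by linarith)
    have h1 : u 1 * c + u 2 * s - R * u 1 = 0 := pow_eq_zero_iff two_ne_zero |>.1 (by linarith)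
    -- The matrix with rows `(cos t, sin t)` and `(sin t, -cos t)` is an isometry, so a zero
    -- satisfies `|(u₁, u₂)| = R |u₁|`; this is where `R < 1` matters.
    have e1 : u 1 ^ 2 + u 2 ^ 2 = R ^ 2 * u 1 ^ 2 := by
      have : (u 1 * c + u 2 * s) ^ 2 + (u 1 * s - u 2 * c) ^ 2 = u 1 ^ 2 + u 2 ^ 2 := by
        linear_combination (u 1 ^ 2 + u 2 ^ 2) * hcs
      rw [h2, show u 1 * c + u 2 * s = R * u 1 by linarith] at this
      linarith
    have hR2 : R ^ 2 < 1 := by nlinarith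
    have z1 : u 1 ^ 2 = 0 := by nlinarith [sq_nonneg (u 1), sq_nonneg (u 2)]
    have z2 : u 2 ^ 2 = 0 := by rw [z1] at e1; linarith
    rcases hu with h | h | h
    · exact h (pow_eq_zero_iff (by norm_num) |>.1 z1)
    · exact h (pow_eq_zero_iff (by norm_num) |>.1 z2)
    · exact h ((mul_eq_zero.1 h3).resolve_left hR0.ne')

end ModelForms

/-! ### Frames adapted to a model form -/

section Frames

theorem pf_neg_frame (α : Λ[2]) (x u v w : E4) :
    pf α ![x, (-1 : ℝ) • u, (-1 : ℝ) • v, (-1 : ℝ) • w] = -pf α ![x, u, v, w] := by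
  simp only [pf, Matrix.cons_val, form_smul_left, form_smul_right]
  ring

theorem pf_smul (c : ℝ) (α : Λ[2]) (u : Fin 4 → E4) :
    pf (c • α) u = c ^ 2 * pf α u := by
  simp only [pf, ContinuousAlternatingMap.smul_apply, smul_eq_mul]
  ring

namespace IsNearSymplecticGerm

variable {D : E4 →L[ℝ] Λ[2]} {X : E4} (h : IsNearSymplecticGerm D X)
include h

/-- If `D` vanishes somewhere on the segment from `u` to `w`, then `D w` is a multiple of `D u` and
the Pfaffian changes by a square. Otherwise `pf_same_sign` applies. -/
theorem pf_pos (b : Module.Basis (Fin 4) ℝ E4) {u w : E4} (hu : 0 < pf (D u) b) (hw : D w ≠ 0) :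
    0 < pf (D w) b := by
  by_cases hs : ∀ t ∈ Icc (0 : ℝ) 1, D (u + t • (w - u)) ≠ 0
  · exact (mul_pos_iff_of_pos_left hu).1 (h.pf_same_sign b hs)
  · push Not at hs
    obtain ⟨t, ht, h0⟩ := hs
    rw [map_add, map_smul, map_sub] at h0
    have ht0 : t ≠ 0 := by
      rintro rfl
      rw [zero_smul, add_zero] at h0
      rw [h0] at hu
      simp [pf] at hu
    have e : D w = (-(1 - t) / t) • D u := by
      have : t • D w = (-(1 - t)) • D u := by
        rw [← sub_eq_zero, ← h0]
        module
      rw [div_eq_inv_mul, ← smul_smul, ← this, smul_smul, inv_mul_cancel₀ ht0, one_smul]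
    rw [e, pf_smul]
    refine mul_pos (sq_pos_of_ne_zero fun h1 => hw ?_) hu
    rw [e, h1, zero_smul]

/-- Vectors with nondegenerate pairing matrix complete the kernel to a basis. -/
theorem linearIndependent_of_pairing {f : Fin 3 → E4}
    (hf : ∀ c : Fin 3 → ℝ, (∀ j, germForm D X (∑ i, c i • f i) (f j) = 0) → c = 0) :
    LinearIndependent ℝ ![X, f 0, f 1, f 2] := by
  rw [Fintype.linearIndependent_iff]
  intro c hc
  rw [Fin.sum_univ_four] at hc
  change c 0 • X + c 1 • f 0 + c 2 • f 1 + c 3 • f 2 = 0 at hc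
  have h1 : ∑ i, ![c 1, c 2, c 3] i • f i = -(c 0 • X) := by
    rw [Fin.sum_univ_three, eq_neg_iff_add_eq_zero, ← hc]
    simp only [Matrix.cons_val]
    abel
  have h2 := hf ![c 1, c 2, c 3] fun j => by
    rw [h1, germForm_apply, map_neg, map_smul, h.apply_self]
    simp
  have z1 : c 1 = 0 := congrFun h2 0
  have z2 : c 2 = 0 := congrFun h2 1
  have z3 : c 3 = 0 := congrFun h2 2
  have z0 : c 0 = 0 := by
    rw [z1, z2, z3] at hc
    simpa [h.ne_zero] using hc
  intro i
  fin_cases i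
  · exact z0
  · exact z1
  · exact z2
  · exact z3

end IsNearSymplecticGerm

variable {M : Type*} [TopologicalSpace M] [ChartedSpace E4 M]
  {V : Type*} [NormedAddCommGroup V] [InnerProductSpace ℝ V]
  {σ : DiffForm M 2} {γ : ℝ → M} {C : Set M} {e : M → V}

/-- A periodic frame of the normal bundle of a loop of zeros of `σ` in which the derivative of `σ`
looks like that of `m` along the axis. -/
structure IsAdaptedFrame (σ : DiffForm M 2) (γ : ℝ → M) (e : M → V)
    (m : E4 → Λ[2]) (f : Fin 3 → ℝ → E4) : Prop where
  smooth : ∀ i, SmoothAlong e γ (f i)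
  periodic : ∀ i t, f i (t + 2 * Real.pi) = f i t
  linearIndependent : ∀ t, LinearIndependent ℝ ![velocity γ t, f 0 t, f 1 t, f 2 t]
  pairing : ∀ t i j, derivAt σ (γ t) (f i t) ![velocity γ t, f j t] =
    fderiv ℝ m (t • stdVec 0) (stdVec i.succ) ![stdVec 0, stdVec j.succ]
  pos : ∀ t u, derivAt σ (γ t) u ≠ 0 →
    0 < pf (derivAt σ (γ t) u) ![velocity γ t, f 0 t, f 1 t, f 2 t]

variable [IsManifold (𝓡 4) ∞ M] [FiniteDimensional ℝ V]

/-- A section on which the quadratic form has a constant sign `s` can be normalised. -/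
theorem IsLoop.exists_normalized (hl : IsLoop σ γ C) (he : IsInjImmersion e)
    (h : IsNearSymplectic σ) {u : ℝ → E4} (hu : SmoothAlong e γ u) {s ε : ℝ}
    (hs : ∀ t, 0 < s * loopForm σ γ t (u t) (u t)) (hs1 : s * s = 1)
    (hε : ε * ε = 1) (hup : ∀ t, u (t + 2 * Real.pi) = ε • u t) :
    ∃ a : ℝ → ℝ, (∀ t, 0 < a t) ∧ SmoothAlong e γ (fun t => a t • u t) ∧
      (∀ t, a (t + 2 * Real.pi) • u (t + 2 * Real.pi) = ε • a t • u t) ∧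
      ∀ t, loopForm σ γ t (a t • u t) (a t • u t) = s := by
  let g : ℝ → ℝ := fun t => s * loopForm σ γ t (u t) (u t)
  have hg : ContDiff ℝ ∞ g := contDiff_const.mul (contDiff_loopForm he h hl hu hu)
  refine ⟨fun t => (Real.sqrt (g t))⁻¹, fun t => inv_pos.2 (Real.sqrt_pos.2 (hs t)),
    SmoothAlong.smul ((hg.sqrt fun t => (hs t).ne').inv fun t => (Real.sqrt_pos.2 (hs t)).ne') hu,
    fun t => ?_, fun t => ?_⟩
  · have : g (t + 2 * Real.pi) = g t := by
      simp only [g, loopForm_periodic hl, hup, map_smul, LinearMap.smul_apply, smul_eq_mul]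
      linear_combination s * loopForm σ γ t (u t) (u t) * hε
    change (Real.sqrt (g (t + 2 * Real.pi)))⁻¹ • u (t + 2 * Real.pi) = ε • (Real.sqrt (g t))⁻¹ • u t
    rw [this, hup, smul_comm]
  · simp only [map_smul, LinearMap.smul_apply, smul_eq_mul]
    have h1 : loopForm σ γ t (u t) (u t) = s * g t := by
      simp only [g]
      linear_combination -(loopForm σ γ t (u t) (u t)) * hs1
    have h2 : (Real.sqrt (g t))⁻¹ * (Real.sqrt (g t))⁻¹ * g t = 1 := by
      rw [← mul_inv, Real.mul_self_sqrt (hs t).le, inv_mul_cancel₀ (hs t).ne']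
    rw [h1]
    linear_combination s * h2

/-- Gram–Schmidt for the Lorentzian form, starting from `n`; its components are removed with a plus
sign since it has square `-1`. Whatever is orthogonal to `n` and independent of the velocity is
positive by `pos_of_orthogonal`, so it can be normalised. Each correction term has the monodromy of
the field that it corrects. -/
theorem IsLoop.exists_orthonormal_fields (hl : IsLoop σ γ C) (he : IsInjImmersion e)
    (h : IsNearSymplectic σ) : ∃ ε : ℝ, (ε = 1 ∨ ε = -1) ∧ ∃ v q n : ℝ → E4,
      SmoothAlong e γ v ∧ SmoothAlong e γ q ∧ SmoothAlong e γ n ∧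
      (∀ t, v (t + 2 * Real.pi) = v t) ∧ (∀ t, q (t + 2 * Real.pi) = ε • q t) ∧
      (∀ t, n (t + 2 * Real.pi) = ε • n t) ∧
      ∀ t, loopForm σ γ t (v t) (v t) = 1 ∧ loopForm σ γ t (q t) (q t) = 1 ∧
        loopForm σ γ t (n t) (n t) = -1 ∧ loopForm σ γ t (v t) (q t) = 0 ∧
        loopForm σ γ t (v t) (n t) = 0 ∧ loopForm σ γ t (q t) (n t) = 0 := by
  obtain ⟨ε, hε, v, q, n, hv, hq, hn, hvp, hqp, hnp, hvqn⟩ := hl.exists_orthogonal_fields he h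
  have hεε : ε * ε = 1 := by rcases hε with rfl | rfl <;> norm_num
  have hG := hl.germ h
  have hsymm : ∀ t x y, loopForm σ γ t x y = loopForm σ γ t y x := fun t x y =>
    (hG t).germForm_symm x y
  obtain ⟨a, ha, hns, hna, hnn⟩ := hl.exists_normalized he h hn (s := -1)
    (fun t => by linarith [(hvqn t).1]) (by norm_num) hεε hnp
  set n' : ℝ → E4 := fun t => a t • n t
  let v₁ : ℝ → E4 := fun t => v t + loopForm σ γ t (v t) (n' t) • n' t
  have hv₁ : SmoothAlong e γ v₁ := hv.add (hns.smul (contDiff_loopForm he h hl hv hns))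
  have hindep : ∀ t (x y z w : ℝ), x • velocity γ t + y • n t + z • v t + w • q t = 0 →
      z = 0 ∧ w = 0 := fun t x y z w h0 => by
    have := Fintype.linearIndependent_iff.1 (hvqn t).2 ![x, y, z, w] (by
      rw [Fin.sum_univ_four]; exact h0)
    exact ⟨this 2, this 3⟩
  have hv₁n : ∀ t, loopForm σ γ t (n' t) (v₁ t) = 0 := fun t => by
    simp only [v₁, map_add, map_smul, smul_eq_mul]
    rw [hnn, hsymm t (v t)]
    ring
  have hneg : ∀ t, germForm (derivAt σ (γ t)) (velocity γ t) (n' t) (n' t) < 0 := fun t => by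
    have := hnn t
    rw [loopForm] at this
    rw [this]; norm_num
  have hv₁pos : ∀ t, 0 < 1 * loopForm σ γ t (v₁ t) (v₁ t) := fun t => by
    rw [one_mul]
    rcases (hG t).pos_of_orthogonal (hl.posDir t) (hneg t) (hv₁n t) with h1 | h1
    · exact h1
    · obtain ⟨c, hc⟩ := ((hG t).kernel _).1 h1
      have := hindep t (-c) (loopForm σ γ t (v t) (n' t) * a t) 1 0 (by
        have h3 : v t + (loopForm σ γ t (v t) (n' t) * a t) • n t = c • velocity γ t := by
          rw [← hc, mul_smul]
        rw [neg_smul, ← h3]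
        module)
      exact absurd this.1 one_ne_zero
  have hv₁p : ∀ t, v₁ (t + 2 * Real.pi) = (1 : ℝ) • v₁ t := fun t => by
    have hn'p : n' (t + 2 * Real.pi) = ε • n' t := hna t
    simp only [v₁, hn'p, hvp, loopForm_periodic hl, map_smul, smul_eq_mul, smul_smul, one_smul]
    rw [mul_right_comm, hεε, one_mul]
  obtain ⟨b, hb, hvs, hvb, hvv⟩ := hl.exists_normalized he h hv₁ (s := 1) hv₁pos (by norm_num)
    (by norm_num) hv₁p
  set v' : ℝ → E4 := fun t => b t • v₁ t with hv'
  have hvn' : ∀ t, loopForm σ γ t (v' t) (n' t) = 0 := fun t => by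
    rw [hsymm]
    simp only [hv', map_smul, hv₁n, smul_zero]
  let q₁ : ℝ → E4 := fun t => (q t + loopForm σ γ t (q t) (n' t) • n' t) -
    loopForm σ γ t (q t) (v' t) • v' t
  have hq₁ : SmoothAlong e γ q₁ := (hq.add (hns.smul (contDiff_loopForm he h hl hq hns))).sub
    (hvs.smul (contDiff_loopForm he h hl hq hvs))
  have hq₁n : ∀ t, loopForm σ γ t (n' t) (q₁ t) = 0 := fun t => by
    simp only [q₁, map_add, map_sub, map_smul, smul_eq_mul]
    rw [hnn, hsymm t (q t) (n' t), hsymm t (n' t) (v' t), hvn']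
    ring
  have hq₁v : ∀ t, loopForm σ γ t (v' t) (q₁ t) = 0 := fun t => by
    simp only [q₁, map_add, map_sub, map_smul, smul_eq_mul]
    rw [hvv, hsymm t (v' t) (q t), hvn']
    ring
  have hq₁pos : ∀ t, 0 < 1 * loopForm σ γ t (q₁ t) (q₁ t) := fun t => by
    rw [one_mul]
    rcases (hG t).pos_of_orthogonal (hl.posDir t) (hneg t) (hq₁n t) with h1 | h1
    · exact h1
    · obtain ⟨c, hc⟩ := ((hG t).kernel _).1 h1
      have := hindep t (-c) (loopForm σ γ t (q t) (n' t) * a t - loopForm σ γ t (q t) (v' t) * b t *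
          (loopForm σ γ t (v t) (n' t) * a t)) (-(loopForm σ γ t (q t) (v' t) * b t)) 1 (by
        have h3 : (q t + loopForm σ γ t (q t) (n' t) • (a t • n t)) -
            loopForm σ γ t (q t) (v' t) • (b t • (v t + loopForm σ γ t (v t) (n' t) • (a t • n t)))
            = c • velocity γ t := hc
        rw [neg_smul, ← h3]
        module)
      exact absurd this.2 one_ne_zero
  have hq₁p : ∀ t, q₁ (t + 2 * Real.pi) = ε • q₁ t := fun t => by
    have hn'p : n' (t + 2 * Real.pi) = ε • n' t := hna t
    have hv'p : v' (t + 2 * Real.pi) = v' t := by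
      have := hvb t
      rwa [one_smul] at this
    simp only [q₁, hn'p, hv'p, hqp, loopForm_periodic hl, map_smul, smul_eq_mul,
      LinearMap.smul_apply, smul_smul, smul_sub, smul_add]
    rw [show ε * (ε * loopForm σ γ t (q t) (n' t)) * ε = ε * loopForm σ γ t (q t) (n' t) by
      linear_combination ε * loopForm σ γ t (q t) (n' t) * hεε]
  obtain ⟨k, hk, hqs, hqk, hqq⟩ := hl.exists_normalized he h hq₁ (s := 1) hq₁pos (by norm_num)
    hεε hq₁p
  refine ⟨ε, hε, v', fun t => k t • q₁ t, n', hvs, hqs, hns, fun t => ?_, hqk, hna, fun t =>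
    ⟨hvv t, hqq t, hnn t, ?_, hvn' t, ?_⟩⟩
  · have := hvb t
    rwa [one_smul] at this
  · rw [map_smul, hq₁v, smul_zero]
  · rw [hsymm, map_smul, hq₁n, smul_zero]

/-- Positivity of `m` makes its pairing matrix invertible, so the three fields and the velocity are
independent and the Pfaffian on them keeps a constant sign. If that sign is negative, all three
fields are negated: the pairing is quadratic in them, while the Pfaffian is odd. -/
theorem IsLoop.exists_adaptedFrame_of_pairing (hl : IsLoop σ γ C) (he : IsInjImmersion e)
    (h : IsNearSymplectic σ) {m : E4 → Λ[2]} (hm : IsModelForm m)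
    {f : Fin 3 → ℝ → E4} (hf : ∀ i, SmoothAlong e γ (f i))
    (hfp : ∀ i t, f i (t + 2 * Real.pi) = f i t)
    (hpair : ∀ t i j, loopForm σ γ t (f i t) (f j t) =
      fderiv ℝ m (t • stdVec 0) (stdVec i.succ) ![stdVec 0, stdVec j.succ]) :
    ∃ f, IsAdaptedFrame σ γ e m f := by
  have hG := hl.germ h
  have hns : ∀ t (c : Fin 3 → ℝ), (∀ j, loopForm σ γ t (∑ i, c i • f i t) (f j t) = 0) →
      c = 0 := by
    intro t c hc
    by_contra hne
    let u : E4 := ∑ i, c i • stdVec i.succ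
    have hu : ∀ i, u (Fin.succ i) = c i := fun i => by
      simp only [u, Fin.sum_univ_three, stdVec]
      fin_cases i <;> simp
    have h0 : ∀ j : Fin 3, fderiv ℝ m (t • stdVec 0) u ![stdVec 0, stdVec j.succ] = 0 := fun j => by
      rw [← hc j]
      simp only [u, map_sum, map_smul, ContinuousAlternatingMap.sum_apply,
        ContinuousAlternatingMap.smul_apply, LinearMap.sum_apply, LinearMap.smul_apply, hpair]
    refine (hm.pos t u ?_).ne' ?_
    · by_contra! hall
      refine hne (funext fun i => ?_)
      rw [← hu]
      fin_cases i
      · exact hall.1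
      · exact hall.2.1
      · exact hall.2.2
    · have h1 := h0 0
      have h2 := h0 1
      have h3 := h0 2
      simp only [Fin.succ_zero_eq_one, Fin.succ_one_eq_two, show Fin.succ (2 : Fin 3) = 3 from rfl]
        at h1 h2 h3
      rw [pf, h1, h2, h3]
      ring
  have hli : ∀ t, LinearIndependent ℝ ![velocity γ t, f 0 t, f 1 t, f 2 t] := fun t =>
    (hG t).linearIndependent_of_pairing (f := fun i => f i t) (hns t)
  have hD0 : ∀ t, derivAt σ (γ t) (f 0 t) ≠ 0 := fun t h0 => by
    have := hns t ![1, 0, 0] fun j => by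
      rw [Fin.sum_univ_three]
      simp only [Matrix.cons_val, one_smul, zero_smul, add_zero]
      rw [loopForm, germForm_apply, h0]
      rfl
    exact one_ne_zero (congrFun this 0)
  have hcont : Continuous fun t =>
      pf (derivAt σ (γ t) (f 0 t)) ![velocity γ t, f 0 t, f 1 t, f 2 t] := by
    refine (contDiff_pf_along he h hl (hf 0) (f := ![velocity γ, f 0, f 1, f 2])
      (fun i => ?_)).continuous.congr fun t => ?_
    · fin_cases i
      · exact smoothAlong_velocity he hl.smooth
      · exact hf 0
      · exact hf 1
      · exact hf 2
    · congr 1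
      ext i
      fin_cases i <;> rfl
  have hne : ∀ t, pf (derivAt σ (γ t) (f 0 t)) ![velocity γ t, f 0 t, f 1 t, f 2 t] ≠ 0 := by
    intro t
    obtain ⟨b, hb⟩ := exists_basis_of_linearIndependent (hli t)
    rw [← hb]
    exact pf_ne_zero ((hG t).nondeg _ (hD0 t)) b
  rcases lt_or_gt_of_ne (hne 0) with h0 | h0
  · have hneg : ∀ t, pf (derivAt σ (γ t) (f 0 t)) ![velocity γ t, f 0 t, f 1 t, f 2 t] < 0 :=
      fun t => sign_const_of_ne_zero isPreconnected_univ hcont.continuousOn (fun t _ => hne t)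
        (mem_univ 0) (mem_univ t) h0
    have hli' : ∀ t, LinearIndependent ℝ ![velocity γ t, (-1 : ℝ) • f 0 t, (-1 : ℝ) • f 1 t,
        (-1 : ℝ) • f 2 t] := fun t => linearIndependent_of_pf_ne_zero
      (α := derivAt σ (γ t) (f 0 t)) (by rw [pf_neg_frame]; exact neg_ne_zero.2 (hne t))
    refine ⟨fun i t => (-1 : ℝ) • f i t, fun i => SmoothAlong.smul contDiff_const (hf i),
      fun i t => by simp only [hfp], hli', fun t i j => ?_, fun t u hu => ?_⟩
    · rw [← hpair, map_smul, form_smul_right, ContinuousAlternatingMap.smul_apply, smul_eq_mul,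
        loopForm, germForm_apply]
      ring
    · obtain ⟨b, hb⟩ := exists_basis_of_linearIndependent (hli' t)
      rw [← hb]
      refine (hG t).pf_pos b (u := f 0 t) ?_ hu
      rw [hb, pf_neg_frame]
      exact neg_pos.2 (hneg t)
  · have hpos : ∀ t, 0 < pf (derivAt σ (γ t) (f 0 t)) ![velocity γ t, f 0 t, f 1 t, f 2 t] :=
      fun t => by
      have := sign_const_of_ne_zero isPreconnected_univ hcont.neg.continuousOn
        (fun t _ => neg_ne_zero.2 (hne t)) (mem_univ 0) (mem_univ t) (neg_neg_of_pos h0)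
      exact neg_neg_iff_pos.1 this
    refine ⟨f, hf, hfp, hli, hpair, fun t u hu => ?_⟩
    obtain ⟨b, hb⟩ := exists_basis_of_linearIndependent (hli t)
    have := hpos t
    rw [← hb] at this ⊢
    exact (hG t).pf_pos b this hu

/-- The pairing matrix of `ω_A` is `diag(1, 1, -2)`. That of `ω_B` is `R` on `x₃` and, on `(x₁,
x₂)`, the reflection with rows `(cos t, sin t)`, `(sin t, -cos t)` minus `R` in the first entry. The
half-angle rotation that diagonalises the reflection is only antiperiodic, which matches `q` and `n`
when `ε = -1`. -/
theorem IsLoop.exists_adaptedFrame (hl : IsLoop σ γ C) (he : IsInjImmersion e)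
    (h : IsNearSymplectic σ) {R : ℝ} (hR0 : 0 < R) (hR1 : R < 1) :
    ∃ m, (m = omegaA ∨ m = omegaB R) ∧ IsModelForm m ∧ ∃ f, IsAdaptedFrame σ γ e m f := by
  obtain ⟨ε, hε, v, q, n, hv, hq, hn, hvp, hqp, hnp, hon⟩ := hl.exists_orthonormal_fields he h
  have hsymm : ∀ t x y, loopForm σ γ t x y = loopForm σ γ t y x := fun t x y =>
    (hl.germ h t).germForm_symm x y
  have hvv := fun t => (hon t).1
  have hqq := fun t => (hon t).2.1
  have hnn := fun t => (hon t).2.2.1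
  have hvq := fun t => (hon t).2.2.2.1
  have hvn := fun t => (hon t).2.2.2.2.1
  have hqn := fun t => (hon t).2.2.2.2.2
  have hqv : ∀ t, loopForm σ γ t (q t) (v t) = 0 := fun t => by rw [hsymm, hvq]
  have hnv : ∀ t, loopForm σ γ t (n t) (v t) = 0 := fun t => by rw [hsymm, hvn]
  have hnq : ∀ t, loopForm σ γ t (n t) (q t) = 0 := fun t => by rw [hsymm, hqn]
  rcases hε with rfl | rfl
  · refine ⟨omegaA, Or.inl rfl, isModelForm_omegaA, hl.exists_adaptedFrame_of_pairing he h
      isModelForm_omegaA (f := ![v, q, fun t => Real.sqrt 2 • n t]) (fun i => ?_) (fun i t => ?_)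
      fun t i j => ?_⟩
    · fin_cases i
      · exact hv
      · exact hq
      · exact SmoothAlong.smul contDiff_const hn
    · fin_cases i
      · exact hvp t
      · exact (hqp t).trans (one_smul _ _)
      · change Real.sqrt 2 • n (t + 2 * Real.pi) = Real.sqrt 2 • n t
        rw [hnp, one_smul]
    · rw [fderiv_omegaA, sd_apply]
      have h2 : Real.sqrt 2 * Real.sqrt 2 = 2 := Real.mul_self_sqrt (by norm_num)
      fin_cases i <;> fin_cases j <;> simp [stdVec, hvv, hqq, hnn, hvq, hvn, hqn, hqv, hnv, hnq, h2]
  · let c : ℝ → ℝ := fun t => Real.cos (t / 2)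
    let s : ℝ → ℝ := fun t => Real.sin (t / 2)
    have hcs : ∀ t, s t ^ 2 + c t ^ 2 = 1 := fun t => Real.sin_sq_add_cos_sq (t / 2)
    have hc : ContDiff ℝ ∞ c := Real.contDiff_cos.comp (contDiff_id.div_const 2)
    have hs : ContDiff ℝ ∞ s := Real.contDiff_sin.comp (contDiff_id.div_const 2)
    have hcp : ∀ t, c (t + 2 * Real.pi) = -c t := fun t => by
      simp only [c]
      rw [show (t + 2 * Real.pi) / 2 = t / 2 + Real.pi by ring, Real.cos_add_pi]
    have hsp : ∀ t, s (t + 2 * Real.pi) = -s t := fun t => by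
      simp only [s]
      rw [show (t + 2 * Real.pi) / 2 = t / 2 + Real.pi by ring, Real.sin_add_pi]
    -- In the half-angle basis the `(x₁, x₂)` block has diagonal entries `1 - R c²`, `-(1 + R s²)`
    -- and off-diagonal entry `R s c`. Completing the square with coefficient `k` leaves `B > 0` and
    -- `-A < 0`; the fields `f₀`, `f₁` undo the rotation.
    let A : ℝ → ℝ := fun t => 1 + R * s t ^ 2
    have hA : ContDiff ℝ ∞ A := contDiff_const.add (contDiff_const.mul (hs.pow 2))
    have hApos : ∀ t, 0 < A t := fun t => by
      have := mul_nonneg hR0.le (sq_nonneg (s t))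
      simp only [A]
      linarith
    have hAp : ∀ t, A (t + 2 * Real.pi) = A t := fun t => by simp only [A, hsp, neg_sq]
    let k : ℝ → ℝ := fun t => R * s t * c t / A t
    have hk : ContDiff ℝ ∞ k := ((contDiff_const.mul hs).mul hc).div hA fun t => (hApos t).ne'
    have hkA : ∀ t, k t * A t = R * s t * c t := fun t => div_mul_cancel₀ _ (hApos t).ne'
    have hkp : ∀ t, k (t + 2 * Real.pi) = k t := fun t => by simp only [k, hAp, hsp, hcp]; ring
    let B : ℝ → ℝ := fun t => 1 - R * c t ^ 2 + k t ^ 2 * A t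
    have hB : ContDiff ℝ ∞ B :=
      (contDiff_const.sub (contDiff_const.mul (hc.pow 2))).add ((hk.pow 2).mul hA)
    have hBpos : ∀ t, 0 < B t := fun t => by
      have h1 := mul_nonneg (sq_nonneg (k t)) (hApos t).le
      have h2 : c t ^ 2 ≤ 1 := by nlinarith [hcs t, sq_nonneg (s t)]
      simp only [B]
      nlinarith [sq_nonneg (c t)]
    have hBp : ∀ t, B (t + 2 * Real.pi) = B t := fun t => by simp only [B, hkp, hAp, hcp, neg_sq]
    let a : ℝ → ℝ := fun t => Real.sqrt (A t)
    let b : ℝ → ℝ := fun t => Real.sqrt (B t)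
    have ha : ContDiff ℝ ∞ a := hA.sqrt fun t => (hApos t).ne'
    have hb : ContDiff ℝ ∞ b := hB.sqrt fun t => (hBpos t).ne'
    have haa : ∀ t, a t * a t = A t := fun t => Real.mul_self_sqrt (hApos t).le
    have hbb : ∀ t, b t * b t = B t := fun t => Real.mul_self_sqrt (hBpos t).le
    have hap : ∀ t, a (t + 2 * Real.pi) = a t := fun t => by simp only [a, hAp]
    have hbp : ∀ t, b (t + 2 * Real.pi) = b t := fun t => by simp only [b, hBp]
    have hRR : Real.sqrt R * Real.sqrt R = R := Real.mul_self_sqrt hR0.le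
    let f₀ : ℝ → E4 := fun t => (c t * b t) • q t - ((c t * k t + s t) * a t) • n t
    let f₁ : ℝ → E4 := fun t => (s t * b t) • q t - ((s t * k t - c t) * a t) • n t
    have h00 : ∀ t, loopForm σ γ t (f₀ t) (f₀ t) = Real.cos t - R := fun t => by
      have : Real.cos t = c t ^ 2 - s t ^ 2 := by
        rw [show t = 2 * (t / 2) by ring, Real.cos_two_mul']
        simp [c, s]
      simp only [f₀, map_sub, map_smul, LinearMap.sub_apply, LinearMap.smul_apply, smul_eq_mul, hqq,
        hnn, hqn, hnq, this]
      have e1 : c t ^ 2 * (b t * b t) - (c t * k t + s t) ^ 2 * (a t * a t) =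
          c t ^ 2 - s t ^ 2 - R := by
        rw [haa, hbb]
        simp only [B]
        linear_combination (-2 * c t * s t) * hkA t - R * (c t ^ 2 + s t ^ 2 + 1) * hcs t
      linear_combination e1
    have h11 : ∀ t, loopForm σ γ t (f₁ t) (f₁ t) = -Real.cos t := fun t => by
      have : Real.cos t = c t ^ 2 - s t ^ 2 := by
        rw [show t = 2 * (t / 2) by ring, Real.cos_two_mul']
        simp [c, s]
      simp only [f₁, map_sub, map_smul, LinearMap.sub_apply, LinearMap.smul_apply, smul_eq_mul, hqq,
        hnn, hqn, hnq, this]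
      have e1 : s t ^ 2 * (b t * b t) - (s t * k t - c t) ^ 2 * (a t * a t) =
          -(c t ^ 2 - s t ^ 2) := by
        rw [haa, hbb]
        simp only [B]
        linear_combination (2 * c t * s t) * hkA t
      linear_combination e1
    have h01 : ∀ t, loopForm σ γ t (f₀ t) (f₁ t) = Real.sin t := fun t => by
      have : Real.sin t = 2 * s t * c t := by
        rw [show t = 2 * (t / 2) by ring, Real.sin_two_mul]
        simp [c, s]
      simp only [f₀, f₁, map_sub, map_smul, LinearMap.sub_apply, LinearMap.smul_apply, smul_eq_mul,
        hqq, hnn, hqn, hnq, this]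
      have e1 : c t * s t * (b t * b t) - (c t * k t + s t) * (s t * k t - c t) * (a t * a t) =
          2 * s t * c t := by
        rw [haa, hbb]
        simp only [B]
        linear_combination (c t ^ 2 - s t ^ 2) * hkA t
      linear_combination e1
    have hv0 : ∀ t, loopForm σ γ t (v t) (f₀ t) = 0 := fun t => by
      simp [f₀, hvq, hvn]
    have hv1 : ∀ t, loopForm σ γ t (v t) (f₁ t) = 0 := fun t => by
      simp [f₁, hvq, hvn]
    have h10 : ∀ t, loopForm σ γ t (f₁ t) (f₀ t) = Real.sin t := fun t => by rw [hsymm, h01]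
    have h0v : ∀ t, loopForm σ γ t (f₀ t) (v t) = 0 := fun t => by rw [hsymm, hv0]
    have h1v : ∀ t, loopForm σ γ t (f₁ t) (v t) = 0 := fun t => by rw [hsymm, hv1]
    refine ⟨omegaB R, Or.inr rfl, isModelForm_omegaB hR0 hR1, hl.exists_adaptedFrame_of_pairing he h
      (isModelForm_omegaB hR0 hR1) (f := ![f₀, f₁, fun t => Real.sqrt R • v t]) (fun i => ?_)
      (fun i t => ?_) fun t i j => ?_⟩
    · fin_cases i
      · exact (SmoothAlong.smul (hc.mul hb) hq).sub
          (SmoothAlong.smul (((hc.mul hk).add hs).mul ha) hn)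
      · exact (SmoothAlong.smul (hs.mul hb) hq).sub
          (SmoothAlong.smul (((hs.mul hk).sub hc).mul ha) hn)
      · exact SmoothAlong.smul contDiff_const hv
    · fin_cases i
      · change f₀ (t + 2 * Real.pi) = f₀ t
        simp only [f₀, hcp, hsp, hap, hbp, hkp, hqp, hnp]
        module
      · change f₁ (t + 2 * Real.pi) = f₁ t
        simp only [f₁, hcp, hsp, hap, hbp, hkp, hqp, hnp]
        module
      · change Real.sqrt R • v (t + 2 * Real.pi) = Real.sqrt R • v t
        rw [hvp]
    · rw [fderiv_omegaB, sd_apply]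
      fin_cases i <;> fin_cases j <;>
        simp [stdVec, h00, h11, h01, h10, hv0, hv1, h0v, h1v, hvv, hRR]

end Frames

/-! ### Tubes around the axis and uniform radii -/

/-- Uniformity over a circle of a condition that is monotone in a radius. -/
theorem exists_uniform_radius {P : ℝ → ℝ → Prop} {T : ℝ} (hT : 0 < T)
    (hper : ∀ t ε, P t ε → P (t + T) ε) (hper' : ∀ t ε, P (t + T) ε → P t ε)
    (hmono : ∀ t ε ε', ε' ≤ ε → P t ε → P t ε')
    (hloc : ∀ t, ∃ ε, 0 < ε ∧ ∀ᶠ s in 𝓝 t, P s ε) : ∃ ε, 0 < ε ∧ ∀ t, P t ε := by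
  choose ε hε hev using hloc
  obtain ⟨F, -, hF⟩ := isCompact_Icc.elim_nhds_subcover (s := Icc 0 T) (fun t => {s | P s (ε t)})
    fun t _ => hev t
  obtain ⟨δ, hδ, hle⟩ : ∃ δ, 0 < δ ∧ ∀ t ∈ F, δ ≤ ε t := by
    rcases F.eq_empty_or_nonempty with rfl | hne
    · exact ⟨1, one_pos, by simp⟩
    · obtain ⟨t, ht, hmin⟩ := F.exists_min_image ε hne
      exact ⟨ε t, hε t, hmin⟩
  have hIcc : ∀ t ∈ Icc 0 T, P t δ := fun t ht => by
    obtain ⟨s, hs, hP⟩ := mem_iUnion₂.1 (hF ht)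
    exact hmono t _ _ (hle s hs) hP
  have hz : ∀ (n : ℤ) t, P t δ → P (t + n * T) δ := by
    intro n
    induction n using Int.induction_on with
    | zero => intro t h; simpa using h
    | succ i ih =>
      intro t h
      have := hper _ _ (ih t h)
      rwa [show t + (i : ℤ) * T + T = t + ((i + 1 : ℤ) : ℝ) * T by push_cast; ring] at this
    | pred i ih =>
      intro t h
      refine hper' _ _ ?_
      have := ih t h
      rwa [show t + ((-i : ℤ) : ℝ) * T = t + ((-i - 1 : ℤ) : ℝ) * T + T by push_cast; ring] at this
  refine ⟨δ, hδ, fun t => ?_⟩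
  obtain ⟨n, hn, -⟩ := existsUnique_add_zsmul_mem_Ico hT t 0
  rw [zero_add, zsmul_eq_mul] at hn
  have := hz (-n) _ (hIcc _ ⟨hn.1, hn.2.le⟩)
  rwa [show t + n * T + ((-n : ℤ) : ℝ) * T = t by push_cast; ring] at this

/-- The component of `y` orthogonal to the axis. -/
def normalPart (y : E4) : E4 := y - y 0 • stdVec 0

theorem normalPart_zero (y : E4) : normalPart y 0 = 0 := by simp [normalPart, stdVec]

theorem normalPart_apply (y : E4) {i : Fin 4} (hi : i ≠ 0) : normalPart y i = y i := by
  simp [normalPart, stdVec, hi]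

theorem norm_normalPart_sq (y : E4) : ‖normalPart y‖ ^ 2 = y 1 ^ 2 + y 2 ^ 2 + y 3 ^ 2 := by
  rw [EuclideanSpace.norm_sq_eq, Fin.sum_univ_four, normalPart_zero,
    normalPart_apply _ one_ne_zero, normalPart_apply y (i := 2) (by decide),
    normalPart_apply y (i := 3) (by decide)]
  simp

theorem mem_tube_iff {r : ℝ} (hr : 0 < r) {y : E4} : y ∈ tube r ↔ ‖normalPart y‖ < r := by
  rw [← sq_lt_sq₀ (norm_nonneg _) hr.le, norm_normalPart_sq]
  rfl

theorem contDiff_normalPart : ContDiff ℝ ∞ normalPart :=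
  contDiff_id.sub ((EuclideanSpace.proj 0 : E4 →L[ℝ] ℝ).contDiff.smul contDiff_const)

theorem normalPart_add_axis (y : E4) (t : ℝ) : normalPart (y + t • stdVec 0) = normalPart y := by
  simp only [normalPart, PiLp.add_apply, PiLp.smul_apply, stdVec, EuclideanSpace.single,
    PiLp.single_apply, if_true, smul_eq_mul, mul_one]
  module

theorem normalPart_axis (t : ℝ) : normalPart (t • stdVec 0) = 0 := by
  simp [normalPart, stdVec]

theorem axis_zero (t : ℝ) : (t • stdVec 0 : E4) 0 = t := by simp [stdVec]

theorem axis_mem_tube {r : ℝ} (hr : 0 < r) (t : ℝ) : (t • stdVec 0 : E4) ∈ tube r := by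
  rw [mem_tube_iff hr, normalPart_axis, norm_zero]
  exact hr

theorem isOpen_tube (r : ℝ) : IsOpen (tube r) :=
  isOpen_lt (by fun_prop) continuous_const

theorem tube_mono {r r' : ℝ} (h0 : 0 ≤ r) (h : r ≤ r') : tube r ⊆ tube r' := fun _ hy =>
  lt_of_lt_of_le hy (pow_le_pow_left₀ h0 h 2)

theorem add_axis_mem_tube {r t : ℝ} {y : E4} : y + t • stdVec 0 ∈ tube r ↔ y ∈ tube r := by
  simp [tube, stdVec]

/-- A property that holds near the axis, periodically, holds on a tube. -/
theorem exists_tube_of_eventually {Q : E4 → Prop} {T : ℝ} (hT : 0 < T)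
    (hper : ∀ y, Q (y + T • stdVec 0) ↔ Q y) (hloc : ∀ t : ℝ, ∀ᶠ y in 𝓝 (t • stdVec 0 : E4), Q y) :
    ∃ r, 0 < r ∧ ∀ y ∈ tube r, Q y := by
  obtain ⟨r, hr, h⟩ := exists_uniform_radius (P := fun t ε => ∀ y : E4, y 0 = t →
    ‖normalPart y‖ < ε → Q y) hT (fun t ε h y hy hn => by
      rw [← sub_add_cancel y (T • stdVec 0), hper]
      refine h _ (by simp [stdVec, hy]) ?_
      rwa [sub_eq_add_neg, ← neg_smul, normalPart_add_axis]) (fun t ε h y hy hn => by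
      rw [← hper]
      refine h _ (by simp [stdVec, hy]) ?_
      rwa [normalPart_add_axis]) (fun t ε ε' hle h y hy hn => h y hy (hn.trans_le hle)) (fun t => by
      obtain ⟨δ, hδ, hball⟩ := Metric.eventually_nhds_iff_ball.1 (hloc t)
      refine ⟨δ / 2, by positivity, ?_⟩
      filter_upwards [Metric.ball_mem_nhds t (half_pos hδ)] with s hs y hy hn
      refine hball y ?_
      have e : y - t • stdVec 0 = normalPart y + (s - t) • stdVec 0 := by
        rw [normalPart, hy]
        module
      have h1 : ‖(stdVec 0 : E4)‖ = 1 := by simp [stdVec]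
      rw [mem_ball_iff_norm, e]
      refine (norm_add_le _ _).trans_lt ?_
      rw [norm_smul, h1, mul_one]
      rw [mem_ball_iff_norm] at hs
      linarith)
  exact ⟨r, hr, fun y hy => h _ y rfl ((mem_tube_iff hr).1 hy)⟩

/-! ### Tubular coordinates from an immersion into Euclidean space -/

section Tube

variable {M : Type*} [TopologicalSpace M] [ChartedSpace E4 M]
  {V : Type*} [NormedAddCommGroup V] [InnerProductSpace ℝ V]
  {γ : ℝ → M} {e : M → V} {W : ℝ → V →L[ℝ] E4}

variable [IsManifold (𝓡 4) ∞ M]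

/-- Inverse function theorem for `(t, y) ↦ (t, W t (e(y) - e(γ t)))`. Its derivative is block
triangular, with the identity on `t` and an injective map on `y`. -/
theorem exists_local_slice (he : IsInjImmersion e) (hγ : ContMDiff 𝓘(ℝ) (𝓡 4) ∞ γ)
    (hW : ContDiff ℝ ∞ W) {t₀ : ℝ} {p : M} (hinj : Function.Injective ((W t₀).comp (dAt e p))) :
    ∃ g : ℝ × E4 → E4, ContDiffAt ℝ ∞ g (t₀, W t₀ (e p - e (γ t₀))) ∧
      g (t₀, W t₀ (e p - e (γ t₀))) = chart p p ∧
      (∀ᶠ q in 𝓝 (t₀, W t₀ (e p - e (γ t₀))),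
        W q.1 (e ((chart p).symm (g q)) - e (γ q.1)) = q.2) ∧
      ∀ᶠ q in 𝓝 (t₀, chart p p),
        g (q.1, W q.1 (e ((chart p).symm q.2) - e (γ q.1))) = q.2 := by
  set y₀ := chart p p with hy₀
  have hyt : y₀ ∈ (chart p).target := mem_extChartAt_target p
  have hback : (chart p).symm y₀ = p := extChartAt_to_inv p
  let E : E4 → V := e ∘ (chart p).symm
  have hE : ContDiffAt ℝ ∞ E y₀ := contDiffAt_comp_symm he p hyt
  have heγ : ContDiff ℝ ∞ fun t => e (γ t) := (he.smooth.comp hγ).contDiff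
  let H : ℝ × E4 → ℝ × E4 := fun q => (q.1, W q.1 (E q.2 - e (γ q.1)))
  have hH : ContDiffAt ℝ ∞ H (t₀, y₀) := by
    refine contDiffAt_fst.prodMk (ContDiffAt.clm_apply (hW.contDiffAt.comp _ contDiffAt_fst) ?_)
    exact (ContDiffAt.comp (g := E) (t₀, y₀) hE contDiffAt_snd).sub
      (heγ.contDiffAt.comp _ contDiffAt_fst)
  have hsnd : ∀ u : E4, fderiv ℝ H (t₀, y₀) (0, u) = (0, W t₀ (fderiv ℝ E y₀ u)) := by
    intro u
    have h1 : HasFDerivAt (fun y : E4 => (t₀, y)) (ContinuousLinearMap.inr ℝ ℝ E4) y₀ :=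
      hasFDerivAt_prodMk_right t₀ y₀
    have h2 := (hH.differentiableAt (by simp)).hasFDerivAt.comp y₀ h1
    have h3 : HasFDerivAt (fun y : E4 => (t₀, W t₀ (E y - e (γ t₀))))
        ((0 : E4 →L[ℝ] ℝ).prod ((W t₀).comp (fderiv ℝ E y₀))) y₀ :=
      (hasFDerivAt_const t₀ y₀).prodMk ((W t₀).hasFDerivAt.comp y₀
        ((hE.differentiableAt (by simp)).hasFDerivAt.sub_const _))
    exact DFunLike.congr_fun (h2.unique h3) u
  have hfst : ∀ w : ℝ × E4, (fderiv ℝ H (t₀, y₀) w).1 = w.1 := by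
    intro w
    have h2 := hasFDerivAt_fst.comp (t₀, y₀) (hH.differentiableAt (by simp)).hasFDerivAt
    exact DFunLike.congr_fun (h2.unique hasFDerivAt_fst) w
  have hEd : fderiv ℝ E y₀ = (dAt e p).comp (tder (chart p).symm y₀) := by
    rw [dAt_comp_symm he p hyt, hback]
  have hHinj : Function.Injective (fderiv ℝ H (t₀, y₀)) := by
    rw [injective_iff_map_eq_zero]
    rintro ⟨s, u⟩ h0
    have hs : s = 0 := by
      have := hfst (s, u)
      rw [h0] at this
      exact this.symm
    subst hs
    rw [hsnd, hEd] at h0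
    have h1 : (W t₀).comp (dAt e p) (tder (chart p).symm y₀ u) = 0 :=
      (Prod.ext_iff.1 h0).2
    have h2 := tder_symm_injective p hyt (((map_eq_zero_iff _ hinj).1 h1).trans (map_zero _).symm)
    rw [h2]
    rfl
  let A : (ℝ × E4) ≃L[ℝ] (ℝ × E4) := (LinearEquiv.ofInjectiveEndo
    (fderiv ℝ H (t₀, y₀)).toLinearMap hHinj).toContinuousLinearEquiv
  have hA : HasFDerivAt H (A : (ℝ × E4) →L[ℝ] (ℝ × E4)) (t₀, y₀) :=
    (hH.differentiableAt (by simp)).hasFDerivAt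
  have hne : (∞ : WithTop ℕ∞) ≠ 0 := by simp
  let G := hH.toOpenPartialHomeomorph H hA hne
  have hG : ∀ q, G q = H q := fun q => rfl
  have hmem : (t₀, y₀) ∈ G.source := hH.mem_toOpenPartialHomeomorph_source hA hne
  have hH0 : H (t₀, y₀) = (t₀, W t₀ (e p - e (γ t₀))) := by
    simp only [H, E, Function.comp_apply, hback]
  have hinv : ContDiffAt ℝ ∞ G.symm (t₀, W t₀ (e p - e (γ t₀))) := by
    rw [← hH0]
    exact hH.to_localInverse hA hne
  have hl : ∀ᶠ q in 𝓝 (t₀, y₀), G.symm (H q) = q := by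
    filter_upwards [G.open_source.mem_nhds hmem] with q hq using G.left_inv hq
  have hr : ∀ᶠ q in 𝓝 (t₀, W t₀ (e p - e (γ t₀))), H (G.symm q) = q := by
    rw [← hH0]
    filter_upwards [G.open_target.mem_nhds (G.map_source hmem)] with q hq using G.right_inv hq
  refine ⟨fun q => (G.symm q).2, contDiff_snd.contDiffAt.comp _ hinv, ?_, ?_, ?_⟩
  · rw [← hH0]
    exact congrArg Prod.snd hl.self_of_nhds
  · filter_upwards [hr] with q hq
    have h1 : (G.symm q).1 = q.1 := (Prod.ext_iff.1 hq).1
    have h2 := (Prod.ext_iff.1 hq).2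
    simp only [H] at h2
    rwa [h1] at h2
  · filter_upwards [hl] with q hq
    exact congrArg Prod.snd hq

variable [CompactSpace M]

omit [IsManifold (𝓡 4) ∞ M] in
/-- Points with image near that of `γ t` are near `γ t₀`. -/
theorem exists_radius_of_nhds (he : IsInjImmersion e) (hγ : ContMDiff 𝓘(ℝ) (𝓡 4) ∞ γ) {t₀ : ℝ}
    {N : Set M} (hN : N ∈ 𝓝 (γ t₀)) :
    ∃ ρ, 0 < ρ ∧ ∀ᶠ t in 𝓝 t₀, ∀ p, ‖e p - e (γ t)‖ < ρ → p ∈ N := by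
  have hemb : IsEmbedding e := (he.smooth.continuous.isClosedEmbedding he.inj).isEmbedding
  rw [hemb.isInducing.nhds_eq_comap] at hN
  obtain ⟨S, hS, hSN⟩ := hN
  obtain ⟨ρ, hρ, hball⟩ := Metric.mem_nhds_iff.1 hS
  refine ⟨ρ / 2, half_pos hρ, ?_⟩
  have hc : ContinuousAt (fun t => e (γ t)) t₀ :=
    (he.smooth.continuous.comp hγ.continuous).continuousAt
  filter_upwards [hc.eventually (Metric.ball_mem_nhds _ (half_pos hρ))] with t ht p hp
  refine hSN (hball ?_)
  rw [dist_eq_norm] at ht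
  rw [mem_ball_iff_norm]
  have : e p - e (γ t₀) = (e p - e (γ t)) + (e (γ t) - e (γ t₀)) := by abel
  rw [this]
  refine (norm_add_le _ _).trans_lt ?_
  linarith

/-- `Φ y` is the point `p` near `γ (y 0)` with `W (e p - e γ) = normalPart y`. Compactness of the
circle gives one radius `ρ` for uniqueness and one radius `r` for existence; smooth local slices
solve the same equation, so uniqueness makes `Φ` smooth. This takes the place of an exponential map.
-/
theorem exists_fibre_inverse (he : IsInjImmersion e) (hγ : ContMDiff 𝓘(ℝ) (𝓡 4) ∞ γ)
    (hγp : ∀ t, γ (t + 2 * Real.pi) = γ t) (hW : ContDiff ℝ ∞ W)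
    (hWp : ∀ t, W (t + 2 * Real.pi) = W t)
    (hinj : ∀ t, Function.Injective ((W t).comp (dAt e (γ t)))) :
    ∃ (r : ℝ) (Φ : E4 → M), 0 < r ∧ ContMDiffOn (𝓡 4) (𝓡 4) ∞ Φ (tube r) ∧
      (∀ y, Φ (y + (2 * Real.pi) • stdVec 0) = Φ y) ∧ (∀ t : ℝ, Φ (t • stdVec 0) = γ t) ∧
      ∀ y ∈ tube r, W (y 0) (e (Φ y) - e (γ (y 0))) = normalPart y := by
  have heγ : Continuous fun t => e (γ t) := he.smooth.continuous.comp hγ.continuous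
  obtain ⟨ρ, hρ, huniq⟩ := exists_uniform_radius (P := fun t ρ =>
      (∀ p, ‖e p - e (γ t)‖ < ρ → Function.Injective ((W t).comp (dAt e p))) ∧
      ∀ p q, ‖e p - e (γ t)‖ < ρ → ‖e q - e (γ t)‖ < ρ →
        W t (e p - e (γ t)) = W t (e q - e (γ t)) → p = q) Real.two_pi_pos
    (fun t ρ h => by rwa [hγp, hWp]) (fun t ρ h => by rwa [hγp, hWp] at h)
    (fun t ρ ρ' hle h => ⟨fun p hp => h.1 p (hp.trans_le hle), fun p q hp hq =>
      h.2 p q (hp.trans_le hle) (hq.trans_le hle)⟩) (fun t₀ => by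
      obtain ⟨g, -, -, -, hg⟩ := exists_local_slice he hγ hW (hinj t₀)
      set x := γ t₀
      have hyt := mem_extChartAt_target (I := 𝓡 4) x
      set y₀ := chart x x
      have hcont : ContinuousAt (fun q : ℝ × E4 => (W q.1).comp
          (fderiv ℝ (e ∘ (chart x).symm) q.2)) (t₀, y₀) := by
        refine ContinuousAt.clm_comp (hW.continuous.continuousAt.comp continuousAt_fst) ?_
        exact ContinuousAt.comp (g := fderiv ℝ (e ∘ (chart x).symm))
          ((contDiffAt_comp_symm he x hyt).continuousAt_fderiv (by simp)) continuousAt_snd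
      have hinj₀ : Function.Injective ((W t₀).comp
          (fderiv ℝ (e ∘ (chart x).symm) y₀)) := by
        rw [dAt_comp_symm he x hyt, extChartAt_to_inv]
        exact (hinj t₀).comp (tder_symm_injective x hyt)
      have hev := hcont.eventually (ContinuousLinearMap.isOpen_injective.mem_nhds hinj₀)
      have hboth := hg.and hev
      rw [nhds_prod_eq, Filter.eventually_prod_iff] at hboth
      obtain ⟨pa, hpa, pb, hpb, hab⟩ := hboth
      have hN : {p | p ∈ (chart x).source ∧ pb (chart x p)} ∈ 𝓝 x :=
        Filter.inter_mem (extChartAt_source_mem_nhds x)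
          ((continuousAt_extChartAt x).eventually hpb)
      obtain ⟨ρ, hρ, hρN⟩ := exists_radius_of_nhds he hγ hN
      refine ⟨ρ, hρ, ?_⟩
      filter_upwards [hρN, hpa] with t ht hta
      refine ⟨fun p hp => ?_, fun p q hp hq hpq => ?_⟩
      · obtain ⟨hs, hb⟩ := ht p hp
        have h1 := (hab hta hb).2
        have hpt := (chart x).map_source hs
        change Function.Injective ((W t).comp (fderiv ℝ (e ∘ (chart x).symm)
          (chart x p))) at h1
        rw [dAt_comp_symm he x hpt, (chart x).left_inv hs] at h1
        have hsur : Function.Surjective (tder (chart x).symm (chart x p)) :=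
          LinearMap.surjective_of_injective (tder_symm_injective x hpt)
        intro u v huv
        obtain ⟨u, rfl⟩ := hsur u
        obtain ⟨v, rfl⟩ := hsur v
        exact congrArg _ (h1 huv)
      · obtain ⟨hsp, hbp⟩ := ht p hp
        obtain ⟨hsq, hbq⟩ := ht q hq
        have h1 := (hab hta hbp).1
        have h2 := (hab hta hbq).1
        simp only [(chart x).left_inv hsp] at h1
        simp only [(chart x).left_inv hsq] at h2
        exact (chart x).injOn hsp hsq (by rw [← h1, ← h2, hpq]))
  have hslice : ∀ (t₀ : ℝ) (p : M), ‖e p - e (γ t₀)‖ < ρ →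
      ∃ s : ℝ × E4 → M, ContMDiffAt (𝓘(ℝ, ℝ × E4)) (𝓡 4) ∞ s (t₀, W t₀ (e p - e (γ t₀))) ∧
        ∀ᶠ q in 𝓝 (t₀, W t₀ (e p - e (γ t₀))), ‖e (s q) - e (γ q.1)‖ < ρ ∧
          W q.1 (e (s q) - e (γ q.1)) = q.2 := by
    intro t₀ p hp
    obtain ⟨g, hg, hg0, hg1, -⟩ := exists_local_slice he hγ hW ((huniq t₀).1 p hp)
    have hs : ContMDiffAt (𝓘(ℝ, ℝ × E4)) (𝓡 4) ∞ (fun q => (chart p).symm (g q))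
        (t₀, W t₀ (e p - e (γ t₀))) := by
      refine ContMDiffAt.comp (g := (chart p).symm) (f := g) _ ?_ hg.contMDiffAt
      rw [hg0]
      exact (contMDiffOn_symm p).contMDiffAt ((isOpen_target p).mem_nhds (mem_extChartAt_target p))
    refine ⟨_, hs, Filter.Eventually.and ?_ hg1⟩
    have hc : ContinuousAt (fun q : ℝ × E4 => ‖e ((chart p).symm (g q)) - e (γ q.1)‖)
        (t₀, W t₀ (e p - e (γ t₀))) :=
      ((he.smooth.continuous.continuousAt.comp hs.continuousAt).sub
        (heγ.continuousAt.comp continuousAt_fst)).norm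
    refine hc.eventually (gt_mem_nhds ?_)
    simp only [hg0, extChartAt_to_inv]
    exact hp
  have hself : ∀ t, ‖e (γ t) - e (γ t)‖ < ρ := fun t => by simpa using hρ
  obtain ⟨r, hr, hex⟩ := exists_uniform_radius (P := fun t r => ∀ z : E4, ‖z‖ < r →
      ∃ p, ‖e p - e (γ t)‖ < ρ ∧ W t (e p - e (γ t)) = z) Real.two_pi_pos
    (fun t r h => by rwa [hγp, hWp]) (fun t r h => by rwa [hγp, hWp] at h)
    (fun t r r' hle h z hz => h z (hz.trans_le hle)) (fun t₀ => by
      obtain ⟨s, -, hs⟩ := hslice t₀ _ (hself t₀)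
      rw [sub_self, map_zero, nhds_prod_eq, Filter.eventually_prod_iff] at hs
      obtain ⟨pa, hpa, pb, hpb, hab⟩ := hs
      obtain ⟨r, hr, hball⟩ := Metric.eventually_nhds_iff_ball.1 hpb
      refine ⟨r, hr, ?_⟩
      filter_upwards [hpa] with t ht z hz
      exact ⟨_, hab ht (hball z (by simpa using hz))⟩)
  have : Nonempty M := ⟨γ 0⟩
  let Pr : ℝ → E4 → M → Prop := fun t z p => ‖e p - e (γ t)‖ < ρ ∧ W t (e p - e (γ t)) = z
  -- The choice depends only on a predicate that is `2π`-periodic in `y 0`, so `Φ` is periodic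
  -- everywhere, also where no solution exists.
  let Φ : E4 → M := fun y => Classical.epsilon (Pr (y 0) (normalPart y))
  have hΦ : ∀ y ∈ tube r, Pr (y 0) (normalPart y) (Φ y) := fun y hy =>
    Classical.epsilon_spec (hex (y 0) _ ((mem_tube_iff hr).1 hy))
  have hΦu : ∀ y ∈ tube r, ∀ p, Pr (y 0) (normalPart y) p → Φ y = p := fun y hy p hp =>
    (huniq (y 0)).2 _ _ (hΦ y hy).1 hp.1 ((hΦ y hy).2.trans hp.2.symm)
  refine ⟨r, Φ, hr, fun y hy => ?_, fun y => ?_, fun t => ?_, fun y hy => (hΦ y hy).2⟩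
  · obtain ⟨s, hs, hsev⟩ := hslice (y 0) (Φ y) (hΦ y hy).1
    rw [(hΦ y hy).2] at hs hsev
    have hq : ContDiff ℝ ∞ fun y : E4 => (y 0, normalPart y) :=
      (EuclideanSpace.proj 0 : E4 →L[ℝ] ℝ).contDiff.prodMk contDiff_normalPart
    have h1 : ContMDiffAt (𝓡 4) (𝓡 4) ∞ (fun y : E4 => s (y 0, normalPart y)) y :=
      ContMDiffAt.comp (g := s) y hs hq.contMDiff.contMDiffAt
    refine (h1.congr_of_eventuallyEq ?_).contMDiffWithinAt
    filter_upwards [hq.continuous.continuousAt.eventually hsev, (isOpen_tube r).mem_nhds hy]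
      with y' h2 h3
    exact hΦu y' h3 _ h2
  · have h1 : (y + (2 * Real.pi) • stdVec 0 : E4) 0 = y 0 + 2 * Real.pi := by simp [stdVec]
    simp only [Φ, Pr, h1, normalPart_add_axis, hγp, hWp]
  · refine hΦu _ (axis_mem_tube hr t) _ ?_
    rw [axis_zero, normalPart_axis]
    exact ⟨hself t, by rw [sub_self, map_zero]⟩

end Tube

/-! ### The linear map of a frame -/

section FrameMap

/-- The linear map that sends the standard basis to the vectors `fr i`. -/
def frameMap (fr : Fin 4 → E4) : E4 →L[ℝ] E4 :=
  ∑ i, (EuclideanSpace.proj i : E4 →L[ℝ] ℝ).smulRight (fr i)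

theorem frameMap_apply (fr : Fin 4 → E4) (u : E4) : frameMap fr u = ∑ i, u i • fr i := by
  simp [frameMap]

theorem frameMap_stdVec (fr : Fin 4 → E4) (i : Fin 4) : frameMap fr (stdVec i) = fr i := by
  rw [frameMap_apply, Fin.sum_univ_four]
  fin_cases i <;> simp [stdVec]

theorem frameMap_injective {fr : Fin 4 → E4} (h : LinearIndependent ℝ fr) :
    Function.Injective (frameMap fr) := by
  rw [injective_iff_map_eq_zero]
  intro u hu
  rw [frameMap_apply] at hu
  ext i
  exact Fintype.linearIndependent_iff.1 h (fun i => u i) hu i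

end FrameMap

theorem mem_ball_axis {y : E4} {t δ : ℝ} (h1 : |y 0 - t| < δ / 2) (h2 : ‖normalPart y‖ < δ / 2) :
    y ∈ Metric.ball (t • stdVec 0 : E4) δ := by
  have e : y - t • stdVec 0 = normalPart y + (y 0 - t) • stdVec 0 := by
    rw [normalPart]
    module
  have h3 : ‖(stdVec 0 : E4)‖ = 1 := by simp [stdVec]
  rw [mem_ball_iff_norm, e]
  refine (norm_add_le _ _).trans_lt ?_
  rw [norm_smul, h3, mul_one, Real.norm_eq_abs]
  linarith

/-! ### Tubular charts with prescribed normal frame -/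

section Tube

variable {M : Type*} [TopologicalSpace M] [ChartedSpace E4 M] [IsManifold (𝓡 4) ∞ M]
  [CompactSpace M]
  {V : Type*} [NormedAddCommGroup V] [InnerProductSpace ℝ V] [FiniteDimensional ℝ V]
  {σ : DiffForm M 2} {γ : ℝ → M} {C : Set M} {e : M → V}

omit [CompactSpace M] [FiniteDimensional ℝ V] in
/-- A periodic map that is an immersion along the axis and maps it to a simple loop is injective up
to the period near the axis. -/
theorem IsLoop.exists_injective_radius (hl : IsLoop σ γ C) (he : IsInjImmersion e) {Φ : E4 → M}
    (hΦ : ∀ t : ℝ, ContMDiffAt (𝓡 4) (𝓡 4) ∞ Φ (t • stdVec 0))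
    (hper : ∀ y, Φ (y + (2 * Real.pi) • stdVec 0) = Φ y) (haxis : ∀ t : ℝ, Φ (t • stdVec 0) = γ t)
    (hinj : ∀ t : ℝ, Function.Injective (tder Φ (t • stdVec 0))) :
    ∃ r, 0 < r ∧ ∀ y ∈ tube r, ∀ y' ∈ tube r, Φ y = Φ y' →
      ∃ n : ℤ, y' = y + (2 * Real.pi * n) • stdVec 0 := by
  have heγ : Continuous fun t => e (γ t) := he.smooth.continuous.comp hl.smooth.continuous
  have hz : ∀ (n : ℤ) y, Φ (y + (2 * Real.pi * n) • stdVec 0) = Φ y := by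
    intro n y
    have hp : Function.Periodic Φ ((2 * Real.pi) • stdVec 0) := hper
    have := hp.zsmul n y
    rwa [← Int.cast_smul_eq_zsmul ℝ, smul_smul, mul_comm] at this
  obtain ⟨r, hr, h⟩ := exists_uniform_radius (P := fun t ε => ∀ y : E4, y 0 = t →
      ‖normalPart y‖ < ε → ∀ y' : E4, ‖normalPart y'‖ < ε → Φ y = Φ y' →
      ∃ n : ℤ, y' = y + (2 * Real.pi * n) • stdVec 0) Real.two_pi_pos
    (fun t ε h y hy hn y' hn' hyy => by
      obtain ⟨n, hn⟩ := h (y + (-(2 * Real.pi)) • stdVec 0) (by simp [stdVec, hy])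
        (by rwa [normalPart_add_axis]) y' hn' (by
          have := hper (y + (-(2 * Real.pi)) • stdVec 0)
          rw [neg_smul, neg_add_cancel_right] at this
          rw [neg_smul, ← this, hyy])
      refine ⟨n - 1, hn.trans ?_⟩
      push_cast
      module)
    (fun t ε h y hy hn y' hn' hyy => by
      obtain ⟨n, hn⟩ := h (y + (2 * Real.pi) • stdVec 0) (by simp [stdVec, hy])
        (by rwa [normalPart_add_axis]) y' hn' (by rw [hper, hyy])
      refine ⟨n + 1, hn.trans ?_⟩
      push_cast
      module)
    (fun t ε ε' hle h y hy hn y' hn' => h y hy (hn.trans_le hle) y' (hn'.trans_le hle))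
    (fun t₀ => by
      obtain ⟨k, -, -, -, hk⟩ := exists_local_inverse (hΦ t₀) (hinj t₀)
        (mem_extChartAt_source (I := 𝓡 4) _)
      obtain ⟨δ, hδ, hball⟩ := Metric.eventually_nhds_iff_ball.1 hk
      -- As the loop is simple, within one period and away from `t₀` it stays at distance at least
      -- `c` from `γ t₀` in the ambient space. Three errors below `c / 3` force points with equal
      -- images to have parameters near `t₀` up to a period, where the local inverse decides.
      obtain ⟨c, hc, hK⟩ := (isCompact_Icc.diff (Metric.isOpen_ball (x := t₀) (ε := δ / 2))
          : IsCompact (Icc (t₀ - Real.pi) (t₀ + Real.pi) \ Metric.ball t₀ (δ / 2))).exists_forall_le'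
        (f := fun s => ‖e (γ s) - e (γ t₀)‖) ((heγ.sub continuous_const).norm.continuousOn)
        (a := 0) (fun s hs => by
          rw [norm_pos_iff, sub_ne_zero]
          intro hes
          obtain ⟨n, hn⟩ := (hl.eq_iff s t₀).1 (he.inj hes)
          have hlt : |(n : ℝ)| < 1 := by
            rw [abs_lt]
            constructor <;> nlinarith [hs.1.1, hs.1.2, Real.pi_pos]
          have hn0 : n = 0 := by
            have : |n| < 1 := by exact_mod_cast hlt
            exact Int.abs_lt_one_iff.1 this
          refine hs.2 ?_
          rw [hn, hn0]
          simpa using hδ)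
      obtain ⟨r₁, hr₁, hclose⟩ := exists_tube_of_eventually (T := 2 * Real.pi)
        (Q := fun y : E4 => ‖e (Φ y) - e (γ (y 0))‖ < c / 3) Real.two_pi_pos (fun y => by
          have h1 : (y + (2 * Real.pi) • stdVec 0 : E4) 0 = y 0 + 2 * Real.pi := by simp [stdVec]
          rw [hper, h1, hl.periodic]) (fun t => by
          have hc0 : ContinuousAt (fun y : E4 => y 0) (t • stdVec 0) :=
            (EuclideanSpace.proj 0 : E4 →L[ℝ] ℝ).continuous.continuousAt
          have : ContinuousAt (fun y : E4 => ‖e (Φ y) - e (γ (y 0))‖) (t • stdVec 0) :=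
            ((he.smooth.continuous.continuousAt.comp (hΦ t).continuousAt).sub
              (ContinuousAt.comp (g := fun t => e (γ t)) heγ.continuousAt hc0)).norm
          refine this.eventually (gt_mem_nhds ?_)
          simp only [haxis, axis_zero, sub_self, norm_zero]
          positivity)
      refine ⟨min (δ / 2) r₁, lt_min (half_pos hδ) hr₁, ?_⟩
      have hcont : ∀ᶠ t in 𝓝 t₀, ‖e (γ t) - e (γ t₀)‖ < c / 3 := by
        refine (heγ.sub continuous_const).norm.continuousAt.eventually (gt_mem_nhds ?_)
        simp only [Pi.sub_apply, sub_self, norm_zero]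
        positivity
      filter_upwards [hcont, Metric.ball_mem_nhds t₀ (half_pos hδ)] with t ht1 ht2 y hy hn y' hn' hyy
      obtain ⟨n, hn2, -⟩ := existsUnique_add_zsmul_mem_Ico Real.two_pi_pos (y' 0) (t₀ - Real.pi)
      rw [zsmul_eq_mul] at hn2
      let y'' : E4 := y' + (2 * Real.pi * n) • stdVec 0
      have hy0 : y'' 0 = y' 0 + n * (2 * Real.pi) := by simp [y'', stdVec]; ring
      have hΦ'' : Φ y'' = Φ y' := hz n y'
      have hn'' : ‖normalPart y''‖ < min (δ / 2) r₁ := by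
        simp only [y'']
        rwa [normalPart_add_axis]
      have hs : y'' 0 ∈ Metric.ball t₀ (δ / 2) := by
        by_contra hnot
        have h1 := hK (y'' 0) ⟨⟨by rw [hy0]; exact hn2.1, by rw [hy0]; linarith [hn2.2]⟩, hnot⟩
        have h2 := hclose y'' ((mem_tube_iff hr₁).2 (hn''.trans_le (min_le_right _ _)))
        have h3 := hclose y ((mem_tube_iff hr₁).2 (hn.trans_le (min_le_right _ _)))
        rw [hy] at h3
        rw [hΦ'', ← hyy, norm_sub_rev] at h2
        have h4 : e (γ (y'' 0)) - e (γ t₀) = (e (γ (y'' 0)) - e (Φ y)) + (e (Φ y) - e (γ t)) +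
          (e (γ t) - e (γ t₀)) := by abel
        have h5 := norm_add₃_le (a := e (γ (y'' 0)) - e (Φ y)) (b := e (Φ y) - e (γ t))
          (c := e (γ t) - e (γ t₀))
        rw [← h4] at h5
        linarith
      have hb1 := hball y (mem_ball_axis (by rw [hy]; simpa [Real.dist_eq] using ht2)
        (hn.trans_le (min_le_left _ _)))
      have hb2 := hball y'' (mem_ball_axis (by simpa [Real.dist_eq] using hs)
        (hn''.trans_le (min_le_left _ _)))
      rw [hΦ'', ← hyy, hb1] at hb2
      refine ⟨-n, ?_⟩
      rw [hb2]
      simp only [y'']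
      push_cast
      module)
  exact ⟨r, hr, fun y hy y' hy' => h _ y rfl ((mem_tube_iff hr).1 hy) y' ((mem_tube_iff hr).1 hy')⟩

/-- A tubular chart along a loop with prescribed normal frame. -/
theorem IsLoop.exists_tubularChart (hl : IsLoop σ γ C) (he : IsInjImmersion e)
    {fr : Fin 4 → ℝ → E4} (hfr : ∀ i, SmoothAlong e γ (fr i))
    (hfp : ∀ i t, fr i (t + 2 * Real.pi) = fr i t)
    (hli : ∀ t, LinearIndependent ℝ fun i => fr i t) (h0 : fr 0 = velocity γ) :
    ∃ (r : ℝ) (Φ : E4 → M), 0 < r ∧ IsTubularChart Φ r C ∧ (∀ t : ℝ, Φ (t • stdVec 0) = γ t) ∧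
      ∀ (t : ℝ) i, tder Φ (t • stdVec 0) (stdVec i) = fr i t := by
  let F : ℝ → E4 →L[ℝ] E4 := fun t => frameMap fun i => fr i t
  have hFinj : ∀ t, Function.Injective (F t) := fun t => frameMap_injective (hli t)
  have hFsur : ∀ t, Function.Surjective (F t) := fun t =>
    LinearMap.surjective_of_injective (f := (F t : E4 →ₗ[ℝ] E4)) (hFinj t)
  let L : ℝ → E4 →L[ℝ] V := fun t => (dAt e (γ t)).comp (F t)
  have hLinj : ∀ t, Function.Injective (L t) := fun t => (he.inj_der _).comp (hFinj t)
  have hL : ContDiff ℝ ∞ L := by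
    rw [contDiff_clm_apply_iff]
    intro u
    have : (fun t => L t u) = fun t => ∑ i, u i • dAt e (γ t) (fr i t) := by
      ext1 t
      simp only [L, F, ContinuousLinearMap.comp_apply, frameMap_apply, map_sum, map_smul]
    rw [this]
    exact ContDiff.sum fun i _ => contDiff_const.smul (hfr i)
  have hLp : ∀ t, L (t + 2 * Real.pi) = L t := fun t => by
    simp only [L, F, hl.periodic, hfp]
  -- `W t` is a left inverse of the differential of `e` expressed in the frame. With this choice the
  -- fibre directions of `Φ` along the axis are the frame vectors.
  let W : ℝ → V →L[ℝ] E4 := fun t => pinv (L t)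
  have hW : ContDiff ℝ ∞ W := contDiff_iff_contDiffAt.2 fun t =>
    (contDiffAt_pinv (hLinj t)).comp t hL.contDiffAt
  have hWF : ∀ t u, W t (dAt e (γ t) (F t u)) = u := fun t u => pinv_apply_self (hLinj t) u
  have hWinj : ∀ t, Function.Injective ((W t).comp (dAt e (γ t))) := by
    intro t u v huv
    obtain ⟨u, rfl⟩ := hFsur t u
    obtain ⟨v, rfl⟩ := hFsur t v
    simp only [ContinuousLinearMap.comp_apply, hWF] at huv
    rw [huv]
  obtain ⟨r₀, Φ, hr₀, hΦ, hper, haxis, hfib⟩ := exists_fibre_inverse he hl.smooth hl.periodic hW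
    (fun t => by simp only [W, hLp]) hWinj
  have hΦat : ∀ y ∈ tube r₀, ContMDiffAt (𝓡 4) (𝓡 4) ∞ Φ y := fun y hy =>
    hΦ.contMDiffAt ((isOpen_tube r₀).mem_nhds hy)
  have hax := fun t : ℝ => axis_mem_tube hr₀ t
  have heΦ : ∀ y ∈ tube r₀, ContDiffAt ℝ ∞ (e ∘ Φ) y := fun y hy =>
    (ContMDiffAt.comp y he.smooth.contMDiffAt (hΦat y hy)).contDiffAt
  have hdΦ : ∀ y ∈ tube r₀, fderiv ℝ (e ∘ Φ) y = (dAt e (Φ y)).comp (tder Φ y) := fun y hy => by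
    have := mfderiv_comp y (he.smooth.mdifferentiable (by simp) _)
      ((hΦat y hy).mdifferentiableAt (by simp))
    rw [mfderiv_eq_fderiv] at this
    exact this
  have htd : ∀ (t : ℝ) i, tder Φ (t • stdVec 0) (stdVec i) = fr i t := by
    intro t i
    have hd := ((heΦ _ (hax t)).differentiableAt (by simp)).hasFDerivAt
    rw [hdΦ _ (hax t), haxis] at hd
    by_cases hi : i = 0
    · subst hi
      have h1 := hd.comp_hasDerivAt t (hasDerivAt_axisPt t)
      have h2 : (e ∘ Φ) ∘ axisPt = e ∘ γ := by
        ext1 s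
        exact congrArg e (haxis s)
      rw [h2] at h1
      have h3 : HasDerivAt (e ∘ γ) (dAt e (γ t) (velocity γ t)) t := by
        have h4 := mfderiv_comp t (he.smooth.mdifferentiable (by simp) (γ t))
          (hl.smooth.mdifferentiable (by simp) t)
        rw [mfderiv_eq_fderiv] at h4
        have h5 : deriv (e ∘ γ) t = dAt e (γ t) (velocity γ t) := by
          rw [← fderiv_apply_one_eq_deriv]
          exact DFunLike.congr_fun h4 (1 : ℝ)
        rw [← h5]
        exact ((he.smooth.comp hl.smooth).contDiff.differentiable (by simp) t).hasDerivAt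
      rw [h0]
      exact he.inj_der _ (h1.unique h3)
    · have hline : HasDerivAt (fun s : ℝ => t • stdVec 0 + s • stdVec i) (stdVec i) 0 := by
        have := ((hasDerivAt_id (0 : ℝ)).smul_const (stdVec i)).const_add (t • stdVec 0)
        rw [one_smul] at this
        exact this
      have hd' : HasFDerivAt (e ∘ Φ) ((dAt e (γ t)).comp (tder Φ (t • stdVec 0)))
          (t • stdVec 0 + (0 : ℝ) • stdVec i) := by rwa [zero_smul, add_zero]
      have h1 := (W t).hasFDerivAt.comp_hasDerivAt (0 : ℝ)
        ((hd'.comp_hasDerivAt (0 : ℝ) hline).sub_const (e (γ t)))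
      -- On the fibre over `t` the equation defining `Φ` is linear in `s`; differentiating it at `0`
      -- identifies the fibre direction.
      have h2 : (fun s : ℝ => W t (e (Φ (t • stdVec 0 + s • stdVec i)) - e (γ t))) =ᶠ[𝓝 0]
          fun s => s • stdVec i := by
        have hc : ContinuousAt (fun s : ℝ => t • stdVec 0 + s • stdVec i) 0 := hline.continuousAt
        have hmem : t • stdVec 0 + (0 : ℝ) • stdVec i ∈ tube r₀ := by
          rw [zero_smul, add_zero]; exact hax t
        filter_upwards [hc.eventually ((isOpen_tube r₀).mem_nhds hmem)] with s hs
        have h3 := hfib _ hs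
        have h4 : (t • stdVec 0 + s • stdVec i : E4) 0 = t := by
          simp [stdVec, Ne.symm hi]
        rw [h4] at h3
        rw [h3, normalPart, h4]
        abel
      have h3 : HasDerivAt (fun s : ℝ => s • stdVec i) (stdVec i) 0 := by
        have := (hasDerivAt_id (0 : ℝ)).smul_const (stdVec i)
        rw [one_smul] at this
        exact this
      have h5 := h1.unique (h3.congr_of_eventuallyEq h2)
      refine hWinj t ?_
      change W t (dAt e (γ t) (tder Φ (t • stdVec 0) (stdVec i))) = W t (dAt e (γ t) (fr i t))
      rw [← frameMap_stdVec (fun i => fr i t) i, hWF]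
      exact h5
  have htF : ∀ t : ℝ, tder Φ (t • stdVec 0) = F t := fun t => by
    refine ContinuousLinearMap.coe_injective (stdBasis.ext fun i => ?_)
    rw [stdBasis_apply]
    exact (htd t i).trans (frameMap_stdVec (fun i => fr i t) i).symm
  have hinj : ∀ t : ℝ, Function.Injective (tder Φ (t • stdVec 0)) := fun t => by
    rw [htF]
    exact hFinj t
  obtain ⟨r₁, hr₁, h1⟩ := exists_tube_of_eventually (T := 2 * Real.pi)
    (Q := fun y => Function.Injective (fderiv ℝ (e ∘ Φ) y)) Real.two_pi_pos (fun y => by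
      have : (fun z => (e ∘ Φ) (z + (2 * Real.pi) • stdVec 0)) = e ∘ Φ := by
        ext1 z
        exact congrArg e (hper z)
      rw [← fderiv_comp_add_right, this]) (fun t => by
      refine ((heΦ _ (hax t)).continuousAt_fderiv (by simp)).eventually
        (ContinuousLinearMap.isOpen_injective.mem_nhds ?_)
      rw [Set.mem_ofPred_eq, hdΦ _ (hax t)]
      exact (he.inj_der _).comp (hinj t))
  obtain ⟨r₂, hr₂, h2⟩ := hl.exists_injective_radius he (fun t => hΦat _ (hax t)) hper haxis hinj
  let r := min r₀ (min r₁ r₂)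
  have hr : 0 < r := lt_min hr₀ (lt_min hr₁ hr₂)
  have s0 : tube r ⊆ tube r₀ := tube_mono hr.le (min_le_left _ _)
  have s1 : tube r ⊆ tube r₁ := tube_mono hr.le ((min_le_right _ _).trans (min_le_left _ _))
  have s2 : tube r ⊆ tube r₂ := tube_mono hr.le ((min_le_right _ _).trans (min_le_right _ _))
  refine ⟨r, Φ, hr, ⟨hΦ.mono s0, fun y hy => ?_, fun y hy y' hy' => ⟨h2 y (s2 hy) y' (s2 hy'), ?_⟩,
    ?_⟩, haxis, htd⟩
  · have h3 := h1 y (s1 hy)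
    rw [hdΦ y (s0 hy)] at h3
    have h4 : Function.Injective (tder Φ y) := Function.Injective.of_comp (f := dAt e (Φ y)) h3
    exact h4
  · rintro ⟨n, rfl⟩
    have hp : Function.Periodic Φ ((2 * Real.pi) • stdVec 0) := hper
    have := hp.zsmul n y
    rw [← Int.cast_smul_eq_zsmul ℝ, smul_smul, mul_comm] at this
    exact this.symm
  · rw [← hl.range_eq]
    ext p
    constructor
    · rintro ⟨y, hy, rfl⟩
      refine ⟨y 0, ?_⟩
      rw [← haxis]
      congr 1
      ext i
      fin_cases i <;> simp [stdVec, hy.1, hy.2.1, hy.2.2]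
    · rintro ⟨t, rfl⟩
      exact ⟨t • stdVec 0, by simp [stdVec], haxis t⟩

end Tube

/-! ### Smooth dependence of an integral on parameters -/

section Parametric

variable {H : Type} [NormedAddCommGroup H] [NormedSpace ℝ H] [FiniteDimensional ℝ H]

theorem hasFDerivAt_intervalIntegral {E : Type} [NormedAddCommGroup E] [NormedSpace ℝ E]
    [CompleteSpace E] {f : ℝ × H → E} (hf : ContDiff ℝ 1 f) (x : H) :
    HasFDerivAt (fun x => ∫ t in (0 : ℝ)..1, f (t, x))
      (∫ t in (0 : ℝ)..1, (fderiv ℝ f (t, x)).comp (ContinuousLinearMap.inr ℝ ℝ H)) x := by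
  have hpart : ∀ x : H, Continuous fun t : ℝ => (t, x) := fun x => by fun_prop
  have hf' : Continuous fun q => (fderiv ℝ f q).comp (ContinuousLinearMap.inr ℝ ℝ H) :=
    (hf.continuous_fderiv (by simp)).clm_comp continuous_const
  have : ProperSpace H := FiniteDimensional.proper ℝ H
  obtain ⟨C, hC⟩ := (isCompact_Icc.prod (isCompact_closedBall x 1) :
    IsCompact (Icc (0 : ℝ) 1 ×ˢ Metric.closedBall x 1)).exists_bound_of_continuousOn hf'.continuousOn
  refine intervalIntegral.hasFDerivAt_integral_of_dominated_of_fderiv_le (F := fun x t => f (t, x))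
    (F' := fun x t => (fderiv ℝ f (t, x)).comp (ContinuousLinearMap.inr ℝ ℝ H)) (bound := fun _ => C)
    (Metric.ball_mem_nhds x one_pos)
    (Filter.Eventually.of_forall fun x => (hf.continuous.comp (hpart x)).aestronglyMeasurable)
    ((hf.continuous.comp (hpart x)).intervalIntegrable _ _)
    (hf'.comp (hpart x)).aestronglyMeasurable ?_ intervalIntegrable_const ?_
  · refine Filter.Eventually.of_forall fun t ht z hz => hC (t, z) ⟨?_, Metric.ball_subset_closedBall hz⟩
    rw [uIoc_of_le zero_le_one] at ht
    exact ⟨ht.1.le, ht.2⟩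
  · exact Filter.Eventually.of_forall fun t _ z _ =>
      ((hf.differentiable (by simp)) (t, z)).hasFDerivAt.comp z (hasFDerivAt_prodMk_right t z)

theorem contDiff_intervalIntegral {E : Type} [NormedAddCommGroup E] [NormedSpace ℝ E]
    [CompleteSpace E] {f : ℝ × H → E} (hf : ContDiff ℝ ∞ f) :
    ContDiff ℝ ∞ fun x => ∫ t in (0 : ℝ)..1, f (t, x) := by
  rw [contDiff_infty]
  intro n
  induction n generalizing E with
  | zero =>
    exact contDiff_zero.2 (intervalIntegral.continuous_parametric_intervalIntegral_of_continuous'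
      (f := fun x t => f (t, x)) (hf.continuous.comp (by fun_prop)) 0 1)
  | succ n ih =>
    -- The derivative is an integral of the same kind with values in another space, hence the
    -- induction over all targets.
    have := ih (f := fun q => (fderiv ℝ f q).comp (ContinuousLinearMap.inr ℝ ℝ H))
      ((hf.fderiv_right (by simp)).clm_comp contDiff_const)
    push_cast
    exact contDiff_succ_iff_hasFDerivAt.2
      ⟨_, this, fun x => hasFDerivAt_intervalIntegral (hf.of_le (by simp)) x⟩

end Parametric

/-! ### The Poincaré lemma for the contraction to the axis -/

section Primitive

theorem form_eq_sum_sum (α : Λ[2]) (u v : E4) :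
    α ![u, v] = ∑ i, ∑ j, u i * v j * α ![stdVec i, stdVec j] := by
  conv_lhs => rw [← sum_coord_smul_stdVec u, form_apply_sum_left]
  refine Finset.sum_congr rfl fun i _ => ?_
  conv_lhs => rw [form_swap, ← sum_coord_smul_stdVec v, form_apply_sum_left]
  rw [mul_neg, Finset.mul_sum, ← Finset.sum_neg_distrib]
  refine Finset.sum_congr rfl fun j _ => ?_
  rw [form_swap α (stdVec i)]
  ring

theorem hasDerivAt_form {k : ℝ → Λ[2]} {a b : ℝ → E4} {t : ℝ}
    {k' : Λ[2]} {a' b' : E4} (hk : HasDerivAt k k' t) (ha : HasDerivAt a a' t)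
    (hb : HasDerivAt b b' t) : HasDerivAt (fun t => k t ![a t, b t])
      (k' ![a t, b t] + k t ![a', b t] + k t ![a t, b']) t := by
  have hc : ∀ {x : ℝ → E4} {x' : E4}, HasDerivAt x x' t → ∀ i, HasDerivAt (fun t => x t i) (x' i) t :=
    fun hx i => (EuclideanSpace.proj i : E4 →L[ℝ] ℝ).hasFDerivAt.comp_hasDerivAt t hx
  have h := HasDerivAt.fun_sum (u := Finset.univ) fun i _ =>
    HasDerivAt.fun_sum (u := Finset.univ) fun j _ =>
    ((hc ha i).mul (hc hb j)).mul
      ((evalForm ![stdVec i, stdVec j]).hasFDerivAt.comp_hasDerivAt t hk)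
  simp only [form_eq_sum_sum _ (a _) (b _)]
  refine h.congr_deriv ?_
  rw [form_eq_sum_sum (k t) a', form_eq_sum_sum (k t) (a t), ← Finset.sum_add_distrib,
    ← Finset.sum_add_distrib]
  refine Finset.sum_congr rfl fun i _ => ?_
  rw [← Finset.sum_add_distrib, ← Finset.sum_add_distrib]
  refine Finset.sum_congr rfl fun j _ => ?_
  simp only [evalForm_apply, Pi.mul_apply, Function.comp_apply]
  ring

theorem contDiff_form_apply {F : Type*} [NormedAddCommGroup F] [NormedSpace ℝ F]
    {k : F → Λ[2]} {a b : F → E4} (hk : ContDiff ℝ ∞ k) (ha : ContDiff ℝ ∞ a)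
    (hb : ContDiff ℝ ∞ b) : ContDiff ℝ ∞ fun z => k z ![a z, b z] :=
  contDiff_iff_contDiffAt.2 fun z => ContDiffWithinAt.form_apply (v := fun z => ![a z, b z])
    (s := univ) hk.contDiffAt fun i => by
      fin_cases i
      · exact ha.contDiffAt
      · exact hb.contDiffAt

/-- Projection along the axis. -/
def normalL : E4 →L[ℝ] E4 :=
  ContinuousLinearMap.id ℝ E4 - (EuclideanSpace.proj 0 : E4 →L[ℝ] ℝ).smulRight (stdVec 0)

theorem normalL_apply (y : E4) : normalL y = normalPart y := rfl

/-- The contraction to the axis. -/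
def contractL (s : ℝ) : E4 →L[ℝ] E4 :=
  (EuclideanSpace.proj 0 : E4 →L[ℝ] ℝ).smulRight (stdVec 0) + s • normalL

theorem contractL_apply (s : ℝ) (y : E4) : contractL s y = y 0 • stdVec 0 + s • normalPart y := rfl

theorem contractL_one (y : E4) : contractL 1 y = y := by
  rw [contractL_apply, normalPart]
  module

theorem contractL_zero (y : E4) : contractL 0 y = y 0 • stdVec 0 := by
  rw [contractL_apply, zero_smul, add_zero]

theorem contDiff_contractL : ContDiff ℝ ∞ contractL :=
  contDiff_const.add (contDiff_id.smul contDiff_const)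

theorem contractL_apply_zero (s : ℝ) (y : E4) : contractL s y 0 = y 0 := by
  rw [contractL_apply, PiLp.add_apply, PiLp.smul_apply, PiLp.smul_apply, normalPart_zero]
  simp [stdVec]

theorem normalPart_contractL (s : ℝ) (y : E4) : normalPart (contractL s y) = s • normalPart y := by
  rw [normalPart, contractL_apply_zero, contractL_apply, add_sub_cancel_left]

variable {k : E4 → Λ[2]}

/-- The integrand of the homotopy formula for the contraction to the axis. -/
def coneForm (k : E4 → Λ[2]) (q : ℝ × E4) : Λ[1] :=
  (ContinuousAlternatingMap.curryLeft (n := 1) (k (contractL q.1 q.2))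
    (normalPart q.2)).compContinuousLinearMap (contractL q.1)

theorem coneForm_apply (q : ℝ × E4) (v : Fin 1 → E4) : coneForm k q v =
    k (contractL q.1 q.2) ![normalL q.2, contractL q.1 (v 0)] := by
  change k _ (Matrix.vecCons (normalPart q.2) (fun i => contractL q.1 (v i))) = _
  congr 1
  ext i
  fin_cases i <;> rfl

/-- The primitive of a closed form that vanishes on the axis. -/
def primitive (k : E4 → Λ[2]) (y : E4) : Λ[1] :=
  ∫ s in (0 : ℝ)..1, coneForm k (s, y)

section

variable (hk : ContDiff ℝ ∞ k)
include hk

theorem contDiff_coneForm_apply (v : E4) : ContDiff ℝ ∞ fun q : ℝ × E4 =>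
    k (contractL q.1 q.2) ![normalL q.2, contractL q.1 v] :=
  contDiff_form_apply (hk.comp ((contDiff_contractL.comp contDiff_fst).clm_apply contDiff_snd))
    (normalL.contDiff.comp contDiff_snd)
    ((contDiff_contractL.comp contDiff_fst).clm_apply contDiff_const)

theorem contDiff_coneForm : ContDiff ℝ ∞ (coneForm k) := contDiff_iff_contDiffAt.2 fun q =>
  contDiffAt_form_of_coeffs fun i => by
    simp only [coneForm_apply]
    exact (contDiff_coneForm_apply hk _).contDiffAt

theorem contDiff_primitive : ContDiff ℝ ∞ (primitive k) :=
  contDiff_intervalIntegral (contDiff_coneForm hk)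

theorem primitive_apply (y : E4) (v : Fin 1 → E4) : primitive k y v =
    ∫ s in (0 : ℝ)..1, k (contractL s y) ![normalL y, contractL s (v 0)] := by
  have h := (evalForm v).intervalIntegral_comp_comm (μ := MeasureTheory.volume) (a := 0) (b := 1)
    (f := fun s : ℝ => coneForm k (s, y))
    (((contDiff_coneForm hk).continuous.comp (by fun_prop)).intervalIntegrable _ _)
  simp only [evalForm_apply, coneForm_apply] at h
  exact h.symm

theorem fderiv_primitive_apply (y u v : E4) : fderiv ℝ (fun z => primitive k z ![v]) y u =
    ∫ s in (0 : ℝ)..1, (fderiv ℝ k (contractL s y) (contractL s u) ![normalL y, contractL s v] +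
      k (contractL s y) ![normalL u, contractL s v]) := by
  have hc := contDiff_coneForm_apply hk v
  have h1 := hasFDerivAt_intervalIntegral (hc.of_le (by simp)) y
  simp only [primitive_apply hk]
  change fderiv ℝ (fun z => ∫ s in (0 : ℝ)..1, k (contractL s z) ![normalL z, contractL s v]) y u = _
  rw [h1.fderiv, ContinuousLinearMap.intervalIntegral_apply
    ((((hc.continuous_fderiv (by simp)).clm_comp continuous_const).comp
      (by fun_prop : Continuous fun s : ℝ => (s, y))).intervalIntegrable _ _)]
  refine intervalIntegral.integral_congr fun s _ => ?_
  have hline : HasDerivAt (fun t : ℝ => y + t • u) u 0 := by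
    have := ((hasDerivAt_id (0 : ℝ)).smul_const u).const_add y
    rw [one_smul] at this
    exact this
  have h0 : y + (0 : ℝ) • u = y := by rw [zero_smul, add_zero]
  have h2 := HasFDerivAt.comp_hasDerivAt (0 : ℝ) (l := fun q : ℝ × E4 =>
    k (contractL q.1 q.2) ![normalL q.2, contractL q.1 v])
    (hc.differentiable (by simp) (s, y + (0 : ℝ) • u)).hasFDerivAt
    ((hasDerivAt_const (0 : ℝ) s).prodMk hline)
  have h3 := hasDerivAt_form
    ((hk.differentiable (by simp) (contractL s (y + (0 : ℝ) • u))).hasFDerivAt.comp_hasDerivAt (0 : ℝ)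
      ((contractL s).hasFDerivAt.comp_hasDerivAt (0 : ℝ) hline))
    (normalL.hasFDerivAt.comp_hasDerivAt (0 : ℝ) hline) (hasDerivAt_const (0 : ℝ) (contractL s v))
  have h5 := h2.unique h3
  simp only [h0, Function.comp_apply] at h5
  refine h5.trans ?_
  rw [form_swap _ _ 0, ← zero_smul ℝ (0 : E4), form_smul_left, zero_mul, neg_zero, add_zero]

/-- The Poincaré lemma for the contraction to the axis. -/
theorem extDeriv_primitive {y : E4} (h0 : k (y 0 • stdVec 0) = 0)
    (hcl : ∀ s ∈ Icc (0 : ℝ) 1, ∀ u v w, fderiv ℝ k (contractL s y) u ![v, w] -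
      fderiv ℝ k (contractL s y) v ![u, w] + fderiv ℝ k (contractL s y) w ![u, v] = 0) :
    extDeriv (primitive k) y = k y := by
  ext w
  obtain ⟨u, v, rfl⟩ : ∃ u v, w = ![u, v] := ⟨w 0, w 1, by ext i; fin_cases i <;> rfl⟩
  have hcs : ∀ x : E4, ContDiff ℝ ∞ fun s => contractL s x := fun x =>
    contDiff_contractL.clm_apply contDiff_const
  have hkc : ContDiff ℝ ∞ fun s => k (contractL s y) := hk.comp (hcs y)
  have hkd : ∀ x : ℝ → E4, ContDiff ℝ ∞ x → ContDiff ℝ ∞ fun s =>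
      fderiv ℝ k (contractL s y) (x s) := fun x hx =>
    ((hk.fderiv_right (m := ∞) (by simp)).comp (hcs y)).clm_apply hx
  have hint : ∀ u v : E4, Continuous fun s =>
      fderiv ℝ k (contractL s y) (contractL s u) ![normalL y, contractL s v] +
      k (contractL s y) ![normalL u, contractL s v] := fun u v =>
    (contDiff_form_apply (hkd _ (hcs u)) contDiff_const (hcs v)).continuous.add
      (contDiff_form_apply hkc contDiff_const (hcs v)).continuous
  rw [extDeriv_one ((contDiff_primitive hk).differentiable (by simp) y), fderiv_primitive_apply hk,
    fderiv_primitive_apply hk, ← intervalIntegral.integral_sub ((hint u v).intervalIntegrable _ _)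
    ((hint v u).intervalIntegrable _ _)]
  -- By closedness the integrand of `d (primitive k)` is the `s`-derivative of the pull-back of `k`
  -- under `contractL s`, which runs from `0`, as `k` vanishes on the axis, to `k y`.
  have hder : ∀ s : ℝ, HasDerivAt (fun s => k (contractL s y) ![contractL s u, contractL s v])
      (fderiv ℝ k (contractL s y) (normalL y) ![contractL s u, contractL s v] +
        k (contractL s y) ![normalL u, contractL s v] +
        k (contractL s y) ![contractL s u, normalL v]) s := by
    intro s
    have hcd : ∀ x : E4, HasDerivAt (fun s => contractL s x) (normalL x) s := fun x => by
      have := ((hasDerivAt_id s).smul_const (normalL x)).const_add (x 0 • stdVec 0)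
      rw [one_smul] at this
      exact this
    exact hasDerivAt_form ((hk.differentiable (by simp) _).hasFDerivAt.comp_hasDerivAt s (hcd y))
      (hcd u) (hcd v)
  have hftc := intervalIntegral.integral_eq_sub_of_hasDerivAt (a := 0) (b := 1) (fun s _ => hder s)
    (Continuous.intervalIntegrable
      (((contDiff_form_apply (hkd _ contDiff_const) (hcs u) (hcs v)).continuous.add
      (contDiff_form_apply hkc contDiff_const (hcs v)).continuous).add
      (contDiff_form_apply hkc (hcs u) contDiff_const).continuous) _ _)
  rw [contractL_zero, h0, contractL_one, contractL_one, contractL_one] at hftc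
  have hz : ∀ x, (0 : Λ[2]) x = 0 := fun _ => rfl
  rw [hz, sub_zero] at hftc
  rw [← hftc]
  refine intervalIntegral.integral_congr fun s hs => ?_
  rw [uIcc_of_le zero_le_one] at hs
  have h1 := hcl s hs (contractL s u) (contractL s v) (normalL y)
  rw [form_swap _ (contractL s v) (normalL y), form_swap _ (contractL s u) (normalL y)] at h1
  rw [form_swap (k (contractL s y)) (contractL s u) (normalL v)]
  linear_combination -h1

/-- The factor `normalPart y` occurs twice, in the bound for `k` and as the contracted vector; `2`
bounds the norm of `contractL s`. The quadratic decay is what makes the error caused by a cutoff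
controllable. -/
theorem norm_primitive_le {y : E4} {C : ℝ} (hC : ∀ s ∈ Icc (0 : ℝ) 1,
    ‖k (contractL s y)‖ ≤ C * ‖normalPart y‖) : ‖primitive k y‖ ≤ 2 * C * ‖normalPart y‖ ^ 2 := by
  have hC0 : 0 ≤ C * ‖normalPart y‖ := (norm_nonneg _).trans (hC 0 (by simp))
  refine ContinuousAlternatingMap.opNorm_le_bound _ (by nlinarith [norm_nonneg (normalPart y)])
    fun v => ?_
  rw [primitive_apply hk, Fin.prod_univ_one]
  have hb : ∀ s ∈ uIoc (0 : ℝ) 1, ‖k (contractL s y) ![normalL y, contractL s (v 0)]‖ ≤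
      2 * C * ‖normalPart y‖ ^ 2 * ‖v 0‖ := by
    intro s hs
    rw [uIoc_of_le zero_le_one] at hs
    refine (ContinuousAlternatingMap.le_opNorm _ _).trans ?_
    rw [Fin.prod_univ_two]
    change ‖k (contractL s y)‖ * (‖normalPart y‖ * ‖contractL s (v 0)‖) ≤ _
    have h1 : ‖contractL s (v 0)‖ ≤ 2 * ‖v 0‖ := by
      have h2 : contractL s (v 0) = s • v 0 + ((1 - s) * v 0 0) • stdVec 0 := by
        rw [contractL_apply, normalPart]
        module
      have h3 : ‖(stdVec 0 : E4)‖ = 1 := by simp [stdVec]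
      have h4 : |v 0 0| ≤ ‖v 0‖ := PiLp.norm_apply_le (v 0) 0
      rw [h2]
      refine (norm_add_le _ _).trans ?_
      rw [norm_smul, norm_smul, h3, Real.norm_eq_abs, Real.norm_eq_abs, abs_mul, abs_of_pos hs.1,
        abs_of_nonneg (sub_nonneg.2 hs.2)]
      nlinarith [hs.1, hs.2, norm_nonneg (v 0), abs_nonneg (v 0 0)]
    have h5 := mul_le_mul (hC s ⟨hs.1.le, hs.2⟩)
      (mul_le_mul_of_nonneg_left h1 (norm_nonneg (normalPart y))) (by positivity) hC0
    linarith
  simpa using intervalIntegral.norm_integral_le_of_norm_le_const hb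

end

end Primitive

/-! ### A cutoff with small scale-invariant gradient -/

section Cutoff

theorem exists_bound_deriv_smoothTransition : ∃ C, 0 < C ∧ ∀ x, |deriv Real.smoothTransition x| ≤ C := by
  have hS : ContDiff ℝ ∞ Real.smoothTransition := Real.smoothTransition.contDiff
  have hc : Continuous (deriv Real.smoothTransition) := (contDiff_infty_iff_deriv.1 hS).2.continuous
  obtain ⟨C, hC⟩ := isCompact_Icc.exists_bound_of_continuousOn (s := Icc (0 : ℝ) 1) hc.continuousOn
  refine ⟨max C 1, by positivity, fun x => ?_⟩
  by_cases hx : x ∈ Icc (0 : ℝ) 1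
  · exact (hC x hx).trans (le_max_left _ _)
  · have : deriv Real.smoothTransition x = 0 := by
      rw [mem_Icc, not_and_or, not_le, not_le] at hx
      rcases hx with hx | hx
      · have h : Real.smoothTransition =ᶠ[𝓝 x] fun _ => 0 := by
          filter_upwards [gt_mem_nhds hx] with z hz using Real.smoothTransition.zero_of_nonpos hz.le
        rw [h.deriv_eq, deriv_const]
      · have h : Real.smoothTransition =ᶠ[𝓝 x] fun _ => 1 := by
          filter_upwards [lt_mem_nhds hx] with z hz using Real.smoothTransition.one_of_one_le hz.le
        rw [h.deriv_eq, deriv_const]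
    rw [this, abs_zero]
    positivity

theorem norm_normalL_le (y : E4) : ‖normalL y‖ ≤ ‖y‖ := by
  rw [← sq_le_sq₀ (norm_nonneg _) (norm_nonneg _), normalL_apply, norm_normalPart_sq,
    EuclideanSpace.norm_sq_eq, Fin.sum_univ_four]
  simp only [Real.norm_eq_abs, sq_abs]
  nlinarith [sq_nonneg (y 0)]

/-- A logarithmic cutoff function around the axis. -/
theorem exists_cutoff {b δ : ℝ} (hb : 0 < b) (hδ : 0 < δ) : ∃ χ : E4 → ℝ, ContDiff ℝ ∞ χ ∧
    (∀ y, χ y ∈ Icc (0 : ℝ) 1) ∧ (∀ y (t : ℝ), χ (y + t • stdVec 0) = χ y) ∧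
    (∃ b', b' < b ∧ ∀ y, χ y ≠ 0 → ‖normalPart y‖ ≤ b') ∧ (∃ r, 0 < r ∧ ∀ y ∈ tube r, χ y = 1) ∧
    ∀ y, ‖fderiv ℝ χ y‖ * ‖normalPart y‖ ≤ δ := by
  obtain ⟨C, hC, hCb⟩ := exists_bound_deriv_smoothTransition
  -- The slope is chosen so that `2 C κ = δ`. With `a` half of `b² exp (-1 / κ)` the function is `1`
  -- where the squared distance is below `a` and `0` where it is at least `b² - a`. The logarithmic
  -- profile makes the gradient decay like the inverse distance, at the price of an exponentially
  -- thin inner tube.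
  let κ : ℝ := δ / (2 * C)
  have hκ : 0 < κ := by positivity
  let a : ℝ := b ^ 2 * Real.exp (-(1 / κ)) / 2
  have ha : 0 < a := by positivity
  have hexp : Real.exp (-(1 / κ)) < 1 := by
    rw [← Real.exp_zero]
    exact Real.exp_lt_exp.2 (neg_neg_of_pos (by positivity))
  have hab : a < b ^ 2 := by
    have : 0 < b ^ 2 := by positivity
    simp only [a]
    nlinarith
  let q : E4 → ℝ := fun y => ‖normalL y‖ ^ 2
  have hq : ContDiff ℝ ∞ q := (contDiff_norm_sq ℝ).comp normalL.contDiff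
  have hq0 : ∀ y, 0 ≤ q y := fun y => sq_nonneg _
  let l : E4 → ℝ := fun y => -κ * Real.log ((q y + a) / b ^ 2)
  have hpos : ∀ y, 0 < (q y + a) / b ^ 2 := fun y => div_pos (by linarith [hq0 y]) (by positivity)
  have hl : ContDiff ℝ ∞ l := contDiff_const.mul
    (((hq.add contDiff_const).div_const _).log fun y => (hpos y).ne')
  have hS : ContDiff ℝ ∞ Real.smoothTransition := Real.smoothTransition.contDiff
  refine ⟨fun y => Real.smoothTransition (l y), hS.comp hl, fun y =>
    ⟨Real.smoothTransition.nonneg _, Real.smoothTransition.le_one _⟩, fun y t => ?_,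
    ⟨Real.sqrt (b ^ 2 - a), ?_, fun y hy => ?_⟩, ⟨Real.sqrt a, Real.sqrt_pos.2 ha, fun y hy => ?_⟩,
    fun y => ?_⟩
  · simp only [l, q, normalL_apply, normalPart_add_axis]
  · rw [Real.sqrt_lt' hb]
    linarith
  · by_contra hlt
    rw [not_le] at hlt
    refine hy (Real.smoothTransition.zero_of_nonpos ?_)
    have h1 := (Real.sqrt_lt' ((Real.sqrt_nonneg _).trans_lt hlt)).1 hlt
    have h2 : 1 ≤ (q y + a) / b ^ 2 := by
      rw [one_le_div (by positivity)]
      simp only [q, normalL_apply]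
      linarith
    have := Real.log_nonneg h2
    simp only [l]
    nlinarith
  · refine Real.smoothTransition.one_of_one_le ?_
    rw [mem_tube_iff (Real.sqrt_pos.2 ha), Real.lt_sqrt (norm_nonneg _)] at hy
    have h2 : (q y + a) / b ^ 2 ≤ Real.exp (-(1 / κ)) := by
      rw [div_le_iff₀ (by positivity)]
      simp only [q, normalL_apply]
      simp only [a] at hy ⊢
      linarith
    have h3 := Real.log_le_log (hpos y) h2
    rw [Real.log_exp] at h3
    simp only [l]
    have h4 : κ * (1 / κ) = 1 := by field_simp
    nlinarith
  · have hqd : HasFDerivAt q ((2 : ℝ) • (innerSL ℝ (normalL y)).comp normalL) y := by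
      have := (hasStrictFDerivAt_norm_sq (normalL y)).hasFDerivAt.comp y normalL.hasFDerivAt
      refine this.congr_fderiv ?_
      ext1 u
      simp
    have hld : HasFDerivAt l _ y :=
      (((hqd.add_const a).mul_const (b ^ 2)⁻¹).log (hpos y).ne').const_mul (-κ)
    have hSd := ((hS.differentiable (by simp) (l y)).hasDerivAt).comp_hasFDerivAt y hld
    have hSd' : HasFDerivAt (fun y => Real.smoothTransition (l y)) _ y := hSd
    set n := ‖normalPart y‖ with hn
    have hqn : q y = n ^ 2 := rfl
    have hqa : 0 < n ^ 2 + a := by positivity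
    have hbound : ‖fderiv ℝ (fun y => Real.smoothTransition (l y)) y‖ ≤
        2 * C * κ * n / (n ^ 2 + a) := by
      rw [hSd'.fderiv]
      refine ContinuousLinearMap.opNorm_le_bound _ (by positivity) fun u => ?_
      simp only [_root_.smul_apply, smul_eq_mul, ContinuousLinearMap.comp_apply, innerSL_apply_apply]
      rw [hqn, Real.norm_eq_abs]
      have e : deriv Real.smoothTransition (l y) * (-κ * (((n ^ 2 + a) * (b ^ 2)⁻¹)⁻¹ *
          ((b ^ 2)⁻¹ * (2 * inner ℝ (normalL y) (normalL u))))) =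
          deriv Real.smoothTransition (l y) * inner ℝ (normalL y) (normalL u) *
            (-(2 * κ) / (n ^ 2 + a)) := by
        field_simp
      rw [e, abs_mul, abs_mul, abs_div, abs_neg, abs_of_pos hqa, abs_of_pos (by positivity : 0 < 2 * κ)]
      have h1 : |inner ℝ (normalL y) (normalL u)| ≤ n * ‖u‖ :=
        (abs_real_inner_le_norm _ _).trans (mul_le_mul_of_nonneg_left (norm_normalL_le u)
          (norm_nonneg _))
      have h2 := mul_le_mul (hCb (l y)) h1 (abs_nonneg _) hC.le
      refine (mul_le_mul_of_nonneg_right h2 (by positivity)).trans (le_of_eq ?_)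
      ring
    refine (mul_le_mul_of_nonneg_right hbound (norm_nonneg _)).trans ?_
    have h3 : 2 * C * κ = δ := by simp only [κ]; field_simp
    rw [h3, div_mul_eq_mul_div, div_le_iff₀ hqa]
    nlinarith

end Cutoff

/-! ### Interpolation between forms vanishing on the axis -/

section AxisForms

variable {β m : E4 → Λ[2]}

/-- Each term of the Pfaffian has exactly one factor involving `stdVec 0`. When these factors
coincide, what remains is linear in the form. -/
theorem pf_affine {α₀ α₁ : Λ[2]} (h : ∀ v, α₀ ![stdVec 0, v] = α₁ ![stdVec 0, v])
    (l : ℝ) : pf ((1 - l) • α₀ + l • α₁) stdVec = (1 - l) * pf α₀ stdVec + l * pf α₁ stdVec := by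
  simp only [pf, ContinuousAlternatingMap.add_apply, ContinuousAlternatingMap.smul_apply, h,
    smul_eq_mul]
  ring

/-- First order expansion at the axis. -/
theorem eventually_norm_sub_le (hβ : ContDiff ℝ ∞ β) (h0 : ∀ t : ℝ, β (t • stdVec 0) = 0) (t₀ : ℝ)
    {c : ℝ} (hc : 0 < c) : ∀ᶠ y in 𝓝 (t₀ • stdVec 0 : E4),
      ‖β y - fderiv ℝ β (t₀ • stdVec 0) (normalPart y)‖ ≤ c * ‖normalPart y‖ := by
  have h1 := (hβ.contDiffAt (x := t₀ • stdVec 0)).hasStrictFDerivAt (by simp)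
  have h2 := h1.isLittleO.def hc
  have h3 : Filter.Tendsto (fun y : E4 => (y, y 0 • stdVec 0)) (𝓝 (t₀ • stdVec 0 : E4))
      (𝓝 (t₀ • stdVec 0, t₀ • stdVec 0)) := by
    have : Continuous fun y : E4 => (y, (y 0 • stdVec 0 : E4)) := by fun_prop
    have h4 := this.tendsto (t₀ • stdVec 0 : E4)
    rwa [axis_zero] at h4
  filter_upwards [h3.eventually h2] with y hy
  simp only [h0, sub_zero] at hy
  exact hy

theorem exists_norm_le (hβ : ContDiff ℝ ∞ β) (h0 : ∀ t : ℝ, β (t • stdVec 0) = 0)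
    (hp : ∀ y, β (y + (2 * Real.pi) • stdVec 0) = β y) :
    ∃ r C, 0 < r ∧ 0 < C ∧ ∀ y ∈ tube r, ‖β y‖ ≤ C * ‖normalPart y‖ := by
  have hper : ∀ t : ℝ, fderiv ℝ β ((t + 2 * Real.pi) • stdVec 0) = fderiv ℝ β (t • stdVec 0) :=
    fun t => by
      rw [add_smul, ← fderiv_comp_add_right]
      simp only [hp]
  -- The bound enters through its inverse, so that the condition has the monotonicity required of a
  -- radius.
  obtain ⟨C, hC, h⟩ := exists_uniform_radius (P := fun t C => 0 < C →
      ‖fderiv ℝ β (t • stdVec 0)‖ ≤ C⁻¹) Real.two_pi_pos (fun t C h => by rwa [hper])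
    (fun t C h => by rwa [hper] at h) (fun t C C' hle h hC' =>
      (h (hC'.trans_le hle)).trans (inv_anti₀ hC' hle)) (fun t => by
      have hcont : Continuous fun t : ℝ => ‖fderiv ℝ β (t • stdVec 0)‖ :=
        ((hβ.continuous_fderiv (by simp)).comp (by fun_prop)).norm
      refine ⟨(‖fderiv ℝ β (t • stdVec 0)‖ + 1)⁻¹, by positivity, ?_⟩
      filter_upwards [hcont.continuousAt.eventually (gt_mem_nhds (lt_add_one _))] with s hs _
      rw [inv_inv]
      exact hs.le)
  obtain ⟨r, hr, hr'⟩ := exists_tube_of_eventually (T := 2 * Real.pi)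
    (Q := fun y => ‖β y‖ ≤ (C⁻¹ + 1) * ‖normalPart y‖) Real.two_pi_pos
    (fun y => by rw [hp, normalPart_add_axis]) (fun t => by
      filter_upwards [eventually_norm_sub_le hβ h0 t one_pos] with y hy
      have h1 := (fderiv ℝ β (t • stdVec 0)).le_of_opNorm_le (h t hC) (normalPart y)
      have h2 := norm_le_norm_add_norm_sub' (β y) (fderiv ℝ β (t • stdVec 0) (normalPart y))
      linarith)
  exact ⟨r, _, hr, by positivity, hr'⟩

/-- By `pf_affine` the convex combinations of the two derivatives are Pfaffian-positive on unit
normal vectors. These values form a compact set, and a neighbourhood of it is still positive. After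
division by `‖normalPart y‖` the actual forms, with an error of relative size `ε`, stay in that
neighbourhood; this is the room for the cutoff error. -/
theorem exists_pf_pos (hβ : IsAxisForm β) (hm : IsAxisForm m)
    (hmatch : ∀ (t : ℝ) u v, fderiv ℝ β (t • stdVec 0) u ![stdVec 0, v] =
      fderiv ℝ m (t • stdVec 0) u ![stdVec 0, v]) :
    ∃ ε, 0 < ε ∧ ∀ y ∈ tube ε, normalPart y ≠ 0 → ∀ l ∈ Icc (0 : ℝ) 1,
      ∀ err : Λ[2], ‖err‖ ≤ ε * ‖normalPart y‖ →
        0 < pf ((1 - l) • β y + l • m y + err) stdVec := by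
  obtain ⟨ε, hε, h⟩ := exists_uniform_radius (P := fun t ε => ∀ y : E4, y 0 = t → ‖normalPart y‖ < ε →
      normalPart y ≠ 0 → ∀ l ∈ Icc (0 : ℝ) 1, ∀ err : Λ[2],
      ‖err‖ ≤ ε * ‖normalPart y‖ → 0 < pf ((1 - l) • β y + l • m y + err) stdVec) Real.two_pi_pos
    (fun t ε h y hy hn => by
      have := h (y + (-(2 * Real.pi)) • stdVec 0) (by simp [stdVec, hy])
      rw [normalPart_add_axis, ← hβ.periodic, ← hm.periodic, neg_smul, neg_add_cancel_right] at this
      exact this hn)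
    (fun t ε h y hy hn => by
      have := h (y + (2 * Real.pi) • stdVec 0) (by simp [stdVec, hy])
      rw [normalPart_add_axis, hβ.periodic, hm.periodic] at this
      exact this hn)
    (fun t ε ε' hle h y hy hn h0 l hl err herr => h y hy (hn.trans_le hle) h0 l hl err
      (herr.trans (mul_le_mul_of_nonneg_right hle (norm_nonneg _))))
    (fun t₀ => by
      let B := fderiv ℝ β (t₀ • stdVec 0)
      let N := fderiv ℝ m (t₀ • stdVec 0)
      let S : Set E4 := Metric.sphere 0 1 ∩ {x | x 0 = 0}
      have hS : IsCompact S := (isCompact_sphere 0 1).inter_right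
        (isClosed_eq (EuclideanSpace.proj 0 : E4 →L[ℝ] ℝ).continuous continuous_const)
      let G : ℝ × E4 → Λ[2] := fun p => (1 - p.1) • B p.2 + p.1 • N p.2
      have hG : Continuous G := ((continuous_const.sub continuous_fst).smul
        (B.continuous.comp continuous_snd)).add (continuous_fst.smul (N.continuous.comp continuous_snd))
      have hK : IsCompact (G '' (Icc (0 : ℝ) 1 ×ˢ S)) := (isCompact_Icc.prod hS).image hG
      have hpos : G '' (Icc (0 : ℝ) 1 ×ˢ S) ⊆ {α | 0 < pf α stdVec} := by
        rintro _ ⟨⟨l, x⟩, ⟨hl : l ∈ Icc (0 : ℝ) 1, hx : x ∈ S⟩, rfl⟩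
        have hx' : x 1 ≠ 0 ∨ x 2 ≠ 0 ∨ x 3 ≠ 0 := by
          by_contra! hall
          have h1 : ‖x‖ = 1 := by simpa using hx.1
          have h2 : x = 0 := by
            ext i
            fin_cases i
            · exact hx.2
            · exact hall.1
            · exact hall.2.1
            · exact hall.2.2
          rw [h2, norm_zero] at h1
          exact zero_ne_one h1
        have h1 := hβ.pos t₀ x hx'
        have h2 := hm.pos t₀ x hx'
        simp only [G, Set.mem_ofPred_eq]
        rw [pf_affine (hmatch t₀ x)]
        rcases hl.1.eq_or_lt with h0 | h0
        · rw [← h0]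
          simpa using h1
        · exact add_pos_of_nonneg_of_pos (mul_nonneg (sub_nonneg.2 hl.2) h1.le) (mul_pos h0 h2)
      obtain ⟨δ, hδ, hthick⟩ := hK.exists_thickening_subset_open
        (isOpen_lt continuous_const (contDiff_pf stdVec).continuous) hpos
      have hδ3 : 0 < δ / 3 := by positivity
      obtain ⟨ρ, hρ, hball⟩ := Metric.eventually_nhds_iff_ball.1
        ((eventually_norm_sub_le hβ.smooth hβ.zero t₀ hδ3).and
          (eventually_norm_sub_le hm.smooth hm.zero t₀ hδ3))
      refine ⟨min (ρ / 2) (δ / 3), lt_min (half_pos hρ) hδ3, ?_⟩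
      filter_upwards [Metric.ball_mem_nhds t₀ (half_pos hρ)] with t ht y hy hn h0 l hl err herr
      obtain ⟨e1, e2⟩ := hball y (mem_ball_axis (by rw [hy]; simpa [Real.dist_eq] using ht)
        (hn.trans_le (min_le_left _ _)))
      set n := ‖normalPart y‖ with hndef
      have hn0 : 0 < n := norm_pos_iff.2 h0
      have hx : n⁻¹ • normalPart y ∈ S := by
        refine ⟨?_, ?_⟩
        · rw [mem_sphere_zero_iff_norm, norm_smul, norm_inv, Real.norm_of_nonneg hn0.le, ← hndef,
            inv_mul_cancel₀ hn0.ne']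
        · change (n⁻¹ • normalPart y) 0 = 0
          rw [PiLp.smul_apply, normalPart_zero, smul_zero]
      have hmem : n⁻¹ • ((1 - l) • β y + l • m y + err) ∈ {α | 0 < pf α stdVec} := by
        refine hthick (Metric.mem_thickening_iff.2 ⟨_, mem_image_of_mem G (x := (l, n⁻¹ • normalPart y))
          ⟨hl, hx⟩, ?_⟩)
        have e3 : n⁻¹ • ((1 - l) • β y + l • m y + err) - G (l, n⁻¹ • normalPart y) =
            n⁻¹ • ((1 - l) • (β y - B (normalPart y)) + l • (m y - N (normalPart y)) + err) := by
          simp only [G, map_smul]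
          module
        rw [dist_eq_norm, e3, norm_smul, norm_inv, Real.norm_of_nonneg hn0.le,
          inv_mul_lt_iff₀ hn0]
        have h4 := norm_add₃_le (a := (1 - l) • (β y - B (normalPart y)))
          (b := l • (m y - N (normalPart y))) (c := err)
        rw [norm_smul, norm_smul, Real.norm_of_nonneg hl.1,
          Real.norm_of_nonneg (sub_nonneg.2 hl.2)] at h4
        have h5 := mul_le_mul_of_nonneg_left e1 (sub_nonneg.2 hl.2)
        have h6 := mul_le_mul_of_nonneg_left e2 hl.1
        have h7 := herr.trans (mul_le_mul_of_nonneg_right (min_le_right (ρ / 2) (δ / 3)) hn0.le)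
        have h8 := mul_pos hδ3 hn0
        simp only [B, N] at h4
        nlinarith
      have h9 : 0 < pf (n⁻¹ • ((1 - l) • β y + l • m y + err)) stdVec := hmem
      rw [pf_smul] at h9
      exact (mul_pos_iff_of_pos_left (by positivity)).1 h9)
  exact ⟨ε, hε, fun y hy => h _ y rfl ((mem_tube_iff hε).1 hy)⟩

theorem primitive_periodic (hp : ∀ y, m (y + (2 * Real.pi) • stdVec 0) = m y) (y : E4) :
    primitive m (y + (2 * Real.pi) • stdVec 0) = primitive m y := by
  refine intervalIntegral.integral_congr fun s _ => ?_
  have : contractL s (y + (2 * Real.pi) • stdVec 0) = contractL s y + (2 * Real.pi) • stdVec 0 := by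
    rw [contractL_apply, contractL_apply, normalPart_add_axis, PiLp.add_apply, axis_zero]
    module
  simp only [coneForm, this, hp, normalPart_add_axis]

/-- A compactly supported exact deformation of `β` to `m` near the axis. -/
theorem exists_axis_deformation (hβ : IsAxisForm β) (hm : IsModelForm m)
    (hmatch : ∀ (t : ℝ) u v, fderiv ℝ β (t • stdVec 0) u ![stdVec 0, v] =
      fderiv ℝ m (t • stdVec 0) u ![stdVec 0, v]) {r₀ : ℝ} (hr₀ : 0 < r₀)
    (hcl : ∀ y ∈ tube r₀, ∀ u v w, fderiv ℝ β y u ![v, w] - fderiv ℝ β y v ![u, w] +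
      fderiv ℝ β y w ![u, v] = 0) :
    ∃ (b b' r : ℝ) (η : E4 → Λ[1]), 0 < b ∧ b ≤ r₀ ∧ b' < b ∧ 0 < r ∧
      ContDiff ℝ ∞ η ∧ (∀ y, η (y + (2 * Real.pi) • stdVec 0) = η y) ∧
      (∀ y, η y ≠ 0 → ‖normalPart y‖ ≤ b') ∧ (∀ y ∈ tube r, extDeriv η y = m y - β y) ∧
      ∀ y ∈ tube b, normalPart y ≠ 0 → ∀ l ∈ Icc (0 : ℝ) 1,
        0 < pf (β y + l • extDeriv η y) stdVec := by
  let k : E4 → Λ[2] := fun y => m y - β y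
  have hk : ContDiff ℝ ∞ k := hm.smooth.sub hβ.smooth
  have hk0 : ∀ t : ℝ, k (t • stdVec 0) = 0 := fun t => by simp only [k, hm.zero, hβ.zero, sub_zero]
  have hkp : ∀ y, k (y + (2 * Real.pi) • stdVec 0) = k y := fun y => by
    simp only [k, hm.periodic, hβ.periodic]
  obtain ⟨r₁, C, hr₁, hC, hkC⟩ := exists_norm_le hk hk0 hkp
  obtain ⟨ε, hε, hpos⟩ := exists_pf_pos hβ hm.toIsAxisForm hmatch
  let b := min r₀ (min r₁ ε)
  have hb : 0 < b := lt_min hr₀ (lt_min hr₁ hε)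
  have s0 : tube b ⊆ tube r₀ := tube_mono hb.le (min_le_left _ _)
  have s1 : tube b ⊆ tube r₁ := tube_mono hb.le ((min_le_right _ _).trans (min_le_left _ _))
  have s2 : tube b ⊆ tube ε := tube_mono hb.le ((min_le_right _ _).trans (min_le_right _ _))
  -- The primitive is bounded by `2 C n²` with `n = ‖normalPart y‖`, so each of the two terms of `dχ
  -- ∧ primitive` is at most `ε / (4 C) · 2 C n = ε n / 2`.
  obtain ⟨χ, hχ, hχI, hχp, ⟨b', hb', hsupp⟩, ⟨r, hr, hone⟩, hχd⟩ :=
    exists_cutoff hb (δ := ε / (4 * C)) (by positivity)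
  have hcone : ∀ y ∈ tube b, ∀ s ∈ Icc (0 : ℝ) 1, contractL s y ∈ tube b := fun y hy s hs => by
    rw [mem_tube_iff hb, normalPart_contractL, norm_smul, Real.norm_of_nonneg hs.1]
    exact (mul_le_of_le_one_left (norm_nonneg _) hs.2).trans_lt ((mem_tube_iff hb).1 hy)
  have hρ : ContDiff ℝ ∞ (primitive k) := contDiff_primitive hk
  have hdρ : ∀ y ∈ tube b, extDeriv (primitive k) y = k y := fun y hy => by
    refine extDeriv_primitive hk (hk0 _) fun s hs u v w => ?_
    have h1 := hm.closed (contractL s y) u v w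
    have h2 := hcl _ (s0 (hcone y hy s hs)) u v w
    have h3 : ∀ z, fderiv ℝ k z = fderiv ℝ m z - fderiv ℝ β z := fun z =>
      fderiv_sub (hm.smooth.differentiable (by simp) z) (hβ.smooth.differentiable (by simp) z)
    simp only [h3, _root_.sub_apply, ContinuousAlternatingMap.sub_apply]
    linear_combination h1 - h2
  have hη : ContDiff ℝ ∞ fun y => χ y • primitive k y := hχ.smul hρ
  have hdη : ∀ y ∈ tube b, ∃ err : Λ[2], ‖err‖ ≤ ε * ‖normalPart y‖ ∧
      extDeriv (fun y => χ y • primitive k y) y = χ y • k y + err := by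
    intro y hy
    refine ⟨extDeriv (fun y => χ y • primitive k y) y - χ y • k y, ?_, by abel⟩
    refine ContinuousAlternatingMap.opNorm_le_bound _ (by positivity) fun w => ?_
    obtain ⟨u, v, rfl⟩ : ∃ u v, w = ![u, v] := ⟨w 0, w 1, by ext i; fin_cases i <;> rfl⟩
    have hρd := hρ.differentiable (by simp) y
    have hχd' := hχ.differentiable (by simp) y
    have hprod : ∀ u v : E4, fderiv ℝ (fun z => (χ z • primitive k z) ![v]) y u =
        χ y * fderiv ℝ (fun z => primitive k z ![v]) y u + fderiv ℝ χ y u * primitive k y ![v] := by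
      intro u v
      have h2 : DifferentiableAt ℝ (fun z => primitive k z ![v]) y :=
        (evalForm ![v]).differentiableAt.comp y hρd
      have h3 := (hχd'.hasFDerivAt.mul h2.hasFDerivAt).fderiv
      have h4 := DFunLike.congr_fun h3 u
      refine h4.trans ?_
      simp [mul_comm]
    have e1 : (extDeriv (fun y => χ y • primitive k y) y - χ y • k y) ![u, v] =
        fderiv ℝ χ y u * primitive k y ![v] - fderiv ℝ χ y v * primitive k y ![u] := by
      rw [ContinuousAlternatingMap.sub_apply, ContinuousAlternatingMap.smul_apply, ← hdρ y hy,
        extDeriv_one (hη.differentiable (by simp) y), extDeriv_one hρd, hprod, hprod, smul_eq_mul]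
      ring
    have e2 : ∀ u v : E4, |fderiv ℝ χ y u * primitive k y ![v]| ≤
        ε / 2 * ‖normalPart y‖ * (‖u‖ * ‖v‖) := by
      intro u v
      have h1 := (fderiv ℝ χ y).le_opNorm u
      have h2 := (primitive k y).le_opNorm ![v]
      rw [Fin.prod_univ_one] at h2
      have h3 := norm_primitive_le hk (y := y) (C := C) fun s hs => by
        refine (hkC _ (s1 (hcone y hy s hs))).trans ?_
        rw [normalPart_contractL, norm_smul, Real.norm_of_nonneg hs.1]
        exact mul_le_mul_of_nonneg_left (mul_le_of_le_one_left (norm_nonneg _) hs.2) hC.le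
      have h4 := hχd y
      set n := ‖normalPart y‖
      rw [abs_mul]
      calc |fderiv ℝ χ y u| * |primitive k y ![v]|
          ≤ (‖fderiv ℝ χ y‖ * ‖u‖) * (2 * C * n ^ 2 * ‖v‖) := by
            refine mul_le_mul h1 (h2.trans (mul_le_mul_of_nonneg_right h3 (norm_nonneg _)))
              (abs_nonneg _) (by positivity)
        _ = (‖fderiv ℝ χ y‖ * n) * (2 * C * n * (‖u‖ * ‖v‖)) := by ring
        _ ≤ ε / (4 * C) * (2 * C * n * (‖u‖ * ‖v‖)) :=
            mul_le_mul_of_nonneg_right h4 (by positivity)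
        _ = ε / 2 * n * (‖u‖ * ‖v‖) := by field_simp; ring
    rw [e1, Fin.prod_univ_two, Real.norm_eq_abs]
    refine (abs_sub _ _).trans ?_
    have h5 := e2 u v
    have h6 := e2 v u
    simp only [Matrix.cons_val_zero, Matrix.cons_val_one]
    linarith
  refine ⟨b, b', min r b, _, hb, min_le_left _ _, hb', lt_min hr hb, hη, fun y => ?_, fun y hy => ?_,
    fun y hy => ?_, fun y hy hn l hl => ?_⟩
  · simp only [hχp, primitive_periodic hkp]
  · exact hsupp y fun h => hy (by simp only [h, zero_smul])
  · have hyb : y ∈ tube b := tube_mono (lt_min hr hb).le (min_le_right _ _) hy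
    have h1 : (fun y => χ y • primitive k y) =ᶠ[𝓝 y] primitive k := by
      filter_upwards [(isOpen_tube _).mem_nhds (tube_mono (lt_min hr hb).le (min_le_left _ _) hy)]
        with z hz
      simp only [hone z hz, one_smul]
    rw [h1.extDeriv_eq, hdρ y hyb]
  · obtain ⟨err, herr, he⟩ := hdη y hy
    -- The cutoff changes the interpolation parameter from `l` to `l * χ y`, which is still in `[0,
    -- 1]`; everything else counts as error.
    have e3 : β y + l • extDeriv (fun y => χ y • primitive k y) y =
        (1 - l * χ y) • β y + (l * χ y) • m y + l • err := by
      rw [he]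
      simp only [k]
      module
    rw [e3]
    refine hpos y (s2 hy) hn _ ⟨mul_nonneg hl.1 (hχI y).1, mul_le_one₀ hl.2 (hχI y).1 (hχI y).2⟩ _ ?_
    rw [norm_smul, Real.norm_of_nonneg hl.1]
    exact (mul_le_of_le_one_left (norm_nonneg _) hl.2).trans herr

end AxisForms

/-! ### Tubular charts: periodicity, compact images and descent of periodic forms -/

variable {M : Type*} [TopologicalSpace M] [ChartedSpace E4 M]

namespace IsTubularChart

variable {Φ : E4 → M} {r b : ℝ} {C : Set M}

theorem contMDiffAt (h : IsTubularChart Φ r C) {y : E4} (hy : y ∈ tube r) :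
    ContMDiffAt (𝓡 4) (𝓡 4) ∞ Φ y :=
  h.smooth.contMDiffAt ((isOpen_tube r).mem_nhds hy)

theorem tder_injective (h : IsTubularChart Φ r C) {y : E4} (hy : y ∈ tube r) :
    Function.Injective (tder Φ y) := h.injective_mfderiv y hy

theorem mono (h : IsTubularChart Φ r C) (hb : 0 < b) (hbr : b ≤ r) : IsTubularChart Φ b C :=
  have hs := tube_mono hb.le hbr
  ⟨h.smooth.mono hs, fun y hy => h.injective_mfderiv y (hs hy),
    fun y hy y' hy' => h.eq_iff y (hs hy) y' (hs hy'), h.core⟩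

theorem periodic (h : IsTubularChart Φ r C) {y : E4} (hy : y ∈ tube r) (n : ℤ) :
    Φ (y + (2 * Real.pi * n) • stdVec 0) = Φ y :=
  ((h.eq_iff y hy _ (add_axis_mem_tube.2 hy)).2 ⟨n, rfl⟩).symm

theorem tder_periodic (h : IsTubularChart Φ r C) {y : E4} (hy : y ∈ tube r) (n : ℤ) :
    tder Φ (y + (2 * Real.pi * n) • stdVec 0) = tder Φ y := by
  have h1 : (Φ ∘ fun z => z + (2 * Real.pi * n) • stdVec 0) =ᶠ[𝓝 y] Φ := by
    filter_upwards [(isOpen_tube r).mem_nhds hy] with z hz using h.periodic hz n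
  rw [← tder_congr h1, tder_comp (g := fun z => z + (2 * Real.pi * n) • stdVec 0)
    ((h.contMDiffAt (add_axis_mem_tube.2 hy)).mdifferentiableAt
    (by simp)) (by fun_prop), fderiv_add_const]
  simp

theorem pullback_periodic (h : IsTubularChart Φ r C) {k : ℕ} (σ : DiffForm M k) {y : E4}
    (hy : y ∈ tube r) (n : ℤ) :
    pullback Φ σ (y + (2 * Real.pi * n) • stdVec 0) = pullback Φ σ y := by
  rw [pullback_def, pullback_def, h.tder_periodic hy, h.periodic hy]

theorem axis_mem (h : IsTubularChart Φ r C) {p : M} (hp : p ∈ C) :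
    ∃ t : ℝ, Φ (t • stdVec 0) = p := by
  rw [← h.core] at hp
  obtain ⟨y, ⟨h1, h2, h3⟩, rfl⟩ := hp
  refine ⟨y 0, congrArg Φ ?_⟩
  ext i
  fin_cases i <;> simp [stdVec, h1, h2, h3]

theorem axis_mem_core (h : IsTubularChart Φ r C) (t : ℝ) : Φ (t • stdVec 0) ∈ C := by
  rw [← h.core]
  exact ⟨_, by simp [stdVec], rfl⟩

/-- The image of a smaller closed tube is compact. -/
theorem isCompact_image (h : IsTubularChart Φ r C) (hr : 0 < r) (hb : b < r) :
    IsCompact (Φ '' {y | ‖normalPart y‖ ≤ b}) := by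
  have hs : ∀ {y : E4}, ‖normalPart y‖ ≤ b → y ∈ tube r := fun hy =>
    (mem_tube_iff hr).2 (hy.trans_lt hb)
  let S : Set E4 := {y | ‖normalPart y‖ ≤ b ∧ y 0 ∈ Icc 0 (2 * Real.pi)}
  have hS : IsCompact S := by
    refine Metric.isCompact_of_isClosed_isBounded ?_ ?_
    · exact (isClosed_le contDiff_normalPart.continuous.norm continuous_const).inter
        (isClosed_Icc.preimage (by fun_prop))
    · refine Metric.isBounded_iff_subset_ball 0 |>.2 ⟨2 * (2 * Real.pi + |b| + 1), fun y hy => ?_⟩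
      have := mem_ball_axis (y := y) (t := 0) (δ := 2 * (2 * Real.pi + |b| + 1))
        (by rw [sub_zero, abs_of_nonneg hy.2.1]; linarith [hy.2.2, abs_nonneg b])
        (by linarith [hy.1, le_abs_self b, Real.pi_pos])
      simpa using this
  convert hS.image_of_continuousOn (f := Φ)
    (h.smooth.continuousOn.mono fun y hy => hs hy.1) using 1
  refine Subset.antisymm ?_ (image_mono fun y hy => hy.1)
  rintro _ ⟨y, hy, rfl⟩
  obtain ⟨n, hn, -⟩ := existsUnique_add_zsmul_mem_Ico Real.two_pi_pos (y 0) 0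
  refine ⟨y + (2 * Real.pi * n) • stdVec 0, ⟨by rw [normalPart_add_axis]; exact hy, ?_⟩,
    h.periodic (hs hy) n⟩
  have e : (y + (2 * Real.pi * n) • stdVec 0 : E4) 0 = y 0 + n • (2 * Real.pi) := by
    simp [stdVec, mul_comm]
  rw [e]
  exact ⟨hn.1, by linarith [hn.2]⟩

/-- A periodic form on a tube that vanishes near its boundary descends to `M`. -/
theorem exists_pushforward [T2Space M] [IsManifold (𝓡 4) ∞ M] (h : IsTubularChart Φ r C)
    (hr : 0 < r) (hb : b < r) {k : ℕ} {α : E4 → Λ[k]} (hα : ContDiff ℝ ∞ α)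
    (hp : ∀ y, α (y + (2 * Real.pi) • stdVec 0) = α y) (h0 : ∀ y, α y ≠ 0 → ‖normalPart y‖ ≤ b) :
    ∃ η : DiffForm M k, IsSmoothForm η ∧ (∀ y ∈ tube r, pullback Φ η y = α y) ∧
      ∀ p ∉ Φ '' {y | ‖normalPart y‖ ≤ b}, valAt η p = 0 := by
  classical
  have hpn : ∀ y (n : ℤ), α (y + (2 * Real.pi * n) • stdVec 0) = α y := by
    intro y n
    have hper : Function.Periodic (fun s : ℝ => α (y + s • stdVec 0)) (2 * Real.pi) := fun s => by
      simp only [add_smul, ← add_assoc, hp]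
    simpa [mul_comm] using hper.int_mul n 0
  -- Any preimage serves: two of them differ by a multiple of the period, under which `α` and `tder
  -- Φ` are invariant.
  let η : DiffForm M k := fun p => if hq : ∃ y ∈ tube r, Φ y = p then
    (α hq.choose).compContinuousLinearMap (tder Φ hq.choose).inverse else 0
  have hη : ∀ y ∈ tube r, pullback Φ η y = α y := by
    intro y hy
    have hq : ∃ z ∈ tube r, Φ z = Φ y := ⟨y, hy, rfl⟩
    obtain ⟨n, hn⟩ := (h.eq_iff y hy _ hq.choose_spec.1).1 hq.choose_spec.2.symm
    have e : valAt η (Φ y) = (α y).compContinuousLinearMap (tder Φ y).inverse := by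
      have : valAt η (Φ y) =
        (α hq.choose).compContinuousLinearMap (tder Φ hq.choose).inverse := dif_pos hq
      rw [this, hn, h.tder_periodic hy, hpn]
    obtain ⟨A, hA⟩ : ∃ A : E4 ≃L[ℝ] E4, (A : E4 →L[ℝ] E4) = tder Φ y :=
      ⟨(LinearEquiv.ofInjectiveEndo (tder Φ y : E4 →ₗ[ℝ] E4)
        (h.tder_injective hy)).toContinuousLinearEquiv, by ext; rfl⟩
    rw [pullback_def, e, ← hA, ContinuousLinearMap.inverse_equiv]
    ext v
    simp [ContinuousAlternatingMap.compContinuousLinearMap_apply, Function.comp_def]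
  have hsupp : ∀ p ∉ Φ '' {y | ‖normalPart y‖ ≤ b}, valAt η p = 0 := by
    intro p hpK
    by_cases hq : ∃ y ∈ tube r, Φ y = p
    · obtain ⟨y, hy, rfl⟩ := hq
      rw [← comp_eq_zero_iff (h.tder_injective hy), ← pullback_def, hη y hy]
      by_contra hne
      exact hpK ⟨y, h0 y hne, rfl⟩
    · exact dif_neg hq
  refine ⟨η, fun x y hy => ContDiffAt.contDiffWithinAt ?_, hη, hsupp⟩
  -- The support lies in the compact image of a smaller closed tube. On that image smoothness is
  -- checked through `Φ`; off it the form is locally zero.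
  by_cases hq : (chart x).symm y ∈ Φ '' {y | ‖normalPart y‖ ≤ b}
  · obtain ⟨w, hw, hwy⟩ := hq
    have hwr : w ∈ tube r := (mem_tube_iff hr).2 (lt_of_le_of_lt hw hb)
    have e : y = chart x (Φ w) := by rw [hwy, (chart x).right_inv hy]
    rw [e]
    refine contDiffAt_localRep_of_pullback (h.contMDiffAt hwr) (h.tder_injective hwr)
      (by rw [hwy]; exact (chart x).map_target hy) (hα.contDiffAt.congr_of_eventuallyEq ?_)
    filter_upwards [(isOpen_tube r).mem_nhds hwr] with z hz using hη z hz
  · refine (contDiffAt_const (c := 0)).congr_of_eventuallyEq ?_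
    filter_upwards [((contMDiffOn_symm x).contMDiffAt ((isOpen_target x).mem_nhds
      hy)).continuousAt.preimage_mem_nhds ((h.isCompact_image hr hb).isClosed.isOpen_compl.mem_nhds
        hq)] with z hz using localRep_eq_zero (hsupp _ hz)

end IsTubularChart

/-! ### Locality of the differential and of the intrinsic derivative -/

section Local

variable [IsManifold (𝓡 4) ∞ M] {k : ℕ} {σ τ : DiffForm M k} {N : Set M} {p : M}

theorem localRep_eventuallyEq (hN : IsOpen N) (h : ∀ q ∈ N, valAt σ q = valAt τ q) (hp : p ∈ N) :
    localRep σ p =ᶠ[𝓝 (chart p p)] localRep τ p := by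
  filter_upwards [((contMDiffOn_symm p).contMDiffAt ((isOpen_target p).mem_nhds
    (mem_extChartAt_target p))).continuousAt.preimage_mem_nhds (hN.mem_nhds (by
      rwa [extChartAt_to_inv]))] with z hz
  rw [localRep, localRep, pullback_def, pullback_def, h _ hz]

theorem dForm_congr (hN : IsOpen N) (h : ∀ q ∈ N, valAt σ q = valAt τ q) (hp : p ∈ N) :
    valAt (dForm σ) p = valAt (dForm τ) p :=
  (localRep_eventuallyEq hN h hp).extDeriv_eq

theorem derivAt_congr (hN : IsOpen N) (h : ∀ q ∈ N, valAt σ q = valAt τ q) (hp : p ∈ N) :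
    derivAt σ p = derivAt τ p :=
  (localRep_eventuallyEq hN h hp).fderiv_eq

end Local

/-! ### The deformation near one circle -/

theorem pf_comp (α : Λ[2]) (A : E4 →L[ℝ] E4) (u : Fin 4 → E4) :
    pf (α.compContinuousLinearMap A) u = pf α (fun i => A (u i)) := by
  have e : ∀ v w, α.compContinuousLinearMap A ![v, w] = α ![A v, A w] := fun v w => by
    rw [ContinuousAlternatingMap.compContinuousLinearMap_apply]
    congr 1
    ext i j
    fin_cases i <;> rfl
  simp only [pf, e]

theorem nondeg_of_pf_pos {α : Λ[2]} {A : E4 →L[ℝ] E4}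
    (h : 0 < pf (α.compContinuousLinearMap A) stdVec) : Nondeg α := by
  rw [pf_comp] at h
  obtain ⟨b, hb⟩ := exists_basis_of_linearIndependent (linearIndependent_of_pf_ne_zero h.ne')
  exact nondeg_of_pf_ne_zero b (by rw [hb]; exact h.ne')

theorem finrank_range_of_ker {D : E4 →L[ℝ] Λ[2]} {X : E4} (hX : X ≠ 0)
    (hD : D X = 0) (hk : ∀ u, D u = 0 → ∃ c : ℝ, u = c • X) : Module.finrank ℝ D.range = 3 := by
  have h1 := LinearMap.finrank_range_add_finrank_ker (D : E4 →ₗ[ℝ] Λ[2])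
  have h2 : Module.finrank ℝ (LinearMap.ker (D : E4 →ₗ[ℝ] Λ[2])) = 1 :=
    finrank_eq_one ⟨X, hD⟩ (fun h => hX (congrArg Subtype.val h)) fun w => by
      obtain ⟨c, hc⟩ := hk w w.2
      exact ⟨c, Subtype.ext hc.symm⟩
  have h3 : Module.finrank ℝ E4 = 4 := by simp
  have h4 : Module.finrank ℝ (LinearMap.range (D : E4 →ₗ[ℝ] Λ[2])) = 3 := by omega
  exact h4

theorem eq_axis_of_normal {u : E4} (h : ¬ (u 1 ≠ 0 ∨ u 2 ≠ 0 ∨ u 3 ≠ 0)) : u = u 0 • stdVec 0 := by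
  push Not at h
  ext i
  fin_cases i <;> simp [stdVec, h.1, h.2.1, h.2.2]

theorem fderiv_axis_eq_zero {m : E4 → Λ[2]} (hm : ContDiff ℝ ∞ m)
    (h0 : ∀ t : ℝ, m (t • stdVec 0) = 0) (t : ℝ) : fderiv ℝ m (t • stdVec 0) (stdVec 0) = 0 := by
  have h1 : HasDerivAt (fun s : ℝ => m (s • stdVec 0)) (fderiv ℝ m (t • stdVec 0) (stdVec 0)) t :=
    HasFDerivAt.comp_hasDerivAt t (hm.differentiable (by simp) _).hasFDerivAt
      (by simpa using (hasDerivAt_id t).smul_const (stdVec 0))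
  simp only [h0] at h1
  exact h1.unique (hasDerivAt_const t _)

variable {M : Type*} [TopologicalSpace M] [ChartedSpace E4 M] [IsManifold (𝓡 4) ∞ M]
  {V : Type*} [NormedAddCommGroup V] [InnerProductSpace ℝ V]
  {σ τ : DiffForm M 2} {γ : ℝ → M} {C : Set M} {e : M → V} {Φ : E4 → M} {ρ r : ℝ}
  {β m : E4 → Λ[2]} {f : Fin 3 → ℝ → E4}

/-- The germ along a loop, seen in a tubular chart. -/
theorem IsTubularChart.fderiv_axis (hΦ : IsTubularChart Φ ρ C) (hρ : 0 < ρ) (hτ : IsSmoothForm τ)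
    (h0 : valAt τ (Φ (r • stdVec 0)) = 0) (hβ : ∀ᶠ y in 𝓝 (r • stdVec 0), β y = pullback Φ τ y)
    (u : E4) : fderiv ℝ β (r • stdVec 0) u =
      (derivAt τ (Φ (r • stdVec 0)) (tder Φ (r • stdVec 0) u)).compContinuousLinearMap
        (tder Φ (r • stdVec 0)) := by
  rw [Filter.EventuallyEq.fderiv_eq hβ,
    fderiv_pullback_of_zero hτ (hΦ.contMDiffAt (axis_mem_tube hρ r)) h0]

/-- Along the axis `tder Φ` maps the standard basis to the velocity and the adapted frame. Thus the
frame's positivity and pairing conditions become statements on the derivative of `β`; the pairings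
that involve the axis direction vanish on both sides. -/
theorem IsAdaptedFrame.axisForm (hf : IsAdaptedFrame σ γ e m f) (hm : IsModelForm m)
    (h : IsNearSymplectic σ) (hl : IsLoop σ γ C) (hΦ : IsTubularChart Φ ρ C) (hρ : 0 < ρ)
    (hγ : ∀ t : ℝ, Φ (t • stdVec 0) = γ t)
    (hfr : ∀ (t : ℝ) i, tder Φ (t • stdVec 0) (stdVec i) = ![velocity γ t, f 0 t, f 1 t, f 2 t] i)
    (hβ : ContDiff ℝ ∞ β) (hβp : ∀ y, β (y + (2 * Real.pi) • stdVec 0) = β y) (hr : 0 < r)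
    (hrρ : r ≤ ρ) (hβσ : ∀ y ∈ tube r, β y = pullback Φ σ y) :
    IsAxisForm β ∧ (∀ (t : ℝ) u v, fderiv ℝ β (t • stdVec 0) u ![stdVec 0, v] =
        fderiv ℝ m (t • stdVec 0) u ![stdVec 0, v]) ∧
      ∀ y ∈ tube r, ∀ u v w, fderiv ℝ β y u ![v, w] - fderiv ℝ β y v ![u, w] +
        fderiv ℝ β y w ![u, v] = 0 := by
  have hev : ∀ y ∈ tube r, ∀ᶠ z in 𝓝 y, β z = pullback Φ σ z := fun y hy => by
    filter_upwards [(isOpen_tube r).mem_nhds hy] with z hz using hβσ z hz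
  have h0 : ∀ t : ℝ, valAt σ (Φ (t • stdVec 0)) = 0 := fun t => by
    rw [hγ]; exact hl.zero t
  have hd : ∀ (t : ℝ) u, fderiv ℝ β (t • stdVec 0) u = (derivAt σ (γ t)
      (tder Φ (t • stdVec 0) u)).compContinuousLinearMap (tder Φ (t • stdVec 0)) := fun t u => by
    rw [hΦ.fderiv_axis hρ h.smooth (h0 t) (hev _ (axis_mem_tube hr t)), hγ]
  have hz : ∀ t : ℝ, β (t • stdVec 0) = 0 := fun t => by
    rw [hβσ _ (axis_mem_tube hr t), pullback_def, h0]
    rfl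
  refine ⟨⟨hβ, hβp, hz, fun t u hu => ?_⟩, fun t u v => ?_, fun y hy u v w => ?_⟩
  · rw [hd, pf_comp, funext (hfr t)]
    refine hf.pos t _ fun hD => ?_
    obtain ⟨c, hc⟩ := ((hl.germ h t).kernel _).1 hD
    have e1 : tder Φ (t • stdVec 0) u = tder Φ (t • stdVec 0) (c • stdVec 0) := by
      rw [hc, map_smul, hfr]; rfl
    have e2 := hΦ.tder_injective (axis_mem_tube hρ t) e1
    rw [e2] at hu
    simp [stdVec] at hu
  · have key : germForm (fderiv ℝ β (t • stdVec 0)) (stdVec 0) =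
        germForm (fderiv ℝ m (t • stdVec 0)) (stdVec 0) := by
      refine LinearMap.BilinForm.ext_basis stdBasis fun i j => ?_
      simp only [stdBasis_apply, germForm_apply]
      refine Fin.cases ?_ (fun i => ?_) i
      · rw [fderiv_axis_eq_zero hβ hz, fderiv_axis_eq_zero hm.smooth hm.zero]
      · refine Fin.cases ?_ (fun j => ?_) j
        · rw [form_self, form_self]
        · have e1 : ∀ i : Fin 3, tder Φ (t • stdVec 0) (stdVec i.succ) = f i t := fun i => by
            rw [hfr]; fin_cases i <;> rfl
          rw [← hf.pairing, hd, ContinuousAlternatingMap.compContinuousLinearMap_apply, e1]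
          congr 1
          ext a b
          fin_cases a
          · exact congrFun (congrArg _ (hfr t 0)) b
          · exact congrFun (congrArg _ (e1 j)) b
    exact LinearMap.congr_fun₂ key u v
  · have hs := hΦ.contMDiffAt (tube_mono hr.le hrρ hy)
    have h1 := extDeriv_pullback_center h.smooth hs
    rw [h.closed, ← Filter.EventuallyEq.extDeriv_eq (hev y hy)] at h1
    have h2 := extDeriv_two (hβ.differentiable (by simp) y) u v w
    simp only [fderiv_form_apply (hβ.differentiable (by simp) y)] at h2
    rw [← h2, h1]
    rfl

/-- A deformation of `σ` inside a neighbourhood of a loop of zeros, that makes it a model form. -/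
theorem IsLoop.exists_deformation [T2Space M] [CompactSpace M] [FiniteDimensional ℝ V]
    (hl : IsLoop σ γ C) (he : IsInjImmersion e) (h : IsNearSymplectic σ) {R : ℝ} (hR0 : 0 < R)
    (hR1 : R < 1) {N : Set M} (hN : IsOpen N) (hCN : C ⊆ N) (hNZ : N ∩ zeroLocus σ ⊆ C) :
    ∃ (η : DiffForm M 1) (K : Set M), IsSmoothForm η ∧ IsClosed K ∧ K ⊆ N ∧
      (∀ p ∉ K, valAt η p = 0) ∧
      (∀ l ∈ Icc (0 : ℝ) 1, ∀ p ∈ N, (p ∉ C → Nondeg (valAt (σ + l • dForm η) p)) ∧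
        (p ∈ C → valAt (σ + l • dForm η) p = 0 ∧
          Module.finrank ℝ (derivAt (σ + l • dForm η) p).range = 3)) ∧
      ∃ (r : ℝ) (Φ : E4 → M) (m : E4 → Λ[2]), 0 < r ∧ (m = omegaA ∨ m = omegaB R) ∧
        IsTubularChart Φ r C ∧ ∀ y ∈ tube r, Φ y ∈ N ∧ pullback Φ (σ + dForm η) y = m y := by
  obtain ⟨m, hmAB, hm, f, hf⟩ := hl.exists_adaptedFrame he h hR0 hR1
  obtain ⟨ρ', Φ, hρ', hΦ', hγ, hfr⟩ := hl.exists_tubularChart he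
    (fr := fun i t => ![velocity γ t, f 0 t, f 1 t, f 2 t] i)
    (fun i => by
      fin_cases i
      exacts [smoothAlong_velocity he hl.smooth, hf.smooth 0, hf.smooth 1, hf.smooth 2])
    (fun i t => by
      fin_cases i
      exacts [hl.velocity_periodic t, hf.periodic 0 t, hf.periodic 1 t, hf.periodic 2 t])
    hf.linearIndependent rfl
  obtain ⟨ρ, hρ, hρN, hΦ⟩ : ∃ ρ, 0 < ρ ∧ (∀ y ∈ tube ρ, Φ y ∈ N) ∧ IsTubularChart Φ ρ C := by
    obtain ⟨a, ha, haN⟩ := exists_tube_of_eventually (Q := fun y => y ∈ tube ρ' → Φ y ∈ N)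
      Real.two_pi_pos (fun y => by
        rw [add_axis_mem_tube]
        refine forall_congr' fun hy => ?_
        have := hΦ'.periodic hy 1
        rw [Int.cast_one, mul_one] at this
        rw [this]) fun t => by
      filter_upwards [(hΦ'.contMDiffAt (axis_mem_tube hρ' t)).continuousAt.preimage_mem_nhds
        (hN.mem_nhds (hCN (hΦ'.axis_mem_core t)))] with y hy _ using hy
    have hm0 := lt_min ha hρ'
    exact ⟨min a ρ', hm0, fun y hy => haN y (tube_mono hm0.le (min_le_left _ _) hy)
      (tube_mono hm0.le (min_le_right _ _) hy), hΦ'.mono hm0 (min_le_right _ _)⟩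
  -- This cutoff only extends the pull-back to all of `E4`. Its gradient bound is irrelevant, hence
  -- the arbitrary `1`.
  obtain ⟨χ, hχ, -, hχp, ⟨a, haρ, hχa⟩, ⟨r₁, hr₁, hχ1⟩, -⟩ := exists_cutoff hρ one_pos
  let β : E4 → Λ[2] := fun y => χ y • pullback Φ σ y
  have hχ0 : ∀ y, y ∉ tube ρ → χ y = 0 := fun y hy => by
    by_contra hne
    exact hy ((mem_tube_iff hρ).2 ((hχa y hne).trans_lt haρ))
  have hβ : ContDiff ℝ ∞ β := contDiff_iff_contDiffAt.2 fun y => by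
    by_cases hy : y ∈ tube ρ
    · exact hχ.contDiffAt.smul (contDiffAt_pullback h.smooth (hΦ.contMDiffAt hy))
    · refine (contDiffAt_const (c := 0)).congr_of_eventuallyEq ?_
      rw [mem_tube_iff hρ, not_lt] at hy
      filter_upwards [contDiff_normalPart.continuous.norm.continuousAt.eventually
        (lt_mem_nhds (haρ.trans_le hy))] with z hz
      have : χ z = 0 := by
        by_contra hne
        exact absurd (hχa z hne) (not_le.2 hz)
      simp only [β, this, zero_smul]
  have hβp : ∀ y, β (y + (2 * Real.pi) • stdVec 0) = β y := fun y => by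
    simp only [β, hχp]
    by_cases hy : y ∈ tube ρ
    · have := hΦ.pullback_periodic σ hy 1
      rw [Int.cast_one, mul_one] at this
      rw [this]
    · rw [hχ0 y hy, zero_smul, zero_smul]
  have hr₂ : 0 < min r₁ ρ := lt_min hr₁ hρ
  have hβσ : ∀ y ∈ tube (min r₁ ρ), β y = pullback Φ σ y := fun y hy => by
    simp only [β, hχ1 y (tube_mono hr₂.le (min_le_left _ _) hy), one_smul]
  obtain ⟨hβa, hmatch, hcl⟩ := hf.axisForm hm h hl hΦ hρ hγ hfr hβ hβp hr₂ (min_le_right _ _) hβσ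
  obtain ⟨b, b', r, α, hb, hb₂, hb', hr, hα, hαp, hα0, hαr, hpos⟩ :=
    exists_axis_deformation hβa hm hmatch hr₂ hcl
  have hbρ : b ≤ ρ := hb₂.trans (min_le_right _ _)
  have hΦb := hΦ.mono hb hbρ
  obtain ⟨η, hη, hηα, hη0⟩ := hΦb.exists_pushforward hb hb' hα hαp hα0
  have hpull : ∀ (l : ℝ), ∀ y ∈ tube b,
      pullback Φ (σ + l • dForm η) y = β y + l • extDeriv α y := fun l y hy => by
    have e1 : pullback Φ (dForm η) y = extDeriv α y := by
      rw [← extDeriv_pullback_center hη (hΦb.contMDiffAt hy)]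
      refine Filter.EventuallyEq.extDeriv_eq ?_
      filter_upwards [(isOpen_tube b).mem_nhds hy] with z hz using hηα z hz
    rw [hβσ y (tube_mono hb.le hb₂ hy), ← e1]
    rfl
  have hsm : ∀ l : ℝ, IsSmoothForm (σ + l • dForm η) := fun l =>
    isSmoothForm_add h.smooth (isSmoothForm_smul l (isSmoothForm_dForm hη))
  refine ⟨η, _, hη, (hΦb.isCompact_image hb hb').isClosed, ?_, hη0, fun l hl01 p hp =>
    ⟨fun hpC => ?_, fun hpC => ?_⟩, min r b, Φ, m, lt_min hr hb, hmAB,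
    hΦb.mono (lt_min hr hb) (min_le_right _ _), fun y hy => ⟨hρN y ?_, ?_⟩⟩
  · rintro _ ⟨y, hy, rfl⟩
    exact hρN y ((mem_tube_iff hρ).2 ((lt_of_le_of_lt hy hb').trans_le hbρ))
  · by_cases hpK : p ∈ Φ '' {y | ‖normalPart y‖ ≤ b'}
    · obtain ⟨y, hy, rfl⟩ := hpK
      have hyb : y ∈ tube b := (mem_tube_iff hb).2 (lt_of_le_of_lt hy hb')
      refine nondeg_of_pf_pos (A := tder Φ y) ?_
      rw [← pullback_def, hpull l y hyb]
      refine hpos y hyb (fun h0 => hpC ?_) l hl01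
      have : y = y 0 • stdVec 0 := by rwa [normalPart, sub_eq_zero] at h0
      rw [this]
      exact hΦ.axis_mem_core _
    · have e1 := dForm_congr (σ := η) (τ := 0)
        (hΦb.isCompact_image hb hb').isClosed.isOpen_compl hη0 hpK
      rw [dForm_zero] at e1
      have e2 : valAt (σ + l • dForm η) p = valAt σ p := by
        change valAt σ p + l • valAt (dForm η) p = _
        rw [e1]
        change valAt σ p + l • 0 = _
        rw [smul_zero, add_zero]
      rw [e2]
      exact h.nondeg p fun h0 => hpC (hNZ ⟨hp, h0⟩)
  · obtain ⟨t, rfl⟩ := hΦ.axis_mem hpC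
    have ht := axis_mem_tube hb t
    -- Near the axis the deformed form is the plain interpolation of `β` and `m`, so its derivative
    -- on the axis interpolates too. By `pf_affine` that derivative is nonzero on all non-axial
    -- vectors, which gives rank 3.
    have hev : ∀ᶠ y in 𝓝 (t • stdVec 0 : E4),
        (1 - l) • β y + l • m y = pullback Φ (σ + l • dForm η) y := by
      filter_upwards [(isOpen_tube _).mem_nhds (axis_mem_tube hr t), (isOpen_tube _).mem_nhds ht]
        with y hyr hyb
      rw [hpull l y hyb, hαr y hyr]
      module
    have h0 : valAt (σ + l • dForm η) (Φ (t • stdVec 0)) = 0 := by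
      rw [← comp_eq_zero_iff (hΦb.tder_injective ht), ← pullback_def, ← hev.self_of_nhds, hβa.zero,
        hm.zero, smul_zero, smul_zero, add_zero]
    have hD := fun u => (hΦb.fderiv_axis hb (hsm l) h0 hev u).symm
    have hE : ∀ u, fderiv ℝ (fun y => (1 - l) • β y + l • m y) (t • stdVec 0) u =
        (1 - l) • fderiv ℝ β (t • stdVec 0) u + l • fderiv ℝ m (t • stdVec 0) u := fun u => by
      have hd : HasFDerivAt (fun y => (1 - l) • β y + l • m y) _ (t • stdVec 0) :=
        ((hβ.differentiable (by simp) _).hasFDerivAt.const_smul (1 - l)).add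
          ((hm.smooth.differentiable (by simp) _).hasFDerivAt.const_smul l)
      rw [hd.fderiv]
      rfl
    have hinj := hΦb.tder_injective ht
    refine ⟨h0, finrank_range_of_ker (X := tder Φ (t • stdVec 0) (stdVec 0))
      ((map_ne_zero_iff _ hinj).2 (stdVec_ne_zero 0)) ?_ fun v hv => ?_⟩
    · rw [← comp_eq_zero_iff hinj, hD, hE, fderiv_axis_eq_zero hβ hβa.zero,
        fderiv_axis_eq_zero hm.smooth hm.zero, smul_zero, smul_zero, add_zero]
    · obtain ⟨u, rfl⟩ := (LinearMap.injective_iff_surjective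
        (f := (tder Φ (t • stdVec 0) : E4 →ₗ[ℝ] E4))).1 hinj v
      have h1 := (hD u).trans (hE u)
      refine ⟨u 0, ?_⟩
      have hu : ¬ (u 1 ≠ 0 ∨ u 2 ≠ 0 ∨ u 3 ≠ 0) := fun hu => by
        have h2 := pf_affine (hmatch t u) l
        have h3 := hβa.pos t u hu
        have h4 := hm.pos t u hu
        have h5 : 0 < (1 - l) * pf (fderiv ℝ β (t • stdVec 0) u) stdVec +
            l * pf (fderiv ℝ m (t • stdVec 0) u) stdVec := by
          rcases hl01.1.eq_or_lt with rfl | hl0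
          · simpa using h3
          · have := mul_pos hl0 h4
            have := mul_nonneg (sub_nonneg.2 hl01.2) h3.le
            linarith
        rw [← h2, ← h1, (comp_eq_zero_iff hinj).2
          (show derivAt (σ + l • dForm η) _ (tder Φ (t • stdVec 0) u) = 0 from hv)] at h5
        have e : pf 0 stdVec = 0 := by simp [pf]
        exact absurd h5 (by rw [e]; exact lt_irrefl 0)
      rw [← map_smul]
      exact congrArg _ (eq_axis_of_normal hu)
  · exact tube_mono (lt_min hr hb).le ((min_le_right _ _).trans hbρ) hy
  · have e := hpull 1 y (tube_mono (lt_min hr hb).le (min_le_right _ _) hy)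
    rw [one_smul, one_smul, hαr y (tube_mono (lt_min hr hb).le (min_le_left _ _) hy)] at e
    rw [e]
    module

theorem Nondeg.ne_zero {α : Λ[2]} (h : Nondeg α) : α ≠ 0 := by
  rintro rfl
  exact stdVec_ne_zero 0 (h _ fun w => rfl)

/-! ### All circles together -/

variable {M : Type*} [TopologicalSpace M] [T2Space M] [CompactSpace M] [ChartedSpace E4 M]
  [IsManifold (𝓡 4) ∞ M] {σ : DiffForm M 2}

theorem exists_isInjImmersion (M : Type*) [TopologicalSpace M] [T2Space M] [CompactSpace M]
    [ChartedSpace E4 M] [IsManifold (𝓡 4) ∞ M] :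
    ∃ (n : ℕ) (e : M → EuclideanSpace ℝ (Fin n)), IsInjImmersion e := by
  obtain ⟨n, e, h1, h2, h3⟩ := exists_embedding_euclidean_of_compact (M := M) (I := 𝓡 4)
  exact ⟨n, e, h1, h2.injective, h3⟩

/-- The components of the zero locus are finitely many, with disjoint neighbourhoods. -/
theorem IsNearSymplectic.exists_disjoint_nhds (h : IsNearSymplectic σ) {U : Set M} (hU : IsOpen U)
    (hZU : zeroLocus σ ⊆ U) :
    (connectedComponentIn (zeroLocus σ) '' zeroLocus σ).Finite ∧ ∃ N : Set M → Set M,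
      (∀ C ∈ connectedComponentIn (zeroLocus σ) '' zeroLocus σ, IsOpen (N C) ∧ C ⊆ N C ∧ N C ⊆ U) ∧
      (connectedComponentIn (zeroLocus σ) '' zeroLocus σ).PairwiseDisjoint N := by
  have hfin : (connectedComponentIn (zeroLocus σ) '' zeroLocus σ).Finite := by
    -- Each component is a neighbourhood of its points within the compact zero locus, so finitely
    -- many cover it.
    obtain ⟨t, -, ht⟩ := (isClosed_zeroLocus h.smooth).isCompact.elim_nhdsWithin_subcover
      (connectedComponentIn (zeroLocus σ)) fun z hz => by
        obtain ⟨γ, hl⟩ := h.exists_loop hz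
        obtain ⟨s, hs⟩ := hl.range_eq.symm ▸ mem_connectedComponentIn hz
        exact hs ▸ hl.nhds s
    refine (t.finite_toSet.image (connectedComponentIn (zeroLocus σ))).subset ?_
    rintro _ ⟨z, hz, rfl⟩
    obtain ⟨x, hx, hzx⟩ := mem_iUnion₂.1 (ht hz)
    exact ⟨x, hx, connectedComponentIn_eq hzx⟩
  have hc : ∀ C ∈ connectedComponentIn (zeroLocus σ) '' zeroLocus σ, IsCompact C := by
    rintro _ ⟨z, hz, rfl⟩
    obtain ⟨γ, hl⟩ := h.exists_loop hz
    exact hl.range_eq ▸ Function.Periodic.compact_of_continuous hl.periodic Real.two_pi_pos.ne'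
      hl.smooth.continuous
  have hd : (connectedComponentIn (zeroLocus σ) '' zeroLocus σ).PairwiseDisjoint
      (fun C => 𝓝ˢ C) := by
    intro C hC C' hC' hne
    refine separatedNhds_iff_disjoint.1 (SeparatedNhds.of_isCompact_isCompact (hc C hC) (hc C' hC') ?_)
    obtain ⟨z, hz, rfl⟩ := hC
    obtain ⟨z', hz', rfl⟩ := hC'
    exact disjoint_left.2 fun p hp hp' =>
      hne ((connectedComponentIn_eq hp).trans (connectedComponentIn_eq hp').symm)
  obtain ⟨S, hS, hSd⟩ := hd.exists_mem_filter hfin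
  refine ⟨hfin, fun C => interior (S C) ∩ U, ?_, hSd.mono fun C =>
    inter_subset_left.trans interior_subset⟩
  rintro _ ⟨z, hz, rfl⟩
  exact ⟨isOpen_interior.inter hU, subset_inter (subset_interior_iff_mem_nhdsSet.2 (hS _))
    ((connectedComponentIn_subset _ _).trans hZU), inter_subset_right⟩

/-- A deformation of `σ` near its zeros, that makes it a model form near each circle of zeros. -/
theorem IsNearSymplectic.exists_deformation (h : IsNearSymplectic σ) {U : Set M} (hU : IsOpen U)
    (hZU : zeroLocus σ ⊆ U) {R : ℝ} (hR0 : 0 < R) (hR1 : R < 1) :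
    ∃ η : DiffForm M 1, IsSmoothForm η ∧ (∀ t ∈ Icc (0 : ℝ) 1, ∀ p,
        (p ∉ U → valAt (σ + t • dForm η) p = valAt σ p) ∧
        (p ∉ zeroLocus σ → Nondeg (valAt (σ + t • dForm η) p)) ∧
        (p ∈ zeroLocus σ → valAt (σ + t • dForm η) p = 0 ∧
          Module.finrank ℝ (derivAt (σ + t • dForm η) p).range = 3)) ∧
      ∀ z ∈ zeroLocus σ, ∃ (r : ℝ) (Φ : E4 → M) (m : E4 → Λ[2]), 0 < r ∧
        (m = omegaA ∨ m = omegaB R) ∧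
        IsTubularChart Φ r (connectedComponentIn (zeroLocus σ) z) ∧
        ∀ y ∈ tube r, pullback Φ (σ + (1 : ℝ) • dForm η) y = m y := by
  obtain ⟨n, e, he⟩ := exists_isInjImmersion M
  obtain ⟨hfin, N, hN, hNd⟩ := h.exists_disjoint_nhds hU hZU
  set 𝒞 := connectedComponentIn (zeroLocus σ) '' zeroLocus σ
  have hmem : ∀ {p}, p ∈ zeroLocus σ → connectedComponentIn (zeroLocus σ) p ∈ 𝒞 := fun hp =>
    mem_image_of_mem _ hp
  -- A zero in `N C` lies in the neighbourhood of its own component as well; by disjointness that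
  -- component is `C`.
  have hNZ : ∀ C ∈ 𝒞, N C ∩ zeroLocus σ ⊆ C := fun C hC p hp => by
    have hp' := mem_connectedComponentIn hp.2
    by_contra hpC
    exact disjoint_left.1 (hNd (hmem hp.2) hC fun hE => hpC (hE ▸ hp'))
      ((hN _ (hmem hp.2)).2.1 hp') hp.1
  have hloop : ∀ C ∈ 𝒞, ∃ γ, IsLoop σ γ C := by
    rintro _ ⟨z, hz, rfl⟩
    exact h.exists_loop hz
  have hex := fun C (hC : C ∈ 𝒞) => (hloop C hC).choose_spec.exists_deformation he h hR0 hR1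
    (hN C hC).1 (hN C hC).2.1 (hNZ C hC)
  choose! η K hη hK hKN hη0 hdef hchart using hex
  let H : DiffForm M 1 := ∑ C ∈ hfin.toFinset, η C
  have hHs : IsSmoothForm H := (dForm_sum _ fun C hC => hη C (hfin.mem_toFinset.1 hC)).1
  have hHval : ∀ p, valAt H p = ∑ C ∈ hfin.toFinset, valAt (η C) p := fun p =>
    Finset.sum_apply p _ _
  have hval : ∀ (ζ : DiffForm M 1) (t : ℝ) p,
      valAt (σ + t • dForm ζ) p = valAt σ p + t • valAt (dForm ζ) p := fun ζ t p => rfl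
  -- The supports lie in disjoint neighbourhoods, so on `N C` only the summand of `C` is present.
  have hin : ∀ C ∈ 𝒞, ∀ t : ℝ, ∀ p ∈ N C,
      valAt (σ + t • dForm H) p = valAt (σ + t • dForm (η C)) p := by
    intro C hC t p hp
    rw [hval, hval, dForm_congr (hN C hC).1 (fun q hq => ?_) hp]
    rw [hHval]
    refine Finset.sum_eq_single_of_mem C (hfin.mem_toFinset.2 hC) fun C' hC' hne => ?_
    rw [hfin.mem_toFinset] at hC'
    exact hη0 C' hC' q fun hq' => disjoint_left.1 (hNd hC' hC hne) (hKN C' hC' hq') hq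
  have hout : ∀ t : ℝ, ∀ p, (∀ C ∈ 𝒞, p ∉ N C) → valAt (σ + t • dForm H) p = valAt σ p := by
    intro t p hp
    have hcl : IsClosed (⋃ C ∈ 𝒞, K C) := hfin.isClosed_biUnion hK
    rw [hval, dForm_congr (τ := 0) hcl.isOpen_compl (fun q hq => ?_) (mem_compl fun hq => ?_),
      dForm_zero]
    · change _ + t • 0 = _
      rw [smul_zero, add_zero]
    · rw [hHval]
      refine Finset.sum_eq_zero fun C hC => ?_
      rw [hfin.mem_toFinset] at hC
      exact hη0 C hC q fun hq' => hq (mem_biUnion hC hq')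
    · obtain ⟨C, hC, hq⟩ := mem_iUnion₂.1 hq
      exact hp C hC (hKN C hC hq)
  refine ⟨H, hHs, fun t ht p => ⟨fun hp => hout t p fun C hC hpC => hp ((hN C hC).2.2 hpC),
    fun hp => ?_, fun hp => ?_⟩, fun z hz => ?_⟩
  · by_cases hpN : ∃ C ∈ 𝒞, p ∈ N C
    · obtain ⟨C, hC, hpC⟩ := hpN
      rw [hin C hC t p hpC]
      refine (hdef C hC t ht p hpC).1 fun hpC' => hp ?_
      obtain ⟨z, -, rfl⟩ := hC
      exact connectedComponentIn_subset _ _ hpC'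
    · push Not at hpN
      rw [hout t p hpN]
      exact h.nondeg p hp
  · have hC := hmem hp
    have hpC := (hN _ hC).2.1 (mem_connectedComponentIn hp)
    rw [hin _ hC t p hpC, derivAt_congr (hN _ hC).1 (hin _ hC t) hpC]
    exact (hdef _ hC t ht p hpC).2 (mem_connectedComponentIn hp)
  · obtain ⟨r, Φ, m, hr, hm, hΦ, hpull⟩ := hchart _ (hmem hz)
    refine ⟨r, Φ, m, hr, hm, hΦ, fun y hy => ?_⟩
    rw [← (hpull y hy).2, pullback_def, hin _ (hmem hz) 1 _ (hpull y hy).1, one_smul, pullback_def]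

end SDForms

end

/-! ### The main theorem -/

theorem theorem4p3 {M : Type*} [TopologicalSpace M] [T2Space M] [CompactSpace M]
    [ChartedSpace SDForms.E4 M] [IsManifold (𝓡 4) ∞ M]
    (o : SDForms.OrientationForm M) (g : SDForms.Metric M) (σ : SDForms.DiffForm M 2)
    (hσ : SDForms.IsSelfDualHarmonic o g σ) (htr : SDForms.IsTransverse o g σ)
    (U : Set M) (hU : IsOpen U) (hZU : SDForms.zeroLocus σ ⊆ U)
    (R : ℝ) (hR0 : 0 < R) (hR1 : R < 1) :
    ∃ Ω : ℝ → SDForms.DiffForm M 2,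
      SDForms.IsSmoothFamily Ω ∧
      Ω 0 = σ ∧
      (∀ t ∈ Icc (0 : ℝ) 1,
        SDForms.IsSingularSymplectic (Ω t) ∧
        SDForms.zeroLocus (Ω t) = SDForms.zeroLocus σ ∧
        (∀ x, x ∉ U → Ω t x = σ x) ∧
        SDForms.SameClass σ (Ω t)) ∧
      ∀ z ∈ SDForms.zeroLocus σ, ∃ r : ℝ, 0 < r ∧ ∃ Φ : SDForms.E4 → M,
        SDForms.IsTubularChart Φ r (connectedComponentIn (SDForms.zeroLocus σ) z) ∧
        ∃ ε : ℝ, (ε = 1 ∨ ε = -1) ∧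
          ((∀ y ∈ SDForms.tube r, SDForms.pullback Φ (Ω 1) y = ε • SDForms.omegaA y) ∨
           (∀ y ∈ SDForms.tube r, SDForms.pullback Φ (Ω 1) y = ε • SDForms.omegaB R y)) := by
  have h := hσ.isNearSymplectic htr
  obtain ⟨η, hη, hdef, hchart⟩ := h.exists_deformation hU hZU hR0 hR1
  have hdη := SDForms.isSmoothForm_dForm hη
  have hzero : ∀ t ∈ Icc (0 : ℝ) 1, SDForms.zeroLocus (σ + t • SDForms.dForm η) =
      SDForms.zeroLocus σ := fun t ht => Set.ext fun p =>
    ⟨fun hp => by_contra fun hp' => ((hdef t ht p).2.1 hp').ne_zero hp,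
      fun hp => ((hdef t ht p).2.2 hp).1⟩
  -- The family is affine in `t` with exact direction, so closedness, the cohomology class (with
  -- primitive `t • η`) and joint smoothness are immediate.
  refine ⟨fun t => σ + t • SDForms.dForm η, fun x => ?_, ?_, fun t ht => ⟨⟨?_, fun p hp => ?_,
    fun p hp => ?_⟩, hzero t ht, fun p hp => (hdef t ht p).1 hp, t • η,
    SDForms.isSmoothForm_smul t hη, ?_⟩, fun z hz => ?_⟩
  · have hs : Set.MapsTo Prod.snd (Icc (0 : ℝ) 1 ×ˢ (extChartAt (𝓡 4) x).target)
      (extChartAt (𝓡 4) x).target := fun q hq => hq.2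
    exact ((h.smooth x).comp contDiff_snd.contDiffOn hs).add
      (contDiff_fst.contDiffOn.smul ((hdη x).comp contDiff_snd.contDiffOn hs))
  · simp
  · rw [SDForms.dForm_add h.smooth (SDForms.isSmoothForm_smul t hdη), SDForms.dForm_smul,
      SDForms.dForm_dForm hη, h.closed, smul_zero, add_zero]
  · rw [hzero t ht] at hp
    exact (hdef t ht p).2.1 hp
  · rw [hzero t ht] at hp
    exact ((hdef t ht p).2.2 hp).2
  · rw [SDForms.dForm_smul, add_sub_cancel_left]
  · obtain ⟨r, Φ, m, hr, hm, hΦ, hpull⟩ := hchart z hz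
    -- The sign is always `1`: each circle is oriented so that its quadratic form has signature `(2,
    -- 1)`, as both models have.
    refine ⟨r, hr, Φ, hΦ, 1, Or.inl rfl, ?_⟩
    rcases hm with rfl | rfl
    · exact Or.inl fun y hy => by rw [one_smul]; exact hpull y hy
    · exact Or.inr fun y hy => by rw [one_smul]; exact hpull y hy
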